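/- Let $d\ge 2$ and let $\Omega\subset\mathbb R^d$ be a bounded open set with $C^{1,1}$ boundary (locally, in suitable orthonormal coordinates, $\Omega$ is the region below the graph of a $C^1$ function with Lipschitz derivative). Let $\varepsilon>0$ and let $T_t:\Omega\to\Omega_t=T_t(\Omega)$, $|t|<\varepsilon$, be bi-Lipschitz maps with $T_0=I$, twice differentiable in the following sense: $t\mapsto T_tx$ is $C^2$ on $(-\varepsilon,\varepsilon)$ for every $x\in\Omega$, and for almost every $x\in\Omega$ the Jacobi matrix $DT_t(x)$ exists for all $|t|<\varepsilon$, and the first and second $t$-derivatives of $DT_t(x)$ and of $(DT_t(x))^{-1}$ are bounded, uniformly in $x$ and $t$ (the first derivatives exist for all $t$ and are Lipschitz in $t$; the second ones exist for almost every $t$). Put $$S=\frac{\partial T_t}{\partial t}\Big|_{t=0},\qquad R=\frac{\partial^2T_t}{\partial t^2}\Big|_{t=0},$$ extended continuously from $\Omega$ to $\overline\Omega$. Let $\nu=\nu(\cdot,t)$ be the outer unit normal and $ds_t$ the area element of $\partial\Omega_t$ ($ds=ds_0$), and $\delta\rho=S\cdot\nu$ on $\partial\Omega$. Let $\Gamma=\bigcup_{|t|<\varepsilon}\partial\Omega_t\times\{t\}\subset\mathbb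 R^{d+1}$, and let $\mathbf a=\mathbf a(x,t)$ be an $\mathbb R^d$-valued function of class $C^{1,1}$ (i.e. $C^1$ with locally Lipschitz first derivatives) in an open neighbourhood of $\Gamma$. Suppose that for $ds$-almost every $x\in\partial\Omega$ the functions $\mathbf a_t$ and $\nabla\cdot\mathbf a$ of $(x,t)$ are differentiable at $(x,0)$, so that $\mathbf a_{tt}$, $\nabla\cdot\mathbf a_t$ and $\nabla(\nabla\cdot\mathbf a)$ make sense almost everywhere on $\partial\Omega$ at $t=0$. Then $\nu\cdot\mathbf a(\cdot,t)$ is integrable on $\partial\Omega_t$ for small $|t|$, the function $t\mapsto\int_{\partial\Omega_t}\nu\cdot\mathbf a\,ds_t$ is differentiable near $t=0$ and twice differentiable at $t=0$, and $$\frac{d^2}{dt^2}\int_{\partial\Omega_t}\nu\cdot\mathbf a\,ds_t\Big|_{t=0}=\int_{\partial\Omega}\nu\cdot\mathbf a_{tt}(\cdot,0)\,ds+\int_{\partial\Omega}\Big(2\nabla\cdot\mathbf a_t(\cdot,0)+\nabla\cdot\big[(\nabla\cdot\mathbf a(\cdot,0))S\big]\Big)\,\delta\rho\,ds+\int_{\partial\Omega}(\nabla\cdot\mathbf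 a(\cdot,0))\,\big(R-(S\cdot\nabla)S\big)\cdot\nu\,ds,$$ where all three integrands are integrable. On the right-hand side the first derivatives of $S$ on $\partial\Omega$ are those of a locally Lipschitz vector field $\tilde S$ on $\mathbb R^d$ with $\tilde S=S$ on $\partial\Omega$ that is differentiable at $ds$-almost every point of $\partial\Omega$; such a $\tilde S$ exists, and the formula holds for every such $\tilde S$. -/

import Mathlib

open MeasureTheory Set Filter Topology
open scoped NNReal RealInnerProductSpace

noncomputable section

/-- Euclidean space of dimension `d`. -/
abbrev Vec (d : ℕ) : Type := EuclideanSpace ℝ (Fin d)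

/-- `Ω` is an open set whose boundary is of class `C^{1,1}`: near each boundary point, in suitable
orthonormal coordinates, `Ω` is the set lying below the graph of a `C¹` function `ψ` with Lipschitz
derivative, defined on the hyperplane orthogonal to a unit vector `n`. -/
def IsC11Domain {d : ℕ} (Ω : Set (Vec d)) : Prop :=
  IsOpen Ω ∧
  ∀ x₀ ∈ frontier Ω, ∃ n : Vec d, ‖n‖ = 1 ∧ ∃ (ψ : ((ℝ ∙ n)ᗮ : Submodule ℝ (Vec d)) → ℝ) (K : ℝ≥0),
    ContDiff ℝ 1 ψ ∧ LipschitzWith K (fderiv ℝ ψ) ∧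
    ∃ r > 0, ∀ x ∈ Metric.ball x₀ r,
      (x ∈ Ω ↔ ⟪n, x⟫ < ψ ((ℝ ∙ n)ᗮ.orthogonalProjectionOnto x))

/-- `n` is the outer unit normal of `D` at `y`: inside small balls around `y`, any open cone around
the direction `-n` (of half-angle less than a right angle) lies in `D` and the opposite cone lies
outside `D`. Equivalently the boundary has the tangent hyperplane `n^⊥` at `y`. -/
def IsOuterUnitNormal {d : ℕ} (D : Set (Vec d)) (y n : Vec d) : Prop :=
  ‖n‖ = 1 ∧ ∀ δ > 0, ∃ r > 0, ∀ z ∈ Metric.ball y r,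
    (⟪z - y, n⟫ < -δ * ‖z - y‖ → z ∈ D) ∧ (δ * ‖z - y‖ < ⟪z - y, n⟫ → z ∉ D)

open Classical in
/-- The outer unit normal field of `D` (with value `0` where no outer unit normal exists). -/
def outerNormal {d : ℕ} (D : Set (Vec d)) (y : Vec d) : Vec d :=
  if h : ∃ n, IsOuterUnitNormal D y n then h.choose else 0

/-- The area element of `∂D`: the `(d-1)`-dimensional Hausdorff measure on the boundary, normalized
so as to agree with Lebesgue measure on hyperplanes. -/
def area {d : ℕ} (D : Set (Vec d)) : Measure (Vec d) :=
  (Measure.euclideanHausdorffMeasure (d - 1) : Measure (Vec d)).restrict (frontier D)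

/-- The divergence of a vector field. -/
def divergence {d : ℕ} (F : Vec d → Vec d) (x : Vec d) : ℝ :=
  ∑ i, fderiv ℝ F x (EuclideanSpace.single i 1) i

/-- Time derivative `a_t` of a time dependent vector field. -/
def timeDeriv {d : ℕ} (a : Vec d × ℝ → Vec d) (z : Vec d × ℝ) : Vec d :=
  deriv (fun s => a (z.1, s)) z.2

/-- Spatial divergence `∇·a` of a time dependent vector field. -/
def spaceDiv {d : ℕ} (a : Vec d × ℝ → Vec d) (z : Vec d × ℝ) : ℝ :=
  divergence (fun y => a (y, z.2)) z.1

/-- On the open interval `I`, the curve `A` has a first and second derivative bounded by `C`. The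
bound on the second derivative, which exists for almost every `t`, is expressed by the Lipschitz
continuity of the first one. -/
def BoundedTimeDerivs {L : Type*} [NormedAddCommGroup L] [NormedSpace ℝ L]
    (I : Set ℝ) (C : ℝ≥0) (A : ℝ → L) : Prop :=
  DifferentiableOn ℝ A I ∧ (∀ t ∈ I, ‖deriv A t‖ ≤ C) ∧ LipschitzOnWith C (deriv A) I

/-- `T t : Ω → Ω_t = T t '' Ω`, `|t| < ε`, is a twice differentiable family of bi-Lipschitz
deformations of `Ω` with `T 0 = id`: `t ↦ T t x` is `C²` for every `x ∈ Ω`, and the first and second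
`t`-derivatives of the Jacobi matrices `DT_t` and of their inverses are bounded uniformly in `t`
and (almost every) `x ∈ Ω`. -/
structure IsTwiceDifferentiableFamily {d : ℕ} (Ω : Set (Vec d)) (ε : ℝ)
    (T : ℝ → Vec d → Vec d) : Prop where
  pos : 0 < ε
  zero : ∀ x ∈ Ω, T 0 x = x
  biLipschitz : ∀ t ∈ Ioo (-ε) ε, ∃ K : ℝ≥0, ∀ x ∈ Ω, ∀ y ∈ Ω,
    dist (T t x) (T t y) ≤ K * dist x y ∧ dist x y ≤ K * dist (T t x) (T t y)
  smooth_time : ∀ x ∈ Ω, ContDiffOn ℝ 2 (fun t => T t x) (Ioo (-ε) ε)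
  jacobi : ∃ C : ℝ≥0, ∀ᵐ x ∂(volume.restrict Ω),
    (∀ t ∈ Ioo (-ε) ε, DifferentiableAt ℝ (T t) x) ∧
    BoundedTimeDerivs (Ioo (-ε) ε) C (fun t => fderiv ℝ (T t) x) ∧
    BoundedTimeDerivs (Ioo (-ε) ε) C (fun t => (fderiv ℝ (T t) x).inverse)

/-- The vector field `S = ∂T_t/∂t` at `t = 0`, continuously extended from `Ω` to its closure. -/
def velocity {d : ℕ} (Ω : Set (Vec d)) (T : ℝ → Vec d → Vec d) : Vec d → Vec d :=
  extendFrom Ω (fun x => deriv (fun t => T t x) 0)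

/-- The vector field `R = ∂²T_t/∂t²` at `t = 0`, continuously extended from `Ω` to its closure. -/
def acceleration {d : ℕ} (Ω : Set (Vec d)) (T : ℝ → Vec d → Vec d) : Vec d → Vec d :=
  extendFrom Ω (fun x => iteratedDeriv 2 (fun t => T t x) 0)

/-- `S'` is a locally Lipschitz vector field on the whole space that equals `S` on `∂Ω` and is
differentiable at almost every point of `∂Ω` with respect to surface area; first derivatives of a
Lipschitz field `S` at points of the null set `∂Ω` are those of such an extension. -/
def IsBoundaryExtension {d : ℕ} (Ω : Set (Vec d)) (S S' : Vec d → Vec d) : Prop :=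
  LocallyLipschitz S' ∧ EqOn S' S (frontier Ω) ∧ ∀ᵐ x ∂(area Ω), DifferentiableAt ℝ S' x

/-- The lateral boundary `Γ`, the union of `∂Ω_t × {t}` over `|t| < ε`. -/
def lateralBoundary {d : ℕ} (Ω : Set (Vec d)) (ε : ℝ) (T : ℝ → Vec d → Vec d) :
    Set (Vec d × ℝ) :=
  {z | z.2 ∈ Ioo (-ε) ε ∧ z.1 ∈ frontier (T z.2 '' Ω)}

/-- `a` is of class `C^{1,1}` in an open neighbourhood of the set `Γ`. -/
def IsC11Near {d : ℕ} (Γ : Set (Vec d × ℝ)) (a : Vec d × ℝ → Vec d) : Prop :=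
  ∃ U : Set (Vec d × ℝ), IsOpen U ∧ Γ ⊆ U ∧ ContDiffOn ℝ 1 a U ∧ LocallyLipschitzOn U (fderiv ℝ a)

/-- The flux of `a(·,t)` through `∂Ω_t`. -/
def boundaryFlux {d : ℕ} (Ω : Set (Vec d)) (T : ℝ → Vec d → Vec d) (a : Vec d × ℝ → Vec d)
    (t : ℝ) : ℝ :=
  ∫ y, ⟪outerNormal (T t '' Ω) y, a (y, t)⟫ ∂(area (T t '' Ω))

end

/-!
The vector field `a` matters only near `∂Ω × {0}`, so it may be replaced by a globally defined
field `b` of class `C^{1,1}` with compact support. By the divergence theorem on the deformed domain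
and a change of variables, the flux at time `t` is then the integral of `det (DT_t) (∇·b)(T_t, t)`
over the fixed domain `Ω`, and no derivative on the moving boundary is needed to differentiate it.

*First derivative.* The flux is differentiable for small `t`, with derivative
`∫_Ω tr (cof(DT_t) Dw_t)`, where `w_t = b_t(T_t, t) + (∇·b)(T_t, t) ∂T_t/∂t` is the field
`fluxField b T t` (`IsNearIdentity.hasDerivAt_integral_det_mul_spaceDiv`). For the motion of the
domain this is Jacobi's formula together with Rademacher's theorem for `∇·b`. In time, `∇·b` need
not be differentiable at almost every point of a given time slice; but the difference quotients of
`b` in time are uniformly Lipschitz and converge, so that their Jacobi matrices converge weakly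
(`tendsto_setIntegral_trace_comp_fderiv`).

*Second derivative.* The difference quotient at time zero is the sum of
`∫_Ω tr (((cof(DT_t) - I) / t) Dw_t)` and of `∫_Ω ∇·((w_t - w_0) / t)`. By weak convergence, the
first integral tends to the integral of `tr(DS) tr(Dw_0) - tr(DS Dw_0)`, the form `nullForm`. The
second one is a boundary integral, to which dominated convergence applies, because `b_t` and `∇·b`
are differentiable at almost every point of `∂Ω`. The null form is a divergence and symmetric, so
its integral depends only on the boundary values of both fields and can be written as a boundary
integral as soon as one of them is differentiable almost everywhere on `∂Ω`
(`IsLipschitzDomain.integral_nullForm`). Therefore `S` may be replaced by any extension `S'` of its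
boundary values, and everything becomes a boundary integral. As `∂ₜ(∇·b) = ∇·bₜ` wherever `b_t` and
`∇·b` are differentiable (`fderiv_spaceDiv_eq_spaceDiv_timeDeriv`), the integrands add up to those
of the formula (`IsNearIdentity.hasDerivAt_integral_trace_cofactorMap`). The extension `S'` exists
since `S` can be extended in each chart to be constant transversally to the boundary, where
Rademacher's theorem holds in the parameter domain
(`IsLipschitzDomain.exists_isBoundaryExtension`).

All this takes place on Lipschitz domains, described by an interior cone condition, because the
deformed domains are no smoother. The area formula for Lipschitz graphs (`restrict_range_graphMap`)
leads to the divergence theorem on them (`IsLipschitzDomain.integral_divergence`), and the class is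
stable under maps close to the identity (`IsLipschitzDomain.exists_isLipschitzDomain_image`). That
`T_t` is such a map for small `t` follows from the quasiconvexity of Lipschitz domains, by which
bounds on Jacobi matrices that hold almost everywhere become Lipschitz bounds
(`IsTwiceDifferentiableFamily.exists_hasTimeEstimates`).
-/


/-! ### Lipschitz functions and mollification -/

/-- The Lipschitz constant on a ball slightly larger than the support works for nearby points, the
supremum of `f` for points of the support and points at distance at least one. -/
theorem LocallyLipschitz.exists_lipschitzWith_of_hasCompactSupport {E F : Type*}
    [NormedAddCommGroup E] [ProperSpace E] [NormedAddCommGroup F] {f : E → F}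
    (hf : LocallyLipschitz f) (hc : HasCompactSupport f) : ∃ K, LipschitzWith K f := by
  obtain ⟨R, hR⟩ := hc.isCompact.isBounded.subset_closedBall (0 : E)
  obtain ⟨K, hK⟩ := (hf.locallyLipschitzOn (s := Metric.closedBall (0 : E) (R + 1))
    ).exists_lipschitzOnWith_of_compact (isCompact_closedBall _ _)
  obtain ⟨M, hM⟩ := hc.exists_bound_of_continuous hf.continuous
  have hz : ∀ y, R < ‖y‖ → f y = 0 := fun y hy => by
    by_contra h
    have := hR (subset_tsupport f h)
    rw [mem_closedBall_zero_iff] at this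
    linarith
  have key : ∀ x y, ‖x‖ ≤ R + 1 → dist (f x) (f y) ≤ max (K : ℝ) M * dist x y := by
    intro x y hx
    by_cases hy : ‖y‖ ≤ R + 1
    · refine (hK.dist_le_mul x (by simpa using hx) y (by simpa using hy)).trans ?_
      gcongr
      exact le_max_left _ _
    · push Not at hy
      rw [hz y (by linarith)]
      by_cases hx' : ‖x‖ ≤ R
      · have h1 : 1 ≤ dist x y := by
          rw [dist_eq_norm, norm_sub_rev]
          have := norm_sub_norm_le y x
          linarith
        rw [dist_zero_right]
        calc ‖f x‖ ≤ M := hM x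
          _ ≤ max (K : ℝ) M := le_max_right _ _
          _ ≤ max (K : ℝ) M * dist x y := le_mul_of_one_le_right (le_max_of_le_left K.2) h1
      · push Not at hx'
        rw [hz x hx', dist_self]
        exact mul_nonneg (le_max_of_le_left K.2) dist_nonneg
  refine ⟨⟨max (K : ℝ) M, le_max_of_le_left K.2⟩, LipschitzWith.of_dist_le_mul fun x y => ?_⟩
  by_cases hx : ‖x‖ ≤ R + 1
  · exact key x y hx
  · by_cases hy : ‖y‖ ≤ R + 1
    · rw [dist_comm, dist_comm x]; exact key y x hy
    · push Not at hx hy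
      rw [hz x (by linarith), hz y (by linarith), dist_self]
      exact mul_nonneg (NNReal.coe_nonneg _) dist_nonneg

section Mollify

variable {E F : Type*} [NormedAddCommGroup E] [NormedSpace ℝ E] [FiniteDimensional ℝ E]
  [MeasurableSpace E] [BorelSpace E] (μ : Measure E) [μ.IsAddHaarMeasure]
  [NormedAddCommGroup F] [NormedSpace ℝ F] [FiniteDimensional ℝ F]

/-- A fixed smooth bump function of integral one, supported in the closed ball of radius `2`. -/
noncomputable def mollifier (z : E) : ℝ :=
  ContDiffBump.normed (⟨1, 2, one_pos, one_lt_two⟩ : ContDiffBump (0 : E)) μ z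

theorem mollifier_nonneg (z : E) : 0 ≤ mollifier μ z := ContDiffBump.nonneg_normed _ _

theorem contDiff_mollifier {n : ℕ∞} : ContDiff ℝ n (mollifier μ) := ContDiffBump.contDiff_normed _

theorem continuous_mollifier : Continuous (mollifier μ) := ContDiffBump.continuous_normed _

theorem integral_mollifier : ∫ z, mollifier μ z ∂μ = 1 := ContDiffBump.integral_normed _

theorem hasCompactSupport_mollifier : HasCompactSupport (mollifier μ) :=
  ContDiffBump.hasCompactSupport_normed _

theorem mollifier_eq_zero {z : E} (hz : 2 ≤ ‖z‖) : mollifier μ z = 0 := by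
  by_contra h
  have : z ∈ Function.support (mollifier μ) := h
  have h2 : Function.support (mollifier μ) = Metric.ball 0 2 := ContDiffBump.support_normed_eq _
  rw [h2, mem_ball_zero_iff] at this
  linarith

theorem integrable_mollifier : Integrable (mollifier μ) μ := ContDiffBump.integrable_normed _

theorem continuous_fderiv_mollifier : Continuous (fderiv ℝ (mollifier μ)) :=
  (contDiff_mollifier μ (n := 1)).continuous_fderiv (by simp)

theorem hasCompactSupport_fderiv_mollifier : HasCompactSupport (fderiv ℝ (mollifier μ)) :=
  (hasCompactSupport_mollifier μ).fderiv ℝ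

/-- The mollification of `f` at scale `r`, that is, the average of `f (x - r z)` with respect to
the weight `mollifier μ z`. -/
noncomputable def mollify (r : ℝ) (f : E → F) (x : E) : F :=
  ∫ z, mollifier μ z • f (x - r • z) ∂μ

theorem integrable_mollifier_smul {f : E → F} (hf : Continuous f) (r : ℝ) (x : E) :
    Integrable (fun z => mollifier μ z • f (x - r • z)) μ :=
  ((continuous_mollifier μ).smul (by fun_prop)).integrable_of_hasCompactSupport
    (hasCompactSupport_mollifier μ).smul_right

theorem norm_integral_mollifier_smul_le {g : E → F} {C : ℝ}
    (h : ∀ z, ‖z‖ ≤ 2 → ‖g z‖ ≤ C) : ‖∫ z, mollifier μ z • g z ∂μ‖ ≤ C := by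
  calc ‖∫ z, mollifier μ z • g z ∂μ‖ ≤ ∫ z, mollifier μ z * C ∂μ := by
        refine norm_integral_le_of_norm_le ((integrable_mollifier μ).mul_const C)
          (ae_of_all _ fun z => ?_)
        rw [norm_smul, Real.norm_of_nonneg (mollifier_nonneg μ z)]
        by_cases hz : ‖z‖ ≤ 2
        · exact mul_le_mul_of_nonneg_left (h z hz) (mollifier_nonneg μ z)
        · rw [mollifier_eq_zero μ (not_le.1 hz).le]; simp
    _ = C := by rw [integral_mul_const, integral_mollifier, one_mul]

theorem LipschitzWith.mollify {f : E → F} {K : ℝ≥0} (hf : LipschitzWith K f) (r : ℝ) :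
    LipschitzWith K (mollify μ r f) := by
  refine LipschitzWith.of_dist_le_mul fun x y => ?_
  rw [dist_eq_norm, _root_.mollify, _root_.mollify,
    ← integral_sub (integrable_mollifier_smul μ hf.continuous r x)
      (integrable_mollifier_smul μ hf.continuous r y)]
  simp_rw [← smul_sub]
  refine norm_integral_mollifier_smul_le μ fun z _ => ?_
  rw [← dist_eq_norm]
  refine (hf.dist_le_mul _ _).trans ?_
  rw [dist_sub_right]

/-- A bound on `f` in a ball around `x` controls the difference of values of the mollification. -/
theorem norm_mollify_sub_le {f : E → F} (hf : Continuous f) {r C : ℝ} {x : E} {w : F}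
    (h : ∀ z, ‖z‖ ≤ 2 → ‖f (x - r • z) - w‖ ≤ C) : ‖mollify μ r f x - w‖ ≤ C := by
  have : mollify μ r f x - w = ∫ z, mollifier μ z • (f (x - r • z) - w) ∂μ := by
    simp_rw [smul_sub]
    rw [integral_sub (integrable_mollifier_smul μ hf r x) ((integrable_mollifier μ).smul_const w),
      integral_smul_const, integral_mollifier, one_smul, _root_.mollify]
  rw [this]
  exact norm_integral_mollifier_smul_le μ h

theorem LipschitzWith.norm_mollify_sub_le {f : E → F} {K : ℝ≥0} (hf : LipschitzWith K f)
    {r : ℝ} (hr : 0 ≤ r) (x : E) : ‖_root_.mollify μ r f x - f x‖ ≤ K * (r * 2) := by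
  refine _root_.norm_mollify_sub_le μ hf.continuous fun z hz => ?_
  refine (hf.norm_sub_le _ _).trans ?_
  have : x - r • z - x = -(r • z) := by abel
  rw [this, norm_neg, norm_smul, Real.norm_of_nonneg hr]
  gcongr

theorem LipschitzWith.tendsto_mollify {f : E → F} {K : ℝ≥0} (hf : LipschitzWith K f) (x : E) :
    Tendsto (fun r => _root_.mollify μ r f x) (𝓝[>] 0) (𝓝 (f x)) := by
  rw [tendsto_iff_norm_sub_tendsto_zero]
  have : Tendsto (fun r : ℝ => K * (r * 2)) (𝓝[>] 0) (𝓝 0) := by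
    have : Continuous fun r : ℝ => K * (r * 2) := by fun_prop
    simpa using (this.tendsto 0).mono_left nhdsWithin_le_nhds
  refine squeeze_zero' (Eventually.of_forall fun _ => norm_nonneg _) ?_ this
  filter_upwards [self_mem_nhdsWithin] with r hr
  exact hf.norm_mollify_sub_le μ (le_of_lt hr) x

theorem mollify_eq_convolution {r : ℝ} (hr : 0 < r) (f : E → F) :
    mollify μ r f = convolution (fun t => (r ^ Module.finrank ℝ E)⁻¹ * mollifier μ (r⁻¹ • t)) f
      (ContinuousLinearMap.lsmul ℝ ℝ) μ := by
  ext x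
  rw [convolution_def]
  have := Measure.integral_comp_inv_smul μ
    (fun z => (r ^ Module.finrank ℝ E)⁻¹ • mollifier μ z • f (x - r • z)) r
  simp only [ContinuousLinearMap.lsmul_apply]
  simp only [smul_smul, mul_inv_cancel₀ hr.ne', one_smul] at this
  rw [this, _root_.mollify, ← integral_smul]
  congr 1
  ext z
  rw [abs_of_pos (by positivity), smul_smul, ← mul_assoc, mul_inv_cancel₀ (by positivity), one_mul]

theorem contDiff_mollify {r : ℝ} (hr : 0 < r) {f : E → F} (hf : Continuous f) {n : ℕ∞} :
    ContDiff ℝ n (mollify μ r f) := by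
  rw [mollify_eq_convolution μ hr]
  refine HasCompactSupport.contDiff_convolution_left _ ?_ ?_ (hf.locallyIntegrable)
  · exact ((hasCompactSupport_mollifier μ).comp_homeomorph
      (Homeomorph.smulOfNeZero r⁻¹ (inv_ne_zero hr.ne'))).mul_left
  · exact contDiff_const.mul ((contDiff_mollifier μ).comp (contDiff_const_smul _))

theorem hasFDerivAt_mollify {r : ℝ} (hr : 0 < r) {f : E → F} (hf : Continuous f) (x : E) :
    HasFDerivAt (mollify μ r f)
      (∫ z, (fderiv ℝ (mollifier μ) z).smulRight (r⁻¹ • f (x - r • z)) ∂μ) x := by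
  rw [mollify_eq_convolution μ hr]
  have hcd : ContDiff ℝ 1 (fun t => (r ^ Module.finrank ℝ E)⁻¹ * mollifier μ (r⁻¹ • t)) :=
    contDiff_const.mul ((contDiff_mollifier μ (n := 1)).comp (contDiff_const_smul _))
  have hcs : HasCompactSupport
      (fun t => (r ^ Module.finrank ℝ E)⁻¹ * mollifier μ (r⁻¹ • t)) :=
    ((hasCompactSupport_mollifier μ).comp_homeomorph
      (Homeomorph.smulOfNeZero r⁻¹ (inv_ne_zero hr.ne'))).mul_left
  have := hcs.hasFDerivAt_convolution_left (ContinuousLinearMap.lsmul ℝ ℝ) (μ := μ) hcd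
    (hf.locallyIntegrable) x
  convert this using 1
  rw [convolution_def]
  have h2 := Measure.integral_comp_inv_smul μ
    (fun z => (r ^ Module.finrank ℝ E)⁻¹ •
      (fderiv ℝ (mollifier μ) z).smulRight (r⁻¹ • f (x - r • z))) r
  simp only [smul_smul, mul_inv_cancel₀ hr.ne', one_smul] at h2
  have h3 : ∀ t, ((ContinuousLinearMap.lsmul ℝ ℝ : ℝ →L[ℝ] F →L[ℝ] F).precompL E
      (fderiv ℝ (fun t => (r ^ Module.finrank ℝ E)⁻¹ * mollifier μ (r⁻¹ • t)) t)) (f (x - t)) =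
      (r ^ Module.finrank ℝ E)⁻¹ •
        (fderiv ℝ (mollifier μ) (r⁻¹ • t)).smulRight (r⁻¹ • f (x - t)) := by
    intro t
    have hd : HasFDerivAt (fun t => (r ^ Module.finrank ℝ E)⁻¹ * mollifier μ (r⁻¹ • t))
        ((r ^ Module.finrank ℝ E)⁻¹ • ((fderiv ℝ (mollifier μ) (r⁻¹ • t)).comp
          (r⁻¹ • ContinuousLinearMap.id ℝ E))) t := by
      refine HasFDerivAt.const_mul ?_ _
      exact (((contDiff_mollifier μ (n := 1)).differentiable (by simp)) _).hasFDerivAt.comp t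
        ((hasFDerivAt_id t).const_smul r⁻¹)
    rw [hd.fderiv]
    ext v
    simp [smul_smul, mul_comm, mul_left_comm, mul_assoc]
  refine Eq.trans ?_ (integral_congr_ae (ae_of_all _ fun t => (h3 t).symm))
  rw [h2, ← integral_smul]
  congr 1
  ext1 z
  rw [abs_of_pos (by positivity), smul_smul, mul_inv_cancel₀ (by positivity), one_smul]

/-- Difference quotient form of the derivative of a mollification. -/
theorem fderiv_mollify_eq {r : ℝ} (hr : 0 < r) {f : E → F} (hf : Continuous f) (x : E) :
    fderiv ℝ (mollify μ r f) x =
      ∫ z, (fderiv ℝ (mollifier μ) z).smulRight (r⁻¹ • (f (x - r • z) - f x)) ∂μ := by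
  have h1 := hasFDerivAt_mollify μ hr (f := fun y => f y - f x) (by fun_prop) x
  have h2 : mollify μ r (fun y => f y - f x) = fun y => mollify μ r f y - f x := by
    ext y
    simp only [_root_.mollify, smul_sub]
    rw [integral_sub (integrable_mollifier_smul μ hf r y) ((integrable_mollifier μ).smul_const _),
      integral_smul_const, integral_mollifier, one_smul]
  rw [← h1.fderiv, h2, fderiv_sub_const]

/-- The derivatives of the mollifications converge at every point of differentiability. -/
theorem LipschitzWith.tendsto_fderiv_mollify {f : E → F} {K : ℝ≥0} (hf : LipschitzWith K f) {x : E}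
    (hx : DifferentiableAt ℝ f x) :
    Tendsto (fun r => fderiv ℝ (_root_.mollify μ r f) x) (𝓝[>] 0) (𝓝 (fderiv ℝ f x)) := by
  -- the limit of the difference quotients is the same for `f` and for its linear part
  have key : ∀ (g : E → F) (K' : ℝ≥0), LipschitzWith K' g → ∀ L : E →L[ℝ] F, HasFDerivAt g L x →
      Tendsto (fun r => fderiv ℝ (_root_.mollify μ r g) x) (𝓝[>] 0)
        (𝓝 (∫ z, (fderiv ℝ (mollifier μ) z).smulRight (-L z) ∂μ)) := by
    intro g K' hg L hL
    have h1 : Tendsto (fun r : ℝ => ∫ z, (fderiv ℝ (mollifier μ) z).smulRight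
        (r⁻¹ • (g (x - r • z) - g x)) ∂μ) (𝓝[>] 0)
        (𝓝 (∫ z, (fderiv ℝ (mollifier μ) z).smulRight (-L z) ∂μ)) := by
      refine tendsto_integral_filter_of_dominated_convergence
        (fun z => ‖fderiv ℝ (mollifier μ) z‖ * (K' * ‖z‖)) ?_ ?_ ?_ ?_
      · refine Eventually.of_forall fun r => Continuous.aestronglyMeasurable ?_
        have hg := hg.continuous
        have := continuous_fderiv_mollifier μ
        fun_prop
      · filter_upwards [self_mem_nhdsWithin] with r (hr : 0 < r)
        refine ae_of_all _ fun z => ?_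
        rw [ContinuousLinearMap.norm_smulRight_apply]
        gcongr
        rw [norm_smul, norm_inv, Real.norm_of_nonneg hr.le, inv_mul_le_iff₀ hr]
        refine (hg.norm_sub_le _ _).trans (le_of_eq ?_)
        have : x - r • z - x = -(r • z) := by abel
        rw [this, norm_neg, norm_smul, Real.norm_of_nonneg hr.le]
        ring
      · refine Continuous.integrable_of_hasCompactSupport ?_ ?_
        · have := continuous_fderiv_mollifier μ
          fun_prop
        · exact (hasCompactSupport_fderiv_mollifier μ).norm.mul_right
      · refine ae_of_all _ fun z => ?_
        have h3 : Tendsto (fun r : ℝ => r⁻¹ • (g (x - r • z) - g x)) (𝓝[>] 0) (𝓝 (-L z)) := by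
          have := (hL.hasLineDerivAt (-z)).tendsto_slope_zero_right
          simpa [sub_eq_add_neg] using this
        exact ((ContinuousLinearMap.smulRightL ℝ E F
          (fderiv ℝ (mollifier μ) z)).continuous.tendsto _).comp h3
    refine h1.congr' ?_
    filter_upwards [self_mem_nhdsWithin] with r (hr : 0 < r)
    exact (fderiv_mollify_eq μ hr hg.continuous x).symm
  have h1 := key f K hf _ hx.hasFDerivAt
  have h2 := key (fderiv ℝ f x) _ (fderiv ℝ f x).lipschitz _ (fderiv ℝ f x).hasFDerivAt
  have h3 : ∀ r : ℝ, fderiv ℝ (_root_.mollify μ r (fderiv ℝ f x)) x = fderiv ℝ f x := by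
    intro r
    have : _root_.mollify μ r (fderiv ℝ f x) = fun y => fderiv ℝ f x y -
        ∫ z, mollifier μ z • fderiv ℝ f x (r • z) ∂μ := by
      ext y
      simp only [_root_.mollify, map_sub, smul_sub]
      rw [integral_sub ((integrable_mollifier μ).smul_const _), integral_smul_const,
        integral_mollifier, one_smul]
      exact ((continuous_mollifier μ).smul (by fun_prop)).integrable_of_hasCompactSupport
        (hasCompactSupport_mollifier μ).smul_right
    rw [this, fderiv_sub_const]
    exact (fderiv ℝ f x).fderiv
  simp_rw [h3] at h2
  rwa [tendsto_nhds_unique h2 tendsto_const_nhds] at h1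

end Mollify

/-! ### The area of Lipschitz graphs -/

section Graph

variable {V : Type*} [NormedAddCommGroup V] [InnerProductSpace ℝ V]

/-- The parametrization of the graph, in direction `n`, of a function `ψ` on the hyperplane
orthogonal to `n`. -/
def graphMap (n : V) (ψ : ((ℝ ∙ n)ᗮ : Submodule ℝ V) → ℝ) (p : ((ℝ ∙ n)ᗮ : Submodule ℝ V)) : V :=
  (p : V) + ψ p • n

theorem inner_orthogonal_span_singleton (n : V) (p : ((ℝ ∙ n)ᗮ : Submodule ℝ V)) :
    ⟪n, (p : V)⟫ = 0 :=
  Submodule.mem_orthogonal_singleton_iff_inner_right.1 p.2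

theorem norm_add_smul_sq {n : V} (hn : ‖n‖ = 1) (p : ((ℝ ∙ n)ᗮ : Submodule ℝ V)) (s : ℝ) :
    ‖(p : V) + s • n‖ ^ 2 = ‖p‖ ^ 2 + s ^ 2 := by
  rw [norm_add_sq_real, inner_smul_right, real_inner_comm, inner_orthogonal_span_singleton,
    norm_smul, hn]
  simp

theorem norm_le_norm_add_smul {n : V} (hn : ‖n‖ = 1) (p : ((ℝ ∙ n)ᗮ : Submodule ℝ V)) (s : ℝ) :
    ‖p‖ ≤ ‖(p : V) + s • n‖ := by
  refine le_of_sq_le_sq ?_ (norm_nonneg _)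
  rw [norm_add_smul_sq hn]
  nlinarith [sq_nonneg s]

/-- The area density of the graph of a linear function with gradient `A`. -/
noncomputable def graphDensity {E : Type*} [NormedAddCommGroup E] [NormedSpace ℝ E]
    (A : E →L[ℝ] ℝ) : ℝ≥0 := NNReal.sqrt (1 + ‖A‖₊ ^ 2)

theorem coe_graphDensity {E : Type*} [NormedAddCommGroup E] [NormedSpace ℝ E]
    (A : E →L[ℝ] ℝ) : (graphDensity A : ℝ) = √(1 + ‖A‖ ^ 2) := by
  simp [graphDensity]

theorem graphDensity_le {E : Type*} [NormedAddCommGroup E] [NormedSpace ℝ E]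
    (A B : E →L[ℝ] ℝ) {δ : ℝ≥0} (h : ‖A - B‖ ≤ δ) : graphDensity A ≤ graphDensity B + δ := by
  rw [← NNReal.coe_le_coe, NNReal.coe_add, coe_graphDensity, coe_graphDensity]
  have h1 : ‖A‖ ≤ ‖B‖ + δ := by linarith [norm_sub_norm_le A B]
  have h2 : ‖B‖ ≤ √(1 + ‖B‖ ^ 2) := Real.le_sqrt_of_sq_le (by linarith)
  have h3 := Real.sq_sqrt (show 0 ≤ 1 + ‖B‖ ^ 2 by positivity)
  have h4 : 0 ≤ (δ : ℝ) := δ.2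
  refine Real.sqrt_le_iff.2 ⟨by positivity, ?_⟩
  have h5 : ‖A‖ ^ 2 ≤ (‖B‖ + δ) ^ 2 := by gcongr
  nlinarith

theorem measurable_graphDensity {E : Type*} [NormedAddCommGroup E] [NormedSpace ℝ E]
    {X : Type*} [MeasurableSpace X] {f : X → E →L[ℝ] ℝ} (hf : Measurable f) :
    Measurable fun x => graphDensity (f x) := by
  unfold graphDensity
  exact NNReal.continuous_sqrt.measurable.comp ((hf.nnnorm.pow_const 2).const_add 1)

theorem graphMap_injective {n : V} (hn : ‖n‖ = 1) (ψ : ((ℝ ∙ n)ᗮ : Submodule ℝ V) → ℝ) :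
    Function.Injective (graphMap n ψ) := by
  intro p q h
  have h1 : ((p - q : ((ℝ ∙ n)ᗮ : Submodule ℝ V)) : V) + (ψ p - ψ q) • n = 0 := by
    unfold graphMap at h
    rw [sub_smul, Submodule.coe_sub]
    have : (p : V) = q + ψ q • n - ψ p • n := by rw [← h]; abel
    rw [this]; abel
  have := norm_le_norm_add_smul hn (p - q) (ψ p - ψ q)
  rw [h1, norm_zero] at this
  exact sub_eq_zero.1 (norm_le_zero_iff.1 this)

theorem dist_le_dist_graphMap {n : V} (hn : ‖n‖ = 1) (ψ : ((ℝ ∙ n)ᗮ : Submodule ℝ V) → ℝ)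
    (p q : ((ℝ ∙ n)ᗮ : Submodule ℝ V)) : dist p q ≤ dist (graphMap n ψ p) (graphMap n ψ q) := by
  rw [dist_eq_norm, dist_eq_norm]
  have : graphMap n ψ p - graphMap n ψ q = ((p - q : ((ℝ ∙ n)ᗮ : Submodule ℝ V)) : V) +
      (ψ p - ψ q) • n := by
    unfold graphMap
    rw [sub_smul, Submodule.coe_sub]; abel
  rw [this]
  exact norm_le_norm_add_smul hn _ _

theorem LipschitzWith.graphMap {n : V} (hn : ‖n‖ = 1) {ψ : ((ℝ ∙ n)ᗮ : Submodule ℝ V) → ℝ}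
    {M : ℝ≥0} (hψ : LipschitzWith M ψ) : LipschitzWith (1 + M) (graphMap n ψ) := by
  refine LipschitzWith.add (LipschitzWith.of_dist_le_mul fun p q => by simp [Subtype.dist_eq])
    (LipschitzWith.of_dist_le_mul fun p q => ?_)
  rw [dist_eq_norm, ← sub_smul, norm_smul, hn, mul_one, ← dist_eq_norm]
  exact hψ.dist_le_mul p q

theorem isClosedEmbedding_graphMap [CompleteSpace V] {n : V} (hn : ‖n‖ = 1)
    {ψ : ((ℝ ∙ n)ᗮ : Submodule ℝ V) → ℝ} {M : ℝ≥0} (hψ : LipschitzWith M ψ) :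
    IsClosedEmbedding (graphMap n ψ) :=
  AntilipschitzWith.isClosedEmbedding (K := 1)
    (AntilipschitzWith.of_le_mul_dist fun p q => by
      simpa using dist_le_dist_graphMap hn ψ p q) (hψ.graphMap hn).uniformContinuous

variable [FiniteDimensional ℝ V] [MeasurableSpace V] [BorelSpace V]

open Module in
theorem euclideanHausdorffMeasure_graphMap_linear {n : V} (hn : ‖n‖ = 1)
    (A : ((ℝ ∙ n)ᗮ : Submodule ℝ V) →L[ℝ] ℝ) (t : Set ((ℝ ∙ n)ᗮ : Submodule ℝ V)) :
    (Measure.euclideanHausdorffMeasure (finrank ℝ ((ℝ ∙ n)ᗮ : Submodule ℝ V)) : Measure V)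
      (graphMap n A '' t) = graphDensity A * volume t := by
  let f : ((ℝ ∙ n)ᗮ : Submodule ℝ V) →ₗ[ℝ] V :=
    ((ℝ ∙ n)ᗮ : Submodule ℝ V).subtype + (A : ((ℝ ∙ n)ᗮ : Submodule ℝ V) →ₗ[ℝ] ℝ).smulRight n
  have hf : (f : ((ℝ ∙ n)ᗮ : Submodule ℝ V) → V) = graphMap n A := by
    ext p; simp [f, graphMap]
  have h := f.euclideanHausdorffMeasure_image_eq_normDet_mul_volume t
  rw [hf] at h
  rw [h]
  congr 1
  -- the Gram operator of the graph map is the identity plus a rank one operator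
  have hsq : f.normDet ^ 2 = 1 + ‖A‖ ^ 2 := by
    have h1 := f.normDet_sq
    set a := (InnerProductSpace.toDual ℝ ((ℝ ∙ n)ᗮ : Submodule ℝ V)).symm A with ha
    have haA : ∀ p, A p = ⟪a, p⟫ := fun p => by
      rw [ha, InnerProductSpace.toDual_symm_apply]
    have hna : ‖a‖ = ‖A‖ := by simp [ha]
    have h2 : f.adjoint ∘ₗ f = LinearMap.transvection
        (A : ((ℝ ∙ n)ᗮ : Submodule ℝ V) →ₗ[ℝ] ℝ) a := by
      ext1 p
      refine ext_inner_left ℝ fun q => ?_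
      rw [LinearMap.comp_apply, LinearMap.adjoint_inner_right]
      have : f q = (q : V) + A q • n := rfl
      have h' : f p = (p : V) + A p • n := rfl
      rw [this, h', LinearMap.transvection.apply]
      simp only [inner_add_left, inner_add_right, inner_smul_left, inner_smul_right,
        inner_orthogonal_span_singleton, real_inner_comm n, real_inner_self_eq_norm_sq, hn]
      simp [haA, real_inner_comm]
    rw [h2, LinearMap.transvection.det] at h1
    rw [← hna, ← real_inner_self_eq_norm_sq a, ← haA]
    exact_mod_cast h1
  rw [← ENNReal.ofReal_coe_nnreal, coe_graphDensity, ← hsq, Real.sqrt_sq f.normDet_nonneg]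

theorem LipschitzOnWith.euclideanHausdorffMeasure_image_le {X Y : Type*} [MetricSpace X]
    [MetricSpace Y] [MeasurableSpace X] [BorelSpace X] [MeasurableSpace Y] [BorelSpace Y]
    {f : X → Y} {s : Set X} {K : ℝ≥0} (hf : LipschitzOnWith K f s) (k : ℕ) :
    (Measure.euclideanHausdorffMeasure k : Measure Y) (f '' s) ≤
      (K : ENNReal) ^ k * (Measure.euclideanHausdorffMeasure k : Measure X) s := by
  simp_rw [Measure.euclideanHausdorffMeasure_def, Measure.smul_apply]
  have := hf.hausdorffMeasure_image_le (d := k) (by positivity)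
  rw [ENNReal.rpow_natCast] at this
  calc _ ≤ Measure.addHaarScalarFactor (volume : Measure (EuclideanSpace ℝ (Fin k)))
        (Measure.hausdorffMeasure k) • ((K : ENNReal) ^ k * (Measure.hausdorffMeasure k) s) := by
        gcongr
    _ = _ := by simp only [ENNReal.smul_def, smul_eq_mul]; ring

/-- Two graphs over the same set whose defining functions differ by a `δ`-Lipschitz function have
comparable areas. -/
theorem euclideanHausdorffMeasure_graphMap_le {n : V} (hn : ‖n‖ = 1)
    {ψ φ : ((ℝ ∙ n)ᗮ : Submodule ℝ V) → ℝ} {s : Set ((ℝ ∙ n)ᗮ : Submodule ℝ V)} {δ : ℝ≥0}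
    (h : LipschitzOnWith δ (fun p => φ p - ψ p) s) (k : ℕ) :
    (Measure.euclideanHausdorffMeasure k : Measure V) (graphMap n φ '' s) ≤
      ((1 + δ : ℝ≥0) : ENNReal) ^ k *
        (Measure.euclideanHausdorffMeasure k : Measure V) (graphMap n ψ '' s) := by
  set inv := Function.invFun (graphMap n ψ)
  have hinv : ∀ p, inv (graphMap n ψ p) = p := Function.leftInverse_invFun (graphMap_injective hn ψ)
  have hl : LipschitzOnWith (1 + δ) (fun x => graphMap n φ (inv x)) (graphMap n ψ '' s) := by
    refine LipschitzOnWith.of_dist_le_mul ?_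
    rintro _ ⟨p, hp, rfl⟩ _ ⟨q, hq, rfl⟩
    simp only [hinv]
    have h1 := h.dist_le_mul p hp q hq
    have h2 := dist_le_dist_graphMap hn ψ p q
    have h3 : graphMap n φ p - graphMap n φ q = (graphMap n ψ p - graphMap n ψ q) +
        ((φ p - ψ p) - (φ q - ψ q)) • n := by
      unfold graphMap
      simp only [sub_smul]
      abel
    rw [dist_eq_norm, h3]
    refine (norm_add_le _ _).trans ?_
    rw [norm_smul, hn, mul_one, ← dist_eq_norm, ← dist_eq_norm, NNReal.coe_add, NNReal.coe_one,
      add_mul, one_mul]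
    gcongr
    exact h1.trans (by gcongr)
  have := hl.euclideanHausdorffMeasure_image_le k
  rw [image_image] at this
  simpa only [hinv] using this

open Module in
/-- Area estimate on a set where the gradient is almost constant. -/
theorem graphMap_area_estimate {n : V} (hn : ‖n‖ = 1)
    {ψ : ((ℝ ∙ n)ᗮ : Submodule ℝ V) → ℝ} (hψ : Continuous ψ)
    {ψ' : ((ℝ ∙ n)ᗮ : Submodule ℝ V) → ((ℝ ∙ n)ᗮ : Submodule ℝ V) →L[ℝ] ℝ}
    {D : ((ℝ ∙ n)ᗮ : Submodule ℝ V) →L[ℝ] ℝ} {δ : ℝ≥0} (hδ : 0 < δ)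
    {s : Set ((ℝ ∙ n)ᗮ : Submodule ℝ V)} (hs : MeasurableSet s)
    (hd : ∀ p ∈ s, HasFDerivAt ψ (ψ' p) p) (hD : ∀ p ∈ s, ‖ψ' p - D‖ ≤ δ) :
    (Measure.euclideanHausdorffMeasure (finrank ℝ ((ℝ ∙ n)ᗮ : Submodule ℝ V)) : Measure V)
        (graphMap n ψ '' s) ≤
      ((1 + δ : ℝ≥0) : ENNReal) ^ (finrank ℝ ((ℝ ∙ n)ᗮ : Submodule ℝ V)) *
        ((graphDensity D + δ : ℝ≥0) * volume s) ∧
    graphDensity D * volume s ≤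
      ((1 + δ : ℝ≥0) : ENNReal) ^ (finrank ℝ ((ℝ ∙ n)ᗮ : Submodule ℝ V)) *
        (Measure.euclideanHausdorffMeasure (finrank ℝ ((ℝ ∙ n)ᗮ : Submodule ℝ V)) : Measure V)
          (graphMap n ψ '' s) + δ * volume s := by
  set k := finrank ℝ ((ℝ ∙ n)ᗮ : Submodule ℝ V) with hk
  set H : Measure V := Measure.euclideanHausdorffMeasure k with hH
  rcases s.eq_empty_or_nonempty with rfl | hne
  · simp
  obtain ⟨t, A, htd, htm, hst, happ, hA⟩ := exists_partition_approximatesLinearOn_of_hasFDerivWithinAt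
    ψ s ψ' (fun p hp => (hd p hp).hasFDerivWithinAt) (fun _ => δ) (fun _ => hδ.ne')
  have hAD : ∀ i, ‖A i - D‖ ≤ δ := fun i => by
    obtain ⟨y, hy, h⟩ := hA hne i
    rw [h]; exact hD y hy
  have hsU : s = ⋃ i, s ∩ t i := by rw [← inter_iUnion, inter_eq_left.2 hst]
  have hm : ∀ i, MeasurableSet (s ∩ t i) := fun i => hs.inter (htm i)
  have hemb : MeasurableEmbedding (graphMap n ψ) :=
    (Continuous.measurableEmbedding (by unfold graphMap; fun_prop) (graphMap_injective hn ψ))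
  have hdis : Pairwise (Function.onFun Disjoint fun i => s ∩ t i) := fun i j hij =>
    (htd hij).mono inter_subset_right inter_subset_right
  have hvol : volume s = ∑' i, volume (s ∩ t i) := by
    conv_lhs => rw [hsU]
    exact measure_iUnion hdis hm
  have hHs : H (graphMap n ψ '' s) = ∑' i, H (graphMap n ψ '' (s ∩ t i)) := by
    conv_lhs => rw [hsU, image_iUnion]
    refine measure_iUnion (fun i j hij => ?_) fun i => hemb.measurableSet_image.2 (hm i)
    exact (disjoint_image_iff (graphMap_injective hn ψ)).2 (hdis hij)
  have hl : ∀ i, LipschitzOnWith δ (fun p => ψ p - A i p) (s ∩ t i) := fun i =>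
    LipschitzOnWith.of_dist_le_mul fun p hp q hq => by
      have := happ i p hp q hq
      rw [dist_eq_norm, dist_eq_norm]
      rw [map_sub] at this
      rwa [show ψ p - A i p - (ψ q - A i q) = ψ p - ψ q - (A i p - A i q) by ring]
  have hl' : ∀ i, LipschitzOnWith δ (fun p => A i p - ψ p) (s ∩ t i) := fun i => by
    refine LipschitzOnWith.of_dist_le_mul fun p hp q hq => ?_
    have := (hl i).dist_le_mul p hp q hq
    rw [dist_eq_norm] at this ⊢
    rwa [← norm_neg, show -(A i p - ψ p - (A i q - ψ q)) = ψ p - A i p - (ψ q - A i q) by ring]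
  constructor
  · rw [hHs, hvol, ← ENNReal.tsum_mul_left, ← ENNReal.tsum_mul_left]
    refine ENNReal.tsum_le_tsum fun i => ?_
    refine (euclideanHausdorffMeasure_graphMap_le hn (hl i) k).trans ?_
    rw [euclideanHausdorffMeasure_graphMap_linear hn]
    gcongr
    exact graphDensity_le _ _ (hAD i)
  · rw [hHs, hvol, ← ENNReal.tsum_mul_left, ← ENNReal.tsum_mul_left, ← ENNReal.tsum_mul_left,
      ← ENNReal.tsum_add]
    refine ENNReal.tsum_le_tsum fun i => ?_
    have h1 : graphDensity D ≤ graphDensity (A i) + δ :=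
      graphDensity_le _ _ (by rw [norm_sub_rev]; exact hAD i)
    calc (graphDensity D : ENNReal) * volume (s ∩ t i)
        ≤ ((graphDensity (A i) + δ : ℝ≥0) : ENNReal) * volume (s ∩ t i) := by gcongr
      _ = graphDensity (A i) * volume (s ∩ t i) + δ * volume (s ∩ t i) := by
          rw [ENNReal.coe_add, add_mul]
      _ ≤ _ := by
          refine add_le_add ?_ le_rfl
          rw [← euclideanHausdorffMeasure_graphMap_linear hn]
          exact euclideanHausdorffMeasure_graphMap_le hn (hl' i) k

open Module in
/-- The area of the graph over a set of points of differentiability. The set is cut into countably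
many pieces on which the gradient is within `δ` of a constant one; the errors add up to a multiple
of `δ`. -/
theorem euclideanHausdorffMeasure_graphMap_image {n : V} (hn : ‖n‖ = 1)
    {ψ : ((ℝ ∙ n)ᗮ : Submodule ℝ V) → ℝ} {M : ℝ≥0} (hψ : LipschitzWith M ψ)
    {s : Set ((ℝ ∙ n)ᗮ : Submodule ℝ V)} (hs : MeasurableSet s)
    (hd : ∀ p ∈ s, DifferentiableAt ℝ ψ p) (hfin : volume s ≠ ⊤) :
    (Measure.euclideanHausdorffMeasure (finrank ℝ ((ℝ ∙ n)ᗮ : Submodule ℝ V)) : Measure V)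
        (graphMap n ψ '' s) = ∫⁻ p in s, graphDensity (fderiv ℝ ψ p) := by
  set k := finrank ℝ ((ℝ ∙ n)ᗮ : Submodule ℝ V) with hk
  set H : Measure V := Measure.euclideanHausdorffMeasure k with hH
  have hmJ : Measurable fun p => (graphDensity (fderiv ℝ ψ p) : ENNReal) :=
    (measurable_graphDensity (measurable_fderiv ℝ ψ)).coe_nnreal_ennreal
  have hemb : MeasurableEmbedding (graphMap n ψ) :=
    (isClosedEmbedding_graphMap hn hψ).measurableEmbedding
  have key : ∀ δ : ℝ≥0, 0 < δ →
      H (graphMap n ψ '' s) ≤ ((1 + δ : ℝ≥0) : ENNReal) ^ k *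
        ((∫⁻ p in s, graphDensity (fderiv ℝ ψ p)) + (2 * δ : ℝ≥0) * volume s) ∧
      (∫⁻ p in s, graphDensity (fderiv ℝ ψ p)) ≤ ((1 + δ : ℝ≥0) : ENNReal) ^ k *
        H (graphMap n ψ '' s) + (2 * δ : ℝ≥0) * volume s := by
    intro δ hδ
    set D := TopologicalSpace.denseSeq (((ℝ ∙ n)ᗮ : Submodule ℝ V) →L[ℝ] ℝ)
    set u : ℕ → Set ((ℝ ∙ n)ᗮ : Submodule ℝ V) :=
      disjointed fun m => {p | ‖fderiv ℝ ψ p - D m‖ ≤ δ} with hu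
    have hum : ∀ m, MeasurableSet (u m) := fun m => MeasurableSet.disjointed (fun m =>
      measurableSet_le ((measurable_fderiv ℝ ψ).sub_const _).norm measurable_const) m
    have huD : ∀ m, ∀ p ∈ u m, ‖fderiv ℝ ψ p - D m‖ ≤ δ := fun m p hp =>
      disjointed_subset (fun m => {p | ‖fderiv ℝ ψ p - D m‖ ≤ δ}) m hp
    have hsU : s = ⋃ m, s ∩ u m := by
      rw [← inter_iUnion, hu, iUnion_disjointed, eq_comm, inter_eq_left]
      intro p _
      obtain ⟨m, hm⟩ := (TopologicalSpace.denseRange_denseSeq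
        (((ℝ ∙ n)ᗮ : Submodule ℝ V) →L[ℝ] ℝ)).exists_dist_lt (fderiv ℝ ψ p)
        (show 0 < (δ : ℝ) from hδ)
      refine mem_iUnion.2 ⟨m, ?_⟩
      have h := dist_eq_norm (fderiv ℝ ψ p) (D m)
      exact h.symm.trans_le hm.le
    have hm : ∀ i, MeasurableSet (s ∩ u i) := fun i => hs.inter (hum i)
    have hdis : Pairwise (Function.onFun Disjoint fun i => s ∩ u i) := fun i j hij =>
      (disjoint_disjointed _ hij).mono inter_subset_right inter_subset_right
    have hvol : volume s = ∑' i, volume (s ∩ u i) := by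
      conv_lhs => rw [hsU]
      exact measure_iUnion hdis hm
    have hHs : H (graphMap n ψ '' s) = ∑' i, H (graphMap n ψ '' (s ∩ u i)) := by
      conv_lhs => rw [hsU, image_iUnion]
      refine measure_iUnion (fun i j hij => ?_) fun i => hemb.measurableSet_image.2 (hm i)
      exact (disjoint_image_iff (graphMap_injective hn ψ)).2 (hdis hij)
    have hI : ∫⁻ p in s, graphDensity (fderiv ℝ ψ p) =
        ∑' i, ∫⁻ p in s ∩ u i, graphDensity (fderiv ℝ ψ p) := by
      conv_lhs => rw [hsU]
      exact lintegral_iUnion hm hdis _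
    have hest := fun i => graphMap_area_estimate hn hψ.continuous hδ (hm i)
      (fun p hp => (hd p hp.1).hasFDerivAt) (fun p hp => huD i p hp.2)
    have h2 : ((2 * δ : ℝ≥0) : ENNReal) = δ + δ := by rw [two_mul]; simp
    constructor
    · rw [hHs, hI, hvol, ← ENNReal.tsum_mul_left, ← ENNReal.tsum_add, ← ENNReal.tsum_mul_left]
      refine ENNReal.tsum_le_tsum fun i => (hest i).1.trans ?_
      refine mul_le_mul_right ?_ _
      rw [h2, add_mul, ← add_assoc, ENNReal.coe_add, add_mul]
      refine add_le_add ?_ le_rfl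
      rw [← setLIntegral_const, ← setLIntegral_const (s ∩ u i) (δ : ENNReal),
        ← lintegral_add_left hmJ]
      refine setLIntegral_mono (hmJ.add_const _) fun p hp => ?_
      exact_mod_cast graphDensity_le _ _ (by rw [norm_sub_rev]; exact huD i p hp.2)
    · rw [hHs, hI, hvol, ← ENNReal.tsum_mul_left, ← ENNReal.tsum_mul_left, ← ENNReal.tsum_add]
      refine ENNReal.tsum_le_tsum fun i => ?_
      rw [h2, add_mul, ← add_assoc]
      refine le_trans ?_ (add_le_add (hest i).2 le_rfl)
      rw [← setLIntegral_const, ← setLIntegral_const (s ∩ u i) (δ : ENNReal),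
        ← lintegral_add_right _ measurable_const]
      refine setLIntegral_mono (by fun_prop) fun p hp => ?_
      exact_mod_cast graphDensity_le _ _ (huD i p hp.2)
  have hfinI : ∫⁻ p in s, graphDensity (fderiv ℝ ψ p) ≠ ⊤ := by
    refine ne_top_of_le_ne_top (b := ((graphDensity
      (0 : ((ℝ ∙ n)ᗮ : Submodule ℝ V) →L[ℝ] ℝ) + M : ℝ≥0) : ENNReal) * volume s)
      (ENNReal.mul_ne_top ENNReal.coe_ne_top hfin) ?_
    rw [← setLIntegral_const]
    refine setLIntegral_mono (by fun_prop) fun p hp => ?_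
    exact_mod_cast graphDensity_le _ _ (by simpa using norm_fderiv_le_of_lipschitz ℝ hψ)
  have hfinH : H (graphMap n ψ '' s) ≠ ⊤ := ne_top_of_le_ne_top (by finiteness) (key 1 one_pos).1
  generalize H (graphMap n ψ '' s) = a at *
  generalize ∫⁻ p in s, (graphDensity (fderiv ℝ ψ p) : ENNReal) = b at *
  generalize volume s = c at *
  lift a to ℝ≥0 using hfinH
  lift b to ℝ≥0 using hfinI
  lift c to ℝ≥0 using hfin
  norm_cast at key ⊢
  have hc1 : Tendsto (fun δ : ℝ≥0 => (1 + δ) ^ k * (b + 2 * δ * c)) (𝓝[>] 0) (𝓝 b) := by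
    have : Continuous fun δ : ℝ≥0 => (1 + δ) ^ k * (b + 2 * δ * c) := by fun_prop
    simpa using (this.tendsto 0).mono_left nhdsWithin_le_nhds
  have hc2 : Tendsto (fun δ : ℝ≥0 => (1 + δ) ^ k * a + 2 * δ * c) (𝓝[>] 0) (𝓝 a) := by
    have : Continuous fun δ : ℝ≥0 => (1 + δ) ^ k * a + 2 * δ * c := by fun_prop
    simpa using (this.tendsto 0).mono_left nhdsWithin_le_nhds
  refine le_antisymm (ge_of_tendsto hc1 ?_) (ge_of_tendsto hc2 ?_)
  · filter_upwards [self_mem_nhdsWithin] with δ hδ using (key δ hδ).1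
  · filter_upwards [self_mem_nhdsWithin] with δ hδ using (key δ hδ).2

open Module in
/-- The area formula for Lipschitz graphs: the Hausdorff measure on the graph of `ψ` is the image
of the measure with density `√(1 + ‖ψ'‖²)` under the parametrization. -/
theorem restrict_range_graphMap {n : V} (hn : ‖n‖ = 1)
    {ψ : ((ℝ ∙ n)ᗮ : Submodule ℝ V) → ℝ} {M : ℝ≥0} (hψ : LipschitzWith M ψ) :
    (Measure.euclideanHausdorffMeasure (finrank ℝ ((ℝ ∙ n)ᗮ : Submodule ℝ V)) :
      Measure V).restrict (range (graphMap n ψ)) =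
    (volume.withDensity fun p => (graphDensity (fderiv ℝ ψ p) : ENNReal)).map (graphMap n ψ) := by
  set k := finrank ℝ ((ℝ ∙ n)ᗮ : Submodule ℝ V) with hk
  set H : Measure V := Measure.euclideanHausdorffMeasure k with hH
  have hemb : MeasurableEmbedding (graphMap n ψ) :=
    (isClosedEmbedding_graphMap hn hψ).measurableEmbedding
  have hmD : MeasurableSet {p | DifferentiableAt ℝ ψ p} := measurableSet_of_differentiableAt ℝ ψ
  have hnull : volume {p | DifferentiableAt ℝ ψ p}ᶜ = 0 := hψ.ae_differentiableAt
  have hnullH : H (graphMap n ψ '' {p | DifferentiableAt ℝ ψ p}ᶜ) = 0 := by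
    have := ((hψ.graphMap hn).lipschitzOnWith
      (s := {p | DifferentiableAt ℝ ψ p}ᶜ)).euclideanHausdorffMeasure_image_le k
    rw [hk, InnerProductSpace.euclideanHausdorffMeasure_eq_volume, hnull, mul_zero] at this
    exact le_antisymm this zero_le
  -- both sides are additive, so bounded sets of points of differentiability suffice
  have key : ∀ s, MeasurableSet s → H (graphMap n ψ '' s) =
      ∫⁻ p in s, graphDensity (fderiv ℝ ψ p) := by
    intro s hs
    set u : ℕ → Set ((ℝ ∙ n)ᗮ : Submodule ℝ V) := disjointed (spanningSets volume) with hu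
    have hum : ∀ i, MeasurableSet (u i) := fun i =>
      MeasurableSet.disjointed (measurableSet_spanningSets volume) i
    have hsU : s ∩ {p | DifferentiableAt ℝ ψ p} = ⋃ i, s ∩ {p | DifferentiableAt ℝ ψ p} ∩ u i := by
      rw [← inter_iUnion, hu, iUnion_disjointed, iUnion_spanningSets, inter_univ]
    have hm : ∀ i, MeasurableSet (s ∩ {p | DifferentiableAt ℝ ψ p} ∩ u i) :=
      fun i => (hs.inter hmD).inter (hum i)
    have hdis : Pairwise (Function.onFun Disjoint
        fun i => s ∩ {p | DifferentiableAt ℝ ψ p} ∩ u i) := fun i j hij =>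
      (disjoint_disjointed _ hij).mono inter_subset_right inter_subset_right
    have h1 : H (graphMap n ψ '' s) = H (graphMap n ψ '' (s ∩ {p | DifferentiableAt ℝ ψ p})) := by
      refine le_antisymm ?_ (measure_mono (image_mono inter_subset_left))
      have : graphMap n ψ '' s ⊆ graphMap n ψ '' (s ∩ {p | DifferentiableAt ℝ ψ p}) ∪
          graphMap n ψ '' {p | DifferentiableAt ℝ ψ p}ᶜ := by
        rw [← image_union]
        refine image_mono fun p hp => ?_
        by_cases h : DifferentiableAt ℝ ψ p
        · exact Or.inl ⟨hp, h⟩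
        · exact Or.inr h
      refine (measure_mono this).trans ((measure_union_le _ _).trans ?_)
      rw [hnullH, add_zero]
    have h2 : ∫⁻ p in s, (graphDensity (fderiv ℝ ψ p) : ENNReal) =
        ∫⁻ p in s ∩ {p | DifferentiableAt ℝ ψ p}, graphDensity (fderiv ℝ ψ p) := by
      have : (s ∩ {p | DifferentiableAt ℝ ψ p} : Set _) =ᵐ[volume] s := by
        have h3 : ({p | DifferentiableAt ℝ ψ p} : Set _) =ᵐ[volume] univ :=
          eventuallyEq_univ.2 hψ.ae_differentiableAt
        simpa using (ae_eq_refl s).inter h3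
      rw [setLIntegral_congr this]
    rw [h1, h2, hsU, image_iUnion, lintegral_iUnion hm hdis, measure_iUnion
      (fun i j hij => (disjoint_image_iff (graphMap_injective hn ψ)).2 (hdis hij))
      (fun i => hemb.measurableSet_image.2 (hm i))]
    congr 1
    ext1 i
    refine euclideanHausdorffMeasure_graphMap_image hn hψ (hm i) (fun p hp => hp.1.2) ?_
    refine ne_top_of_le_ne_top (measure_spanningSets_lt_top volume i).ne
      (measure_mono (inter_subset_right.trans (disjointed_subset _ _)))
  ext t ht
  rw [Measure.restrict_apply ht, hemb.map_apply, withDensity_apply _ (hemb.measurable ht),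
    ← key _ (hemb.measurable ht), image_preimage_eq_inter_range]

end Graph

/-! ### Lipschitz domains, their local graphs and their outer normals -/

section Domain

variable {V : Type*} [NormedAddCommGroup V] [InnerProductSpace ℝ V] [FiniteDimensional ℝ V]

/-- A Lipschitz domain, described by an interior cone condition that is uniform near each boundary
point: with each point `x` of `D` close to `x₀`, the part close to `x₀` of a fixed cone of
directions around `-n`, with apex `x`, lies in `D`. -/
def IsLipschitzDomain (D : Set V) : Prop :=
  IsOpen D ∧ ∀ x₀ ∈ frontier D, ∃ n : V, ‖n‖ = 1 ∧ ∃ c : ℝ, 0 ≤ c ∧ c < 1 ∧ ∃ r > 0,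
    ∀ x ∈ D ∩ Metric.ball x₀ r, ∀ y ∈ Metric.ball x₀ r, c * ‖x - y‖ < ⟪n, x - y⟫ → y ∈ D

/-- In the ball of radius `r` around `x₀`, the set `D` is the region below the graph of `ψ`. -/
def IsSubgraphNear (D : Set V) (x₀ n : V) (ψ : ((ℝ ∙ n)ᗮ : Submodule ℝ V) → ℝ) (r : ℝ) : Prop :=
  ∀ x ∈ Metric.ball x₀ r, (x ∈ D ↔ ⟪n, x⟫ < ψ ((ℝ ∙ n)ᗮ.orthogonalProjectionOnto x))

theorem orthogonalProjectionOnto_add_smul {n : V} (p : ((ℝ ∙ n)ᗮ : Submodule ℝ V)) (s : ℝ) :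
    (ℝ ∙ n)ᗮ.orthogonalProjectionOnto ((p : V) + s • n) = p := by
  rw [map_add, map_smul, Submodule.orthogonalProjectionOnto_mem_subspace_eq_self]
  have : (ℝ ∙ n)ᗮ.orthogonalProjectionOnto n = 0 :=
    Submodule.orthogonalProjectionOnto_orthogonal_apply_eq_zero (Submodule.mem_span_singleton_self n)
  rw [this, smul_zero, add_zero]

theorem inner_add_smul {n : V} (hn : ‖n‖ = 1) (p : ((ℝ ∙ n)ᗮ : Submodule ℝ V)) (s : ℝ) :
    ⟪n, (p : V) + s • n⟫ = s := by
  rw [inner_add_right, inner_orthogonal_span_singleton, inner_smul_right,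
    real_inner_self_eq_norm_sq, hn]
  simp

theorem orthogonalProjectionOnto_add_inner_smul {n : V} (hn : ‖n‖ = 1) (x : V) :
    ((ℝ ∙ n)ᗮ.orthogonalProjectionOnto x : V) + ⟪n, x⟫ • n = x := by
  have h := Submodule.starProjection_add_starProjection_orthogonal (K := (ℝ ∙ n)) x
  rw [Submodule.starProjection_unit_singleton ℝ hn, Submodule.starProjection_apply] at h
  rw [add_comm]; exact h

theorem norm_orthogonalProjectionOnto_le (n : V) (x : V) :
    ‖(ℝ ∙ n)ᗮ.orthogonalProjectionOnto x‖ ≤ ‖x‖ :=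
  Submodule.norm_orthogonalProjectionOnto_apply_le _ _

/-- A Lipschitz domain is locally the region below the graph of a Lipschitz function. -/
theorem IsLipschitzDomain.exists_isSubgraphNear {D : Set V} (hD : IsLipschitzDomain D) {x₀ : V}
    (hx₀ : x₀ ∈ frontier D) : ∃ n : V, ‖n‖ = 1 ∧
      ∃ (ψ : ((ℝ ∙ n)ᗮ : Submodule ℝ V) → ℝ) (M : ℝ≥0), LipschitzWith M ψ ∧
        ∃ r > 0, IsSubgraphNear D x₀ n ψ r := by
  obtain ⟨hopen, hD⟩ := hD
  obtain ⟨n, hn, c, hc0, hc1, r, hr, hcone⟩ := hD x₀ hx₀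
  set P := (ℝ ∙ n)ᗮ.orthogonalProjectionOnto with hP
  set B := Metric.ball x₀ r
  -- a slope for which the cone of slope `M` is contained in the cone of the cone condition
  set M : ℝ≥0 := ⟨1 / (1 - c), by have : 0 < 1 - c := by linarith
                                  positivity⟩ with hM
  have hMc : (M : ℝ) * (1 - c) = 1 := by
    exact one_div_mul_cancel (by linarith)
  have hcone' : ∀ x ∈ D ∩ B, ∀ y ∈ B, M * ‖P y - P x‖ < ⟪n, x⟫ - ⟪n, y⟫ → y ∈ D := by
    intro x hx y hy h
    refine hcone x hx y hy ?_
    have h1 : ‖x - y‖ ≤ ‖P y - P x‖ + (⟪n, x⟫ - ⟪n, y⟫) := by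
      have h2 := orthogonalProjectionOnto_add_inner_smul hn (x - y)
      rw [← h2]
      refine (norm_add_le _ _).trans ?_
      rw [norm_smul, hn, mul_one, inner_sub_right]
      have h3 : 0 ≤ ⟪n, x⟫ - ⟪n, y⟫ := le_trans (by positivity) h.le
      rw [Real.norm_of_nonneg h3, map_sub, Submodule.norm_coe, norm_sub_rev]
    rw [inner_sub_right]
    have h4 : ‖P y - P x‖ < (⟪n, x⟫ - ⟪n, y⟫) * (1 - c) := by
      have : 0 < 1 - c := by linarith
      calc ‖P y - P x‖ = M * ‖P y - P x‖ * (1 - c) := by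
            rw [mul_right_comm, hMc, one_mul]
        _ < _ := by gcongr
    set s := ⟪n, x⟫ - ⟪n, y⟫
    have hs : 0 < s := lt_of_le_of_lt (by positivity) h
    calc c * ‖x - y‖ ≤ c * (s * (1 - c) + s) := by gcongr; linarith
      _ < s := by nlinarith [mul_pos hs (pow_pos (show 0 < 1 - c by linarith) 2)]
  have hne : (D ∩ B).Nonempty := by
    have := mem_closure_iff.1 (frontier_subset_closure hx₀) B Metric.isOpen_ball
      (Metric.mem_ball_self hr)
    rwa [inter_comm]
  have : Nonempty (D ∩ B : Set V) := hne.to_subtype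
  have hbdd : ∀ p, BddAbove (range fun x : (D ∩ B : Set V) => ⟪n, (x : V)⟫ - M * ‖p - P x‖) := by
    intro p
    refine ⟨‖x₀‖ + r, ?_⟩
    rintro _ ⟨⟨x, hx⟩, rfl⟩
    have h1 : ⟪n, x⟫ ≤ ‖x‖ := by simpa [hn] using real_inner_le_norm n x
    have h2 : ‖x‖ ≤ ‖x₀‖ + r := by
      have := mem_ball_iff_norm.1 hx.2
      linarith [norm_sub_norm_le x x₀]
    have h3 : 0 ≤ M * ‖p - P x‖ := by positivity
    simp only
    linarith
  -- the graph function is the upper envelope of the downward cones of slope `M` with apex in `D`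
  set ψ : ((ℝ ∙ n)ᗮ : Submodule ℝ V) → ℝ :=
    fun p => ⨆ x : (D ∩ B : Set V), (⟪n, (x : V)⟫ - M * ‖p - P x‖) with hψ
  refine ⟨n, hn, ψ, M, ?_, r, hr, ?_⟩
  · refine LipschitzWith.of_le_add_mul M fun p q => ciSup_le fun x => ?_
    have h1 := le_ciSup (hbdd q) x
    have h2 : ‖q - P x‖ ≤ ‖p - P x‖ + dist p q := by
      rw [dist_comm, dist_eq_norm]
      have := norm_add_le (p - P x) (q - p)
      simpa [add_comm] using this
    have h3 := mul_le_mul_of_nonneg_left h2 M.2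
    simp only [NNReal.val_eq_coe] at h3
    simp only [hψ]
    linarith
  · intro y hy
    constructor
    · intro hyD
      obtain ⟨δ, hδ, hball⟩ := Metric.isOpen_iff.1 (hopen.inter Metric.isOpen_ball) y ⟨hyD, hy⟩
      have hz : y + (δ / 2) • n ∈ D ∩ B := by
        refine hball ?_
        rw [mem_ball_iff_norm, add_sub_cancel_left, norm_smul, hn, mul_one,
          Real.norm_of_nonneg (by positivity)]
        linarith
      have h1 := le_ciSup (hbdd (P y)) ⟨_, hz⟩
      have h2 : P (y + (δ / 2) • n) = P y := by
        rw [map_add, map_smul]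
        have : P n = 0 := Submodule.orthogonalProjectionOnto_orthogonal_apply_eq_zero
          (Submodule.mem_span_singleton_self n)
        rw [this, smul_zero, add_zero]
      simp only [h2, sub_self, norm_zero, mul_zero, sub_zero, inner_add_right, inner_smul_right,
        real_inner_self_eq_norm_sq, hn] at h1
      have : ⟪n, y⟫ + δ / 2 * 1 ^ 2 ≤ ψ (P y) := h1
      linarith
    · intro h
      obtain ⟨x, hx⟩ := exists_lt_of_lt_ciSup h
      exact hcone' x x.2 y hy (by linarith)

/-- The (non-normalized) normal `n - ∇ψ` of the graph of a function with derivative `A`. -/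
noncomputable def graphNormal (n : V) (A : ((ℝ ∙ n)ᗮ : Submodule ℝ V) →L[ℝ] ℝ) : V :=
  n - ((InnerProductSpace.toDual ℝ ((ℝ ∙ n)ᗮ : Submodule ℝ V)).symm A : V)

theorem inner_graphNormal (n : V) (A : ((ℝ ∙ n)ᗮ : Submodule ℝ V) →L[ℝ] ℝ) (z : V) :
    ⟪z, graphNormal n A⟫ = ⟪n, z⟫ - A ((ℝ ∙ n)ᗮ.orthogonalProjectionOnto z) := by
  set a := (InnerProductSpace.toDual ℝ ((ℝ ∙ n)ᗮ : Submodule ℝ V)).symm A with ha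
  have : A ((ℝ ∙ n)ᗮ.orthogonalProjectionOnto z) = ⟪(a : V), z⟫ := by
    rw [← Submodule.inner_orthogonalProjectionOnto_eq_of_mem_left, ha,
      InnerProductSpace.toDual_symm_apply]
  rw [this, graphNormal, inner_sub_right, real_inner_comm, real_inner_comm (a : V)]

theorem norm_graphNormal {n : V} (hn : ‖n‖ = 1) (A : ((ℝ ∙ n)ᗮ : Submodule ℝ V) →L[ℝ] ℝ) :
    ‖graphNormal n A‖ = graphDensity A := by
  rw [coe_graphDensity, eq_comm, Real.sqrt_eq_iff_mul_self_eq (by positivity) (norm_nonneg _), ← sq]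
  have := norm_add_smul_sq hn (-(InnerProductSpace.toDual ℝ ((ℝ ∙ n)ᗮ : Submodule ℝ V)).symm A) 1
  rw [norm_neg, LinearIsometryEquiv.norm_map, one_smul, Submodule.coe_neg, neg_add_eq_sub] at this
  rw [graphNormal, this]
  ring

variable {D : Set V} {x₀ n : V} {ψ : ((ℝ ∙ n)ᗮ : Submodule ℝ V) → ℝ} {r : ℝ}

theorem IsSubgraphNear.mem_frontier_iff (h : IsSubgraphNear D x₀ n ψ r) (hn : ‖n‖ = 1)
    (hD : IsOpen D) (hψ : Continuous ψ) {y : V} (hy : y ∈ Metric.ball x₀ r) :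
    y ∈ frontier D ↔ ⟪n, y⟫ = ψ ((ℝ ∙ n)ᗮ.orthogonalProjectionOnto y) := by
  have hcont : Continuous fun y => ⟪n, y⟫ - ψ ((ℝ ∙ n)ᗮ.orthogonalProjectionOnto y) := by fun_prop
  rw [hD.frontier_eq]
  constructor
  · rintro ⟨hcl, hnot⟩
    have h1 : ψ ((ℝ ∙ n)ᗮ.orthogonalProjectionOnto y) ≤ ⟪n, y⟫ :=
      not_lt.1 fun hlt => hnot ((h y hy).2 hlt)
    by_contra hne
    have h2 : 0 < ⟪n, y⟫ - ψ ((ℝ ∙ n)ᗮ.orthogonalProjectionOnto y) :=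
      sub_pos.2 (lt_of_le_of_ne h1 (Ne.symm hne))
    have h3 : Metric.ball x₀ r ∩
        {y | 0 < ⟪n, y⟫ - ψ ((ℝ ∙ n)ᗮ.orthogonalProjectionOnto y)} ∈ 𝓝 y :=
      inter_mem (Metric.isOpen_ball.mem_nhds hy) ((isOpen_lt continuous_const hcont).mem_nhds h2)
    obtain ⟨z, hz, hzD⟩ := mem_closure_iff_nhds.1 hcl _ h3
    have := (h z hz.1).1 hzD
    have h4 := hz.2
    simp only [mem_ofPred_eq] at h4
    linarith
  · intro heq
    refine ⟨?_, fun hyD => absurd ((h y hy).1 hyD) (by rw [heq]; exact lt_irrefl _)⟩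
    have ht : Tendsto (fun s : ℝ => y - s • n) (𝓝[>] 0) (𝓝 y) := by
      have : Continuous fun s : ℝ => y - s • n := by fun_prop
      simpa using (this.tendsto 0).mono_left nhdsWithin_le_nhds
    refine mem_closure_of_tendsto ht ?_
    filter_upwards [self_mem_nhdsWithin, ht (Metric.isOpen_ball.mem_nhds hy)] with s hs hsb
    rw [h _ hsb]
    have : (ℝ ∙ n)ᗮ.orthogonalProjectionOnto (y - s • n) =
        (ℝ ∙ n)ᗮ.orthogonalProjectionOnto y := by
      have h0 : (ℝ ∙ n)ᗮ.orthogonalProjectionOnto n = 0 :=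
        Submodule.orthogonalProjectionOnto_orthogonal_apply_eq_zero
          (Submodule.mem_span_singleton_self n)
      rw [map_sub, map_smul, h0, smul_zero, sub_zero]
    rw [this, ← heq, inner_sub_right, inner_smul_right, real_inner_self_eq_norm_sq, hn]
    have : (0 : ℝ) < s := hs
    linarith

theorem orthogonalProjectionOnto_graphMap (ψ : ((ℝ ∙ n)ᗮ : Submodule ℝ V) → ℝ)
    (p : ((ℝ ∙ n)ᗮ : Submodule ℝ V)) :
    (ℝ ∙ n)ᗮ.orthogonalProjectionOnto (graphMap n ψ p) = p :=
  orthogonalProjectionOnto_add_smul p (ψ p)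

theorem mem_range_graphMap_iff (hn : ‖n‖ = 1) {y : V} :
    y ∈ range (graphMap n ψ) ↔ ⟪n, y⟫ = ψ ((ℝ ∙ n)ᗮ.orthogonalProjectionOnto y) := by
  constructor
  · rintro ⟨p, rfl⟩
    rw [orthogonalProjectionOnto_graphMap, graphMap, inner_add_smul hn]
  · intro h
    refine ⟨(ℝ ∙ n)ᗮ.orthogonalProjectionOnto y, ?_⟩
    rw [graphMap, ← h, orthogonalProjectionOnto_add_inner_smul hn]

end Domain

section OuterNormal

variable {d : ℕ} {D : Set (Vec d)}

theorem IsOuterUnitNormal.eq {y n m : Vec d} (hn : IsOuterUnitNormal D y n)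
    (hm : IsOuterUnitNormal D y m) : n = m := by
  by_contra hne
  -- the direction `m - n` points strictly into `D` according to `n`, and out of it according to `m`
  set v := m - n with hv
  have hv0 : v ≠ 0 := sub_ne_zero.2 (Ne.symm hne)
  have hlt : ⟪n, m⟫ < 1 := inner_lt_one_iff_real_of_norm_eq_one hn.1 hm.1 |>.2 hne
  have h1 : ⟪v, n⟫ < 0 := by
    rw [hv, inner_sub_left, real_inner_self_eq_norm_sq, hn.1, real_inner_comm]; linarith
  have h2 : 0 < ⟪v, m⟫ := by
    rw [hv, inner_sub_left, real_inner_self_eq_norm_sq, hm.1]; linarith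
  have hvn : 0 < ‖v‖ := norm_pos_iff.2 hv0
  obtain ⟨r₁, hr₁, H₁⟩ := hn.2 (-⟪v, n⟫ / (2 * ‖v‖)) (by apply div_pos <;> linarith)
  obtain ⟨r₂, hr₂, H₂⟩ := hm.2 (⟪v, m⟫ / (2 * ‖v‖)) (by positivity)
  set s := min r₁ r₂ / (2 * ‖v‖) with hs
  have hspos : 0 < s := by have := lt_min hr₁ hr₂; positivity
  have hsv : ‖s • v‖ = min r₁ r₂ / 2 := by
    rw [norm_smul, Real.norm_of_nonneg hspos.le, hs]; field_simp
  have hmin := lt_min hr₁ hr₂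
  have hb₁ : y + s • v ∈ Metric.ball y r₁ := by
    rw [mem_ball_iff_norm, add_sub_cancel_left, hsv]
    linarith [min_le_left r₁ r₂]
  have hb₂ : y + s • v ∈ Metric.ball y r₂ := by
    rw [mem_ball_iff_norm, add_sub_cancel_left, hsv]
    linarith [min_le_right r₁ r₂]
  refine (H₂ _ hb₂).2 ?_ ((H₁ _ hb₁).1 ?_)
  · rw [add_sub_cancel_left, inner_smul_left, norm_smul, Real.norm_of_nonneg hspos.le]
    have : ⟪v, m⟫ / (2 * ‖v‖) * (s * ‖v‖) = s * ⟪v, m⟫ / 2 := by field_simp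
    rw [this]
    simp only [conj_trivial]
    nlinarith
  · rw [add_sub_cancel_left, inner_smul_left, norm_smul, Real.norm_of_nonneg hspos.le]
    have : -(-⟪v, n⟫ / (2 * ‖v‖)) * (s * ‖v‖) = s * ⟪v, n⟫ / 2 := by field_simp
    rw [this]
    simp only [conj_trivial]
    nlinarith

theorem IsOuterUnitNormal.outerNormal_eq {y n : Vec d} (hn : IsOuterUnitNormal D y n) :
    outerNormal D y = n := by
  have h : ∃ n, IsOuterUnitNormal D y n := ⟨n, hn⟩
  rw [outerNormal, dif_pos h]
  exact h.choose_spec.eq hn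

theorem norm_outerNormal_le (D : Set (Vec d)) (y : Vec d) : ‖outerNormal D y‖ ≤ 1 := by
  unfold outerNormal
  split_ifs with h
  · exact h.choose_spec.1.le
  · simp

variable {x₀ n : Vec d} {ψ : ((ℝ ∙ n)ᗮ : Submodule ℝ (Vec d)) → ℝ} {r : ℝ}

/-- At a point of differentiability of the graph function, the normalized upward normal of the graph
satisfies the two-sided cone condition that defines the outer unit normal. -/
theorem IsSubgraphNear.outerNormal_graphMap (h : IsSubgraphNear D x₀ n ψ r) (hn : ‖n‖ = 1)
    {p : ((ℝ ∙ n)ᗮ : Submodule ℝ (Vec d))} (hp : graphMap n ψ p ∈ Metric.ball x₀ r)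
    (hψ : DifferentiableAt ℝ ψ p) :
    outerNormal D (graphMap n ψ p) =
      (graphDensity (fderiv ℝ ψ p) : ℝ)⁻¹ • graphNormal n (fderiv ℝ ψ p) := by
  refine IsOuterUnitNormal.outerNormal_eq ?_
  set y := graphMap n ψ p with hy
  set A := fderiv ℝ ψ p with hA
  set J : ℝ := ((graphDensity A : ℝ≥0) : ℝ) with hJ
  have hJ1 : 1 ≤ J := by
    rw [hJ, coe_graphDensity]; exact Real.one_le_sqrt.2 (by linarith [sq_nonneg ‖A‖])
  have hJ0 : 0 < J := by linarith
  refine ⟨?_, fun δ hδ => ?_⟩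
  · rw [norm_smul, norm_graphNormal hn, ← hJ, norm_inv, Real.norm_of_nonneg hJ0.le,
      inv_mul_cancel₀ hJ0.ne']
  · obtain ⟨r₁, hr₁, hbig⟩ := Metric.eventually_nhds_iff_ball.1
      (hψ.hasFDerivAt.isLittleO.bound hδ)
    obtain ⟨r₂, hr₂, hball⟩ := Metric.isOpen_iff.1 Metric.isOpen_ball y hp
    refine ⟨min r₁ r₂, lt_min hr₁ hr₂, fun z hz => ?_⟩
    have hzB := hball (Metric.ball_subset_ball (min_le_right _ _) hz)
    set q := (ℝ ∙ n)ᗮ.orthogonalProjectionOnto z with hq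
    have hqp : (ℝ ∙ n)ᗮ.orthogonalProjectionOnto (z - y) = q - p := by
      rw [map_sub, hy, orthogonalProjectionOnto_graphMap]
    have hle : ‖q - p‖ ≤ ‖z - y‖ := by
      rw [← hqp]; exact norm_orthogonalProjectionOnto_le n _
    have hqb : q ∈ Metric.ball p r₁ := by
      rw [mem_ball_iff_norm] at hz ⊢
      exact hle.trans_lt (hz.trans_le (min_le_left _ _))
    have h1 := hbig q hqb
    rw [Real.norm_eq_abs] at h1
    have h2 := abs_le.1 h1
    have h3 : δ * ‖q - p‖ ≤ δ * ‖z - y‖ := by gcongr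
    have hyn : ⟪n, y⟫ = ψ p := by rw [hy, graphMap, inner_add_smul hn]
    have h5 : ⟪z - y, J⁻¹ • graphNormal n A⟫ = J⁻¹ * (⟪n, z⟫ - ψ p - A (q - p)) := by
      rw [inner_smul_right, inner_graphNormal, hqp, inner_sub_right, hyn]
    rw [h5, h z hzB, not_lt]
    have hJi : J⁻¹ ≤ 1 := inv_le_one_of_one_le₀ hJ1
    have hJi0 : 0 < J⁻¹ := by positivity
    have hδz : 0 ≤ δ * ‖z - y‖ := by positivity
    constructor
    · intro h6
      by_contra h7
      push Not at h7
      have h8 : -(δ * ‖z - y‖) ≤ ⟪n, z⟫ - ψ p - A (q - p) := by linarith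
      have h9 : J⁻¹ * -(δ * ‖z - y‖) ≤ J⁻¹ * (⟪n, z⟫ - ψ p - A (q - p)) := by gcongr
      nlinarith
    · intro h6
      by_contra h7
      push Not at h7
      have h8 : ⟪n, z⟫ - ψ p - A (q - p) ≤ δ * ‖z - y‖ := by linarith
      have h9 : J⁻¹ * (⟪n, z⟫ - ψ p - A (q - p)) ≤ J⁻¹ * (δ * ‖z - y‖) := by gcongr
      nlinarith

end OuterNormal

/-! ### The Gauss-Green formula on Lipschitz domains -/

section Subgraph

variable {V : Type*} [NormedAddCommGroup V] [InnerProductSpace ℝ V] [FiniteDimensional ℝ V]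
  [MeasurableSpace V] [BorelSpace V]

theorem measurePreserving_add_smul {n : V} (hn : ‖n‖ = 1) :
    MeasurePreserving (fun q : ((ℝ ∙ n)ᗮ : Submodule ℝ V) × ℝ => (q.1 : V) + q.2 • n) := by
  have h1 := ((ℝ ∙ n).measurePreserving_measurableEquivProd (0 : V)).symm
  rw [InnerProductSpace.euclideanHausdorffMeasure_eq_volume] at h1
  have h2 : MeasurePreserving (LinearIsometryEquiv.toSpanUnitSingleton (𝕜 := ℝ) n hn) :=
    LinearIsometryEquiv.measurePreserving _
  have h3 : MeasurePreserving (Prod.map (LinearIsometryEquiv.toSpanUnitSingleton (𝕜 := ℝ) n hn)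
      (id : ((ℝ ∙ n)ᗮ : Submodule ℝ V) → _)) := h2.prod (MeasurePreserving.id _)
  have h4 := (h1.comp h3).comp (Measure.measurePreserving_swap
    (μ := (volume : Measure ((ℝ ∙ n)ᗮ : Submodule ℝ V))) (ν := (volume : Measure ℝ)))
  rw [← Measure.volume_eq_prod] at h4
  convert h4 using 1
  ext1 q
  simp [add_comm]

theorem measurePreserving_graphMap_add_smul {n : V} (hn : ‖n‖ = 1)
    {ψ : ((ℝ ∙ n)ᗮ : Submodule ℝ V) → ℝ} (hψ : Measurable ψ) :
    MeasurePreserving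
      (fun q : ((ℝ ∙ n)ᗮ : Submodule ℝ V) × ℝ => graphMap n ψ q.1 + q.2 • n) := by
  have h1 : MeasurePreserving (fun q : ((ℝ ∙ n)ᗮ : Submodule ℝ V) × ℝ => (q.1, ψ q.1 + q.2)) :=
    MeasurePreserving.skew_product (g := fun p s => ψ p + s) (MeasurePreserving.id volume)
      (by fun_prop) (ae_of_all _ fun p => map_add_left_eq_self volume (ψ p))
  convert (measurePreserving_add_smul hn).comp h1 using 1
  ext1 q
  simp [graphMap, add_smul, add_assoc]

theorem LipschitzWith.integral_lineDeriv_eq_zero {E : Type*} [NormedAddCommGroup E]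
    [NormedSpace ℝ E] [FiniteDimensional ℝ E] [MeasurableSpace E] [BorelSpace E] {μ : Measure E}
    [μ.IsAddHaarMeasure] {f : E → ℝ} {K : ℝ≥0} (hf : LipschitzWith K f) (hc : HasCompactSupport f)
    (v : E) : ∫ x, lineDeriv ℝ f x v ∂μ = 0 := by
  have := LipschitzWith.integral_lineDeriv_mul_eq (μ := μ) (LipschitzWith.const (1 : ℝ)) hf hc (-v)
  simpa [lineDeriv] using this.symm

/-- The Gauss-Green formula in the region below a Lipschitz graph. The change of variables
`(p, s) ↦ p + (ψ p + s) n` flattens the graph; the derivatives along the graph integrate to zero,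
and the derivative in the direction `n` produces the boundary values. -/
theorem integral_fderiv_subgraph {n : V} (hn : ‖n‖ = 1) {ψ : ((ℝ ∙ n)ᗮ : Submodule ℝ V) → ℝ}
    {M : ℝ≥0} (hψ : LipschitzWith M ψ) {f : V → ℝ} (hf : ContDiff ℝ 1 f)
    (hc : HasCompactSupport f) (v : V) :
    ∫ x in {x | ⟪n, x⟫ < ψ ((ℝ ∙ n)ᗮ.orthogonalProjectionOnto x)}, fderiv ℝ f x v =
      ∫ p, f (graphMap n ψ p) * ⟪v, graphNormal n (fderiv ℝ ψ p)⟫ := by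
  set Ψ : ((ℝ ∙ n)ᗮ : Submodule ℝ V) × ℝ → V := fun q => graphMap n ψ q.1 + q.2 • n with hΨ
  have hmp : MeasurePreserving Ψ := measurePreserving_graphMap_add_smul hn hψ.continuous.measurable
  have hΨ' : ∀ q, Ψ q = (q.1 : V) + (ψ q.1 + q.2) • n := fun q => by
    simp [hΨ, graphMap, add_smul, add_assoc]
  have hψc := hψ.continuous
  have hΨc : Continuous Ψ := by
    have : Ψ = fun q => (q.1 : V) + (ψ q.1 + q.2) • n := funext hΨ'
    rw [this]; fun_prop
  have hΨi : Function.Injective Ψ := by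
    intro q q' h
    rw [hΨ', hΨ'] at h
    have h1 := congrArg (ℝ ∙ n)ᗮ.orthogonalProjectionOnto h
    rw [orthogonalProjectionOnto_add_smul, orthogonalProjectionOnto_add_smul] at h1
    have h2 := congrArg (fun x => ⟪n, x⟫) h
    simp only [inner_add_smul hn] at h2
    rw [h1] at h2
    exact Prod.ext h1 (by linarith)
  have hemb : MeasurableEmbedding Ψ := hΨc.measurableEmbedding hΨi
  have hpre : Ψ ⁻¹' {x | ⟪n, x⟫ < ψ ((ℝ ∙ n)ᗮ.orthogonalProjectionOnto x)} =
      univ ×ˢ Iio (0 : ℝ) := by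
    ext q
    simp only [mem_preimage, mem_ofPred_eq, hΨ', inner_add_smul hn,
      orthogonalProjectionOnto_add_smul, mem_prod, mem_univ, true_and, mem_Iio]
    constructor <;> intro h <;> linarith
  have hdf : Continuous (fderiv ℝ f) := hf.continuous_fderiv (by simp)
  have hint : ∀ w : V, Integrable (fun q => fderiv ℝ f (Ψ q) w) := fun w =>
    (hmp.integrable_comp_emb hemb (g := fun x => fderiv ℝ f x w)).2
      ((hdf.clm_apply continuous_const).integrable_of_hasCompactSupport
        (hc.fderiv_apply (𝕜 := ℝ) w))
  rw [← hmp.setIntegral_preimage_emb hemb (fun x => fderiv ℝ f x v), hpre]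
  set w : ((ℝ ∙ n)ᗮ : Submodule ℝ V) := (ℝ ∙ n)ᗮ.orthogonalProjectionOnto v with hw
  have hv : v = (w : V) + ⟪n, v⟫ • n := (orthogonalProjectionOnto_add_inner_smul hn v).symm
  have hmψ : Measurable fun p => fderiv ℝ ψ p w := measurable_fderiv_apply_const ℝ ψ w
  have hbψ : ∀ p, ‖fderiv ℝ ψ p w‖ ≤ M * ‖w‖ := fun p =>
    ((fderiv ℝ ψ p).le_opNorm w).trans
      (mul_le_mul_of_nonneg_right (norm_fderiv_le_of_lipschitz ℝ hψ) (norm_nonneg _))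
  have hint2 : Integrable (fun q : ((ℝ ∙ n)ᗮ : Submodule ℝ V) × ℝ =>
      fderiv ℝ ψ q.1 w * fderiv ℝ f (Ψ q) n) :=
    (hint n).bdd_mul (c := M * ‖w‖) (hmψ.comp measurable_fst).aestronglyMeasurable
      (ae_of_all _ fun q => hbψ q.1)
  -- derivatives in directions tangent to the graph have integral zero
  have htan : ∀ s : ℝ, ∫ p, (fderiv ℝ f (Ψ (p, s)) w + fderiv ℝ ψ p w * fderiv ℝ f (Ψ (p, s)) n)
      = 0 := by
    intro s
    have hl : LipschitzWith (1 + M) fun p => Ψ (p, s) := by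
      have h1 := (hψ.graphMap hn).add (LipschitzWith.const (α := ((ℝ ∙ n)ᗮ : Submodule ℝ V)) (s • n))
      simpa [hΨ] using h1
    obtain ⟨K, hK⟩ := hf.locallyLipschitz.exists_lipschitzWith_of_hasCompactSupport hc
    have hcs : HasCompactSupport fun p => f (Ψ (p, s)) := by
      refine hc.comp_isClosedEmbedding (g := fun p => Ψ (p, s)) ?_
      exact (Homeomorph.addRight (s • n)).isClosedEmbedding.comp (isClosedEmbedding_graphMap hn hψ)
    rw [← (hK.comp hl).integral_lineDeriv_eq_zero (μ := volume) hcs w]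
    refine integral_congr_ae ?_
    filter_upwards [hψ.ae_differentiableAt] with p hp
    have h1 : HasFDerivAt (fun p => Ψ (p, s)) (((ℝ ∙ n)ᗮ : Submodule ℝ V).subtypeL +
        (fderiv ℝ ψ p).smulRight n) p := by
      have h2 := (((ℝ ∙ n)ᗮ : Submodule ℝ V).subtypeL.hasFDerivAt (x := p)).add
        ((hp.hasFDerivAt.add_const s).smul_const n)
      exact h2.congr_of_eventuallyEq (Eventually.of_forall fun p => hΨ' (p, s))
    have h3 := (hf.differentiable (by simp) (Ψ (p, s))).hasFDerivAt.comp p h1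
    rw [(h3.hasLineDerivAt w).lineDeriv]
    simp
  have hnor : ∀ p, ∫ s in Iio (0 : ℝ), fderiv ℝ f (Ψ (p, s)) n = f (graphMap n ψ p) := by
    intro p
    rw [← integral_Iic_eq_integral_Iio]
    have hcomp : ∀ s, HasDerivAt (fun s => f (Ψ (p, s))) (fderiv ℝ f (Ψ (p, s)) n) s := by
      intro s
      have h1 : HasDerivAt (fun s => Ψ (p, s)) n s := by
        have := ((hasDerivAt_id s).smul_const n).const_add (graphMap n ψ p)
        simpa [hΨ] using this
      exact (hf.differentiable (by simp) (Ψ (p, s))).hasFDerivAt.comp_hasDerivAt s h1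
    have hcd : ContDiff ℝ 1 fun s => f (Ψ (p, s)) :=
      hf.comp (by simp only [hΨ]; fun_prop)
    have hcs : HasCompactSupport fun s => f (Ψ (p, s)) := by
      refine hc.comp_isClosedEmbedding (g := fun s => Ψ (p, s)) ?_
      refine AntilipschitzWith.isClosedEmbedding (K := 1) ?_ ?_ (f := fun s => Ψ (p, s))
      · refine AntilipschitzWith.of_le_mul_dist fun s s' => ?_
        simp [hΨ, dist_eq_norm, ← sub_smul, norm_smul, hn]
      · refine LipschitzWith.uniformContinuous (K := 1) (LipschitzWith.of_dist_le_mul fun s s' => ?_)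
        simp [hΨ, dist_eq_norm, ← sub_smul, norm_smul, hn]
    have := hcs.integral_Iic_deriv_eq hcd 0
    simp only [fun s => (hcomp s).deriv] at this
    rw [this]
    simp [hΨ]
  have hcoef : ∀ p, ⟪v, graphNormal n (fderiv ℝ ψ p)⟫ = ⟪n, v⟫ - fderiv ℝ ψ p w := fun p =>
    inner_graphNormal n _ v
  have hint3 : Integrable (fun q : ((ℝ ∙ n)ᗮ : Submodule ℝ V) × ℝ =>
      ⟪v, graphNormal n (fderiv ℝ ψ q.1)⟫ * fderiv ℝ f (Ψ q) n) := by
    simp only [hcoef, sub_mul]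
    exact ((hint n).const_mul _).sub hint2
  have hdiff : ∀ q, fderiv ℝ f (Ψ q) v - ⟪v, graphNormal n (fderiv ℝ ψ q.1)⟫ * fderiv ℝ f (Ψ q) n
      = fderiv ℝ f (Ψ q) w + fderiv ℝ ψ q.1 w * fderiv ℝ f (Ψ q) n := by
    intro q
    rw [hcoef]
    nth_rewrite 1 [hv]
    rw [map_add, map_smul, smul_eq_mul]
    ring
  have hzero : ∫ q in univ ×ˢ Iio (0 : ℝ), (fderiv ℝ f (Ψ q) v -
      ⟪v, graphNormal n (fderiv ℝ ψ q.1)⟫ * fderiv ℝ f (Ψ q) n) = 0 := by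
    simp only [hdiff]
    have hi : IntegrableOn (fun q => fderiv ℝ f (Ψ q) w + fderiv ℝ ψ q.1 w * fderiv ℝ f (Ψ q) n)
      (univ ×ˢ Iio (0 : ℝ)) := ((hint w).add hint2).integrableOn
    rw [IntegrableOn, Measure.volume_eq_prod, ← Measure.prod_restrict, Measure.restrict_univ] at hi
    rw [Measure.volume_eq_prod, ← Measure.prod_restrict, Measure.restrict_univ,
      integral_prod_symm _ hi]
    simp only [htan, integral_zero]
  rw [integral_sub (hint v).integrableOn hint3.integrableOn, sub_eq_zero] at hzero
  rw [hzero]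
  have hi := hint3.integrableOn (s := univ ×ˢ Iio (0 : ℝ))
  rw [IntegrableOn, Measure.volume_eq_prod, ← Measure.prod_restrict, Measure.restrict_univ] at hi
  rw [Measure.volume_eq_prod, ← Measure.prod_restrict, Measure.restrict_univ, integral_prod _ hi]
  refine integral_congr_ae (ae_of_all _ fun p => ?_)
  simp only
  rw [integral_const_mul, hnor, mul_comm]

end Subgraph

/-- A finite partition of unity on a compact set, subordinate to a given choice of neighbourhoods
and indexed by points of the set. -/
theorem exists_finite_smooth_partition {V : Type*} [NormedAddCommGroup V] [NormedSpace ℝ V]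
    [FiniteDimensional ℝ V] {K : Set V} (hK : IsCompact K) (U : V → Set V)
    (hU : ∀ x ∈ K, IsOpen (U x) ∧ x ∈ U x) :
    ∃ (t : Finset V) (χ : V → V → ℝ), (∀ x ∈ t, x ∈ K) ∧
      (∀ x ∈ t, ContDiff ℝ 1 (χ x) ∧ tsupport (χ x) ⊆ U x) ∧ ∀ y ∈ K, ∑ x ∈ t, χ x y = 1 := by
  classical
  obtain ⟨t, htK, htU⟩ := hK.elim_nhds_subcover U fun x hx => (hU x hx).1.mem_nhds (hU x hx).2
  have hcover : K ⊆ ⋃ x : t, U x := by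
    intro y hy
    obtain ⟨x, hx, hxy⟩ := mem_iUnion₂.1 (htU hy)
    exact mem_iUnion.2 ⟨⟨x, hx⟩, hxy⟩
  obtain ⟨f, hf⟩ := SmoothPartitionOfUnity.exists_isSubordinate (modelWithCornersSelf ℝ V)
    hK.isClosed (fun x : t => U x) (fun x => (hU x (htK x x.2)).1) hcover
  refine ⟨t, fun x y => if h : x ∈ t then f ⟨x, h⟩ y else 0, htK, fun x hx => ?_, fun y hy => ?_⟩
  · simp only [hx, dite_true]
    exact ⟨((f ⟨x, hx⟩).contMDiff.contDiff).of_le (by norm_cast), hf ⟨x, hx⟩⟩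
  · have h1 := f.sum_eq_one hy
    rw [finsum_eq_sum_of_fintype] at h1
    rw [← Finset.sum_coe_sort t]
    simpa using h1

section Area

variable {d : ℕ} {D : Set (Vec d)}

theorem finrank_orthogonal_span_singleton' {n : Vec d} (hn : ‖n‖ = 1) :
    Module.finrank ℝ ((ℝ ∙ n)ᗮ : Submodule ℝ (Vec d)) = d - 1 := by
  have h1 := Submodule.finrank_add_finrank_orthogonal (ℝ ∙ n)
  have hn0 : n ≠ 0 := by rintro rfl; simp at hn
  rw [finrank_span_singleton hn0, finrank_euclideanSpace_fin] at h1
  omega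

variable {x₀ n : Vec d} {ψ : ((ℝ ∙ n)ᗮ : Submodule ℝ (Vec d)) → ℝ} {r : ℝ} {M : ℝ≥0}

theorem restrict_range_graphMap_area (hn : ‖n‖ = 1) (hψ : LipschitzWith M ψ) :
    (Measure.euclideanHausdorffMeasure (d - 1) : Measure (Vec d)).restrict (range (graphMap n ψ)) =
    (volume.withDensity fun p => (graphDensity (fderiv ℝ ψ p) : ENNReal)).map (graphMap n ψ) := by
  rw [← finrank_orthogonal_span_singleton' hn]
  exact restrict_range_graphMap hn hψ

theorem IsSubgraphNear.indicator_frontier (h : IsSubgraphNear D x₀ n ψ r) (hn : ‖n‖ = 1)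
    (hD : IsOpen D) (hψ : Continuous ψ) {g : Vec d → ℝ} (hg : ∀ y ∉ Metric.ball x₀ r, g y = 0) :
    (frontier D).indicator g = (range (graphMap n ψ)).indicator g := by
  ext y
  by_cases hy : y ∈ Metric.ball x₀ r
  · have : y ∈ frontier D ↔ y ∈ range (graphMap n ψ) := by
      rw [h.mem_frontier_iff hn hD hψ hy, mem_range_graphMap_iff hn]
    by_cases h' : y ∈ range (graphMap n ψ)
    · rw [indicator_of_mem (this.2 h'), indicator_of_mem h']
    · rw [indicator_of_notMem (mt this.1 h'), indicator_of_notMem h']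
  · simp [indicator, hg y hy]

theorem IsSubgraphNear.integrable_area_iff (h : IsSubgraphNear D x₀ n ψ r) (hn : ‖n‖ = 1)
    (hD : IsOpen D) (hψ : LipschitzWith M ψ) {g : Vec d → ℝ}
    (hg : ∀ y ∉ Metric.ball x₀ r, g y = 0) :
    Integrable g (area D) ↔
      Integrable fun p => graphDensity (fderiv ℝ ψ p) • g (graphMap n ψ p) := by
  have hemb := (isClosedEmbedding_graphMap hn hψ)
  rw [area, ← IntegrableOn, ← integrable_indicator_iff isClosed_frontier.measurableSet,
    h.indicator_frontier hn hD hψ.continuous hg,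
    integrable_indicator_iff hemb.isClosed_range.measurableSet, IntegrableOn,
    restrict_range_graphMap_area hn hψ, hemb.measurableEmbedding.integrable_map_iff,
    integrable_withDensity_iff_integrable_smul (measurable_graphDensity (measurable_fderiv ℝ ψ))]
  rfl

theorem IsSubgraphNear.integral_area (h : IsSubgraphNear D x₀ n ψ r) (hn : ‖n‖ = 1)
    (hD : IsOpen D) (hψ : LipschitzWith M ψ) {g : Vec d → ℝ}
    (hg : ∀ y ∉ Metric.ball x₀ r, g y = 0) :
    ∫ y, g y ∂(area D) = ∫ p, graphDensity (fderiv ℝ ψ p) • g (graphMap n ψ p) := by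
  have hemb := (isClosedEmbedding_graphMap hn hψ)
  rw [area, ← integral_indicator isClosed_frontier.measurableSet,
    h.indicator_frontier hn hD hψ.continuous hg,
    integral_indicator hemb.isClosed_range.measurableSet,
    restrict_range_graphMap_area hn hψ, hemb.measurableEmbedding.integral_map,
    integral_withDensity_eq_integral_smul (measurable_graphDensity (measurable_fderiv ℝ ψ))]

/-- The Gauss-Green formula for functions supported in a single chart. Integrability on the boundary
is part of the statement, because measurability of `outerNormal` is deduced from it. -/
theorem IsSubgraphNear.gaussGreen (h : IsSubgraphNear D x₀ n ψ r) (hn : ‖n‖ = 1)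
    (hD : IsOpen D) (hψ : LipschitzWith M ψ) {f : Vec d → ℝ} (hf : ContDiff ℝ 1 f)
    (hfs : tsupport f ⊆ Metric.ball x₀ r) (v : Vec d) :
    Integrable (fun y => f y * ⟪v, outerNormal D y⟫) (area D) ∧
      ∫ y, f y * ⟪v, outerNormal D y⟫ ∂(area D) = ∫ x in D, fderiv ℝ f x v := by
  have hc : HasCompactSupport f := Metric.isCompact_of_isClosed_isBounded (isClosed_tsupport f)
    (Metric.isBounded_ball.subset hfs)
  have hf0 : ∀ y ∉ Metric.ball x₀ r, f y = 0 := fun y hy =>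
    image_eq_zero_of_notMem_tsupport fun hy' => hy (hfs hy')
  have hg : ∀ y ∉ Metric.ball x₀ r, f y * ⟪v, outerNormal D y⟫ = 0 := fun y hy => by
    rw [hf0 y hy, zero_mul]
  have hae : (fun p => graphDensity (fderiv ℝ ψ p) •
        (f (graphMap n ψ p) * ⟪v, outerNormal D (graphMap n ψ p)⟫)) =ᵐ[volume]
      fun p => f (graphMap n ψ p) * ⟪v, graphNormal n (fderiv ℝ ψ p)⟫ := by
    filter_upwards [hψ.ae_differentiableAt] with p hp
    by_cases hpb : graphMap n ψ p ∈ Metric.ball x₀ r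
    · rw [h.outerNormal_graphMap hn hpb hp, inner_smul_right, NNReal.smul_def, smul_eq_mul]
      have hJ : ((graphDensity (fderiv ℝ ψ p) : ℝ≥0) : ℝ) ≠ 0 := by
        rw [coe_graphDensity]; positivity
      field_simp
    · rw [hf0 _ hpb]; simp
  have hmeas : AEStronglyMeasurable (fun p => ⟪v, graphNormal n (fderiv ℝ ψ p)⟫) volume := by
    simp only [inner_graphNormal]
    exact ((measurable_fderiv_apply_const ℝ ψ _).const_sub _).aestronglyMeasurable
  rw [h.integrable_area_iff hn hD hψ hg, h.integral_area hn hD hψ hg, integral_congr_ae hae,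
    integrable_congr hae]
  constructor
  · refine Integrable.mul_bdd (c := ‖v‖ * (1 + M)) ?_ hmeas (ae_of_all _ fun p => ?_)
    · exact (hf.continuous.comp (hψ.graphMap hn).continuous).integrable_of_hasCompactSupport
        (hc.comp_isClosedEmbedding (isClosedEmbedding_graphMap hn hψ))
    · refine (norm_inner_le_norm _ _).trans ?_
      gcongr
      rw [norm_graphNormal hn]
      have := graphDensity_le (fderiv ℝ ψ p) 0 (δ := M)
        (by simpa using norm_fderiv_le_of_lipschitz ℝ hψ)
      have h0 : graphDensity (0 : ((ℝ ∙ n)ᗮ : Submodule ℝ (Vec d)) →L[ℝ] ℝ) = 1 := by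
        simp [graphDensity]
      rw [h0] at this
      exact_mod_cast this
  · rw [← integral_fderiv_subgraph hn hψ hf hc v, ← integral_indicator hD.measurableSet,
      ← integral_indicator]
    · congr 1
      ext x
      by_cases hx : x ∈ Metric.ball x₀ r
      · have := h x hx
        simp only [indicator, this, mem_ofPred_eq]
      · have : fderiv ℝ f x = 0 := by
          have h1 : x ∉ tsupport (fderiv ℝ f) := fun h2 => hx (hfs (tsupport_fderiv_subset ℝ h2))
          exact image_eq_zero_of_notMem_tsupport h1
        simp [indicator, this]
    · have hψc := hψ.continuous
      exact measurableSet_lt (by fun_prop) (by fun_prop)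

/-- The boundary of a bounded Lipschitz domain has finite area. -/
theorem IsLipschitzDomain.isFiniteMeasure_area (hD : IsLipschitzDomain D)
    (hb : Bornology.IsBounded D) : IsFiniteMeasure (area D) := by
  have hK : IsCompact (frontier D) := Metric.isCompact_of_isClosed_isBounded isClosed_frontier
    (hb.closure.subset frontier_subset_closure)
  refine ⟨?_⟩
  rw [area, Measure.restrict_apply_univ]
  refine hK.measure_lt_top_of_nhdsWithin fun x hx => ?_
  obtain ⟨n, hn, ψ, M, hψ, r, hr, hg⟩ := hD.exists_isSubgraphNear hx
  refine ⟨frontier D ∩ Metric.ball x r, inter_mem self_mem_nhdsWithin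
    (mem_nhdsWithin_of_mem_nhds (Metric.ball_mem_nhds x hr)), ?_⟩
  have hsub : frontier D ∩ Metric.ball x r ⊆
      graphMap n ψ '' (Metric.closedBall ((ℝ ∙ n)ᗮ.orthogonalProjectionOnto x) r) := by
    rintro y ⟨hy, hyb⟩
    rw [hg.mem_frontier_iff hn hD.1 hψ.continuous hyb] at hy
    refine ⟨(ℝ ∙ n)ᗮ.orthogonalProjectionOnto y, ?_, ?_⟩
    · rw [mem_closedBall_iff_norm, ← map_sub]
      exact (norm_orthogonalProjectionOnto_le n _).trans (mem_ball_iff_norm.1 hyb).le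
    · rw [graphMap, ← hy, orthogonalProjectionOnto_add_inner_smul hn]
  refine lt_of_le_of_lt ((measure_mono hsub).trans
    ((hψ.graphMap hn).lipschitzOnWith.euclideanHausdorffMeasure_image_le (d - 1))) ?_
  rw [← finrank_orthogonal_span_singleton' hn, InnerProductSpace.euclideanHausdorffMeasure_eq_volume]
  exact ENNReal.mul_lt_top (by finiteness) measure_closedBall_lt_top

/-- The Gauss-Green formula for `C¹` functions: a partition of unity reduces it to functions
supported inside the domain or in a chart at a boundary point. -/
theorem IsLipschitzDomain.gaussGreen_contDiff (hD : IsLipschitzDomain D)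
    (hb : Bornology.IsBounded D) {f : Vec d → ℝ} (hf : ContDiff ℝ 1 f) (v : Vec d) :
    Integrable (fun y => f y * ⟪v, outerNormal D y⟫) (area D) ∧
      ∫ y, f y * ⟪v, outerNormal D y⟫ ∂(area D) = ∫ x in D, fderiv ℝ f x v := by
  have hK : IsCompact (closure D) := hb.isCompact_closure
  -- around each point of the closure, there is a neighborhood in which the formula holds
  have hloc : ∀ x, ∃ U : Set (Vec d), x ∈ closure D → (IsOpen U ∧ x ∈ U) ∧
      ∀ g : Vec d → ℝ, ContDiff ℝ 1 g → tsupport g ⊆ U →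
        (Integrable (fun y => g y * ⟪v, outerNormal D y⟫) (area D) ∧
        ∫ y, g y * ⟪v, outerNormal D y⟫ ∂(area D) = ∫ x in D, fderiv ℝ g x v) ∧
        IntegrableOn (fun x => fderiv ℝ g x v) D := by
    intro x
    by_cases hx : x ∈ closure D
    swap
    · exact ⟨∅, fun h => absurd h hx⟩
    have hI : ∀ g : Vec d → ℝ, ContDiff ℝ 1 g → IntegrableOn (fun x => fderiv ℝ g x v) D := by
      intro g hg
      have : Continuous fun x => fderiv ℝ g x v :=
        (hg.continuous_fderiv (by simp)).clm_apply continuous_const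
      exact (this.continuousOn.integrableOn_compact hK).mono_set subset_closure
    by_cases hxD : x ∈ D
    · refine ⟨D ∩ Metric.ball x 1, fun _ => ⟨⟨hD.1.inter Metric.isOpen_ball, hxD,
        Metric.mem_ball_self one_pos⟩, fun g hg hgs => ⟨?_, hI g hg⟩⟩⟩
      have hc : HasCompactSupport g := Metric.isCompact_of_isClosed_isBounded (isClosed_tsupport g)
        (Metric.isBounded_ball.subset (hgs.trans inter_subset_right))
      have h0 : (fun y => g y * ⟪v, outerNormal D y⟫) =ᵐ[area D] 0 := by
        refine (ae_restrict_iff' isClosed_frontier.measurableSet).2 (ae_of_all _ fun y hy => ?_)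
        have : g y = 0 := image_eq_zero_of_notMem_tsupport fun h => by
          rw [hD.1.frontier_eq] at hy
          exact hy.2 (hgs h).1
        simp [this]
      refine ⟨(integrable_congr h0).2 (integrable_zero _ _ _), ?_⟩
      rw [integral_congr_ae h0]
      obtain ⟨K, hK⟩ := hg.locallyLipschitz.exists_lipschitzWith_of_hasCompactSupport hc
      have h1 := hK.integral_lineDeriv_eq_zero (μ := volume) hc v
      have h2 : ∫ x in D, fderiv ℝ g x v = ∫ x, fderiv ℝ g x v := by
        refine setIntegral_eq_integral_of_forall_compl_eq_zero fun x hx => ?_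
        have : fderiv ℝ g x = 0 := image_eq_zero_of_notMem_tsupport fun h2 =>
          hx (hgs (tsupport_fderiv_subset ℝ h2)).1
        simp [this]
      rw [h2]
      refine (by simp : _ = (0 : ℝ)).trans (h1.symm.trans ?_)
      refine integral_congr_ae (ae_of_all _ fun x => ?_)
      exact ((hg.differentiable (by simp) x).lineDeriv_eq_fderiv)
    · obtain ⟨n, hn, ψ, M, hψ, r, hr, hgr⟩ := hD.exists_isSubgraphNear (x₀ := x)
        (by rw [hD.1.frontier_eq]; exact ⟨hx, hxD⟩)
      exact ⟨Metric.ball x r, fun _ => ⟨⟨Metric.isOpen_ball, Metric.mem_ball_self hr⟩,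
        fun g hg hgs => ⟨hgr.gaussGreen hn hD.1 hψ hg hgs v, hI g hg⟩⟩⟩
  choose U hU using hloc
  obtain ⟨t, χ, htK, hχ, hsum⟩ := exists_finite_smooth_partition hK U fun x hx => (hU x hx).1
  have hp : ∀ x ∈ t, _ := fun x hx => (hU x (htK x hx)).2 (fun y => χ x y * f y)
    ((hχ x hx).1.mul hf) ((tsupport_mul_subset_left (f := χ x) (g := f)).trans (hχ x hx).2)
  have hae : (fun y => f y * ⟪v, outerNormal D y⟫) =ᵐ[area D]
      fun y => ∑ x ∈ t, χ x y * f y * ⟪v, outerNormal D y⟫ := by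
    refine (ae_restrict_iff' isClosed_frontier.measurableSet).2 (ae_of_all _ fun y hy => ?_)
    simp only
    rw [← Finset.sum_mul, ← Finset.sum_mul, hsum y (frontier_subset_closure hy), one_mul]
  rw [integrable_congr hae, integral_congr_ae hae]
  refine ⟨integrable_finsetSum _ fun x hx => (hp x hx).1.1, ?_⟩
  rw [integral_finsetSum _ fun x hx => (hp x hx).1.1, Finset.sum_congr rfl fun x hx => (hp x hx).1.2,
    ← integral_finsetSum _ fun x hx => (hp x hx).2]
  refine setIntegral_congr_fun hD.1.measurableSet fun y hy => ?_
  have h1 : f =ᶠ[𝓝 y] fun z => ∑ x ∈ t, χ x z * f z := by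
    filter_upwards [hD.1.mem_nhds hy] with z hz
    rw [← Finset.sum_mul, hsum z (subset_closure hz), one_mul]
  rw [h1.fderiv_eq, fderiv_fun_sum fun x hx =>
    (((hχ x hx).1.mul hf).differentiable (by simp)).differentiableAt, sum_apply]

/-- The components of the outer normal are integrable by the Gauss-Green formula for constants. -/
theorem IsLipschitzDomain.aestronglyMeasurable_outerNormal (hD : IsLipschitzDomain D)
    (hb : Bornology.IsBounded D) : AEStronglyMeasurable (outerNormal D) (area D) := by
  have h1 : ∀ i, AEStronglyMeasurable (fun y => outerNormal D y i) (area D) := fun i => by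
    have := (hD.gaussGreen_contDiff hb (contDiff_const (c := (1 : ℝ)))
      (EuclideanSpace.single i 1)).1.aestronglyMeasurable
    simpa [EuclideanSpace.inner_single_left] using this
  have h2 : AEMeasurable (fun y => (outerNormal D y).ofLp) (area D) :=
    aemeasurable_pi_lambda _ fun i => (h1 i).aemeasurable
  exact ((WithLp.measurable_toLp 2 _).comp_aemeasurable h2).aestronglyMeasurable

/-- The Gauss-Green formula for Lipschitz functions on bounded Lipschitz domains. -/
theorem IsLipschitzDomain.gaussGreen (hD : IsLipschitzDomain D)
    (hb : Bornology.IsBounded D) {f : Vec d → ℝ} {K : ℝ≥0} (hf : LipschitzWith K f) (v : Vec d) :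
    ∫ y, f y * ⟪v, outerNormal D y⟫ ∂(area D) = ∫ x in D, fderiv ℝ f x v := by
  have := hD.isFiniteMeasure_area hb
  have hcl : IsCompact (closure D) := hb.isCompact_closure
  have hfin : IsFiniteMeasure (volume.restrict D) :=
    ⟨by rw [Measure.restrict_apply_univ]; exact hb.measure_lt_top⟩
  obtain ⟨C, hC⟩ := hcl.exists_bound_of_continuousOn hf.continuous.continuousOn
  have h1 : Tendsto (fun r => ∫ y, mollify volume r f y * ⟪v, outerNormal D y⟫ ∂(area D)) (𝓝[>] 0)
      (𝓝 (∫ y, f y * ⟪v, outerNormal D y⟫ ∂(area D))) := by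
    refine tendsto_integral_filter_of_dominated_convergence
      (fun _ => (C + K * (1 * 2)) * (‖v‖ * 1)) ?_ ?_ (integrable_const _) ?_
    · filter_upwards with r
      exact (hf.mollify volume r).continuous.aestronglyMeasurable.mul
        (aestronglyMeasurable_const.inner (hD.aestronglyMeasurable_outerNormal hb))
    · filter_upwards [Ioc_mem_nhdsGT one_pos] with r hr
      refine (ae_restrict_iff' isClosed_frontier.measurableSet).2 (ae_of_all _ fun y hy => ?_)
      have hCy := hC y (frontier_subset_closure hy)
      have h2 := hf.norm_mollify_sub_le volume hr.1.le y
      have h3 : (K : ℝ) * (r * 2) ≤ K * (1 * 2) := by have := hr.2; gcongr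
      have h4 := norm_sub_norm_le (mollify volume r f y) (f y)
      have h6 : 0 ≤ C + K * (1 * 2) := by
        have := (norm_nonneg _).trans hCy
        positivity
      rw [norm_mul]
      refine mul_le_mul (by linarith) ((norm_inner_le_norm _ _).trans ?_) (norm_nonneg _) h6
      gcongr
      exact norm_outerNormal_le D y
    · exact ae_of_all _ fun y => (hf.tendsto_mollify volume y).mul_const _
  have h2 : Tendsto (fun r => ∫ x in D, fderiv ℝ (mollify volume r f) x v) (𝓝[>] 0)
      (𝓝 (∫ x in D, fderiv ℝ f x v)) := by
    refine tendsto_integral_filter_of_dominated_convergence (fun _ => K * ‖v‖) ?_ ?_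
      (integrable_const _) ?_
    · filter_upwards with r
      exact (measurable_fderiv_apply_const ℝ _ v).aestronglyMeasurable
    · filter_upwards with r
      refine ae_of_all _ fun x => ((fderiv ℝ _ x).le_opNorm v).trans ?_
      gcongr
      exact norm_fderiv_le_of_lipschitz ℝ (hf.mollify volume r)
    · filter_upwards [ae_restrict_of_ae hf.ae_differentiableAt] with x hx
      exact ((ContinuousLinearMap.apply ℝ ℝ v).continuous.tendsto _).comp
        (hf.tendsto_fderiv_mollify volume hx)
  refine tendsto_nhds_unique h1 (h2.congr' ?_)
  filter_upwards [self_mem_nhdsWithin] with r hr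
  exact (hD.gaussGreen_contDiff hb (contDiff_mollify volume hr hf.continuous) v).2.symm

theorem LipschitzWith.apply_euclidean {X : Type*} [PseudoMetricSpace X] {F : X → Vec d} {K : ℝ≥0}
    (hF : LipschitzWith K F) (i : Fin d) : LipschitzWith K fun x => F x i :=
  LipschitzWith.of_dist_le_mul fun x y => by
    rw [Real.dist_eq]
    exact (PiLp.norm_apply_le (F x - F y) i).trans (by rw [← dist_eq_norm]; exact hF.dist_le_mul x y)

theorem IsLipschitzDomain.integrable_inner_outerNormal (hD : IsLipschitzDomain D)
    (hb : Bornology.IsBounded D) {F : Vec d → Vec d} (hF : AEStronglyMeasurable F (area D)) {C : ℝ}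
    (hC : ∀ y ∈ frontier D, ‖F y‖ ≤ C) :
    Integrable (fun y => ⟪outerNormal D y, F y⟫) (area D) := by
  have := hD.isFiniteMeasure_area hb
  refine Integrable.of_bound ((hD.aestronglyMeasurable_outerNormal hb).inner hF) C ?_
  refine (ae_restrict_iff' isClosed_frontier.measurableSet).2 (ae_of_all _ fun y hy => ?_)
  refine (norm_inner_le_norm _ _).trans ?_
  calc ‖outerNormal D y‖ * ‖F y‖ ≤ 1 * ‖F y‖ := by gcongr; exact norm_outerNormal_le D y
    _ ≤ C := by rw [one_mul]; exact hC y hy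

theorem divergence_eq_sum_fderiv {F : Vec d → Vec d} {x : Vec d} (h : DifferentiableAt ℝ F x) :
    divergence F x = ∑ i, fderiv ℝ (fun y => F y i) x (EuclideanSpace.single i 1) := by
  unfold divergence
  refine Finset.sum_congr rfl fun i _ => ?_
  have h1 := ((EuclideanSpace.proj i : Vec d →L[ℝ] ℝ).hasFDerivAt (x := F x)).comp x h.hasFDerivAt
  have h2 : fderiv ℝ (fun y => F y i) x = (EuclideanSpace.proj i : Vec d →L[ℝ] ℝ).comp
    (fderiv ℝ F x) := h1.fderiv
  rw [h2]
  rfl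

/-- The divergence theorem for Lipschitz vector fields on bounded Lipschitz domains. -/
theorem IsLipschitzDomain.integral_divergence (hD : IsLipschitzDomain D)
    (hb : Bornology.IsBounded D) {F : Vec d → Vec d} {K : ℝ≥0} (hF : LipschitzWith K F) :
    ∫ y, ⟪outerNormal D y, F y⟫ ∂(area D) = ∫ x in D, divergence F x := by
  have := hD.isFiniteMeasure_area hb
  have hfin : IsFiniteMeasure (volume.restrict D) :=
    ⟨by rw [Measure.restrict_apply_univ]; exact hb.measure_lt_top⟩
  have hcl : IsCompact (closure D) := hb.isCompact_closure
  have hI : ∀ i, IntegrableOn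
      (fun x => fderiv ℝ (fun y => F y i) x (EuclideanSpace.single i 1)) D := fun i => by
    refine Integrable.of_bound (measurable_fderiv_apply_const ℝ _ _).aestronglyMeasurable
      (K * ‖(EuclideanSpace.single i 1 : Vec d)‖) (ae_of_all _ fun x => ?_)
    refine ((fderiv ℝ _ x).le_opNorm _).trans ?_
    gcongr
    exact norm_fderiv_le_of_lipschitz ℝ (hF.apply_euclidean i)
  have hI' : ∀ i, Integrable (fun y => F y i * ⟪EuclideanSpace.single i 1, outerNormal D y⟫)
      (area D) := fun i => by
    obtain ⟨C, hC⟩ := hcl.exists_bound_of_continuousOn hF.continuous.continuousOn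
    have := hD.integrable_inner_outerNormal hb (F := fun y => F y i • EuclideanSpace.single i 1)
      ((hF.apply_euclidean i).continuous.smul continuous_const).aestronglyMeasurable (C := C)
      (fun y hy => by
        rw [norm_smul, PiLp.norm_single, norm_one, mul_one]
        exact (PiLp.norm_apply_le _ i).trans (hC y (frontier_subset_closure hy)))
    simpa [inner_smul_right, real_inner_comm] using this
  have h1 : ∫ x in D, divergence F x =
      ∫ x in D, ∑ i, fderiv ℝ (fun y => F y i) x (EuclideanSpace.single i 1) := by
    refine integral_congr_ae ?_
    filter_upwards [ae_restrict_of_ae hF.ae_differentiableAt] with x hx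
    exact divergence_eq_sum_fderiv hx
  rw [h1, integral_finsetSum _ fun i _ => hI i]
  simp_rw [← fun i => hD.gaussGreen hb (hF.apply_euclidean i) (EuclideanSpace.single i 1)]
  rw [← integral_finsetSum _ fun i _ => hI' i]
  refine integral_congr_ae (ae_of_all _ fun y => ?_)
  simp [PiLp.inner_apply]

end Area

/-! ### The null form of two Jacobi matrices -/

noncomputable section LinAlg
variable {d : ℕ}

/-- The trace of an endomorphism of `ℝ^d`, as a continuous linear functional. -/
def traceCLM (d : ℕ) : (Vec d →L[ℝ] Vec d) →L[ℝ] ℝ :=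
  LinearMap.toContinuousLinearMap
    ((LinearMap.trace ℝ (Vec d)).comp (ContinuousLinearMap.coeLM ℝ))

theorem traceCLM_apply (A : Vec d →L[ℝ] Vec d) :
    traceCLM d A = LinearMap.trace ℝ (Vec d) (A : Vec d →ₗ[ℝ] Vec d) := rfl

theorem traceCLM_comm (A B : Vec d →L[ℝ] Vec d) :
    traceCLM d (A.comp B) = traceCLM d (B.comp A) := by
  exact LinearMap.trace_mul_comm ℝ (A : Vec d →ₗ[ℝ] Vec d) (B : Vec d →ₗ[ℝ] Vec d)

theorem traceCLM_smulRight (φ : Vec d →L[ℝ] ℝ) (v : Vec d) : traceCLM d (φ.smulRight v) = φ v := by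
  exact LinearMap.trace_smulRight (φ : Vec d →ₗ[ℝ] ℝ) v

theorem traceCLM_eq_sum (A : Vec d →L[ℝ] Vec d) :
    traceCLM d A = ∑ i, A (EuclideanSpace.single i 1) i := by
  rw [traceCLM_apply, LinearMap.trace_eq_sum_inner _ (EuclideanSpace.basisFun (Fin d) ℝ)]
  simp [EuclideanSpace.inner_single_left]

theorem divergence_eq_trace (F : Vec d → Vec d) (x : Vec d) :
    divergence F x = traceCLM d (fderiv ℝ F x) := (traceCLM_eq_sum _).symm

/-- The second elementary symmetric form `tr A tr B - tr (AB)`. Applied to two Jacobi matrices it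
is a divergence. -/
def nullForm (A B : Vec d →L[ℝ] Vec d) : ℝ :=
  traceCLM d A * traceCLM d B - traceCLM d (A.comp B)

theorem nullForm_comm (A B : Vec d →L[ℝ] Vec d) : nullForm A B = nullForm B A := by
  rw [nullForm, nullForm, traceCLM_comm, mul_comm]

theorem nullForm_add_right (A B C : Vec d →L[ℝ] Vec d) :
    nullForm A (B + C) = nullForm A B + nullForm A C := by
  simp only [nullForm, ContinuousLinearMap.comp_add, map_add]
  ring

theorem nullForm_sub_right (A B C : Vec d →L[ℝ] Vec d) :
    nullForm A (B - C) = nullForm A B - nullForm A C := by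
  simp only [nullForm, ContinuousLinearMap.comp_sub, map_sub]
  ring

/-- `nullForm A B` is the pairing of `B` with `(tr A) I - A`. -/
theorem nullForm_eq_trace_comp (A B : Vec d →L[ℝ] Vec d) :
    nullForm A B = traceCLM d ((traceCLM d A • ContinuousLinearMap.id ℝ (Vec d) - A).comp B) := by
  simp [nullForm, ContinuousLinearMap.sub_comp, ContinuousLinearMap.smul_comp]

theorem continuous_nullForm :
    Continuous fun p : (Vec d →L[ℝ] Vec d) × (Vec d →L[ℝ] Vec d) => nullForm p.1 p.2 := by
  have h1 := (traceCLM d).continuous.comp (continuous_fst (X := Vec d →L[ℝ] Vec d)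
    (Y := Vec d →L[ℝ] Vec d))
  have h2 := (traceCLM d).continuous.comp (continuous_snd (X := Vec d →L[ℝ] Vec d)
    (Y := Vec d →L[ℝ] Vec d))
  exact (h1.mul h2).sub ((traceCLM d).continuous.comp (continuous_fst.clm_comp continuous_snd))

theorem Measurable.nullForm {X : Type*} [MeasurableSpace X] {A B : X → Vec d →L[ℝ] Vec d}
    (hA : Measurable A) (hB : Measurable B) : Measurable fun x => nullForm (A x) (B x) := by
  have h := continuous_nullForm.measurable.comp (hA.prodMk hB)
  exact h

theorem Filter.Tendsto.nullForm {X : Type*} {l : Filter X} {A B : X → Vec d →L[ℝ] Vec d}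
    {A₀ B₀ : Vec d →L[ℝ] Vec d} (hA : Tendsto A l (𝓝 A₀)) (hB : Tendsto B l (𝓝 B₀)) :
    Tendsto (fun x => nullForm (A x) (B x)) l (𝓝 (nullForm A₀ B₀)) := by
  have h := (continuous_nullForm.tendsto (A₀, B₀)).comp (hA.prodMk_nhds hB)
  exact h

theorem norm_nullForm_le (A B : Vec d →L[ℝ] Vec d) :
    ‖nullForm A B‖ ≤ (‖traceCLM d‖ * ‖traceCLM d‖ + ‖traceCLM d‖) * (‖A‖ * ‖B‖) := by
  have h1 := (traceCLM d).le_opNorm A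
  have h2 := (traceCLM d).le_opNorm B
  have h3 := (traceCLM d).le_opNorm (A.comp B)
  have h4 := ContinuousLinearMap.opNorm_comp_le A B
  calc ‖nullForm A B‖ ≤ ‖traceCLM d A‖ * ‖traceCLM d B‖ + ‖traceCLM d (A.comp B)‖ := by
        rw [nullForm, ← norm_mul]; exact norm_sub_le _ _
    _ ≤ (‖traceCLM d‖ * ‖A‖) * (‖traceCLM d‖ * ‖B‖) + ‖traceCLM d‖ * (‖A‖ * ‖B‖) := by
        gcongr
        exact h3.trans (by gcongr)
    _ = _ := by ring

theorem divergence_congr {F G : Vec d → Vec d} {x : Vec d} (h : F =ᶠ[𝓝 x] G) :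
    divergence F x = divergence G x := by
  rw [divergence_eq_trace, divergence_eq_trace, h.fderiv_eq]

theorem divergence_smul {g : Vec d → ℝ} {F : Vec d → Vec d} {x : Vec d}
    (hg : DifferentiableAt ℝ g x) (hF : DifferentiableAt ℝ F x) :
    divergence (fun y => g y • F y) x = fderiv ℝ g x (F x) + g x * divergence F x := by
  rw [divergence_eq_trace, divergence_eq_trace, fderiv_fun_smul hg hF, map_add, map_smul,
    traceCLM_smulRight, smul_eq_mul, add_comm]

/-- The form `nullForm (DP) (DQ)` is a divergence, because second derivatives of `Q` are
symmetric. -/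
theorem divergence_smul_sub_fderiv {P Q : Vec d → Vec d} {x : Vec d}
    (hP : DifferentiableAt ℝ P x) (hQ : ContDiff ℝ 2 Q) :
    divergence (fun y => divergence Q y • P y - fderiv ℝ Q y (P y)) x =
      nullForm (fderiv ℝ P x) (fderiv ℝ Q x) := by
  have h1 : Differentiable ℝ (fderiv ℝ Q) :=
    (hQ.fderiv_right (m := 1) (by norm_num)).differentiable (by norm_num)
  have hsymm : IsSymmSndFDerivAt ℝ Q x := hQ.contDiffAt.isSymmSndFDerivAt (by simp)
  have h2 : HasFDerivAt (fun y => divergence Q y) ((traceCLM d).comp (fderiv ℝ (fderiv ℝ Q) x)) x := by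
    have := (traceCLM d).hasFDerivAt.comp x (h1 x).hasFDerivAt
    refine this.congr_of_eventuallyEq (Eventually.of_forall fun y => divergence_eq_trace _ _)
  have h3 := (h1 x).hasFDerivAt.clm_apply hP.hasFDerivAt
  have h4 : HasFDerivAt (fun y => divergence Q y • P y - fderiv ℝ Q y (P y)) _ x :=
    (h2.smul hP.hasFDerivAt).sub h3
  rw [divergence_eq_trace, HasFDerivAt.fderiv h4]
  have h5 : (fderiv ℝ (fderiv ℝ Q) x).flip (P x) = fderiv ℝ (fderiv ℝ Q) x (P x) := by
    ext v : 1
    exact hsymm _ _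
  simp only [map_sub, map_add, map_smul, traceCLM_smulRight, h5, nullForm,
    divergence_eq_trace, ContinuousLinearMap.comp_apply, smul_eq_mul,
    traceCLM_comm (fderiv ℝ Q x)]
  ring
end LinAlg

section Cutoff

theorem LocallyLipschitz.smul {X F : Type*} [PseudoMetricSpace X] [NormedAddCommGroup F]
    [NormedSpace ℝ F] {f : X → ℝ} {g : X → F} (hf : LocallyLipschitz f)
    (hg : LocallyLipschitz g) : LocallyLipschitz fun x => f x • g x := by
  have h : ContDiff ℝ 1 fun p : ℝ × F => p.1 • p.2 := contDiff_fst.smul contDiff_snd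
  exact h.locallyLipschitz.comp (hf.prodMk hg)

theorem LocallyLipschitz.clm_apply {X E F : Type*} [PseudoMetricSpace X] [NormedAddCommGroup E]
    [NormedSpace ℝ E] [NormedAddCommGroup F] [NormedSpace ℝ F] {A : X → E →L[ℝ] F} {g : X → E}
    (hA : LocallyLipschitz A) (hg : LocallyLipschitz g) : LocallyLipschitz fun x => A x (g x) := by
  have h : ContDiff ℝ 1 fun p : (E →L[ℝ] F) × E => p.1 p.2 := contDiff_fst.clm_apply contDiff_snd
  exact h.locallyLipschitz.comp (hA.prodMk hg)

theorem exists_smooth_cutoff {E : Type*} [NormedAddCommGroup E] [NormedSpace ℝ E]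
    [FiniteDimensional ℝ E] {K U : Set E} (hK : IsCompact K) (hU : IsOpen U) (hKU : K ⊆ U)
    (n : ℕ∞) :
    ∃ χ : E → ℝ, ContDiff ℝ n χ ∧ HasCompactSupport χ ∧ tsupport χ ⊆ U ∧
      (∀ x, χ x ∈ Icc (0 : ℝ) 1) ∧ ∀ᶠ x in 𝓝ˢ K, χ x = 1 := by
  obtain ⟨L, hL, hKL, hLU⟩ := exists_compact_between hK hU hKU
  obtain ⟨f, h1, h2, h3⟩ := exists_contMDiffMap_one_nhds_of_subset_interior (n := n)
    (modelWithCornersSelf ℝ E) hK.isClosed hKL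
  have hs : tsupport f ⊆ L := closure_minimal (fun x hx => by
    by_contra h
    exact hx (h2 x h)) hL.isClosed
  exact ⟨f, f.contMDiff.contDiff, hL.of_isClosed_subset (isClosed_tsupport _) hs, hs.trans hLU,
    h3, h1⟩

/-- Near a compact set, a locally Lipschitz function agrees with a globally Lipschitz one. -/
theorem LocallyLipschitz.exists_lipschitzWith_eventuallyEq {E F : Type*} [NormedAddCommGroup E]
    [NormedSpace ℝ E] [FiniteDimensional ℝ E] [NormedAddCommGroup F] [NormedSpace ℝ F]
    {f : E → F} (hf : LocallyLipschitz f) {K : Set E} (hK : IsCompact K) :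
    ∃ (g : E → F) (L : ℝ≥0), LipschitzWith L g ∧ ∀ᶠ x in 𝓝ˢ K, g x = f x := by
  obtain ⟨χ, h1, h2, -, -, h5⟩ := exists_smooth_cutoff hK isOpen_univ (subset_univ _) 1
  have : ProperSpace E := FiniteDimensional.proper ℝ E
  obtain ⟨L, hL⟩ := ((h1.locallyLipschitz (𝕂 := ℝ)).smul hf
    ).exists_lipschitzWith_of_hasCompactSupport h2.smul_right
  exact ⟨_, L, hL, h5.mono fun x hx => by simp [hx]⟩

end Cutoff

section NullForm
variable {d : ℕ} {D : Set (Vec d)}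

theorem IsLipschitzDomain.integral_divergence_of_locallyLipschitz (hD : IsLipschitzDomain D)
    (hb : Bornology.IsBounded D) {F : Vec d → Vec d} (hF : LocallyLipschitz F) :
    ∫ y, ⟪outerNormal D y, F y⟫ ∂(area D) = ∫ x in D, divergence F x := by
  obtain ⟨G, L, hG, hGF⟩ := hF.exists_lipschitzWith_eventuallyEq hb.isCompact_closure
  rw [eventually_nhdsSet_iff_forall] at hGF
  rw [← setIntegral_congr_fun hD.1.measurableSet (f := divergence G) fun x hx =>
    divergence_congr (hGF x (subset_closure hx)), ← hD.integral_divergence hb hG]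
  refine integral_congr_ae ?_
  refine (ae_restrict_iff' isClosed_frontier.measurableSet).2 (ae_of_all _ fun y hy => ?_)
  simp only
  rw [(hGF y (frontier_subset_closure hy)).self_of_nhds]

theorem IsLipschitzDomain.integral_nullForm_of_contDiff (hD : IsLipschitzDomain D)
    (hb : Bornology.IsBounded D) {P Q : Vec d → Vec d} {K : ℝ≥0} (hP : LipschitzWith K P)
    (hQ : ContDiff ℝ 2 Q) :
    ∫ x in D, nullForm (fderiv ℝ P x) (fderiv ℝ Q x) =
      ∫ y, ⟪outerNormal D y, divergence Q y • P y - fderiv ℝ Q y (P y)⟫ ∂(area D) := by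
  have h1 : ContDiff ℝ 1 (fderiv ℝ Q) := hQ.fderiv_right (by norm_num)
  have h2 : ContDiff ℝ 1 (divergence Q) := by
    have : divergence Q = fun y => traceCLM d (fderiv ℝ Q y) := funext fun y =>
      divergence_eq_trace _ _
    rw [this]
    exact (traceCLM d).contDiff.comp h1
  rw [hD.integral_divergence_of_locallyLipschitz hb
    ((h2.locallyLipschitz.smul hP.locallyLipschitz).sub
      (h1.locallyLipschitz.clm_apply hP.locallyLipschitz))]
  refine integral_congr_ae ?_
  filter_upwards [ae_restrict_of_ae hP.ae_differentiableAt] with x hx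
  exact (divergence_smul_sub_fderiv hx hQ).symm

/-- The boundary integrals of the mollifications of `Q` converge to the integral of the null form,
even if `Q` is nowhere differentiable on the boundary. -/
theorem IsLipschitzDomain.tendsto_integral_nullForm (hD : IsLipschitzDomain D)
    (hb : Bornology.IsBounded D) {P Q : Vec d → Vec d} {K L : ℝ≥0} (hP : LipschitzWith K P)
    (hQ : LipschitzWith L Q) :
    Tendsto (fun r => ∫ y, ⟪outerNormal D y, divergence (mollify volume r Q) y • P y -
      fderiv ℝ (mollify volume r Q) y (P y)⟫ ∂(area D)) (𝓝[>] 0)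
      (𝓝 (∫ x in D, nullForm (fderiv ℝ P x) (fderiv ℝ Q x))) := by
  have hfin : IsFiniteMeasure (volume.restrict D) :=
    ⟨by rw [Measure.restrict_apply_univ]; exact hb.measure_lt_top⟩
  refine Tendsto.congr' (f₁ := fun r => ∫ x in D, nullForm (fderiv ℝ P x)
    (fderiv ℝ (mollify volume r Q) x)) ?_ ?_
  · filter_upwards [self_mem_nhdsWithin] with r hr
    exact hD.integral_nullForm_of_contDiff hb hP (contDiff_mollify volume hr hQ.continuous (n := 2))
  · refine tendsto_integral_filter_of_dominated_convergence
      (fun _ => (‖traceCLM d‖ * ‖traceCLM d‖ + ‖traceCLM d‖) * (K * L)) ?_ ?_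
      (integrable_const _) ?_
    · exact Eventually.of_forall fun r => ((measurable_fderiv ℝ _).nullForm
        (measurable_fderiv ℝ _)).aestronglyMeasurable
    · refine Eventually.of_forall fun r => ae_of_all _ fun x => (norm_nullForm_le _ _).trans ?_
      gcongr
      · exact norm_fderiv_le_of_lipschitz ℝ hP
      · exact norm_fderiv_le_of_lipschitz ℝ (hQ.mollify volume r)
    · filter_upwards [ae_restrict_of_ae hQ.ae_differentiableAt] with x hx
      exact tendsto_const_nhds.nullForm (hQ.tendsto_fderiv_mollify volume hx)

/-- The null form of two Jacobi matrices integrates to a boundary term, which makes sense whenever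
one of the two fields is differentiable almost everywhere on the boundary. -/
theorem IsLipschitzDomain.integral_nullForm_of_lipschitzWith (hD : IsLipschitzDomain D)
    (hb : Bornology.IsBounded D) {P Q : Vec d → Vec d} {K L : ℝ≥0} (hP : LipschitzWith K P)
    (hQ : LipschitzWith L Q) (hdiff : ∀ᵐ x ∂(area D), DifferentiableAt ℝ Q x) :
    ∫ x in D, nullForm (fderiv ℝ P x) (fderiv ℝ Q x) =
      ∫ y, ⟪outerNormal D y, divergence Q y • P y - fderiv ℝ Q y (P y)⟫ ∂(area D) := by
  have := hD.isFiniteMeasure_area hb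
  obtain ⟨C, hC⟩ := hb.isCompact_closure.exists_bound_of_continuousOn hP.continuous.continuousOn
  refine tendsto_nhds_unique (hD.tendsto_integral_nullForm hb hP hQ) ?_
  have hcont : Continuous fun p : (Vec d →L[ℝ] Vec d) × Vec d =>
      traceCLM d p.1 • p.2 - p.1 p.2 := by
    fun_prop
  have hmeas : ∀ Q : Vec d → Vec d,
      Measurable fun y => divergence Q y • P y - fderiv ℝ Q y (P y) := fun Q => by
    simp_rw [divergence_eq_trace]
    have h1 := hcont.measurable.comp ((measurable_fderiv ℝ Q).prodMk hP.continuous.measurable)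
    simpa only [Function.comp_def] using h1
  refine tendsto_integral_filter_of_dominated_convergence
    (fun _ => 1 * ((‖traceCLM d‖ * L) * C + L * C)) ?_ ?_ (integrable_const _) ?_
  · exact Eventually.of_forall fun r => (hD.aestronglyMeasurable_outerNormal hb).inner
      (hmeas _).aestronglyMeasurable
  · refine Eventually.of_forall fun r =>
      (ae_restrict_iff' isClosed_frontier.measurableSet).2 (ae_of_all _ fun y hy => ?_)
    refine (norm_inner_le_norm _ _).trans ?_
    have h1 : ‖fderiv ℝ (mollify volume r Q) y‖ ≤ L :=
      norm_fderiv_le_of_lipschitz ℝ (hQ.mollify volume r)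
    have h2 := hC y (frontier_subset_closure hy)
    have h4 : ‖traceCLM d (fderiv ℝ (mollify volume r Q) y)‖ ≤ ‖traceCLM d‖ * L :=
      (traceCLM d).le_of_opNorm_le_of_le le_rfl h1
    have h5 : ‖fderiv ℝ (mollify volume r Q) y (P y)‖ ≤ L * C :=
      ContinuousLinearMap.le_of_opNorm_le_of_le _ h1 h2
    have h6 : ‖divergence (mollify volume r Q) y • P y‖ ≤ ‖traceCLM d‖ * L * C := by
      rw [norm_smul, divergence_eq_trace]
      exact mul_le_mul h4 h2 (norm_nonneg _) (by positivity)
    have h7 := (norm_sub_le (divergence (mollify volume r Q) y • P y)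
      (fderiv ℝ (mollify volume r Q) y (P y))).trans (add_le_add h6 h5)
    exact mul_le_mul (norm_outerNormal_le D y) h7 (norm_nonneg _) zero_le_one
  · filter_upwards [hdiff] with y hy
    have h1 : Tendsto (fun r => (fderiv ℝ (mollify volume r Q) y, P y)) (𝓝[>] 0)
        (𝓝 (fderiv ℝ Q y, P y)) :=
      (hQ.tendsto_fderiv_mollify volume hy).prodMk_nhds tendsto_const_nhds
    have h2 := (hcont.tendsto (fderiv ℝ Q y, P y)).comp h1
    simp only [Function.comp_def] at h2
    simp only [divergence_eq_trace]
    exact tendsto_const_nhds.inner h2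

theorem integral_nullForm_congr {P Q P' Q' : Vec d → Vec d} (hD : IsOpen D)
    (hP : ∀ᶠ x in 𝓝ˢ (closure D), P' x = P x) (hQ : ∀ᶠ x in 𝓝ˢ (closure D), Q' x = Q x) :
    ∫ x in D, nullForm (fderiv ℝ P' x) (fderiv ℝ Q' x) =
      ∫ x in D, nullForm (fderiv ℝ P x) (fderiv ℝ Q x) := by
  rw [eventually_nhdsSet_iff_forall] at hP hQ
  refine setIntegral_congr_fun hD.measurableSet fun x hx => ?_
  have h1 : P' =ᶠ[𝓝 x] P := hP x (subset_closure hx)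
  have h2 : Q' =ᶠ[𝓝 x] Q := hQ x (subset_closure hx)
  beta_reduce
  rw [h1.fderiv_eq, h2.fderiv_eq]

theorem IsLipschitzDomain.integral_nullForm (hD : IsLipschitzDomain D)
    (hb : Bornology.IsBounded D) {P Q : Vec d → Vec d} (hP : LocallyLipschitz P)
    (hQ : LocallyLipschitz Q) (hdiff : ∀ᵐ x ∂(area D), DifferentiableAt ℝ Q x) :
    ∫ x in D, nullForm (fderiv ℝ P x) (fderiv ℝ Q x) =
      ∫ y, ⟪outerNormal D y, divergence Q y • P y - fderiv ℝ Q y (P y)⟫ ∂(area D) := by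
  obtain ⟨P', K, hP', hPP⟩ := hP.exists_lipschitzWith_eventuallyEq hb.isCompact_closure
  obtain ⟨Q', L, hQ', hQQ⟩ := hQ.exists_lipschitzWith_eventuallyEq hb.isCompact_closure
  have hPn := eventually_nhdsSet_iff_forall.1 hPP
  have hQn := eventually_nhdsSet_iff_forall.1 hQQ
  rw [← integral_nullForm_congr hD.1 hPP hQQ, hD.integral_nullForm_of_lipschitzWith hb hP' hQ' ?_]
  · refine integral_congr_ae ?_
    refine (ae_restrict_iff' isClosed_frontier.measurableSet).2 (ae_of_all _ fun y hy => ?_)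
    have hy' := frontier_subset_closure hy
    have h2 : Q' =ᶠ[𝓝 y] Q := hQn y hy'
    beta_reduce
    rw [(hPn y hy').self_of_nhds, divergence_congr h2, h2.fderiv_eq]
  · have hm := ae_restrict_mem (μ := (Measure.euclideanHausdorffMeasure (d - 1) :
      Measure (Vec d))) (s := frontier D) isClosed_frontier.measurableSet
    filter_upwards [hdiff, hm] with y hy hyf
    exact hy.congr_of_eventuallyEq (hQn y (frontier_subset_closure hyf))

/-- The integral of the null form vanishes if one of the fields vanishes on the boundary: this holds
for the boundary integrals of the mollifications of the other field. -/
theorem IsLipschitzDomain.integral_nullForm_eq_zero (hD : IsLipschitzDomain D)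
    (hb : Bornology.IsBounded D) {P Q : Vec d → Vec d} (hP : LocallyLipschitz P)
    (hQ : LocallyLipschitz Q) (h0 : ∀ x ∈ frontier D, P x = 0) :
    ∫ x in D, nullForm (fderiv ℝ P x) (fderiv ℝ Q x) = 0 := by
  obtain ⟨P', K, hP', hPP⟩ := hP.exists_lipschitzWith_eventuallyEq hb.isCompact_closure
  obtain ⟨Q', L, hQ', hQQ⟩ := hQ.exists_lipschitzWith_eventuallyEq hb.isCompact_closure
  have hPn := eventually_nhdsSet_iff_forall.1 hPP
  rw [← integral_nullForm_congr hD.1 hPP hQQ]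
  refine tendsto_nhds_unique (hD.tendsto_integral_nullForm hb hP' hQ')
    (tendsto_const_nhds.congr fun r => (integral_eq_zero_of_ae ?_).symm)
  refine (ae_restrict_iff' isClosed_frontier.measurableSet).2 (ae_of_all _ fun y hy => ?_)
  have h1 : P' y = 0 := by rw [(hPn y (frontier_subset_closure hy)).self_of_nhds, h0 y hy]
  simp [h1]

theorem integrableOn_nullForm (hb : Bornology.IsBounded D) {P Q : Vec d → Vec d} {K L : ℝ≥0}
    (hP : LipschitzWith K P) (hQ : LipschitzWith L Q) :
    IntegrableOn (fun x => nullForm (fderiv ℝ P x) (fderiv ℝ Q x)) D := by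
  have hfin : IsFiniteMeasure (volume.restrict D) :=
    ⟨by rw [Measure.restrict_apply_univ]; exact hb.measure_lt_top⟩
  refine Integrable.of_bound ((measurable_fderiv ℝ _).nullForm
        (measurable_fderiv ℝ _)).aestronglyMeasurable
    ((‖traceCLM d‖ * ‖traceCLM d‖ + ‖traceCLM d‖) * (K * L)) (ae_of_all _ fun x => ?_)
  refine (norm_nullForm_le _ _).trans ?_
  gcongr
  · exact norm_fderiv_le_of_lipschitz ℝ hP
  · exact norm_fderiv_le_of_lipschitz ℝ hQ

end NullForm

/-! ### Weak convergence of the derivatives of Lipschitz functions -/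

section WeakConvergence
variable {d : ℕ} {D : Set (Vec d)}

/-- A function integrable on an open set of finite measure is approximated in `L¹` by functions
that are smooth with compact support in this set. -/
theorem exists_contDiff_setIntegral_norm_sub_le (hD : IsOpen D) (hfin : volume D ≠ ⊤)
    {m : Vec d → ℝ} (hm : IntegrableOn m D) {ε : ℝ} (hε : 0 < ε) :
    ∃ g : Vec d → ℝ, ContDiff ℝ 1 g ∧ HasCompactSupport g ∧ tsupport g ⊆ D ∧
      ∫ x in D, ‖m x - g x‖ ≤ ε := by
  obtain ⟨g, hgc, hgs, hg⟩ := ((memLp_one_iff_integrable).2 hm).exist_eLpNorm_sub_le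
    (μ := volume.restrict D) (by simp) le_rfl (half_pos hε)
  have hgD : IntegrableOn g D := (hgs.continuous.integrable_of_hasCompactSupport hgc).integrableOn
  have h1 : ∫ x in D, ‖m x - g x‖ ≤ ε / 2 := by
    change ∫ x in D, ‖(m - g) x‖ ≤ ε / 2
    rw [integral_norm_eq_lintegral_enorm (hm.sub hgD).aestronglyMeasurable]
    refine ENNReal.toReal_le_of_le_ofReal (half_pos hε).le ?_
    rw [eLpNorm_one_eq_lintegral_enorm] at hg
    exact hg
  obtain ⟨B, hB⟩ := hgc.exists_bound_of_continuous hgs.continuous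
  have hB0 : 0 ≤ B := (norm_nonneg _).trans (hB 0)
  obtain ⟨K, hKD, hK, hKm⟩ := hD.measurableSet.exists_isCompact_sdiff_lt hfin
    (ε := ENNReal.ofReal (ε / (2 * (B + 1)))) (by positivity)
  obtain ⟨χ, hχ, -, hχD, hχ01, hχ1⟩ := exists_smooth_cutoff hK hD hKD 1
  refine ⟨fun x => χ x * g x, hχ.mul (hgs.of_le (by norm_cast)), hgc.mul_left,
    (tsupport_mul_subset_left).trans hχD, ?_⟩
  have hχD : IntegrableOn (fun x => χ x * g x) D :=
    ((hχ.continuous.mul hgs.continuous).integrable_of_hasCompactSupport hgc.mul_left).integrableOn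
  have h2 : ∫ x in D, ‖g x - χ x * g x‖ ≤ ε / 2 := by
    have hle : ∀ x, ‖g x - χ x * g x‖ ≤ (Kᶜ).indicator (fun _ => B) x := fun x => by
      by_cases hx : x ∈ K
      · have : χ x = 1 := (eventually_nhdsSet_iff_forall.1 hχ1 x hx).self_of_nhds
        simp [this, hx]
      · rw [indicator_of_mem hx]
        have h3 : ‖1 - χ x‖ ≤ 1 := by
          rw [Real.norm_of_nonneg (by linarith [(hχ01 x).2])]; linarith [(hχ01 x).1]
        calc ‖g x - χ x * g x‖ = ‖1 - χ x‖ * ‖g x‖ := by rw [← norm_mul]; ring_nf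
          _ ≤ 1 * B := by gcongr; exact hB x
          _ = B := one_mul B
    have hfin' : IsFiniteMeasure (volume.restrict D) :=
      ⟨by rw [Measure.restrict_apply_univ]; exact hfin.lt_top⟩
    calc ∫ x in D, ‖g x - χ x * g x‖ ≤ ∫ x in D, (Kᶜ).indicator (fun _ => B) x :=
          integral_mono (hgD.sub hχD).norm ((integrable_const B).indicator
            hK.isClosed.measurableSet.compl) hle
      _ = (volume (D \ K)).toReal * B := by
          rw [integral_indicator hK.isClosed.measurableSet.compl, setIntegral_const,
            smul_eq_mul, measureReal_def, Measure.restrict_apply hK.isClosed.measurableSet.compl,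
            inter_comm, sdiff_eq]
      _ ≤ ε / (2 * (B + 1)) * (B + 1) := by
          have := ENNReal.toReal_le_of_le_ofReal (by positivity) hKm.le
          gcongr
          linarith
      _ = ε / 2 := by field_simp
  calc ∫ x in D, ‖m x - χ x * g x‖ ≤ ∫ x in D, (‖m x - g x‖ + ‖g x - χ x * g x‖) :=
        integral_mono (hm.sub hχD).norm ((hm.sub hgD).norm.add (hgD.sub hχD).norm) fun x => by
          simpa using norm_add_le (m x - g x) (g x - χ x * g x)
    _ = (∫ x in D, ‖m x - g x‖) + ∫ x in D, ‖g x - χ x * g x‖ :=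
        integral_add (hm.sub hgD).norm (hgD.sub hχD).norm
    _ ≤ ε := by linarith

theorem LipschitzOnWith.norm_fderiv_le_of_isOpen {E F : Type*} [NormedAddCommGroup E]
    [NormedSpace ℝ E] [NormedAddCommGroup F] [NormedSpace ℝ F] {f : E → F} {K : ℝ≥0} {D : Set E}
    (hf : LipschitzOnWith K f D) (hD : IsOpen D) {x : E} (hx : x ∈ D) : ‖fderiv ℝ f x‖ ≤ K :=
  norm_fderiv_le_of_lipschitzOn ℝ (hD.mem_nhds hx) hf

theorem LipschitzOnWith.ae_differentiableAt_of_isOpen {F : Type*}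
    [NormedAddCommGroup F] [NormedSpace ℝ F] [FiniteDimensional ℝ F] {f : Vec d → F} {K : ℝ≥0}
    (hf : LipschitzOnWith K f D) (hD : IsOpen D) :
    ∀ᵐ x ∂(volume.restrict D), DifferentiableAt ℝ f x := by
  refine (ae_restrict_iff' hD.measurableSet).2 ?_
  filter_upwards [hf.ae_differentiableWithinAt_of_mem (μ := volume)] with x hx hxD
  exact (hx hxD).differentiableAt (hD.mem_nhds hxD)

/-- Integration by parts on an open set, against a test function with compact support in it. -/
theorem setIntegral_mul_fderiv_eq_neg (hD : IsOpen D) {f g : Vec d → ℝ} {K : ℝ≥0}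
    (hf : LipschitzOnWith K f D) (hg : ContDiff ℝ 1 g) (hgc : HasCompactSupport g)
    (hgD : tsupport g ⊆ D) (v : Vec d) :
    ∫ x in D, g x * fderiv ℝ f x v = ∫ x in D, fderiv ℝ g x (-v) * f x := by
  obtain ⟨F, hF, hFf⟩ := hf.extend_real
  obtain ⟨L, hL⟩ := (hg.locallyLipschitz (𝕂 := ℝ)).exists_lipschitzWith_of_hasCompactSupport hgc
  have h0 : ∀ x ∉ D, g x = 0 := fun x hx => image_eq_zero_of_notMem_tsupport fun h => hx (hgD h)
  have h1 : ∀ x ∉ D, fderiv ℝ g x = 0 := fun x hx =>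
    image_eq_zero_of_notMem_tsupport fun h => hx (hgD (tsupport_fderiv_subset ℝ h))
  have h2 := hF.integral_lineDeriv_mul_eq (μ := volume) hL hgc v
  have h3 : ∫ x in D, g x * fderiv ℝ f x v = ∫ x, lineDeriv ℝ F x v * g x := by
    have h4 : ∀ x ∉ D, lineDeriv ℝ F x v * g x = 0 := fun x hx => by rw [h0 x hx, mul_zero]
    rw [← setIntegral_eq_integral_of_forall_compl_eq_zero h4]
    refine integral_congr_ae ?_
    filter_upwards [ae_restrict_of_ae hF.ae_differentiableAt,
      ae_restrict_mem hD.measurableSet] with x hx hxD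
    have : F =ᶠ[𝓝 x] f := by
      filter_upwards [hD.mem_nhds hxD] with y hy using (hFf hy).symm
    rw [hx.lineDeriv_eq_fderiv, this.fderiv_eq, mul_comm]
  have h4 : ∀ x ∉ D, lineDeriv ℝ g x (-v) * F x = 0 := fun x hx => by
    rw [((hg.differentiable (by norm_num)) x).lineDeriv_eq_fderiv, h1 x hx]
    simp
  rw [h3, h2, ← setIntegral_eq_integral_of_forall_compl_eq_zero h4]
  refine setIntegral_congr_fun hD.measurableSet fun x hx => ?_
  beta_reduce
  rw [((hg.differentiable (by norm_num)) x).lineDeriv_eq_fderiv, hFf hx]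

/-- If uniformly Lipschitz functions converge pointwise, then their derivatives converge weakly. -/
theorem tendsto_setIntegral_mul_fderiv {ι : Type*} {l : Filter ι} [l.IsCountablyGenerated]
    (hD : IsOpen D) (hfin : volume D ≠ ⊤) {m : Vec d → ℝ} (hm : IntegrableOn m D)
    {f : ι → Vec d → ℝ} {f₀ : Vec d → ℝ} {K : ℝ≥0} {C : ℝ}
    (hf : ∀ᶠ k in l, LipschitzOnWith K (f k) D) (hf₀ : LipschitzOnWith K f₀ D)
    (hC : ∀ᶠ k in l, ∀ x ∈ D, ‖f k x‖ ≤ C)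
    (hlim : ∀ x ∈ D, Tendsto (fun k => f k x) l (𝓝 (f₀ x))) (v : Vec d) :
    Tendsto (fun k => ∫ x in D, m x * fderiv ℝ (f k) x v) l
      (𝓝 (∫ x in D, m x * fderiv ℝ f₀ x v)) := by
  have hI : ∀ {g : Vec d → ℝ} {h : Vec d → ℝ}, IntegrableOn g D → LipschitzOnWith K h D →
      IntegrableOn (fun x => g x * fderiv ℝ h x v) D := fun {g h} hg hh => by
    refine Integrable.mul_bdd (c := K * ‖v‖) hg
      (measurable_fderiv_apply_const ℝ h v).aestronglyMeasurable ?_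
    refine (ae_restrict_iff' hD.measurableSet).2 (ae_of_all _ fun x hx => ?_)
    exact ContinuousLinearMap.le_of_opNorm_le _ (hh.norm_fderiv_le_of_isOpen hD hx) v
  rw [Metric.tendsto_nhds]
  intro ε hε
  obtain ⟨g, hg, hgc, hgD, hmg⟩ := exists_contDiff_setIntegral_norm_sub_le hD hfin hm
    (ε := ε / (3 * (K * ‖v‖ + 1))) (by positivity)
  have hgI : IntegrableOn g D := (hg.continuous.integrable_of_hasCompactSupport hgc).integrableOn
  have hclose : ∀ h : Vec d → ℝ, LipschitzOnWith K h D →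
      |(∫ x in D, m x * fderiv ℝ h x v) - ∫ x in D, g x * fderiv ℝ h x v| ≤ ε / 3 := fun h hh => by
    rw [← integral_sub (hI hm hh) (hI hgI hh), ← Real.norm_eq_abs]
    have hb : ∀ x ∈ D, ‖m x * fderiv ℝ h x v - g x * fderiv ℝ h x v‖ ≤
        ‖m x - g x‖ * (K * ‖v‖) := fun x hx => by
      rw [← sub_mul, norm_mul]
      gcongr
      exact ContinuousLinearMap.le_of_opNorm_le _ (hh.norm_fderiv_le_of_isOpen hD hx) v
    calc _ ≤ ∫ x in D, ‖m x - g x‖ * (K * ‖v‖) :=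
          norm_integral_le_of_norm_le ((hm.sub hgI).norm.mul_const _)
            ((ae_restrict_iff' hD.measurableSet).2 (ae_of_all _ hb))
      _ ≤ ε / (3 * (K * ‖v‖ + 1)) * (K * ‖v‖ + 1) := by
          rw [integral_mul_const]
          gcongr
          linarith
      _ = ε / 3 := by field_simp
  have hmain : Tendsto (fun k => ∫ x in D, g x * fderiv ℝ (f k) x v) l
      (𝓝 (∫ x in D, g x * fderiv ℝ f₀ x v)) := by
    rw [setIntegral_mul_fderiv_eq_neg hD hf₀ hg hgc hgD]
    refine Tendsto.congr' (f₁ := fun k => ∫ x in D, fderiv ℝ g x (-v) * f k x) ?_ ?_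
    · filter_upwards [hf] with k hk using (setIntegral_mul_fderiv_eq_neg hD hk hg hgc hgD v).symm
    · have hc : Continuous fun x => fderiv ℝ g x (-v) :=
        (hg.continuous_fderiv (by norm_num)).clm_apply continuous_const
      have hci : Integrable (fun x => fderiv ℝ g x (-v)) := hc.integrable_of_hasCompactSupport
        (hgc.fderiv_apply (𝕜 := ℝ) (-v))
      refine tendsto_integral_filter_of_dominated_convergence
        (fun x => ‖fderiv ℝ g x (-v)‖ * C) ?_ ?_ (hci.norm.mul_const C).integrableOn ?_
      · filter_upwards [hf] with k hk
        exact hc.aestronglyMeasurable.mul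
          (hk.continuousOn.aestronglyMeasurable hD.measurableSet)
      · filter_upwards [hC] with k hk
        refine (ae_restrict_iff' hD.measurableSet).2 (ae_of_all _ fun x hx => ?_)
        rw [norm_mul]
        gcongr
        exact hk x hx
      · exact (ae_restrict_iff' hD.measurableSet).2 (ae_of_all _ fun x hx =>
          tendsto_const_nhds.mul (hlim x hx))
  filter_upwards [Metric.tendsto_nhds.1 hmain (ε / 3) (by positivity), hf] with k hk hfk
  have h1 := hclose _ hfk
  have h2 := hclose _ hf₀
  rw [Real.dist_eq] at hk ⊢
  rw [abs_lt] at hk ⊢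
  rw [abs_le] at h1 h2
  constructor <;> linarith

theorem traceCLM_comp_eq_sum (A B : Vec d →L[ℝ] Vec d) : traceCLM d (A.comp B) =
    ∑ i, ∑ j, A (EuclideanSpace.single j 1) i * B (EuclideanSpace.single i 1) j := by
  rw [traceCLM_eq_sum]
  refine Finset.sum_congr rfl fun i _ => ?_
  have h : B (EuclideanSpace.single i 1) =
      ∑ j, B (EuclideanSpace.single i 1) j • EuclideanSpace.single j (1 : ℝ) := by
    conv_lhs => rw [← (EuclideanSpace.basisFun (Fin d) ℝ).sum_repr (B (EuclideanSpace.single i 1))]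
    simp
  rw [ContinuousLinearMap.comp_apply]
  conv_lhs => rw [h]
  simp only [map_sum, map_smul]
  simp [mul_comm]

/-- Matrix fields that converge boundedly almost everywhere can be paired with the Jacobi matrices
of uniformly Lipschitz fields that converge pointwise. -/
theorem tendsto_setIntegral_trace_comp_fderiv {ι : Type*} {l : Filter ι} [l.IsCountablyGenerated]
    (hD : IsOpen D) (hfin : volume D ≠ ⊤) {M : ι → Vec d → Vec d →L[ℝ] Vec d}
    {M₀ : Vec d → Vec d →L[ℝ] Vec d} {f : ι → Vec d → Vec d} {f₀ : Vec d → Vec d} {K : ℝ≥0}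
    {B C : ℝ} (hM : ∀ᶠ k in l, AEStronglyMeasurable (M k) (volume.restrict D))
    (hM₀ : AEStronglyMeasurable M₀ (volume.restrict D))
    (hB : ∀ᶠ k in l, ∀ᵐ x ∂(volume.restrict D), ‖M k x‖ ≤ B)
    (hB₀ : ∀ᵐ x ∂(volume.restrict D), ‖M₀ x‖ ≤ B)
    (hMlim : ∀ᵐ x ∂(volume.restrict D), Tendsto (fun k => M k x) l (𝓝 (M₀ x)))
    (hf : ∀ᶠ k in l, LipschitzOnWith K (f k) D) (hf₀ : LipschitzOnWith K f₀ D)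
    (hC : ∀ᶠ k in l, ∀ x ∈ D, ‖f k x‖ ≤ C)
    (hlim : ∀ x ∈ D, Tendsto (fun k => f k x) l (𝓝 (f₀ x))) :
    Tendsto (fun k => ∫ x in D, traceCLM d ((M k x).comp (fderiv ℝ (f k) x))) l
      (𝓝 (∫ x in D, traceCLM d ((M₀ x).comp (fderiv ℝ f₀ x)))) := by
  have hfin' : IsFiniteMeasure (volume.restrict D) :=
    ⟨by rw [Measure.restrict_apply_univ]; exact hfin.lt_top⟩
  have hcomp : Continuous fun p : (Vec d →L[ℝ] Vec d) × (Vec d →L[ℝ] Vec d) =>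
      traceCLM d (p.1.comp p.2) :=
    (traceCLM d).continuous.comp (continuous_fst.clm_comp continuous_snd)
  have hmeas : ∀ (N : Vec d → Vec d →L[ℝ] Vec d) (g : Vec d → Vec d),
      AEStronglyMeasurable N (volume.restrict D) →
      AEStronglyMeasurable (fun x => traceCLM d ((N x).comp (fderiv ℝ g x)))
        (volume.restrict D) := fun N g hN => by
    have h := hcomp.comp_aestronglyMeasurable
      (hN.prodMk (measurable_fderiv ℝ g).aestronglyMeasurable)
    exact h
  have hbound : ∀ (N A : Vec d →L[ℝ] Vec d) (b : ℝ), ‖N‖ ≤ b → ‖A‖ ≤ K →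
      ‖traceCLM d (N.comp A)‖ ≤ ‖traceCLM d‖ * (b * K) := fun N A b hN hA => by
    refine (traceCLM d).le_of_opNorm_le_of_le le_rfl ?_
    exact (ContinuousLinearMap.opNorm_comp_le N A).trans
      (mul_le_mul hN hA (norm_nonneg _) ((norm_nonneg _).trans hN))
  have hI : ∀ (N : Vec d → Vec d →L[ℝ] Vec d) (g : Vec d → Vec d) (b : ℝ),
      AEStronglyMeasurable N (volume.restrict D) →
      (∀ᵐ x ∂(volume.restrict D), ‖N x‖ ≤ b) → LipschitzOnWith K g D →
      IntegrableOn (fun x => traceCLM d ((N x).comp (fderiv ℝ g x))) D := fun N g b hN hb hg => by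
    refine Integrable.of_bound (hmeas N g hN) (‖traceCLM d‖ * (b * K)) ?_
    filter_upwards [hb, ae_restrict_mem hD.measurableSet] with x hx hxD
    exact hbound _ _ _ hx (hg.norm_fderiv_le_of_isOpen hD hxD)
  -- the coefficients may be replaced by their limits
  have h1 : Tendsto (fun k => ∫ x in D, traceCLM d ((M k x - M₀ x).comp (fderiv ℝ (f k) x))) l
      (𝓝 0) := by
    have h0 : (0 : ℝ) = ∫ _ in D, (0 : ℝ) := by simp
    rw [h0]
    refine tendsto_integral_filter_of_dominated_convergence
      (fun _ => ‖traceCLM d‖ * ((B + B) * K)) ?_ ?_ (integrable_const _) ?_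
    · filter_upwards [hM] with k hk using hmeas _ _ (hk.sub hM₀)
    · filter_upwards [hB, hf] with k hk hfk
      filter_upwards [hk, hB₀, ae_restrict_mem hD.measurableSet] with x hx hx₀ hxD
      exact hbound _ _ _ ((norm_sub_le _ _).trans (add_le_add hx hx₀))
        (hfk.norm_fderiv_le_of_isOpen hD hxD)
    · filter_upwards [hMlim, ae_restrict_mem hD.measurableSet] with x hx hxD
      have h2 : Tendsto (fun k => ‖traceCLM d‖ * (‖M k x - M₀ x‖ * K)) l (𝓝 0) := by
        have h3 := ((tendsto_iff_norm_sub_tendsto_zero.1 hx).mul_const (K : ℝ)).const_mul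
          ‖traceCLM d‖
        simpa using h3
      refine squeeze_zero_norm' ?_ h2
      filter_upwards [hf] with k hfk
      exact hbound _ _ _ le_rfl (hfk.norm_fderiv_le_of_isOpen hD hxD)
  have h2 : Tendsto (fun k => ∫ x in D, traceCLM d ((M₀ x).comp (fderiv ℝ (f k) x))) l
      (𝓝 (∫ x in D, traceCLM d ((M₀ x).comp (fderiv ℝ f₀ x)))) := by
    have hcoord : ∀ (g : Vec d → Vec d), LipschitzOnWith K g D → ∀ j,
        LipschitzOnWith K (fun x => g x j) D := fun g hg j => by
      refine LipschitzOnWith.of_dist_le_mul fun x hx y hy => ?_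
      refine le_trans ?_ (hg.dist_le_mul x hx y hy)
      rw [dist_eq_norm, dist_eq_norm]
      exact PiLp.norm_apply_le (g x - g y) j
    have hentry : ∀ i j, IntegrableOn (fun x => M₀ x (EuclideanSpace.single j 1) i) D :=
      fun i j => by
        refine Integrable.of_bound (C := B * ‖(EuclideanSpace.single j 1 : Vec d)‖) ?_ ?_
        · have hc : Continuous fun A : Vec d →L[ℝ] Vec d => A (EuclideanSpace.single j 1) i :=
            (EuclideanSpace.proj i : Vec d →L[ℝ] ℝ).continuous.comp
              (continuous_id.clm_apply continuous_const)
          have h := hc.comp_aestronglyMeasurable hM₀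
          exact h
        · filter_upwards [hB₀] with x hx
          exact (PiLp.norm_apply_le _ i).trans (ContinuousLinearMap.le_of_opNorm_le _ hx _)
    have hsum : ∀ g : Vec d → Vec d, LipschitzOnWith K g D →
        ∫ x in D, traceCLM d ((M₀ x).comp (fderiv ℝ g x)) = ∑ i, ∑ j, ∫ x in D,
          M₀ x (EuclideanSpace.single j 1) i *
            fderiv ℝ (fun y => g y j) x (EuclideanSpace.single i 1) := fun g hg => by
      have hII : ∀ i j, IntegrableOn (fun x => M₀ x (EuclideanSpace.single j 1) i *
            fderiv ℝ (fun y => g y j) x (EuclideanSpace.single i 1)) D := fun i j => by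
        refine Integrable.mul_bdd (c := K * ‖(EuclideanSpace.single i 1 : Vec d)‖) (hentry i j)
          (measurable_fderiv_apply_const ℝ _ _).aestronglyMeasurable ?_
        filter_upwards [ae_restrict_mem hD.measurableSet] with x hx
        exact ContinuousLinearMap.le_of_opNorm_le _
          ((hcoord g hg j).norm_fderiv_le_of_isOpen hD hx) _
      have hae : (fun x => traceCLM d ((M₀ x).comp (fderiv ℝ g x))) =ᵐ[volume.restrict D]
          fun x => ∑ i, ∑ j, M₀ x (EuclideanSpace.single j 1) i *
            fderiv ℝ (fun y => g y j) x (EuclideanSpace.single i 1) := by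
        filter_upwards [hg.ae_differentiableAt_of_isOpen hD] with x hx
        rw [traceCLM_comp_eq_sum]
        refine Finset.sum_congr rfl fun i _ => Finset.sum_congr rfl fun j _ => ?_
        have h3 : HasFDerivAt (fun y => g y j) ((EuclideanSpace.proj j : Vec d →L[ℝ] ℝ).comp
            (fderiv ℝ g x)) x :=
          (EuclideanSpace.proj j : Vec d →L[ℝ] ℝ).hasFDerivAt.comp x hx.hasFDerivAt
        rw [h3.fderiv]
        rfl
      rw [integral_congr_ae hae, integral_finsetSum _ fun i _ =>
        integrable_finsetSum _ fun j _ => hII i j]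
      exact Finset.sum_congr rfl fun i _ => integral_finsetSum _ fun j _ => hII i j
    rw [hsum f₀ hf₀]
    refine Tendsto.congr' (f₁ := fun k => ∑ i, ∑ j, ∫ x in D,
          M₀ x (EuclideanSpace.single j 1) i *
            fderiv ℝ (fun y => f k y j) x (EuclideanSpace.single i 1)) ?_ ?_
    · filter_upwards [hf] with k hk using (hsum _ hk).symm
    · refine tendsto_finsetSum _ fun i _ => tendsto_finsetSum _ fun j _ => ?_
      refine tendsto_setIntegral_mul_fderiv hD hfin (hentry i j) (K := K) (C := C) ?_
        (hcoord f₀ hf₀ j) ?_ ?_ _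
      · filter_upwards [hf] with k hk using hcoord _ hk j
      · filter_upwards [hC] with k hk x hx
        exact (PiLp.norm_apply_le _ j).trans (hk x hx)
      · intro x hx
        have h3 := ((EuclideanSpace.proj j : Vec d →L[ℝ] ℝ).continuous.tendsto _).comp (hlim x hx)
        exact h3
  have h3 := h1.add h2
  rw [zero_add] at h3
  refine h3.congr' ?_
  filter_upwards [hM, hB, hf] with k hk hkB hfk
  have h4 : IntegrableOn (fun x => traceCLM d ((M k x - M₀ x).comp (fderiv ℝ (f k) x))) D := by
    refine hI _ _ (B + B) (hk.sub hM₀) ?_ hfk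
    filter_upwards [hkB, hB₀] with x hx hx₀
    exact (norm_sub_le _ _).trans (add_le_add hx hx₀)
  rw [← integral_add h4 (hI _ _ B hM₀ hB₀ hfk)]
  refine integral_congr_ae (ae_of_all _ fun x => ?_)
  beta_reduce
  rw [← map_add, ← ContinuousLinearMap.add_comp, sub_add_cancel]

end WeakConvergence

/-! ### Stability of Lipschitz domains under small perturbations -/

section Domains
variable {d : ℕ} {D : Set (Vec d)}

/-- Near a boundary point the graph function has bounded derivative, hence is Lipschitz. -/
theorem IsC11Domain.isLipschitzDomain (hD : IsC11Domain D) : IsLipschitzDomain D := by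
  refine ⟨hD.1, fun x₀ hx₀ => ?_⟩
  obtain ⟨n, hn, ψ, K, hψ, hK, r, hr, h⟩ := hD.2 x₀ hx₀
  set P := (ℝ ∙ n)ᗮ.orthogonalProjectionOnto with hP
  set M : ℝ := ‖fderiv ℝ ψ (P x₀)‖ + K with hM
  have hM0 : 0 ≤ M := by positivity
  have hψ' : ∀ p ∈ Metric.ball (P x₀) 1, ∀ q ∈ Metric.ball (P x₀) 1, ψ p - ψ q ≤ M * ‖p - q‖ := by
    intro p hp q hq
    have h1 : ∀ z ∈ Metric.ball (P x₀) 1, ‖fderiv ℝ ψ z‖ ≤ M := fun z hz => by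
      have h2 := hK.dist_le_mul z (P x₀)
      have h3 : ‖fderiv ℝ ψ z‖ ≤ ‖fderiv ℝ ψ (P x₀)‖ + dist (fderiv ℝ ψ z) (fderiv ℝ ψ (P x₀)) := by
        rw [dist_eq_norm (fderiv ℝ ψ z) _]
        exact norm_le_norm_add_norm_sub' (fderiv ℝ ψ z) (fderiv ℝ ψ (P x₀))
      have h4 : (K : ℝ) * dist z (P x₀) ≤ K * 1 := by
        gcongr
        exact (Metric.mem_ball.1 hz).le
      linarith
    have := (convex_ball (P x₀) 1).norm_image_sub_le_of_norm_fderiv_le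
      (fun z _ => (hψ.differentiable (by norm_num)) z) h1 hq hp
    exact (le_abs_self _).trans this
  have hsq : 0 < 1 + M ^ 2 := by positivity
  -- a cone with this constant consists of the directions of slope greater than `M`
  refine ⟨n, hn, √(M ^ 2 / (1 + M ^ 2)), Real.sqrt_nonneg _, ?_, min r 1, by positivity, ?_⟩
  · rw [Real.sqrt_lt' one_pos, div_lt_iff₀ hsq]
    linarith
  · rintro x ⟨hxD, hx⟩ y hy hxy
    have hx1 := Metric.ball_subset_ball (min_le_left r 1) hx
    have hy1 := Metric.ball_subset_ball (min_le_left r 1) hy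
    have hball : ∀ z ∈ Metric.ball x₀ (min r 1), P z ∈ Metric.ball (P x₀) 1 := fun z hz => by
      rw [Metric.mem_ball, dist_eq_norm, ← map_sub]
      refine (norm_orthogonalProjectionOnto_le n _).trans_lt ?_
      rw [← dist_eq_norm]
      exact (Metric.mem_ball.1 hz).trans_le (min_le_right r 1)
    have h1 := hψ' _ (hball x hx) _ (hball y hy)
    rw [h x hx1] at hxD
    rw [h y hy1]
    set s := ⟪n, x - y⟫ with hs
    set q := ‖P x - P y‖ with hq
    have hnorm : ‖x - y‖ ^ 2 = q ^ 2 + s ^ 2 := by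
      rw [hq, ← map_sub, hs, ← norm_add_smul_sq hn, orthogonalProjectionOnto_add_inner_smul hn]
    have hs0 : 0 < s := lt_of_le_of_lt (by positivity) hxy
    have h2 : M ^ 2 / (1 + M ^ 2) * (q ^ 2 + s ^ 2) < s ^ 2 := by
      have h3 := pow_lt_pow_left₀ hxy (by positivity) two_ne_zero
      rwa [mul_pow, Real.sq_sqrt (by positivity), hnorm] at h3
    have h4 : M * q < s := by
      refine lt_of_pow_lt_pow_left₀ 2 hs0.le ?_
      rw [div_mul_eq_mul_div, div_lt_iff₀ hsq] at h2
      nlinarith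
    have h5 : ⟪n, y⟫ = ⟪n, x⟫ - s := by rw [hs, inner_sub_right]; ring
    linarith

/-- A Lipschitz perturbation of the identity with small Lipschitz constant is a homeomorphism. -/
theorem exists_homeomorph_of_lipschitzWith_sub {g : Vec d → Vec d} {η : ℝ≥0} (hη : η < 1)
    (hg : LipschitzWith η fun x => g x - x) : ∃ h : Vec d ≃ₜ Vec d, ⇑h = g := by
  have happ : ApproximatesLinearOn g
      ((ContinuousLinearEquiv.refl ℝ (Vec d) : Vec d ≃L[ℝ] Vec d) : Vec d →L[ℝ] Vec d) univ η := by
    intro x _ y _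
    have h := hg.dist_le_mul x y
    rw [dist_eq_norm, dist_eq_norm] at h
    refine le_trans (le_of_eq ?_) h
    congr 1
    simp only [ContinuousLinearEquiv.coe_refl, ContinuousLinearMap.id_apply]
    abel
  refine ⟨happ.toHomeomorph g ?_, rfl⟩
  rcases subsingleton_or_nontrivial (Vec d) with h | h
  · exact Or.inl h
  · right
    refine lt_of_lt_of_le hη ?_
    have : ‖((ContinuousLinearEquiv.refl ℝ (Vec d)).symm : Vec d →L[ℝ] Vec d)‖₊ = 1 := by
      simpa using ContinuousLinearMap.nnnorm_id (𝕜 := ℝ) (E := Vec d)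
    rw [this, inv_one]

/-- Lipschitz domains are stable under maps that are close to the identity in the Lipschitz
seminorm. -/
theorem IsLipschitzDomain.exists_isLipschitzDomain_image (hD : IsLipschitzDomain D)
    (hb : Bornology.IsBounded D) : ∃ η : ℝ≥0, 0 < η ∧ η < 1 ∧ ∀ h : Vec d ≃ₜ Vec d,
      LipschitzWith η (fun x => h x - x) → IsLipschitzDomain (h '' D) := by
  choose! n hn c hc0 hc1 r hr hcone using hD.2
  have hK : IsCompact (frontier D) := Metric.isCompact_of_isClosed_isBounded isClosed_frontier
    (hb.closure.subset frontier_subset_closure)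
  obtain ⟨t, htK, ht⟩ := hK.elim_nhds_subcover (fun x => Metric.ball x (r x / 2))
    fun x hx => Metric.ball_mem_nhds x (half_pos (hr x hx))
  have hη : ∀ t : Finset (Vec d), (∀ x ∈ t, x ∈ frontier D) →
      ∃ η : ℝ, 0 < η ∧ η ≤ 1 / 2 ∧ ∀ x ∈ t, η ≤ (1 - c x) / 4 := by
    intro t ht
    classical
    induction t using Finset.induction_on with
    | empty => exact ⟨1 / 2, by norm_num, le_rfl, by simp⟩
    | insert a s _ ih =>
      obtain ⟨η, h1, h2, h3⟩ := ih fun x hx => ht x (Finset.mem_insert_of_mem hx)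
      refine ⟨min η ((1 - c a) / 4), lt_min h1 ?_, (min_le_left _ _).trans h2, ?_⟩
      · have := hc1 a (ht a (Finset.mem_insert_self _ _))
        linarith
      · intro x hx
        rcases Finset.mem_insert.1 hx with rfl | hx
        · exact min_le_right _ _
        · exact (min_le_left _ _).trans (h3 x hx)
  -- with this bound for `η`, the image of `D` satisfies the cone condition with the constant
  -- `(1 + c) / 2` in place of `c`
  obtain ⟨η, hη0, hη2, hη⟩ := hη t htK
  lift η to ℝ≥0 using hη0.le
  refine ⟨η, by exact_mod_cast hη0, ?_, fun h hh => ⟨h.isOpenMap _ hD.1, fun y₀ hy₀ => ?_⟩⟩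
  · rw [← NNReal.coe_lt_coe, NNReal.coe_one]
    linarith
  rw [← h.image_frontier] at hy₀
  obtain ⟨x₀, hx₀, rfl⟩ := hy₀
  obtain ⟨a, hat, hxa⟩ := mem_iUnion₂.1 (ht hx₀)
  have haK := htK a hat
  have hηa := hη a hat
  have hc1a := hc1 a haK
  have hc0a := hc0 a haK
  have hra := hr a haK
  have hdist : ∀ x y, ‖(h x - h y) - (x - y)‖ ≤ η * ‖x - y‖ := fun x y => by
    have h1 := hh.dist_le_mul x y
    rw [dist_eq_norm, dist_eq_norm] at h1
    refine le_trans (le_of_eq ?_) h1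
    congr 1
    abel
  have hlow : ∀ x y, (1 - η) * ‖x - y‖ ≤ ‖h x - h y‖ := fun x y => by
    have h1 := norm_sub_norm_le (x - y) (h x - h y)
    rw [norm_sub_rev (x - y)] at h1
    linarith [hdist x y]
  have hball : ∀ x, h x ∈ Metric.ball (h x₀) (r a / 4) → x ∈ Metric.ball a (r a) := fun x hx => by
    rw [mem_ball_iff_norm] at hx
    have h1 := hlow x x₀
    have h2 : 1 / 2 * ‖x - x₀‖ ≤ (1 - η) * ‖x - x₀‖ := by
      gcongr
      linarith
    have h3 : dist x x₀ < r a / 2 := by rw [dist_eq_norm]; linarith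
    have h4 := dist_triangle x x₀ a
    rw [Metric.mem_ball] at hxa ⊢
    linarith
  refine ⟨n a, hn a haK, (1 + c a) / 2, by linarith, by linarith, r a / 4, by linarith, ?_⟩
  rintro _ ⟨⟨x, hxD, rfl⟩, hx⟩ y' hy hxy
  obtain ⟨y, rfl⟩ := h.surjective y'
  refine ⟨y, hcone a haK x ⟨hxD, hball x hx⟩ y (hball y hy) ?_, rfl⟩
  have h1 : |⟪n a, (h x - h y) - (x - y)⟫| ≤ η * ‖x - y‖ := by
    refine (abs_real_inner_le_norm _ _).trans ?_
    rw [hn a haK, one_mul]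
    exact hdist x y
  rw [inner_sub_right] at h1
  have h2 := (abs_le.1 h1).2
  have hne : 0 < ‖x - y‖ := by
    rw [norm_pos_iff, sub_ne_zero]
    rintro rfl
    simp at hxy
  have h3 : (1 + c a) / 2 * ((1 - η) * ‖x - y‖) ≤ (1 + c a) / 2 * ‖h x - h y‖ := by
    gcongr
    exact hlow x y
  have h4 : 0 ≤ ((1 + c a) / 2 * (1 - η) - η - c a) * ‖x - y‖ := by
    refine mul_nonneg ?_ hne.le
    nlinarith
  linarith

end Domains

/-! ### Gradient bounds and Lipschitz constants on Lipschitz domains -/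

section MollifyDeriv
variable {E : Type*} [NormedAddCommGroup E] [NormedSpace ℝ E] [FiniteDimensional ℝ E]
  [MeasurableSpace E] [BorelSpace E] (μ : Measure E) [μ.IsAddHaarMeasure]
  {F : Type*} [NormedAddCommGroup F] [NormedSpace ℝ F] [FiniteDimensional ℝ F]

theorem ae_comp_sub_smul {p : E → Prop} (hp : ∀ᵐ z ∂μ, p z) {r : ℝ} (hr : r ≠ 0) (x : E) :
    ∀ᵐ z ∂μ, p (x - r • z) := by
  have h1 : ∀ᵐ z ∂μ, p (x - z) := (Measure.measurePreserving_sub_left μ x).quasiMeasurePreserving.ae hp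
  rw [ae_iff] at h1 ⊢
  have h2 := Measure.addHaar_preimage_smul μ hr {z | ¬ p (x - z)}
  rw [h1, mul_zero] at h2
  exact h2

/-- Mollification commutes with differentiation. -/
theorem LipschitzWith.hasFDerivAt_mollify {f : E → F} {K : ℝ≥0} (hf : LipschitzWith K f) {r : ℝ}
    (hr : r ≠ 0) (x : E) :
    HasFDerivAt (_root_.mollify μ r f) (∫ z, mollifier μ z • fderiv ℝ f (x - r • z) ∂μ) x := by
  have hd := ae_comp_sub_smul μ (hf.ae_differentiableAt (μ := μ)) hr x
  refine (hasFDerivAt_integral_of_dominated_loc_of_lip (bound := fun z => mollifier μ z * K)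
    (F := fun x z => mollifier μ z • f (x - r • z)) univ_mem
    (Eventually.of_forall fun y =>
      (integrable_mollifier_smul μ hf.continuous r y).aestronglyMeasurable)
    (integrable_mollifier_smul μ hf.continuous r x) ?_ ?_
    ((integrable_mollifier μ).mul_const _) ?_).2
  · have h := (measurable_fderiv ℝ f).comp (f := fun z => x - r • z) (by fun_prop)
    exact (continuous_mollifier μ).aestronglyMeasurable.smul h.aestronglyMeasurable
  · refine ae_of_all _ fun z => LipschitzOnWith.of_dist_le_mul fun y _ y' _ => ?_
    have h1 := hf.dist_le_mul (y - r • z) (y' - r • z)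
    rw [dist_sub_right] at h1
    rw [dist_eq_norm, ← smul_sub, norm_smul, ← dist_eq_norm, Real.coe_nnabs, abs_mul,
      NNReal.abs_eq, mul_assoc, Real.norm_eq_abs]
    gcongr
  · filter_upwards [hd] with z hz
    have h1 := hz.hasFDerivAt.comp x ((hasFDerivAt_id x).sub_const (r • z))
    exact h1.const_smul (mollifier μ z)

/-- A bound for the gradient at almost every point of an open set bounds increments along every
segment in this set, although the segment itself is a null set: the gradients of the mollifications
satisfy the same bound at every point of the segment. -/
theorem norm_sub_le_of_ae_norm_fderiv_le_of_segment_subset {D : Set E} (hD : IsOpen D) {f : E → F}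
    {K L : ℝ≥0} (hf : LipschitzOnWith K f D) (hL : ∀ᵐ x ∂(μ.restrict D), ‖fderiv ℝ f x‖ ≤ L)
    {x y : E} (hxy : segment ℝ x y ⊆ D) : ‖f x - f y‖ ≤ L * ‖x - y‖ := by
  obtain ⟨g, hg, hgf⟩ := hf.extend_finite_dimension
  have hL' : ∀ᵐ z ∂μ, z ∈ D → ‖fderiv ℝ g z‖ ≤ L := by
    filter_upwards [(ae_restrict_iff' hD.measurableSet).1 hL] with z hz hzD
    have : g =ᶠ[𝓝 z] f := by
      filter_upwards [hD.mem_nhds hzD] with w hw using (hgf hw).symm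
    rw [this.fderiv_eq]
    exact hz hzD
  have hK : IsCompact (segment ℝ x y) := by
    rw [← convexHull_pair]
    exact (Set.toFinite {x, y}).isCompact_convexHull ℝ
  obtain ⟨δ, hδ, hδD⟩ := hK.exists_thickening_subset_open hD hxy
  have hr : ∀ᶠ r in 𝓝[>] (0 : ℝ), ‖mollify μ r g x - mollify μ r g y‖ ≤ L * ‖x - y‖ := by
    filter_upwards [Ioo_mem_nhdsGT (show (0 : ℝ) < δ / 3 by positivity)] with r hr
    refine (convex_segment x y).norm_image_sub_le_of_norm_hasFDerivWithin_le
      (fun z _ => (hg.hasFDerivAt_mollify μ hr.1.ne' z).hasFDerivWithinAt) (fun z hz => ?_)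
      (right_mem_segment ℝ x y) (left_mem_segment ℝ x y)
    refine (norm_integral_le_of_norm_le ((integrable_mollifier μ).mul_const (L : ℝ)) ?_).trans
      (le_of_eq ?_)
    · filter_upwards [ae_comp_sub_smul μ hL' hr.1.ne' z] with w hw
      rw [norm_smul, Real.norm_of_nonneg (mollifier_nonneg μ w)]
      by_cases h2 : 2 ≤ ‖w‖
      · rw [mollifier_eq_zero μ h2, zero_mul, zero_mul]
      · gcongr
        · exact mollifier_nonneg μ w
        refine hw (hδD (Metric.mem_thickening_iff.2 ⟨z, hz, ?_⟩))
        rw [dist_eq_norm, sub_sub_cancel_left, norm_neg, norm_smul, Real.norm_of_nonneg hr.1.le]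
        have := hr.2
        have := hr.1
        nlinarith
    · rw [integral_mul_const, integral_mollifier, one_mul]
  have h1 := ((hg.tendsto_mollify μ x).sub (hg.tendsto_mollify μ y)).norm
  rw [hgf (hxy (left_mem_segment ℝ x y)), hgf (hxy (right_mem_segment ℝ x y))]
  exact le_of_tendsto h1 hr

end MollifyDeriv

section Quasiconvex
variable {d : ℕ} {D : Set (Vec d)}

/-- Near each point of the closure, a Lipschitz domain is quasiconvex: two nearby points are joined
by a polygon with at most three edges, whose length is comparable to their distance. -/
theorem IsLipschitzDomain.exists_local_lipschitz_bound (hD : IsLipschitzDomain D) {x₀ : Vec d}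
    (hx₀ : x₀ ∈ closure D) : ∃ ρ > 0, ∃ C : ℝ, 0 ≤ C ∧ ∀ (f : Vec d → Vec d) (K L : ℝ≥0),
      LipschitzOnWith K f D → (∀ᵐ x ∂(volume.restrict D), ‖fderiv ℝ f x‖ ≤ L) →
      ∀ x ∈ D ∩ Metric.ball x₀ ρ, ∀ y ∈ D ∩ Metric.ball x₀ ρ,
        ‖f x - f y‖ ≤ C * (L * ‖x - y‖) := by
  by_cases hxD : x₀ ∈ D
  · obtain ⟨ρ, hρ, hball⟩ := Metric.isOpen_iff.1 hD.1 x₀ hxD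
    refine ⟨ρ, hρ, 1, zero_le_one, fun f K L hf hL x hx y hy => ?_⟩
    rw [one_mul]
    exact norm_sub_le_of_ae_norm_fderiv_le_of_segment_subset volume hD.1 hf hL
      (((convex_ball x₀ ρ).segment_subset hx.2 hy.2).trans hball)
  · have hfr : x₀ ∈ frontier D := by rw [hD.1.frontier_eq]; exact ⟨hx₀, hxD⟩
    obtain ⟨n, hn, c, hc0, hc1, r, hr, hcone⟩ := hD.2 x₀ hfr
    -- a displacement by `l * |x - y|` in the direction `-n` is long enough to pass from the cone
    -- with apex `x` to the one with apex `y`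
    set l : ℝ := 2 / (1 - c) with hl
    have hl1 : l * (1 - c) = 2 := by rw [hl]; field_simp [(sub_pos.2 hc1).ne']
    have hl0 : 0 < l := by rw [hl]; exact div_pos two_pos (sub_pos.2 hc1)
    refine ⟨r / (2 * l + 4), by positivity, 2 * l + 1, by positivity, fun f K L hf hL x hx y hy => ?_⟩
    set ρ := r / (2 * l + 4) with hρ
    have hρ0 : 0 < ρ := by positivity
    have hρr : (2 * l + 4) * ρ = r := by rw [hρ]; field_simp
    set s := ‖x - y‖ with hs
    have hsρ : s ≤ 2 * ρ := by
      have h1 := dist_triangle_right x y x₀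
      rw [dist_eq_norm, ← hs] at h1
      linarith [Metric.mem_ball.1 hx.2, Metric.mem_ball.1 hy.2]
    have hs0 : 0 ≤ s := norm_nonneg _
    have hρ_le : ρ ≤ r := by nlinarith
    have hnn : ⟪n, n⟫ = 1 := by rw [real_inner_self_eq_norm_sq, hn, one_pow]
    -- points of the vertical edges
    have hvert : ∀ z ∈ D ∩ Metric.ball x₀ ρ, segment ℝ z (z - (l * s) • n) ⊆ D := by
      rintro z ⟨hzD, hz⟩ w hw
      obtain ⟨θ, hθ, rfl⟩ := (segment_eq_image' ℝ z (z - (l * s) • n)) ▸ hw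
      rcases eq_or_lt_of_le (show 0 ≤ θ * (l * s) by have := hθ.1; positivity) with h0 | h0
      · have : θ • (z - (l * s) • n - z) = 0 := by
          rw [sub_sub_cancel_left, smul_neg, smul_smul, ← h0, zero_smul, neg_zero]
        beta_reduce
        rw [this, add_zero]
        exact hzD
      · have h2 : z - (z + θ • (z - (l * s) • n - z)) = (θ * (l * s)) • n := by
          rw [sub_sub_cancel_left, smul_neg, smul_smul]; abel
        refine hcone z ⟨hzD, Metric.ball_subset_ball hρ_le hz⟩ _ ?_ ?_
        · rw [Metric.mem_ball]
          have h3 := dist_triangle (z + θ • (z - (l * s) • n - z)) z x₀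
          rw [dist_comm _ z, dist_eq_norm z, h2, norm_smul, hn, Real.norm_of_nonneg h0.le] at h3
          have h4 : θ * (l * s) ≤ 1 * (l * (2 * ρ)) := by
            gcongr
            exact hθ.2
          have := Metric.mem_ball.1 hz
          nlinarith
        · rw [h2, inner_smul_right, hnn, norm_smul, hn, Real.norm_of_nonneg h0.le]
          nlinarith
    have hmid : segment ℝ (x - (l * s) • n) (y - (l * s) • n) ⊆ D := by
      intro w hw
      obtain ⟨θ, hθ, rfl⟩ := (segment_eq_image' ℝ (x - (l * s) • n) (y - (l * s) • n)) ▸ hw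
      rcases eq_or_lt_of_le hs0 with h0 | h0
      · have hxy : x = y := by rwa [eq_comm, hs, norm_eq_zero, sub_eq_zero] at h0
        simpa [← h0, hxy] using hy.1
      · set w := x - (l * s) • n + θ • (y - (l * s) • n - (x - (l * s) • n)) with hw
        have h2 : x - w = (l * s) • n + θ • (x - y) := by
          rw [hw, sub_sub_sub_cancel_right, ← neg_sub x y, smul_neg]; abel
        have hθs : ‖θ • (x - y)‖ ≤ s := by
          rw [norm_smul, Real.norm_of_nonneg hθ.1, ← hs]
          have := hθ.2
          nlinarith
        have h3 : ‖x - w‖ ≤ l * s + s := by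
          rw [h2]
          refine (norm_add_le _ _).trans (add_le_add ?_ hθs)
          rw [norm_smul, hn, mul_one, Real.norm_of_nonneg (by positivity)]
        have h4 : l * s - s ≤ ⟪n, x - w⟫ := by
          rw [h2, inner_add_right, inner_smul_right, hnn]
          have h5 := (abs_real_inner_le_norm n (θ • (x - y)))
          rw [hn, one_mul] at h5
          linarith [(abs_le.1 (h5.trans hθs)).1]
        refine hcone x ⟨hx.1, Metric.ball_subset_ball hρ_le hx.2⟩ _ ?_ ?_
        · rw [Metric.mem_ball]
          have h5 := dist_triangle w x x₀
          rw [dist_comm w x, dist_eq_norm x w] at h5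
          have := Metric.mem_ball.1 hx.2
          nlinarith
        · have h6 : c * ‖x - w‖ ≤ c * (l * s + s) := by gcongr
          nlinarith
    have e1 := norm_sub_le_of_ae_norm_fderiv_le_of_segment_subset volume hD.1 hf hL (hvert x hx)
    have e2 := norm_sub_le_of_ae_norm_fderiv_le_of_segment_subset volume hD.1 hf hL hmid
    have e3 := norm_sub_le_of_ae_norm_fderiv_le_of_segment_subset volume hD.1 hf hL (hvert y hy)
    rw [sub_sub_self, norm_smul, hn, mul_one, Real.norm_of_nonneg (by positivity)] at e1 e3
    rw [sub_sub_sub_cancel_right, ← hs] at e2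
    rw [norm_sub_rev] at e3
    have e4 : ‖f x - f y‖ ≤ ‖f x - f (x - (l * s) • n)‖ +
        ‖f (x - (l * s) • n) - f (y - (l * s) • n)‖ + ‖f (y - (l * s) • n) - f y‖ := by
      rw [← sub_add_sub_cancel (f x) (f (x - (l * s) • n)) (f y),
        ← sub_add_sub_cancel (f (x - (l * s) • n)) (f (y - (l * s) • n)) (f y), ← add_assoc]
      exact norm_add₃_le
    calc ‖f x - f y‖ ≤ L * (l * s) + L * s + L * (l * s) := by linarith
      _ = (2 * l + 1) * (L * s) := by ring

/-- On a bounded Lipschitz domain, a bound for the gradient almost everywhere and for the values at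
finitely many points controls the Lipschitz constant and the supremum. -/
theorem IsLipschitzDomain.exists_lipschitz_bound (hD : IsLipschitzDomain D)
    (hb : Bornology.IsBounded D) : ∃ (C : ℝ≥0) (P : Set (Vec d)), P.Finite ∧ P ⊆ D ∧
      ∀ (f : Vec d → Vec d) (K L : ℝ≥0), LipschitzOnWith K f D →
        (∀ᵐ x ∂(volume.restrict D), ‖fderiv ℝ f x‖ ≤ L) → (∀ p ∈ P, ‖f p‖ ≤ L) →
        LipschitzOnWith (C * L) f D ∧ ∀ x ∈ D, ‖f x‖ ≤ C * L := by
  choose! ρ hρ C hC hloc using fun x₀ (hx₀ : x₀ ∈ closure D) => hD.exists_local_lipschitz_bound hx₀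
  obtain ⟨t, htK, ht⟩ := hb.isCompact_closure.elim_nhds_subcover (fun x => Metric.ball x (ρ x))
    fun x hx => Metric.ball_mem_nhds x (hρ x hx)
  -- points at distance less than the Lebesgue number `δ` lie in a common ball of the cover
  obtain ⟨δ, hδ, hleb⟩ := lebesgue_number_lemma_of_metric (c := fun x : t => Metric.ball x.1 (ρ x.1))
    hb.isCompact_closure (fun _ => Metric.isOpen_ball) (by
      intro x hx
      obtain ⟨a, ha, hxa⟩ := mem_iUnion₂.1 (ht hx)
      exact mem_iUnion.2 ⟨⟨a, ha⟩, hxa⟩)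
  set C₀ : ℝ := ∑ x ∈ t, C x with hC₀
  have hC₀0 : 0 ≤ C₀ := Finset.sum_nonneg fun x hx => hC x (htK x hx)
  have hCle : ∀ x ∈ t, C x ≤ C₀ := fun x hx =>
    Finset.single_le_sum (f := C) (fun y hy => hC y (htK y hy)) hx
  obtain ⟨P, hPD, hPfin, hP⟩ := exists_finite_cover_balls_of_isCompact_closure
    hb.isCompact_closure hδ
  have hlocal : ∀ (f : Vec d → Vec d) (K L : ℝ≥0), LipschitzOnWith K f D →
      (∀ᵐ x ∂(volume.restrict D), ‖fderiv ℝ f x‖ ≤ L) → ∀ x ∈ D, ∀ y ∈ D, dist x y < δ →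
      ‖f x - f y‖ ≤ C₀ * (L * ‖x - y‖) := fun f K L hf hL x hx y hy hxy => by
    obtain ⟨a, ha⟩ := hleb x (subset_closure hx)
    refine (hloc a.1 (htK a.1 a.2) f K L hf hL x ⟨hx, ha (Metric.mem_ball_self hδ)⟩ y
      ⟨hy, ha (by rwa [Metric.mem_ball, dist_comm])⟩).trans ?_
    gcongr
    exact hCle a.1 a.2
  have hC2 : 0 ≤ C₀ + 1 + C₀ * δ + 2 * (1 + C₀ * δ) / δ := by positivity
  refine ⟨⟨C₀ + 1 + C₀ * δ + 2 * (1 + C₀ * δ) / δ, hC2⟩, P, hPfin, hPD, fun f K L hf hL hfP => ?_⟩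
  -- the points of `P` are `δ`-dense in `D`
  have hsup : ∀ x ∈ D, ‖f x‖ ≤ (1 + C₀ * δ) * L := fun x hx => by
    obtain ⟨p, hp, hxp⟩ := mem_iUnion₂.1 (hP hx)
    have h1 := hlocal f K L hf hL x hx p (hPD hp) hxp
    have h2 : C₀ * (L * ‖x - p‖) ≤ C₀ * (L * δ) := by
      rw [← dist_eq_norm]
      gcongr
      exact (Metric.mem_ball.1 hxp).le
    have h3 := norm_le_norm_add_norm_sub' (f x) (f p)
    have h4 := hfP p hp
    nlinarith
  have hd0 : 0 ≤ 2 * (1 + C₀ * δ) / δ := by positivity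
  have hd1 : 0 ≤ C₀ * δ := by positivity
  constructor
  · refine LipschitzOnWith.of_dist_le_mul fun x hx y hy => ?_
    rw [dist_eq_norm, dist_eq_norm]
    change ‖f x - f y‖ ≤ (C₀ + 1 + C₀ * δ + 2 * (1 + C₀ * δ) / δ) * L * ‖x - y‖
    have hLx : 0 ≤ (L : ℝ) * ‖x - y‖ := by positivity
    by_cases hxy : dist x y < δ
    · have h1 := hlocal f K L hf hL x hx y hy hxy
      nlinarith
    · rw [not_lt, dist_eq_norm] at hxy
      have h1 := (norm_sub_le (f x) (f y)).trans (add_le_add (hsup x hx) (hsup y hy))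
      have h2 : 2 * (1 + C₀ * δ) / δ * (L * δ) ≤ 2 * (1 + C₀ * δ) / δ * (L * ‖x - y‖) := by gcongr
      have h3 : 2 * (1 + C₀ * δ) / δ * (L * δ) = (1 + C₀ * δ) * L + (1 + C₀ * δ) * L := by
        field_simp
        ring
      nlinarith
  · intro x hx
    change ‖f x‖ ≤ (C₀ + 1 + C₀ * δ + 2 * (1 + C₀ * δ) / δ) * L
    exact (hsup x hx).trans (mul_le_mul_of_nonneg_right (by linarith) L.2)

end Quasiconvex

/-! ### Lipschitz estimates for a twice differentiable family of deformations -/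

section TimeEstimates
variable {d : ℕ}

/-- The velocity `∂T_t/∂t` of the family `T` at time `t`. -/
noncomputable def flowVelocity (T : ℝ → Vec d → Vec d) (t : ℝ) (x : Vec d) : Vec d :=
  deriv (fun s => T s x) t

/-- The bounds satisfied by a twice differentiable family of deformations for `|t| < δ`: the maps
and their velocities are Lipschitz functions of `t` with values in the space of Lipschitz functions
of `x`, and the Jacobi matrix of the velocity is the time derivative of the Jacobi matrix. -/
structure HasTimeEstimates (D : Set (Vec d)) (T : ℝ → Vec d → Vec d) (δ : ℝ) (K : ℝ≥0) : Prop where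
  pos : 0 < δ
  zero : ∀ x ∈ D, T 0 x = x
  hasDerivAt : ∀ x ∈ D, ∀ t ∈ Ioo (-δ) δ, HasDerivAt (fun s => T s x) (flowVelocity T t x) t
  hasDerivAt_velocity : ∀ x ∈ D,
    HasDerivAt (fun s => flowVelocity T s x) (iteratedDeriv 2 (fun s => T s x) 0) 0
  lipschitz_sub : ∀ s ∈ Ioo (-δ) δ, ∀ t ∈ Ioo (-δ) δ,
    LipschitzOnWith (K * ‖t - s‖₊) (fun x => T t x - T s x) D
  norm_sub_le : ∀ s ∈ Ioo (-δ) δ, ∀ t ∈ Ioo (-δ) δ, ∀ x ∈ D, ‖T t x - T s x‖ ≤ K * ‖t - s‖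
  lipschitz_velocity : ∀ t ∈ Ioo (-δ) δ, LipschitzOnWith K (flowVelocity T t) D
  norm_velocity_le : ∀ t ∈ Ioo (-δ) δ, ∀ x ∈ D, ‖flowVelocity T t x‖ ≤ K
  lipschitz_velocity_sub : ∀ s ∈ Ioo (-δ) δ, ∀ t ∈ Ioo (-δ) δ,
    LipschitzOnWith (K * ‖t - s‖₊) (fun x => flowVelocity T t x - flowVelocity T s x) D
  norm_velocity_sub_le : ∀ s ∈ Ioo (-δ) δ, ∀ t ∈ Ioo (-δ) δ, ∀ x ∈ D,
    ‖flowVelocity T t x - flowVelocity T s x‖ ≤ K * ‖t - s‖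
  hasDerivAt_fderiv : ∀ t ∈ Ioo (-δ) δ, ∀ᵐ x ∂(volume.restrict D),
    HasDerivAt (fun s => fderiv ℝ (T s) x) (fderiv ℝ (flowVelocity T t) x) t
  differentiableAt : ∀ᵐ x ∂(volume.restrict D), ∀ t ∈ Ioo (-δ) δ, DifferentiableAt ℝ (T t) x

/-- The rate of convergence of the difference quotients of a function with Lipschitz derivative. -/
theorem norm_slope_sub_deriv_le {G : Type*} [NormedAddCommGroup G] [NormedSpace ℝ G] {g : ℝ → G}
    {δ B : ℝ} (hg : DifferentiableOn ℝ g (Ioo (-δ) δ))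
    (hB : ∀ s ∈ Ioo (-δ) δ, ∀ t ∈ Ioo (-δ) δ, ‖deriv g t - deriv g s‖ ≤ B * ‖t - s‖)
    {t u : ℝ} (ht : t ∈ Ioo (-δ) δ) (hu : u ∈ Ioo (-δ) δ) (hut : u ≠ t) :
    ‖(u - t)⁻¹ • (g u - g t) - deriv g t‖ ≤ B * ‖u - t‖ := by
  have hB0 : 0 ≤ B * ‖u - t‖ := (norm_nonneg _).trans (hB t ht u hu)
  have hsub : uIcc t u ⊆ Ioo (-δ) δ := (convex_Ioo (-δ) δ).ordConnected.uIcc_subset ht hu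
  have h1 : ∀ s ∈ uIcc t u, HasDerivWithinAt (fun s => g s - s • deriv g t)
      (deriv g s - deriv g t) (uIcc t u) s := fun s hs => by
    have h2 := (hg.differentiableAt (isOpen_Ioo.mem_nhds (hsub hs))).hasDerivAt.sub
      ((hasDerivAt_id s).smul_const (deriv g t))
    rw [one_smul] at h2
    exact h2.hasDerivWithinAt
  have hBt : 0 ≤ B := by
    have : 0 < ‖u - t‖ := norm_pos_iff.2 (sub_ne_zero.2 hut)
    exact nonneg_of_mul_nonneg_left hB0 this
  have h2 := (convex_uIcc t u).norm_image_sub_le_of_norm_hasDerivWithin_le h1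
    (C := B * ‖u - t‖) (fun s hs => by
      refine (hB t ht s (hsub hs)).trans ?_
      gcongr
      rw [Real.norm_eq_abs, Real.norm_eq_abs]
      exact abs_sub_left_of_mem_uIcc hs) left_mem_uIcc right_mem_uIcc
  have h3 : (u - t)⁻¹ • (g u - g t) - deriv g t =
      (u - t)⁻¹ • (g u - u • deriv g t - (g t - t • deriv g t)) := by
    have h4 : g u - u • deriv g t - (g t - t • deriv g t) = (g u - g t) - (u - t) • deriv g t := by
      rw [sub_smul]; abel
    rw [h4, smul_sub (u - t)⁻¹ (g u - g t), smul_smul, inv_mul_cancel₀ (sub_ne_zero.2 hut), one_smul]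
  rw [h3, norm_smul, norm_inv]
  calc ‖u - t‖⁻¹ * _ ≤ ‖u - t‖⁻¹ * (B * ‖u - t‖ * ‖u - t‖) := by gcongr
    _ = B * ‖u - t‖ := by
      have : ‖u - t‖ ≠ 0 := norm_ne_zero_iff.2 (sub_ne_zero.2 hut)
      field_simp

theorem norm_sub_le_of_norm_deriv_le {G : Type*} [NormedAddCommGroup G] [NormedSpace ℝ G]
    {g : ℝ → G} {δ B : ℝ} (hg : DifferentiableOn ℝ g (Ioo (-δ) δ))
    (hB : ∀ s ∈ Ioo (-δ) δ, ‖deriv g s‖ ≤ B) {s t : ℝ} (hs : s ∈ Ioo (-δ) δ)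
    (ht : t ∈ Ioo (-δ) δ) : ‖g t - g s‖ ≤ B * ‖t - s‖ :=
  (convex_Ioo (-δ) δ).norm_image_sub_le_of_norm_deriv_le
    (fun _ hu => hg.differentiableAt (isOpen_Ioo.mem_nhds hu)) hB hs ht

theorem ContDiffOn.exists_deriv_bounds {g : ℝ → Vec d} {ε : ℝ} (hε : 0 < ε)
    (hg : ContDiffOn ℝ 2 g (Ioo (-ε) ε)) : ∃ B : ℝ≥0,
      (∀ s ∈ Ioo (-(ε / 2)) (ε / 2), ‖deriv g s‖ ≤ B) ∧
      ∀ s ∈ Ioo (-(ε / 2)) (ε / 2), ∀ t ∈ Ioo (-(ε / 2)) (ε / 2),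
        ‖deriv g t - deriv g s‖ ≤ B * ‖t - s‖ := by
  have hsub : Icc (-(ε / 2)) (ε / 2) ⊆ Ioo (-ε) ε := fun s hs => by
    constructor <;> linarith [hs.1, hs.2]
  have h1 : ContDiffOn ℝ 1 (deriv g) (Ioo (-ε) ε) := hg.deriv_of_isOpen isOpen_Ioo (by norm_num)
  have h2 : ContinuousOn (deriv (deriv g)) (Ioo (-ε) ε) :=
    h1.continuousOn_deriv_of_isOpen isOpen_Ioo (by norm_num)
  obtain ⟨B₁, hB₁⟩ := isCompact_Icc.exists_bound_of_continuousOn (h1.continuousOn.mono hsub)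
  obtain ⟨B₂, hB₂⟩ := isCompact_Icc.exists_bound_of_continuousOn (h2.mono hsub)
  have hsub' : Ioo (-(ε / 2)) (ε / 2) ⊆ Ioo (-ε) ε := Ioo_subset_Icc_self.trans hsub
  refine ⟨(max B₁ B₂).toNNReal, fun s hs => ?_, fun s hs t ht => ?_⟩
  · exact (hB₁ s (Ioo_subset_Icc_self hs)).trans ((le_max_left _ _).trans (Real.le_coe_toNNReal _))
  · refine norm_sub_le_of_norm_deriv_le ((h1.differentiableOn (by norm_num)).mono hsub')
      (fun u hu => ?_) hs ht
    exact (hB₂ u (Ioo_subset_Icc_self hu)).trans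
      ((le_max_right _ _).trans (Real.le_coe_toNNReal _))

theorem lipschitzOnWith_of_tendsto {ι E F : Type*} [PseudoMetricSpace E] [PseudoMetricSpace F]
    {l : Filter ι} [l.NeBot] {f : ι → E → F} {f₀ : E → F} {D : Set E} {K : ι → ℝ≥0} {K₀ : ℝ≥0}
    (hf : ∀ᶠ k in l, LipschitzOnWith (K k) (f k) D) (hK : Tendsto K l (𝓝 K₀))
    (hlim : ∀ x ∈ D, Tendsto (fun k => f k x) l (𝓝 (f₀ x))) : LipschitzOnWith K₀ f₀ D := by
  refine LipschitzOnWith.of_dist_le_mul fun x hx y hy => ?_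
  refine le_of_tendsto_of_tendsto ((hlim x hx).dist (hlim y hy))
    (((NNReal.tendsto_coe.2 hK)).mul_const _) ?_
  filter_upwards [hf] with k hk using hk.dist_le_mul x hx y hy

/-- The Lipschitz constants of the single maps `T t` are not assumed to be bounded in `t`, and the
bounds for the time derivatives of the Jacobi matrices hold only almost everywhere. Both are turned
into Lipschitz bounds in `x`, uniform in `t`, by `IsLipschitzDomain.exists_lipschitz_bound`, applied
to the differences `T t - T s` and to differences of difference quotients in `t`; the latter show
that the velocity is Lipschitz and that its Jacobi matrix is the time derivative of the Jacobi
matrix. -/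
theorem IsTwiceDifferentiableFamily.exists_hasTimeEstimates {Ω : Set (Vec d)} {ε : ℝ}
    {T : ℝ → Vec d → Vec d} (hT : IsTwiceDifferentiableFamily Ω ε T) (hΩ : IsLipschitzDomain Ω)
    (hb : Bornology.IsBounded Ω) : ∃ K : ℝ≥0, HasTimeEstimates Ω T (ε / 2) K := by
  have hε := hT.pos
  obtain ⟨C₁, hC₁⟩ := hT.jacobi
  obtain ⟨C, P, hPfin, hPΩ, hbound⟩ := hΩ.exists_lipschitz_bound hb
  choose! B₀ hB₀ using fun p (hp : p ∈ Ω) => (hT.smooth_time p hp).exists_deriv_bounds hε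
  set B : ℝ≥0 := C₁ + ∑ p ∈ hPfin.toFinset, B₀ p with hB
  have hC₁B : C₁ ≤ B := le_self_add
  have hB₀B : ∀ p ∈ P, B₀ p ≤ B := fun p hp =>
    (Finset.single_le_sum (f := B₀) (fun _ _ => zero_le) (hPfin.mem_toFinset.2 hp)).trans
      le_add_self
  set I := Ioo (-(ε / 2)) (ε / 2) with hI
  have hsub : I ⊆ Ioo (-ε) ε := fun s hs => by constructor <;> linarith [hs.1, hs.2]
  have hderiv : ∀ x ∈ Ω, ∀ t ∈ I, HasDerivAt (fun s => T s x) (flowVelocity T t x) t :=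
    fun x hx t ht => (((hT.smooth_time x hx).differentiableOn (by norm_num)).differentiableAt
      (isOpen_Ioo.mem_nhds (hsub ht))).hasDerivAt
  have hlipT : ∀ t ∈ I, ∃ K : ℝ≥0, LipschitzOnWith K (T t) Ω := fun t ht => by
    obtain ⟨K, hK⟩ := hT.biLipschitz t (hsub ht)
    exact ⟨K, LipschitzOnWith.of_dist_le_mul fun x hx y hy => (hK x hx y hy).1⟩
  -- pointwise bounds, for the Jacobi matrices and at the finitely many points of `P`
  have hae1 : ∀ᵐ x ∂(volume.restrict Ω), (∀ t ∈ I, DifferentiableAt ℝ (T t) x) ∧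
      DifferentiableOn ℝ (fun t => fderiv ℝ (T t) x) I ∧
      (∀ t ∈ I, ‖deriv (fun t => fderiv ℝ (T t) x) t‖ ≤ B) ∧
      ∀ s ∈ I, ∀ t ∈ I, ‖deriv (fun t => fderiv ℝ (T t) x) t -
        deriv (fun t => fderiv ℝ (T t) x) s‖ ≤ B * ‖t - s‖ := by
    filter_upwards [hC₁] with x hx
    refine ⟨fun t ht => hx.1 t (hsub ht), hx.2.1.1.mono hsub, fun t ht =>
      (hx.2.1.2.1 t (hsub ht)).trans (by exact_mod_cast hC₁B), fun s hs t ht => ?_⟩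
    have h1 := hx.2.1.2.2.dist_le_mul t (hsub ht) s (hsub hs)
    rw [dist_eq_norm (deriv (fun t => fderiv ℝ (T t) x) t) _, dist_eq_norm] at h1
    exact h1.trans (by gcongr)
  have hP1 : ∀ p ∈ P, ∀ t ∈ I, ‖flowVelocity T t p‖ ≤ B := fun p hp t ht =>
    ((hB₀ p (hPΩ hp)).1 t ht).trans (by exact_mod_cast hB₀B p hp)
  have hP2 : ∀ p ∈ P, ∀ s ∈ I, ∀ t ∈ I,
      ‖flowVelocity T t p - flowVelocity T s p‖ ≤ B * ‖t - s‖ := fun p hp s hs t ht =>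
    ((hB₀ p (hPΩ hp)).2 s hs t ht).trans (by gcongr; exact hB₀B p hp)
  have hdiffOn : ∀ x ∈ Ω, DifferentiableOn ℝ (fun s => T s x) I := fun x hx t ht =>
    (hderiv x hx t ht).differentiableAt.differentiableWithinAt
  -- first differences
  have hfirst : ∀ s ∈ I, ∀ t ∈ I, LipschitzOnWith (C * (B * ‖t - s‖₊)) (fun x => T t x - T s x) Ω ∧
      ∀ x ∈ Ω, ‖T t x - T s x‖ ≤ C * (B * ‖t - s‖₊ : ℝ≥0) := fun s hs t ht => by
    obtain ⟨K₁, hK₁⟩ := hlipT t ht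
    obtain ⟨K₂, hK₂⟩ := hlipT s hs
    refine hbound _ (K₁ + K₂) (B * ‖t - s‖₊) (hK₁.sub hK₂) ?_ fun p hp => ?_
    · filter_upwards [hae1] with x hx
      rw [fderiv_fun_sub (hx.1 t ht) (hx.1 s hs)]
      exact norm_sub_le_of_norm_deriv_le hx.2.1 hx.2.2.1 hs ht
    · exact norm_sub_le_of_norm_deriv_le (hdiffOn p (hPΩ hp)) (hP1 p hp) hs ht
  -- differences of difference quotients
  have hquot : ∀ t ∈ I, ∀ u ∈ I, u ≠ t → ∀ w ∈ I, w ≠ t →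
      LipschitzOnWith (C * (B * ‖u - t‖₊ + B * ‖w - t‖₊))
        (fun x => (u - t)⁻¹ • (T u x - T t x) - (w - t)⁻¹ • (T w x - T t x)) Ω := by
    intro t ht u hu hut w hw hwt
    have hq : ∀ u, LipschitzOnWith (‖(u - t)⁻¹‖₊ * (C * (B * ‖u - t‖₊)))
        (fun x => (u - t)⁻¹ • (T u x - T t x)) Ω ∨ u ∉ I := fun u => by
      by_cases hu : u ∈ I
      · left
        refine LipschitzOnWith.of_dist_le_mul fun x hx y hy => ?_
        have h1 := (hfirst t ht u hu).1.dist_le_mul x hx y hy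
        rw [dist_smul₀, NNReal.coe_mul, mul_assoc]
        gcongr
        exact le_rfl
      · exact Or.inr hu
    have hq1 := (hq u).resolve_right (not_not.2 hu)
    have hq2 := (hq w).resolve_right (not_not.2 hw)
    refine (hbound _ _ (B * ‖u - t‖₊ + B * ‖w - t‖₊) (hq1.sub hq2) ?_ fun p hp => ?_).1
    · filter_upwards [hae1] with x hx
      have h1 := norm_slope_sub_deriv_le hx.2.1 hx.2.2.2 ht hu hut
      have h2 := norm_slope_sub_deriv_le hx.2.1 hx.2.2.2 ht hw hwt
      have h3 : fderiv ℝ (fun x => (u - t)⁻¹ • (T u x - T t x) - (w - t)⁻¹ • (T w x - T t x)) x =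
          (u - t)⁻¹ • (fderiv ℝ (T u) x - fderiv ℝ (T t) x) -
            (w - t)⁻¹ • (fderiv ℝ (T w) x - fderiv ℝ (T t) x) :=
        (((((hx.1 u hu).hasFDerivAt.fun_sub (hx.1 t ht).hasFDerivAt).fun_const_smul
          (u - t)⁻¹).fun_sub (((hx.1 w hw).hasFDerivAt.fun_sub
          (hx.1 t ht).hasFDerivAt).fun_const_smul (w - t)⁻¹))).fderiv
      rw [h3, ← sub_sub_sub_cancel_right _ _ (deriv (fun t => fderiv ℝ (T t) x) t)]
      exact (norm_sub_le _ _).trans (add_le_add h1 h2)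
    · have h1 := norm_slope_sub_deriv_le (hdiffOn p (hPΩ hp)) (hP2 p hp) ht hu hut
      have h2 := norm_slope_sub_deriv_le (hdiffOn p (hPΩ hp)) (hP2 p hp) ht hw hwt
      rw [← sub_sub_sub_cancel_right _ _ (deriv (fun s => T s p) t)]
      exact (norm_sub_le _ _).trans (add_le_add h1 h2)
  have hnhds : ∀ t ∈ I, ∀ᶠ w in 𝓝[≠] t, w ∈ I ∧ w ≠ t := fun t ht => by
    filter_upwards [mem_nhdsWithin_of_mem_nhds (isOpen_Ioo.mem_nhds ht), self_mem_nhdsWithin]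
      with w h1 h2 using ⟨h1, h2⟩
  have hslope : ∀ x ∈ Ω, ∀ t ∈ I, Tendsto (fun w => (w - t)⁻¹ • (T w x - T t x)) (𝓝[≠] t)
      (𝓝 (flowVelocity T t x)) := fun x hx t ht => by
    have h1 := hasDerivAt_iff_tendsto_slope.1 (hderiv x hx t ht)
    exact h1
  -- let `w` tend to `t` in the difference of difference quotients
  have hdiffquot : ∀ t ∈ I, ∀ u ∈ I, u ≠ t → LipschitzOnWith (C * (B * ‖u - t‖₊))
      (fun x => (u - t)⁻¹ • (T u x - T t x) - flowVelocity T t x) Ω := by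
    intro t ht u hu hut
    refine lipschitzOnWith_of_tendsto (l := 𝓝[≠] t)
      (f := fun w x => (u - t)⁻¹ • (T u x - T t x) - (w - t)⁻¹ • (T w x - T t x))
      (K := fun w => C * (B * ‖u - t‖₊ + B * ‖w - t‖₊)) ?_ ?_ fun x hx =>
        tendsto_const_nhds.sub (hslope x hx t ht)
    · filter_upwards [hnhds t ht] with w hw using hquot t ht u hu hut w hw.1 hw.2
    · have hc : Continuous fun w : ℝ => C * (B * ‖u - t‖₊ + B * ‖w - t‖₊) := by fun_prop
      have h1 := hc.tendsto t
      simp only [sub_self, nnnorm_zero, mul_zero, add_zero] at h1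
      exact h1.mono_left nhdsWithin_le_nhds
  have hvel : ∀ t ∈ I, LipschitzOnWith (C * B) (flowVelocity T t) Ω ∧
      ∀ x ∈ Ω, ‖flowVelocity T t x‖ ≤ C * B := fun t ht => by
    constructor
    · refine lipschitzOnWith_of_tendsto (l := 𝓝[≠] t)
        (f := fun w x => (w - t)⁻¹ • (T w x - T t x)) (K := fun _ => C * B) ?_
        tendsto_const_nhds fun x hx => hslope x hx t ht
      filter_upwards [hnhds t ht] with w hw
      refine LipschitzOnWith.of_dist_le_mul fun x hx y hy => ?_
      have h1 := (hfirst t ht w hw.1).1.dist_le_mul x hx y hy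
      have h2 : ‖w - t‖ ≠ 0 := norm_ne_zero_iff.2 (sub_ne_zero.2 hw.2)
      rw [dist_smul₀]
      calc ‖(w - t)⁻¹‖ * dist (T w x - T t x) (T w y - T t y)
          ≤ ‖(w - t)⁻¹‖ * ((C * (B * ‖w - t‖₊) : ℝ≥0) * dist x y) := by gcongr
        _ = (C * B : ℝ≥0) * dist x y := by
          push_cast
          rw [norm_inv]
          field_simp
    · intro x hx
      refine le_of_tendsto (hslope x hx t ht).norm ?_
      filter_upwards [hnhds t ht] with w hw
      have h1 := (hfirst t ht w hw.1).2 x hx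
      have h2 : ‖w - t‖ ≠ 0 := norm_ne_zero_iff.2 (sub_ne_zero.2 hw.2)
      rw [norm_smul]
      calc ‖(w - t)⁻¹‖ * ‖T w x - T t x‖ ≤ ‖(w - t)⁻¹‖ * (C * (B * ‖w - t‖₊ : ℝ≥0)) := by gcongr
        _ = C * B := by
          push_cast
          rw [norm_inv]
          field_simp
  -- the derivative in `x` of the error of the difference quotient is bounded by its Lipschitz
  -- constant, which tends to zero
  have hJ : ∀ t ∈ I, ∀ᵐ x ∂(volume.restrict Ω), DifferentiableAt ℝ (flowVelocity T t) x ∧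
      HasDerivAt (fun s => fderiv ℝ (T s) x) (fderiv ℝ (flowVelocity T t) x) t := fun t ht => by
    filter_upwards [hae1, (hvel t ht).1.ae_differentiableAt_of_isOpen hΩ.1,
      ae_restrict_mem hΩ.1.measurableSet] with x hx hvx hxΩ
    refine ⟨hvx, hasDerivAt_iff_tendsto_slope.2 (tendsto_iff_norm_sub_tendsto_zero.2 ?_)⟩
    have hc : Continuous fun w : ℝ => (C * (B * ‖w - t‖₊) : ℝ≥0) := by fun_prop
    have h1 : Tendsto (fun w : ℝ => ((C * (B * ‖w - t‖₊) : ℝ≥0) : ℝ)) (𝓝[≠] t) (𝓝 0) := by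
      have h2 := (NNReal.continuous_coe.comp hc).tendsto t
      simp only [Function.comp_def, sub_self, nnnorm_zero, mul_zero, NNReal.coe_zero] at h2
      exact h2.mono_left nhdsWithin_le_nhds
    refine squeeze_zero' (Eventually.of_forall fun _ => norm_nonneg _) ?_ h1
    filter_upwards [hnhds t ht] with w hw
    have h3 : fderiv ℝ (fun x => (w - t)⁻¹ • (T w x - T t x) - flowVelocity T t x) x =
        slope (fun s => fderiv ℝ (T s) x) t w - fderiv ℝ (flowVelocity T t) x :=
      ((((hx.1 w hw.1).hasFDerivAt.fun_sub (hx.1 t ht).hasFDerivAt).fun_const_smul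
        (w - t)⁻¹).fun_sub hvx.hasFDerivAt).fderiv
    rw [← h3]
    exact (hdiffquot t ht w hw.1 hw.2).norm_fderiv_le_of_isOpen hΩ.1 hxΩ
  have hsecond : ∀ s ∈ I, ∀ t ∈ I,
      LipschitzOnWith (C * (B * ‖t - s‖₊)) (fun x => flowVelocity T t x - flowVelocity T s x) Ω ∧
      ∀ x ∈ Ω, ‖flowVelocity T t x - flowVelocity T s x‖ ≤ C * (B * ‖t - s‖₊ : ℝ≥0) := by
    intro s hs t ht
    refine hbound _ _ (B * ‖t - s‖₊) ((hvel t ht).1.sub (hvel s hs).1) ?_ fun p hp =>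
      hP2 p hp s hs t ht
    filter_upwards [hae1, hJ t ht, hJ s hs] with x hx h1 h2
    rw [fderiv_fun_sub h1.1 h2.1, ← h1.2.deriv, ← h2.2.deriv]
    exact hx.2.2.2 s hs t ht
  refine ⟨C * B, half_pos hε, hT.zero, hderiv, fun x hx => ?_, fun s hs t ht => ?_,
    fun s hs t ht x hx => ?_, fun t ht => (hvel t ht).1, fun t ht x hx => ?_, fun s hs t ht => ?_,
    fun s hs t ht x hx => ?_, fun t ht => (hJ t ht).mono fun x hx => hx.2, ?_⟩
  · have h1 : ContDiffOn ℝ 1 (deriv fun s => T s x) (Ioo (-ε) ε) :=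
      (hT.smooth_time x hx).deriv_of_isOpen isOpen_Ioo (by norm_num)
    rw [iteratedDeriv_succ, iteratedDeriv_one]
    exact ((h1.differentiableOn (by norm_num)).differentiableAt
      (isOpen_Ioo.mem_nhds ⟨by linarith, hε⟩)).hasDerivAt
  · rw [mul_assoc]; exact (hfirst s hs t ht).1
  · have := (hfirst s hs t ht).2 x hx
    push_cast at this ⊢
    rwa [mul_assoc]
  · have := (hvel t ht).2 x hx
    exact_mod_cast this
  · rw [mul_assoc]; exact (hsecond s hs t ht).1
  · have := (hsecond s hs t ht).2 x hx
    push_cast at this ⊢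
    rwa [mul_assoc]
  · filter_upwards [hae1] with x hx using hx.1

end TimeEstimates

/-! ### Determinants and cofactor matrices -/

section Cofactor
variable {d : ℕ}

/-- The transposed cofactor matrix of an endomorphism of `ℝ^d`; it equals `(det A) A⁻¹` when `A` is
invertible. -/
noncomputable def cofactorMap (A : Vec d →L[ℝ] Vec d) : Vec d →L[ℝ] Vec d :=
  Matrix.toEuclideanCLM (𝕜 := ℝ) ((Matrix.toEuclideanCLM (𝕜 := ℝ) (n := Fin d)).symm A).adjugate

theorem det_toEuclideanCLM (M : Matrix (Fin d) (Fin d) ℝ) :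
    (Matrix.toEuclideanCLM (𝕜 := ℝ) M).det = M.det := by
  rw [ContinuousLinearMap.det, Matrix.coe_toEuclideanCLM_eq_toEuclideanLin,
    Matrix.toEuclideanLin_eq_toLin_orthonormal, LinearMap.det_toLin]

theorem traceCLM_toEuclideanCLM (M : Matrix (Fin d) (Fin d) ℝ) :
    traceCLM d (Matrix.toEuclideanCLM (𝕜 := ℝ) M) = M.trace := by
  rw [traceCLM_eq_sum, Matrix.trace]
  refine Finset.sum_congr rfl fun i _ => ?_
  rw [Matrix.ofLp_toEuclideanCLM]
  simp

theorem exists_toEuclideanCLM_eq (A : Vec d →L[ℝ] Vec d) :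
    ∃ M : Matrix (Fin d) (Fin d) ℝ, Matrix.toEuclideanCLM (𝕜 := ℝ) M = A :=
  ⟨(Matrix.toEuclideanCLM (𝕜 := ℝ) (n := Fin d)).symm A, StarAlgEquiv.apply_symm_apply _ _⟩

theorem comp_cofactorMap (A : Vec d →L[ℝ] Vec d) :
    A.comp (cofactorMap A) = A.det • ContinuousLinearMap.id ℝ (Vec d) := by
  obtain ⟨M, rfl⟩ := exists_toEuclideanCLM_eq A
  rw [cofactorMap, StarAlgEquiv.symm_apply_apply, det_toEuclideanCLM]
  change Matrix.toEuclideanCLM (𝕜 := ℝ) M * Matrix.toEuclideanCLM (𝕜 := ℝ) M.adjugate = _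
  rw [← map_mul, Matrix.mul_adjugate, map_smul, map_one]
  rfl

theorem det_id_vec : (ContinuousLinearMap.id ℝ (Vec d)).det = 1 := by
  simp [ContinuousLinearMap.det]

theorem cofactorMap_id : cofactorMap (ContinuousLinearMap.id ℝ (Vec d)) =
    ContinuousLinearMap.id ℝ (Vec d) := by
  have h := comp_cofactorMap (ContinuousLinearMap.id ℝ (Vec d))
  rwa [det_id_vec, one_smul, ContinuousLinearMap.id_comp] at h

theorem continuous_cofactorMap : Continuous (cofactorMap (d := d)) := by
  have h1 : Continuous (Matrix.toEuclideanCLM (𝕜 := ℝ) (n := Fin d)).symm :=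
    ((Matrix.toEuclideanCLM (𝕜 := ℝ) (n := Fin d)).symm.toAlgEquiv.toLinearMap).continuous_of_finiteDimensional
  have h2 : Continuous (Matrix.toEuclideanCLM (𝕜 := ℝ) (n := Fin d)) :=
    ((Matrix.toEuclideanCLM (𝕜 := ℝ) (n := Fin d)).toAlgEquiv.toLinearMap).continuous_of_finiteDimensional
  exact h2.comp h1.matrix_adjugate

theorem contDiff_det : ContDiff ℝ 1 fun A : Vec d →L[ℝ] Vec d => A.det := by
  have h : (fun A : Vec d →L[ℝ] Vec d => A.det) = fun A => ∑ σ : Equiv.Perm (Fin d),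
      ((Equiv.Perm.sign σ : ℤ) : ℝ) * ∏ i, A (EuclideanSpace.single i 1) (σ i) := by
    ext A
    obtain ⟨M, rfl⟩ := exists_toEuclideanCLM_eq A
    rw [det_toEuclideanCLM, Matrix.det_apply']
    refine Finset.sum_congr rfl fun σ _ => ?_
    congr 1
    refine Finset.prod_congr rfl fun i _ => ?_
    rw [Matrix.ofLp_toEuclideanCLM]
    simp
  rw [h]
  refine ContDiff.sum fun σ _ => contDiff_const.mul (contDiff_prod fun i _ => ?_)
  have h2 : ContDiff ℝ 1 fun A : Vec d →L[ℝ] Vec d => A (EuclideanSpace.single i 1) :=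
    contDiff_id.clm_apply contDiff_const
  exact (EuclideanSpace.proj (σ i) : Vec d →L[ℝ] ℝ).contDiff.comp h2

theorem hasDerivAt_det_one_add_smul (N : Vec d →L[ℝ] Vec d) :
    HasDerivAt (fun s : ℝ => (ContinuousLinearMap.id ℝ (Vec d) + s • N).det) (traceCLM d N) 0 := by
  obtain ⟨M, rfl⟩ := exists_toEuclideanCLM_eq N
  have h1 : ∀ s : ℝ, (ContinuousLinearMap.id ℝ (Vec d) +
      s • Matrix.toEuclideanCLM (𝕜 := ℝ) M).det = (1 + s • M).det := fun s => by
    rw [← det_toEuclideanCLM, map_add, map_smul, map_one]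
    rfl
  set q := (Matrix.det (1 + (Polynomial.X : Polynomial ℝ) • M.map Polynomial.C)).divX.divX with hq
  have h3 : (fun s : ℝ => (ContinuousLinearMap.id ℝ (Vec d) +
      s • Matrix.toEuclideanCLM (𝕜 := ℝ) M).det) =
      fun s : ℝ => 1 + M.trace * s + q.eval s * s ^ 2 := funext fun s => by
    rw [h1, Matrix.det_one_add_smul]
  rw [h3, traceCLM_toEuclideanCLM]
  have h2 : HasDerivAt (fun s : ℝ => 1 + M.trace * s + q.eval s * s ^ 2)
      (M.trace * 1 + (q.derivative.eval 0 * 0 ^ 2 + q.eval 0 * (2 * (0 : ℝ) ^ (2 - 1) * 1))) 0 :=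
    (((hasDerivAt_id (0 : ℝ)).const_mul M.trace).const_add 1).add
      ((q.hasDerivAt 0).mul ((hasDerivAt_id (0 : ℝ)).pow 2))
  simpa using h2

/-- Jacobi's formula for the derivative of the determinant of a curve of invertible matrices. -/
theorem HasDerivAt.det_clm {A : ℝ → Vec d →L[ℝ] Vec d} {A' : Vec d →L[ℝ] Vec d} {t : ℝ}
    (hA : HasDerivAt A A' t) (h0 : (A t).det ≠ 0) :
    HasDerivAt (fun s => (A s).det) (traceCLM d ((cofactorMap (A t)).comp A')) t := by
  have hd := (contDiff_det.differentiable one_ne_zero (A t)).hasFDerivAt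
  have h1 := hd.comp_hasDerivAt t hA
  have h2 : HasDerivAt (fun s : ℝ => (A t + s • A').det)
      (fderiv ℝ (fun A : Vec d →L[ℝ] Vec d => A.det) (A t) A') 0 := by
    have h3 : HasDerivAt (fun s : ℝ => A t + s • A') A' 0 := by
      simpa using ((hasDerivAt_id (0 : ℝ)).smul_const A').const_add (A t)
    have h4 : HasFDerivAt (fun A : Vec d →L[ℝ] Vec d => A.det)
      (fderiv ℝ (fun A : Vec d →L[ℝ] Vec d => A.det) (A t)) (A t + (0 : ℝ) • A') := by
      have hz : (0 : ℝ) • A' = 0 := zero_smul ℝ A'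
      rw [hz, add_zero]; exact hd
    exact h4.comp_hasDerivAt 0 h3
  set N := ((A t).det)⁻¹ • (cofactorMap (A t)).comp A' with hN
  -- the derivative of `det` in direction `A'` is reduced to the one at the identity by the
  -- factorization `A t + s A' = (A t) (1 + s N)`
  have h5 : ∀ s : ℝ, (A t + s • A').det =
      (A t).det * (ContinuousLinearMap.id ℝ (Vec d) + s • N).det := fun s => by
    have h6 : A t + s • A' = (A t).comp (ContinuousLinearMap.id ℝ (Vec d) + s • N) := by
      rw [ContinuousLinearMap.comp_add, ContinuousLinearMap.comp_id, ContinuousLinearMap.comp_smul,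
        hN, ContinuousLinearMap.comp_smul, ← ContinuousLinearMap.comp_assoc, comp_cofactorMap,
        ContinuousLinearMap.smul_comp, ContinuousLinearMap.id_comp, inv_smul_smul₀ h0]
    rw [h6]
    exact LinearMap.det_comp _ _
  simp_rw [h5] at h2
  have h7 := h2.unique ((hasDerivAt_det_one_add_smul N).const_mul (A t).det)
  have h8 : fderiv ℝ (fun A : Vec d →L[ℝ] Vec d => A.det) (A t) A' =
      traceCLM d ((cofactorMap (A t)).comp A') := by
    rw [h7, hN, map_smul, smul_eq_mul, mul_inv_cancel_left₀ h0]
  rw [← h8]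
  exact h1

/-- With this identity, Jacobi's formula alone gives the derivative of the cofactor matrix at the
identity. -/
theorem cofactorMap_sub_id (A : Vec d →L[ℝ] Vec d) :
    cofactorMap A - ContinuousLinearMap.id ℝ (Vec d) =
      (A.det - 1) • ContinuousLinearMap.id ℝ (Vec d) -
        (A - ContinuousLinearMap.id ℝ (Vec d)).comp (cofactorMap A) := by
  rw [ContinuousLinearMap.sub_comp, comp_cofactorMap, ContinuousLinearMap.id_comp]
  ext v : 1
  simp only [sub_apply, smul_apply, sub_smul, one_smul]
  abel

/-- The derivative of the cofactor matrix at the identity in direction `A'` is `(tr A') I - A'`. Its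
pairing with a matrix `B` is the value of `nullForm` at `A'` and `B`. -/
theorem HasDerivAt.cofactorMap {A : ℝ → Vec d →L[ℝ] Vec d} {A' : Vec d →L[ℝ] Vec d} {t : ℝ}
    (hA : HasDerivAt A A' t) (h0 : A t = ContinuousLinearMap.id ℝ (Vec d)) :
    HasDerivAt (fun s => cofactorMap (A s)) (traceCLM d A' • ContinuousLinearMap.id ℝ (Vec d) - A')
      t := by
  have hdet := hA.det_clm (by rw [h0, det_id_vec]; exact one_ne_zero)
  rw [h0, cofactorMap_id, ContinuousLinearMap.id_comp] at hdet
  rw [hasDerivAt_iff_tendsto_slope] at hA hdet ⊢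
  have hc : Tendsto (fun s => _root_.cofactorMap (A s)) (𝓝[≠] t)
      (𝓝 (ContinuousLinearMap.id ℝ (Vec d))) := by
    have hAc : Tendsto A (𝓝[≠] t) (𝓝 (A t)) := by
      have h1 : Tendsto (fun s => (s - t) • slope A t s + A t) (𝓝[≠] t) (𝓝 ((0 : ℝ) • A' + A t)) := by
        refine (Tendsto.smul ?_ hA).add_const _
        have h2 : Tendsto (fun s : ℝ => s - t) (𝓝 t) (𝓝 (t - t)) :=
          (continuous_id.sub continuous_const).tendsto t
        rw [sub_self] at h2
        exact h2.mono_left nhdsWithin_le_nhds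
      have hz : (0 : ℝ) • A' = 0 := zero_smul ℝ A'
      rw [hz, zero_add] at h1
      refine h1.congr' (Eventually.of_forall fun s => ?_)
      have h2 : (s - t) • slope A t s = A s - A t := sub_smul_slope A t s
      rw [h2, sub_add_cancel]
    have h2 := (continuous_cofactorMap.tendsto (A t)).comp hAc
    rw [h0, cofactorMap_id] at h2
    exact h2
  have h1 : Tendsto (fun s => slope (fun s => (A s).det) t s • ContinuousLinearMap.id ℝ (Vec d))
      (𝓝[≠] t) (𝓝 (traceCLM d A' • ContinuousLinearMap.id ℝ (Vec d))) := hdet.smul_const _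
  have h2 : Tendsto (fun s => (slope A t s).comp (_root_.cofactorMap (A s))) (𝓝[≠] t)
      (𝓝 (A'.comp (ContinuousLinearMap.id ℝ (Vec d)))) := by
    have h := ((isBoundedBilinearMap_comp (𝕜 := ℝ) (E := Vec d) (F := Vec d)
      (G := Vec d)).continuous.tendsto (A', ContinuousLinearMap.id ℝ (Vec d))).comp
        (hA.prodMk_nhds hc)
    exact h
  have h3 := h1.sub h2
  rw [ContinuousLinearMap.comp_id] at h3
  refine h3.congr fun s => ?_
  have h5 := cofactorMap_sub_id (A s)
  have h6 : slope A t s = (s - t)⁻¹ • (A s - ContinuousLinearMap.id ℝ (Vec d)) := by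
    rw [← h0]; exact slope_def_module A t s
  have h7 : slope (fun s => (A s).det) t s = (s - t)⁻¹ • ((A s).det - 1) := by
    rw [slope_def_module, h0, det_id_vec]
  have h8 : slope (fun s => _root_.cofactorMap (A s)) t s =
      (s - t)⁻¹ • (_root_.cofactorMap (A s) - ContinuousLinearMap.id ℝ (Vec d)) := by
    have h9 := slope_def_module (fun s => _root_.cofactorMap (A s)) t s
    rw [h9, h0, cofactorMap_id]
  rw [h6, h7, h8, h5, ContinuousLinearMap.smul_comp]
  ext v : 1
  simp only [sub_apply, smul_apply, smul_sub, smul_smul,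
    smul_eq_mul]

theorem exists_det_cofactorMap_bounds (d : ℕ) : ∃ C : ℝ≥0,
    (∀ A B : Vec d →L[ℝ] Vec d, ‖A‖ ≤ 2 → ‖B‖ ≤ 2 → ‖A.det - B.det‖ ≤ C * ‖A - B‖) ∧
    (∀ A : Vec d →L[ℝ] Vec d, ‖A‖ ≤ 2 → ‖A.det‖ ≤ C ∧ ‖cofactorMap A‖ ≤ C) ∧
    ∀ A : Vec d →L[ℝ] Vec d, ‖A‖ ≤ 2 → ‖cofactorMap A - ContinuousLinearMap.id ℝ (Vec d)‖ ≤
      C * ‖A - ContinuousLinearMap.id ℝ (Vec d)‖ := by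
  have hK : IsCompact (Metric.closedBall (0 : Vec d →L[ℝ] Vec d) 2) := isCompact_closedBall _ _
  obtain ⟨C₁, hC₁⟩ := ((contDiff_det (d := d)).locallyLipschitz (𝕂 := ℝ)).locallyLipschitzOn
    (s := Metric.closedBall (0 : Vec d →L[ℝ] Vec d) 2) |>.exists_lipschitzOnWith_of_compact hK
  obtain ⟨C₂, hC₂⟩ := hK.exists_bound_of_continuousOn (contDiff_det (d := d)).continuous.continuousOn
  obtain ⟨C₃, hC₃⟩ := hK.exists_bound_of_continuousOn (continuous_cofactorMap (d := d)).continuousOn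
  have hid : ‖ContinuousLinearMap.id ℝ (Vec d)‖ ≤ 1 := ContinuousLinearMap.norm_id_le
  have h0 : ‖ContinuousLinearMap.id ℝ (Vec d)‖ ≤ 2 := hid.trans (by norm_num)
  have hmem : ∀ A : Vec d →L[ℝ] Vec d, ‖A‖ ≤ 2 → A ∈ Metric.closedBall (0 : Vec d →L[ℝ] Vec d) 2 :=
    fun A hA => by rwa [mem_closedBall_zero_iff]
  have hC₃0 : 0 ≤ C₃ := (norm_nonneg _).trans (hC₃ _ (hmem _ h0))
  have hC₂0 : 0 ≤ C₂ := (norm_nonneg _).trans (hC₂ _ (hmem _ h0))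
  have hdet : ∀ A B : Vec d →L[ℝ] Vec d, ‖A‖ ≤ 2 → ‖B‖ ≤ 2 →
      ‖A.det - B.det‖ ≤ C₁ * ‖A - B‖ := fun A B hA hB => by
    have h := hC₁.dist_le_mul A (hmem A hA) B (hmem B hB)
    rwa [dist_eq_norm, dist_eq_norm A B] at h
  refine ⟨⟨C₁ + C₂ + C₃, by positivity⟩, fun A B hA hB => ?_, fun A hA => ⟨?_, ?_⟩, fun A hA => ?_⟩
  · refine (hdet A B hA hB).trans (mul_le_mul_of_nonneg_right ?_ (norm_nonneg _))
    change (C₁ : ℝ) ≤ C₁ + C₂ + C₃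
    linarith
  · refine (hC₂ _ (hmem A hA)).trans ?_
    change C₂ ≤ C₁ + C₂ + C₃
    linarith [C₁.2]
  · refine (hC₃ _ (hmem A hA)).trans ?_
    change C₃ ≤ C₁ + C₂ + C₃
    linarith [C₁.2]
  · rw [cofactorMap_sub_id]
    have h2 := hdet A _ hA h0
    rw [det_id_vec] at h2
    have h3 : ‖(A.det - 1) •
        ContinuousLinearMap.id ℝ (Vec d)‖ ≤ C₁ * ‖A - ContinuousLinearMap.id ℝ (Vec d)‖ * 1 := by
      rw [norm_smul]
      exact mul_le_mul h2 hid (norm_nonneg _) (by positivity)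
    have h4 : ‖(A - ContinuousLinearMap.id ℝ (Vec d)).comp (cofactorMap A)‖ ≤
        ‖A - ContinuousLinearMap.id ℝ (Vec d)‖ * C₃ :=
      (ContinuousLinearMap.opNorm_comp_le _ _).trans
        (mul_le_mul_of_nonneg_left (hC₃ _ (hmem A hA)) (norm_nonneg _))
    refine (norm_sub_le _ _).trans ((add_le_add h3 h4).trans ?_)
    change _ ≤ (C₁ + C₂ + C₃) * ‖A - ContinuousLinearMap.id ℝ (Vec d)‖
    nlinarith [norm_nonneg (A - ContinuousLinearMap.id ℝ (Vec d))]

theorem exists_det_pos_of_norm_sub_id_le (d : ℕ) : ∃ ρ : ℝ, 0 < ρ ∧ ∀ A : Vec d →L[ℝ] Vec d,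
    ‖A - ContinuousLinearMap.id ℝ (Vec d)‖ ≤ ρ → 0 < A.det := by
  have h1 : ∀ᶠ A in 𝓝 (ContinuousLinearMap.id ℝ (Vec d)), 0 < A.det :=
    (contDiff_det (d := d)).continuous.continuousAt.eventually_const_lt
      (by beta_reduce; rw [det_id_vec]; exact one_pos)
  obtain ⟨ρ, hρ, h⟩ := Metric.nhds_basis_closedBall.eventually_iff.1 h1
  exact ⟨ρ, hρ, fun A hA => h (by rw [Metric.mem_closedBall, dist_eq_norm A _]; exact hA)⟩

end Cofactor

/-! ### Change of variables -/

section ChangeOfVariables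
variable {d : ℕ} {D : Set (Vec d)}

theorem LipschitzOnWith.volume_image_eq_zero {f : Vec d → Vec d} {K : ℝ≥0} {s : Set (Vec d)}
    (hf : LipschitzOnWith K f s) (hs : volume s = 0) : volume (f '' s) = 0 := by
  rw [← EuclideanSpace.euclideanHausdorffMeasure_eq_volume] at hs ⊢
  have h := hf.euclideanHausdorffMeasure_image_le d
  rw [hs, mul_zero] at h
  exact le_antisymm h bot_le

/-- The change of variables formula for injective Lipschitz maps, which need only be differentiable
almost everywhere. -/
theorem setIntegral_image_eq_of_det_pos (hD : IsOpen D) {T : Vec d → Vec d} {K : ℝ≥0}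
    (hT : LipschitzOnWith K T D) (hinj : InjOn T D)
    (hdet : ∀ᵐ x ∂(volume.restrict D), 0 < (fderiv ℝ T x).det) (φ : Vec d → ℝ) :
    ∫ y in T '' D, φ y = ∫ x in D, (fderiv ℝ T x).det * φ (T x) := by
  set s := D ∩ {x | DifferentiableAt ℝ T x} with hs
  have hsm : MeasurableSet s := hD.measurableSet.inter (measurableSet_of_differentiableAt ℝ T)
  have hnull : volume (D \ s) = 0 := by
    have h1 := (ae_restrict_iff' hD.measurableSet).1 (hT.ae_differentiableAt_of_isOpen hD)
    rw [ae_iff] at h1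
    refine measure_mono_null (fun x hx => ?_) h1
    intro h
    exact hx.2 ⟨hx.1, h hx.1⟩
  have hsD : s ⊆ D := inter_subset_left
  have hae : s =ᵐ[volume] D := by
    refine (ae_eq_set).2 ⟨by rw [sdiff_eq_empty.2 hsD]; exact measure_empty, hnull⟩
  have himg : T '' s =ᵐ[volume] T '' D := by
    refine (ae_eq_set).2 ⟨by rw [sdiff_eq_empty.2 (image_mono hsD)]; exact measure_empty, ?_⟩
    refine measure_mono_null ?_ ((hT.mono sdiff_subset).volume_image_eq_zero hnull)
    rintro _ ⟨⟨x, hx, rfl⟩, h2⟩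
    exact ⟨x, ⟨hx, fun h => h2 ⟨x, h, rfl⟩⟩, rfl⟩
  rw [← setIntegral_congr_set himg, ← setIntegral_congr_set hae,
    integral_image_eq_integral_abs_det_fderiv_smul volume hsm
      (fun x hx => hx.2.hasFDerivAt.hasFDerivWithinAt) (hinj.mono hsD)]
  refine integral_congr_ae ?_
  have h1 : ∀ᵐ x ∂(volume.restrict s), 0 < (fderiv ℝ T x).det :=
    ae_restrict_of_ae_restrict_of_subset hsD hdet
  filter_upwards [h1] with x hx
  rw [abs_of_pos hx, smul_eq_mul]

/-- Null sets are preserved by the inverse of a map that expands distances by at least a positive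
factor. -/
theorem ae_comp_of_antilipschitz {T : Vec d → Vec d} {K : ℝ≥0}
    (hT : ∀ x ∈ D, ∀ y ∈ D, dist x y ≤ K * dist (T x) (T y)) {p : Vec d → Prop}
    (hp : ∀ᵐ y, p y) (hD : MeasurableSet D) : ∀ᵐ x ∂(volume.restrict D), p (T x) := by
  have hinj : InjOn T D := fun x hx y hy hxy => by
    have h := hT x hx y hy
    rw [hxy, dist_self, mul_zero] at h
    exact dist_le_zero.1 h
  rw [ae_restrict_iff' hD, ae_iff]
  rw [ae_iff] at hp
  rcases D.eq_empty_or_nonempty with rfl | ⟨x₀, hx₀⟩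
  · simp
  have : Nonempty (Vec d) := ⟨x₀⟩
  set S := Function.invFunOn T D with hS
  have hleft : ∀ x ∈ D, S (T x) = x := fun x hx => hinj.leftInvOn_invFunOn hx
  have hlip : LipschitzOnWith K S (T '' D ∩ {y | ¬ p y}) := by
    refine LipschitzOnWith.of_dist_le_mul ?_
    rintro _ ⟨⟨x, hx, rfl⟩, -⟩ _ ⟨⟨y, hy, rfl⟩, -⟩
    rw [hleft x hx, hleft y hy]
    exact hT x hx y hy
  refine measure_mono_null ?_ (hlip.volume_image_eq_zero (measure_mono_null inter_subset_right hp))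
  intro x hx
  simp only [mem_ofPred_eq, Classical.not_imp] at hx
  exact ⟨T x, ⟨⟨x, hx.1, rfl⟩, hx.2⟩, hleft x hx.1⟩

end ChangeOfVariables

/-! ### Extension of the deformations to the closure -/

section Extension
variable {d : ℕ} {D : Set (Vec d)}

/-- Equi-Lipschitz functions that converge pointwise on a set converge on its closure. -/
theorem tendsto_of_mem_closure_of_lipschitzWith {ι E F : Type*} [PseudoMetricSpace E]
    [PseudoMetricSpace F] {l : Filter ι} {f : ι → E → F} {f₀ : E → F} {C : ℝ≥0} {s : Set E}
    (hf : ∀ᶠ k in l, LipschitzWith C (f k)) (hf₀ : LipschitzWith C f₀)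
    (hlim : ∀ x ∈ s, Tendsto (fun k => f k x) l (𝓝 (f₀ x))) {x : E} (hx : x ∈ closure s) :
    Tendsto (fun k => f k x) l (𝓝 (f₀ x)) := by
  rw [Metric.tendsto_nhds]
  intro ε hε
  obtain ⟨y, hy, hxy⟩ := Metric.mem_closure_iff.1 hx (ε / (3 * (C + 1))) (by positivity)
  have hCy : C * dist x y ≤ ε / 3 := by
    calc C * dist x y ≤ (C + 1) * (ε / (3 * (C + 1))) := by gcongr; linarith
      _ = ε / 3 := by field_simp
  filter_upwards [hf, Metric.tendsto_nhds.1 (hlim y hy) (ε / 3) (by positivity)] with k hk hky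
  have h1 := hk.dist_le_mul x y
  have h2 := hf₀.dist_le_mul x y
  have h3 := dist_triangle4_right (f k x) (f₀ x) (f k y) (f₀ y)
  linarith

/-- Extensions to the whole space of a family of deformations `T`, of its velocity and of its
acceleration at time zero. The differentiability at time zero persists on the closure of `D`. -/
structure IsFlowExtension (D : Set (Vec d)) (T : ℝ → Vec d → Vec d) (δ : ℝ) (K : ℝ≥0)
    (T' S' : ℝ → Vec d → Vec d) (R' : Vec d → Vec d) : Prop where
  eqOn : ∀ t ∈ Ioo (-δ) δ, EqOn (T' t) (T t) D
  eqOn_velocity : ∀ t ∈ Ioo (-δ) δ, EqOn (S' t) (flowVelocity T t) D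
  lipschitz_sub_id : ∀ t ∈ Ioo (-δ) δ, LipschitzWith (K * ‖t‖₊) fun x => T' t x - x
  lipschitz_velocity : ∀ t ∈ Ioo (-δ) δ, LipschitzWith (K + K * ‖t‖₊) (S' t)
  zero : ∀ x ∈ closure D, T' 0 x = x
  norm_sub_le : ∀ t ∈ Ioo (-δ) δ, ∀ x ∈ closure D, ‖T' t x - x‖ ≤ K * ‖t‖
  norm_velocity_le : ∀ t ∈ Ioo (-δ) δ, ∀ x ∈ closure D, ‖S' t x‖ ≤ K
  norm_velocity_sub_le : ∀ t ∈ Ioo (-δ) δ, ∀ x ∈ closure D, ‖S' t x - S' 0 x‖ ≤ K * ‖t‖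
  hasDerivAt : ∀ x ∈ closure D, HasDerivAt (fun t => T' t x) (S' 0 x) 0
  hasDerivAt_velocity : ∀ x ∈ closure D, HasDerivAt (fun t => S' t x) (R' x) 0
  velocity_eq : ∀ x ∈ closure D, velocity D T x = S' 0 x
  acceleration_eq : ∀ x ∈ closure D, acceleration D T x = R' x
  continuous_acceleration : Continuous R'

theorem extendFrom_eq_of_eqOn {X Y : Type*} [TopologicalSpace X] [TopologicalSpace Y] [T2Space Y]
    {s : Set X} {f g : X → Y} (hg : Continuous g) (h : EqOn f g s) {x : X} (hx : x ∈ closure s) :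
    extendFrom s f x = g x := by
  refine extendFrom_eq hx ?_
  refine Tendsto.congr' ?_ (hg.continuousWithinAt (s := s) (x := x))
  filter_upwards [self_mem_nhdsWithin] with y hy using (h hy).symm

/-- The differences `T t - id` and the increments of the velocity are extended instead of the maps
themselves, so that the extensions depend on `t` in a Lipschitz way. -/
theorem HasTimeEstimates.exists_isFlowExtension {T : ℝ → Vec d → Vec d} {δ : ℝ} {K : ℝ≥0}
    (hT : HasTimeEstimates D T δ K) :
    ∃ (K' : ℝ≥0) (T' S' : ℝ → Vec d → Vec d) (R' : Vec d → Vec d),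
      IsFlowExtension D T δ K' T' S' R' := by
  set I := Ioo (-δ) δ with hI
  have h0 : (0 : ℝ) ∈ I := ⟨by linarith [hT.pos], hT.pos⟩
  set c := lipschitzExtensionConstant (Vec d) with hc
  have hTL : ∀ t ∈ I, LipschitzOnWith (K * ‖t‖₊) (fun x => T t x - x) D := fun t ht => by
    have h1 := hT.lipschitz_sub 0 h0 t ht
    rw [sub_zero] at h1
    refine LipschitzOnWith.of_dist_le_mul fun x hx y hy => ?_
    have h2 := h1.dist_le_mul x hx y hy
    simp only [hT.zero x hx, hT.zero y hy] at h2
    exact h2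
  have hSL : ∀ t ∈ I, LipschitzOnWith (K * ‖t‖₊)
      (fun x => flowVelocity T t x - flowVelocity T 0 x) D := fun t ht => by
    have h1 := hT.lipschitz_velocity_sub 0 h0 t ht
    rwa [sub_zero] at h1
  set R : Vec d → Vec d := fun x => iteratedDeriv 2 (fun s => T s x) 0 with hR
  have hslopeR : ∀ x ∈ D, Tendsto (fun t : ℝ => t⁻¹ • (flowVelocity T t x - flowVelocity T 0 x))
      (𝓝[≠] 0) (𝓝 (R x)) := fun x hx => by
    have h1 := hasDerivAt_iff_tendsto_slope.1 (hT.hasDerivAt_velocity x hx)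
    refine h1.congr fun t => ?_
    rw [slope_def_module, sub_zero]
  have hnhds : ∀ᶠ t in 𝓝[≠] (0 : ℝ), t ∈ I ∧ t ≠ 0 := by
    filter_upwards [mem_nhdsWithin_of_mem_nhds (isOpen_Ioo.mem_nhds h0), self_mem_nhdsWithin]
      with w h1 h2 using ⟨h1, h2⟩
  have hRL : LipschitzOnWith K R D := by
    refine lipschitzOnWith_of_tendsto (K := fun _ => K) ?_ tendsto_const_nhds hslopeR
    filter_upwards [hnhds] with t ht
    refine LipschitzOnWith.of_dist_le_mul fun x hx y hy => ?_
    have h1 := (hSL t ht.1).dist_le_mul x hx y hy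
    have h2 : ‖t‖ ≠ 0 := norm_ne_zero_iff.2 ht.2
    rw [dist_smul₀]
    refine (mul_le_mul_of_nonneg_left h1 (norm_nonneg _)).trans (le_of_eq ?_)
    push_cast
    rw [norm_inv]
    field_simp
  choose! u hu huT using fun t (ht : t ∈ I) => (hTL t ht).extend_finite_dimension
  choose! v hv hvS using fun t (ht : t ∈ I) => (hSL t ht).extend_finite_dimension
  obtain ⟨S₀, hS₀, hS₀S⟩ := (hT.lipschitz_velocity 0 h0).extend_finite_dimension
  obtain ⟨R', hR', hR'R⟩ := hRL.extend_finite_dimension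
  have hclos : ∀ {p : Vec d → Prop}, IsClosed {x | p x} → (∀ x ∈ D, p x) → ∀ x ∈ closure D, p x :=
    fun {p} hp h x hx => closure_minimal (t := {x | p x}) h hp hx
  have hKK : (K : ℝ) ≤ (c * K + K : ℝ≥0) := NNReal.coe_le_coe.2 le_add_self
  have hcK : c * K ≤ c * K + K := le_self_add
  have hTeq : ∀ t ∈ I, ∀ x ∈ D, x + u t x = T t x := fun t ht x hx => by
    rw [← huT t ht hx]
    exact add_sub_cancel _ _
  have hSeq : ∀ t ∈ I, ∀ x ∈ D, S₀ x + v t x = flowVelocity T t x := fun t ht x hx => by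
    rw [← hvS t ht hx, ← hS₀S hx]
    exact add_sub_cancel _ _
  have hucont : ∀ t ∈ I, Continuous (u t) := fun t ht => (hu t ht).continuous
  have hvcont : ∀ t ∈ I, Continuous (v t) := fun t ht => (hv t ht).continuous
  have hu0 : ∀ x ∈ closure D, u 0 x = 0 := by
    refine hclos (isClosed_eq (hucont 0 h0) continuous_const) fun x hx => ?_
    rw [← huT 0 h0 hx]
    beta_reduce
    rw [hT.zero x hx, sub_self]
  have hv0 : ∀ x ∈ closure D, v 0 x = 0 := by
    refine hclos (isClosed_eq (hvcont 0 h0) continuous_const) fun x hx => ?_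
    rw [← hvS 0 h0 hx]
    exact sub_self _
  -- the difference quotients are Lipschitz with a constant independent of `t`, hence convergence in
  -- `D` extends to the closure
  have hquot : ∀ (w : ℝ → Vec d → Vec d) (w₀ : Vec d → Vec d),
      (∀ t ∈ I, LipschitzWith (c * (K * ‖t‖₊)) (w t)) → LipschitzWith (c * K) w₀ →
      (∀ x ∈ D, Tendsto (fun t : ℝ => t⁻¹ • w t x) (𝓝[≠] 0) (𝓝 (w₀ x))) →
      ∀ x ∈ closure D, Tendsto (fun t : ℝ => t⁻¹ • w t x) (𝓝[≠] 0) (𝓝 (w₀ x)) := by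
    intro w w₀ hw hw₀ hlim x hx
    refine tendsto_of_mem_closure_of_lipschitzWith (f := fun t x => t⁻¹ • w t x) ?_ hw₀ hlim hx
    filter_upwards [hnhds] with t ht
    refine LipschitzWith.of_dist_le_mul fun x y => ?_
    have h1 := (hw t ht.1).dist_le_mul x y
    have h2 : ‖t‖ ≠ 0 := norm_ne_zero_iff.2 ht.2
    rw [dist_smul₀]
    refine (mul_le_mul_of_nonneg_left h1 (norm_nonneg _)).trans (le_of_eq ?_)
    push_cast
    rw [norm_inv]
    field_simp
  refine ⟨c * K + K, fun t x => x + u t x, fun t x => S₀ x + v t x, R', ?_⟩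
  refine ⟨hTeq, hSeq, fun t ht => ?_, fun t ht => ?_, fun x hx => ?_, fun t ht => ?_,
    fun t ht => ?_, fun t ht => ?_, fun x hx => ?_, fun x hx => ?_, fun x hx => ?_, fun x hx => ?_,
    hR'.continuous⟩
  · simp only [add_sub_cancel_left]
    refine (hu t ht).weaken ?_
    rw [← mul_assoc]
    gcongr
  · refine (hS₀.add (hv t ht)).weaken ?_
    rw [← mul_assoc]
    gcongr
  · simp only [hu0 x hx, add_zero]
  · refine hclos (isClosed_le (by have := hucont t ht; fun_prop) continuous_const) fun x hx => ?_
    rw [hTeq t ht x hx]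
    have h1 := hT.norm_sub_le 0 h0 t ht x hx
    rw [hT.zero x hx, sub_zero] at h1
    exact h1.trans (by gcongr)
  · refine hclos (isClosed_le (by have := hvcont t ht; have := hS₀.continuous; fun_prop)
      continuous_const) fun x hx => ?_
    rw [hSeq t ht x hx]
    exact (hT.norm_velocity_le t ht x hx).trans hKK
  · refine hclos (isClosed_le (by
      have := hvcont t ht; have := hvcont 0 h0; have := hS₀.continuous; fun_prop)
      continuous_const) fun x hx => ?_
    rw [hSeq t ht x hx, hSeq 0 h0 x hx]
    have h1 := hT.norm_velocity_sub_le 0 h0 t ht x hx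
    rw [sub_zero] at h1
    exact h1.trans (by gcongr)
  · rw [hasDerivAt_iff_tendsto_slope]
    have h1 := hquot u S₀ hu hS₀ (fun y hy => by
      have h2 := hasDerivAt_iff_tendsto_slope.1 (hT.hasDerivAt y hy 0 h0)
      rw [hS₀S hy] at h2
      refine h2.congr' ?_
      filter_upwards [hnhds] with t ht
      rw [slope_def_module, sub_zero, ← huT t ht.1 hy, hT.zero y hy]) x hx
    simp only [hv0 x hx, add_zero]
    refine h1.congr fun t => ?_
    rw [slope_def_module, sub_zero, hu0 x hx, add_zero, add_sub_cancel_left]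
  · rw [hasDerivAt_iff_tendsto_slope]
    have h1 := hquot v R' hv hR' (fun y hy => by
      rw [← hR'R hy]
      refine (hslopeR y hy).congr' ?_
      filter_upwards [hnhds] with t ht
      rw [← hvS t ht.1 hy]) x hx
    refine h1.congr fun t => ?_
    rw [slope_def_module, sub_zero, hv0 x hx, add_zero, add_sub_cancel_left]
  · simp only [hv0 x hx, add_zero]
    exact extendFrom_eq_of_eqOn hS₀.continuous hS₀S hx
  · exact extendFrom_eq_of_eqOn hR'.continuous hR'R hx

end Extension

/-! ### Time dependent fields of class `C^{1,1}` -/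

section Field
variable {d : ℕ}

/-- A `C¹` function of two functions that are Lipschitz near `x` is Lipschitz near `x`. -/
theorem exists_lipschitzOnWith_comp_prodMk {X F G H : Type*} [PseudoMetricSpace X]
    [NormedAddCommGroup F] [NormedSpace ℝ F] [NormedAddCommGroup G] [NormedSpace ℝ G]
    [NormedAddCommGroup H] [NormedSpace ℝ H] {f : X → F} {g : X → G} {Ψ : F × G → H} {x : X}
    (hf : ∃ (K : ℝ≥0), ∃ t ∈ 𝓝 x, LipschitzOnWith K f t)
    (hg : ∃ (K : ℝ≥0), ∃ t ∈ 𝓝 x, LipschitzOnWith K g t) (hΨ : ContDiff ℝ 1 Ψ) :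
    ∃ (K : ℝ≥0), ∃ t ∈ 𝓝 x, LipschitzOnWith K (fun y => Ψ (f y, g y)) t := by
  obtain ⟨K₁, t₁, ht₁, h₁⟩ := hf
  obtain ⟨K₂, t₂, ht₂, h₂⟩ := hg
  obtain ⟨K₃, t₃, ht₃, h₃⟩ := hΨ.locallyLipschitz (𝕂 := ℝ) (f x, g x)
  have h12 := (h₁.mono (inter_subset_left (t := t₂))).prodMk (h₂.mono (inter_subset_right (s := t₁)))
  have hc : ContinuousAt (fun y => (f y, g y)) x :=
    (h12.continuousOn.continuousAt (inter_mem ht₁ ht₂))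
  refine ⟨K₃ * max K₁ K₂, (t₁ ∩ t₂) ∩ (fun y => (f y, g y)) ⁻¹' t₃,
    inter_mem (inter_mem ht₁ ht₂) (hc ht₃), ?_⟩
  exact h₃.comp (h12.mono inter_subset_left) fun y hy => hy.2

/-- A vector field of class `C^{1,1}` near a compact set agrees there with a globally defined one
with compact support. -/
theorem IsC11Near.exists_contDiff_eq {Γ K : Set (Vec d × ℝ)} {a : Vec d × ℝ → Vec d}
    (ha : IsC11Near Γ a) (hK : IsCompact K) (hKΓ : K ⊆ Γ) :
    ∃ (b : Vec d × ℝ → Vec d) (L : ℝ≥0), ContDiff ℝ 1 b ∧ HasCompactSupport b ∧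
      LipschitzWith L (fderiv ℝ b) ∧ ∀ᶠ z in 𝓝ˢ K, b z = a z := by
  obtain ⟨U, hU, hΓU, haU, hLU⟩ := ha
  obtain ⟨χ, hχ, hχc, hχU, -, hχ1⟩ := exists_smooth_cutoff hK hU (hKΓ.trans hΓU) 2
  have hχ' : ContDiff ℝ 1 (fderiv ℝ χ) := hχ.fderiv_right (by norm_num)
  have hχ2 : ContDiff ℝ 1 χ := hχ.of_le (by norm_num)
  have haAt : ∀ z ∈ U, ContDiffAt ℝ 1 a z := fun z hz => haU.contDiffAt (hU.mem_nhds hz)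
  have hzero : ∀ z ∉ tsupport χ, (fun z => χ z • a z) =ᶠ[𝓝 z] fun _ => 0 := fun z hz => by
    filter_upwards [(isClosed_tsupport χ).isOpen_compl.mem_nhds hz] with w hw
    rw [image_eq_zero_of_notMem_tsupport hw, zero_smul]
  have hb : ContDiff ℝ 1 fun z => χ z • a z := contDiff_iff_contDiffAt.2 fun z => by
    by_cases hz : z ∈ U
    · exact hχ2.contDiffAt.smul (haAt z hz)
    · exact contDiffAt_const.congr_of_eventuallyEq (hzero z fun h => hz (hχU h))
  have hbc : HasCompactSupport fun z => χ z • a z := hχc.smul_right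
  have hloc : LocallyLipschitz (fderiv ℝ fun z => χ z • a z) := fun z => by
    by_cases hz : z ∈ U
    · have h1 : ∃ (K : ℝ≥0), ∃ t ∈ 𝓝 z, LipschitzOnWith K (fun w => (χ w, fderiv ℝ χ w)) t :=
        (hχ2.prodMk hχ').locallyLipschitz (𝕂 := ℝ) z
      have h2 : ∃ (K : ℝ≥0), ∃ t ∈ 𝓝 z, LipschitzOnWith K (fun w => (fderiv ℝ a w, a w)) t := by
        obtain ⟨K₁, t₁, ht₁, h₁⟩ := hLU hz
        rw [hU.nhdsWithin_eq hz] at ht₁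
        obtain ⟨K₂, t₂, ht₂, h₂⟩ := (haAt z hz).exists_lipschitzOnWith
        exact ⟨max K₁ K₂, t₁ ∩ t₂, inter_mem ht₁ ht₂,
          (h₁.mono inter_subset_left).prodMk (h₂.mono inter_subset_right)⟩
      have hΨ : ContDiff ℝ 1 fun p : (ℝ × ((Vec d × ℝ) →L[ℝ] ℝ)) ×
          (((Vec d × ℝ) →L[ℝ] Vec d) × Vec d) => p.1.1 • p.2.1 + p.1.2.smulRight p.2.2 :=
        (contDiff_fst.fst.smul contDiff_snd.fst).add (contDiff_fst.snd.smulRight contDiff_snd.snd)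
      obtain ⟨K, t, ht, h⟩ := exists_lipschitzOnWith_comp_prodMk h1 h2 hΨ
      refine ⟨K, t ∩ U, inter_mem ht (hU.mem_nhds hz), ?_⟩
      have hfd : ∀ w ∈ t ∩ U, fderiv ℝ (fun z => χ z • a z) w =
          χ w • fderiv ℝ a w + (fderiv ℝ χ w).smulRight (a w) := fun w hw =>
        fderiv_fun_smul (hχ2.differentiable (by norm_num) w)
          ((haAt w hw.2).differentiableAt (by norm_num))
      intro w hw w' hw'
      rw [hfd w hw, hfd w' hw']
      exact h hw.1 hw'.1
    · have h1 := (hzero z fun h => hz (hχU h)).fderiv (𝕜 := ℝ)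
      refine ⟨0, _, h1, fun w hw w' hw' => ?_⟩
      simp only [mem_ofPred_eq] at hw hw'
      rw [hw, hw']
      simp
  obtain ⟨L, hL⟩ := hloc.exists_lipschitzWith_of_hasCompactSupport (hbc.fderiv (𝕜 := ℝ))
  exact ⟨_, L, hb, hbc, hL, hχ1.mono fun z hz => by rw [hz, one_smul]⟩

theorem timeDeriv_eq_fderiv {b : Vec d × ℝ → Vec d} {z : Vec d × ℝ}
    (hb : DifferentiableAt ℝ b z) : timeDeriv b z = fderiv ℝ b z (0, 1) := by
  have h1 : HasDerivAt (fun s : ℝ => (z.1, s)) ((0 : Vec d), (1 : ℝ)) z.2 :=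
    (hasDerivAt_const _ _).prodMk (hasDerivAt_id _)
  have h2 : HasFDerivAt b (fderiv ℝ b z) (z.1, z.2) := hb.hasFDerivAt
  exact (h2.comp_hasDerivAt z.2 h1).deriv

/-- The divergence in the space variables, as a linear functional of the full Jacobi matrix. -/
noncomputable def spaceTrace (d : ℕ) : ((Vec d × ℝ) →L[ℝ] Vec d) →L[ℝ] ℝ :=
  (traceCLM d).comp
    ((ContinuousLinearMap.compL ℝ (Vec d) (Vec d × ℝ) (Vec d)).flip
      (ContinuousLinearMap.inl ℝ (Vec d) ℝ))

theorem spaceTrace_apply (A : (Vec d × ℝ) →L[ℝ] Vec d) :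
    spaceTrace d A = traceCLM d (A.comp (ContinuousLinearMap.inl ℝ (Vec d) ℝ)) := rfl

theorem hasFDerivAt_comp_prodMk_right {F : Type*} [NormedAddCommGroup F] [NormedSpace ℝ F]
    {b : Vec d × ℝ → F} {y : Vec d} {t : ℝ} (hb : DifferentiableAt ℝ b (y, t)) :
    HasFDerivAt (fun y => b (y, t))
      ((fderiv ℝ b (y, t)).comp (ContinuousLinearMap.inl ℝ (Vec d) ℝ)) y :=
  HasFDerivAt.comp y hb.hasFDerivAt (hasFDerivAt_prodMk_left y t)

theorem spaceDiv_eq_spaceTrace {b : Vec d × ℝ → Vec d} {z : Vec d × ℝ}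
    (hb : DifferentiableAt ℝ b z) : spaceDiv b z = spaceTrace d (fderiv ℝ b z) := by
  rw [spaceDiv, divergence_eq_trace, spaceTrace_apply,
    (hasFDerivAt_comp_prodMk_right (y := z.1) (t := z.2) hb).fderiv]

theorem mollify_clm_comp {E : Type*} [NormedAddCommGroup E] [NormedSpace ℝ E]
    [FiniteDimensional ℝ E] [MeasurableSpace E] [BorelSpace E] (μ : Measure E) [μ.IsAddHaarMeasure]
    {F G : Type*} [NormedAddCommGroup F] [NormedSpace ℝ F] [FiniteDimensional ℝ F]
    [NormedAddCommGroup G] [NormedSpace ℝ G] [FiniteDimensional ℝ G] (Λ : F →L[ℝ] G) {f : E → F}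
    (hf : Continuous f) (r : ℝ) (x : E) :
    mollify μ r (fun y => Λ (f y)) x = Λ (mollify μ r f x) := by
  have : CompleteSpace F := FiniteDimensional.complete ℝ F
  have : CompleteSpace G := FiniteDimensional.complete ℝ G
  rw [mollify, mollify, ← Λ.integral_comp_comm (integrable_mollifier_smul μ hf r x)]
  simp only [map_smul]

/-- Time derivative and divergence commute wherever both `b_t` and `∇·b` are differentiable, even
if the single second derivatives of `b` do not exist: mollified fields have symmetric second
derivatives, and the derivatives of the mollifications of `b_t` and `∇·b` converge. -/
theorem fderiv_spaceDiv_eq_spaceDiv_timeDeriv {b : Vec d × ℝ → Vec d} {L M : ℝ≥0}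
    (hb : ContDiff ℝ 1 b) (hbM : LipschitzWith M b) (hL : LipschitzWith L (fderiv ℝ b))
    {z : Vec d × ℝ} (ht : DifferentiableAt ℝ (timeDeriv b) z)
    (hg : DifferentiableAt ℝ (spaceDiv b) z) :
    fderiv ℝ (spaceDiv b) z (0, 1) = spaceDiv (timeDeriv b) z := by
  have hbd : ∀ z, DifferentiableAt ℝ b z := fun z => hb.differentiable (by norm_num) z
  have hc : Continuous (fderiv ℝ b) := hL.continuous
  have : (volume : Measure (Vec d × ℝ)).IsAddHaarMeasure :=
    inferInstanceAs ((volume : Measure (Vec d)).prod (volume : Measure ℝ)).IsAddHaarMeasure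
  set Λ₁ : ((Vec d × ℝ) →L[ℝ] Vec d) →L[ℝ] Vec d :=
    ContinuousLinearMap.apply ℝ (Vec d) ((0 : Vec d), (1 : ℝ)) with hΛ₁
  have h1 : timeDeriv b = fun z => Λ₁ (fderiv ℝ b z) := funext fun z => timeDeriv_eq_fderiv (hbd z)
  have h2 : spaceDiv b = fun z => spaceTrace d (fderiv ℝ b z) :=
    funext fun z => spaceDiv_eq_spaceTrace (hbd z)
  have hLt : LipschitzWith (‖Λ₁‖₊ * L) (timeDeriv b) := by rw [h1]; exact Λ₁.lipschitz.comp hL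
  have hLg : LipschitzWith (‖spaceTrace d‖₊ * L) (spaceDiv b) := by
    rw [h2]; exact (spaceTrace d).lipschitz.comp hL
  have hlim1 := hLg.tendsto_fderiv_mollify volume hg
  have hlim2 := hLt.tendsto_fderiv_mollify volume ht
  have hlim3 : Tendsto (fun r => fderiv ℝ (mollify volume r (spaceDiv b)) z ((0 : Vec d), (1 : ℝ)))
      (𝓝[>] 0) (𝓝 (fderiv ℝ (spaceDiv b) z (0, 1))) := by
    have h := ((ContinuousLinearMap.apply ℝ ℝ ((0 : Vec d), (1 : ℝ))).continuous.tendsto _).comp hlim1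
    exact h
  have hlim4 : Tendsto (fun r => spaceTrace d (fderiv ℝ (mollify volume r (timeDeriv b)) z))
      (𝓝[>] 0) (𝓝 (spaceDiv (timeDeriv b) z)) := by
    rw [spaceDiv_eq_spaceTrace ht]
    have h := ((spaceTrace d).continuous.tendsto _).comp hlim2
    exact h
  refine tendsto_nhds_unique (hlim3.congr' ?_) hlim4
  filter_upwards [self_mem_nhdsWithin] with r hr
  have hr' : (0 : ℝ) < r := hr
  set β := mollify volume r b with hβ
  have hβ2 : ContDiff ℝ 2 β := contDiff_mollify volume hr' hb.continuous (n := 2)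
  have hβ' : mollify volume r (fderiv ℝ b) = fderiv ℝ β := funext fun w => by
    rw [hβ, (hbM.hasFDerivAt_mollify volume hr'.ne' w).fderiv]
    rfl
  have hβd : DifferentiableAt ℝ (fderiv ℝ β) z :=
    (hβ2.fderiv_right (m := 1) (by norm_num)).differentiable (by norm_num) z
  have e1 : mollify volume r (timeDeriv b) = fun w => Λ₁ (fderiv ℝ β w) := funext fun w => by
    rw [h1, mollify_clm_comp volume Λ₁ hc, hβ']
  have e2 : mollify volume r (spaceDiv b) = fun w => spaceTrace d (fderiv ℝ β w) :=
    funext fun w => by rw [h2, mollify_clm_comp volume (spaceTrace d) hc, hβ']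
  have e3 : fderiv ℝ (fun w => Λ₁ (fderiv ℝ β w)) z = Λ₁.comp (fderiv ℝ (fderiv ℝ β) z) :=
    (Λ₁.hasFDerivAt.comp z hβd.hasFDerivAt).fderiv
  have e4 : fderiv ℝ (fun w => spaceTrace d (fderiv ℝ β w)) z =
      (spaceTrace d).comp (fderiv ℝ (fderiv ℝ β) z) :=
    ((spaceTrace d).hasFDerivAt.comp z hβd.hasFDerivAt).fderiv
  have hsymm : IsSymmSndFDerivAt ℝ β z := hβ2.contDiffAt.isSymmSndFDerivAt (by simp)
  rw [e1, e2, e3, e4, ContinuousLinearMap.comp_apply]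
  congr 1
  refine ContinuousLinearMap.ext fun v => ?_
  exact hsymm _ _

end Field

/-! ### Deformations close to the identity -/

section FirstVariation
variable {d : ℕ} {D : Set (Vec d)}

/-- A globally defined time dependent vector field of class `C^{1,1}` whose time derivative and
spatial divergence are bounded; a single constant `C` serves for all bounds. -/
structure HasFieldBounds (b : Vec d × ℝ → Vec d) (C : ℝ≥0) : Prop where
  contDiff : ContDiff ℝ 1 b
  lipschitz : LipschitzWith C b
  lipschitz_fderiv : LipschitzWith C (fderiv ℝ b)
  lipschitz_timeDeriv : LipschitzWith C (timeDeriv b)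
  norm_timeDeriv_le : ∀ z, ‖timeDeriv b z‖ ≤ C
  lipschitz_spaceDiv : LipschitzWith C (spaceDiv b)
  norm_spaceDiv_le : ∀ z, ‖spaceDiv b z‖ ≤ C

theorem HasCompactSupport.exists_hasFieldBounds {b : Vec d × ℝ → Vec d} (hb : ContDiff ℝ 1 b)
    (hbc : HasCompactSupport b) {L : ℝ≥0} (hL : LipschitzWith L (fderiv ℝ b)) :
    ∃ C, HasFieldBounds b C := by
  obtain ⟨C₁, hC₁⟩ := ContDiff.lipschitzWith_of_hasCompactSupport hbc hb (by norm_num)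
  have hC₁' : ∀ z, ‖fderiv ℝ b z‖ ≤ C₁ := fun z => norm_fderiv_le_of_lipschitz ℝ hC₁
  have hbd : ∀ z, DifferentiableAt ℝ b z := fun z => hb.differentiable (by norm_num) z
  set Λ₁ : ((Vec d × ℝ) →L[ℝ] Vec d) →L[ℝ] Vec d :=
    ContinuousLinearMap.apply ℝ (Vec d) ((0 : Vec d), (1 : ℝ)) with hΛ₁
  have h1 : timeDeriv b = fun z => Λ₁ (fderiv ℝ b z) := funext fun z => timeDeriv_eq_fderiv (hbd z)
  have h2 : spaceDiv b = fun z => spaceTrace d (fderiv ℝ b z) :=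
    funext fun z => spaceDiv_eq_spaceTrace (hbd z)
  set N : ℝ≥0 := 1 + ‖Λ₁‖₊ + ‖spaceTrace d‖₊ with hN
  set P : ℝ≥0 := C₁ + L with hP
  have h1N : (1 : ℝ≥0) ≤ N := by rw [hN, add_assoc]; exact le_self_add
  have hΛN : ‖Λ₁‖₊ ≤ N := by rw [hN, add_right_comm]; exact le_add_self
  have hsN : ‖spaceTrace d‖₊ ≤ N := le_add_self
  have hC₁P : C₁ ≤ P := le_self_add
  have hLP : L ≤ P := le_add_self
  have hPN : P ≤ N * P := le_mul_of_one_le_left zero_le h1N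
  have hop : ∀ {G : Type} [NormedAddCommGroup G] [NormedSpace ℝ G]
      (Λ : ((Vec d × ℝ) →L[ℝ] Vec d) →L[ℝ] G), ‖Λ‖₊ ≤ N → ∀ z, ‖Λ (fderiv ℝ b z)‖ ≤ (N * P : ℝ≥0) :=
    fun Λ hΛ z => (Λ.le_opNorm _).trans (by
      rw [NNReal.coe_mul]
      exact mul_le_mul (NNReal.coe_le_coe.2 hΛ) ((hC₁' z).trans (NNReal.coe_le_coe.2 hC₁P))
        (norm_nonneg _) N.2)
  refine ⟨N * P, hb, hC₁.weaken (hC₁P.trans hPN), hL.weaken (hLP.trans hPN), ?_,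
    fun z => ?_, ?_, fun z => ?_⟩
  · rw [h1]
    exact (Λ₁.lipschitz.comp hL).weaken (mul_le_mul' hΛN hLP)
  · rw [h1]
    exact hop Λ₁ hΛN z
  · rw [h2]
    exact ((spaceTrace d).lipschitz.comp hL).weaken (mul_le_mul' hsN hLP)
  · rw [h2]
    exact hop (spaceTrace d) hsN z

/-- A family of deformations on a time interval so short that every `T t` is close to the identity:
it is injective with positive Jacobian, and the deformed domains are Lipschitz domains. -/
structure IsNearIdentity (D : Set (Vec d)) (T : ℝ → Vec d → Vec d) (δ : ℝ) (K : ℝ≥0) : Prop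
    extends HasTimeEstimates D T δ K where
  mul_le_one : K * δ ≤ 1
  dist_le : ∀ t ∈ Ioo (-δ) δ, ∀ x ∈ D, ∀ y ∈ D, dist x y ≤ (2 : ℝ≥0) * dist (T t x) (T t y)
  norm_fderiv_sub_id_le : ∀ᵐ x ∂(volume.restrict D), ∀ t ∈ Ioo (-δ) δ,
    ‖fderiv ℝ (T t) x - ContinuousLinearMap.id ℝ (Vec d)‖ ≤ K * ‖t‖
  det_pos : ∀ᵐ x ∂(volume.restrict D), ∀ t ∈ Ioo (-δ) δ, 0 < (fderiv ℝ (T t) x).det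
  isLipschitzDomain_image : ∀ t ∈ Ioo (-δ) δ, IsLipschitzDomain (T t '' D)
  isBounded_image : ∀ t ∈ Ioo (-δ) δ, Bornology.IsBounded (T t '' D)
  exists_norm_sub_le : ∀ t ∈ Ioo (-δ) δ, ∀ y ∈ frontier (T t '' D),
    ∃ x ∈ frontier D, ‖y - x‖ ≤ K * ‖t‖

theorem HasTimeEstimates.mono {T : ℝ → Vec d → Vec d} {δ δ' : ℝ} {K : ℝ≥0}
    (hT : HasTimeEstimates D T δ K) (hδ' : 0 < δ') (h : δ' ≤ δ) : HasTimeEstimates D T δ' K := by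
  have hI : Ioo (-δ') δ' ⊆ Ioo (-δ) δ := Ioo_subset_Ioo (by linarith) h
  exact
    { pos := hδ'
      zero := hT.zero
      hasDerivAt := fun x hx t ht => hT.hasDerivAt x hx t (hI ht)
      hasDerivAt_velocity := hT.hasDerivAt_velocity
      lipschitz_sub := fun s hs t ht => hT.lipschitz_sub s (hI hs) t (hI ht)
      norm_sub_le := fun s hs t ht => hT.norm_sub_le s (hI hs) t (hI ht)
      lipschitz_velocity := fun t ht => hT.lipschitz_velocity t (hI ht)
      norm_velocity_le := fun t ht => hT.norm_velocity_le t (hI ht)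
      lipschitz_velocity_sub := fun s hs t ht => hT.lipschitz_velocity_sub s (hI hs) t (hI ht)
      norm_velocity_sub_le := fun s hs t ht => hT.norm_velocity_sub_le s (hI hs) t (hI ht)
      hasDerivAt_fderiv := fun t ht => hT.hasDerivAt_fderiv t (hI ht)
      differentiableAt := hT.differentiableAt.mono fun _ hx t ht => hx t (hI ht) }

/-- For small `t` the extension of `T t` to the whole space is a homeomorphism close to the
identity, so that the image of the domain is a Lipschitz domain with boundary `T t (∂D)`. -/
theorem HasTimeEstimates.exists_isNearIdentity {T : ℝ → Vec d → Vec d} {δ : ℝ} {K : ℝ≥0}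
    (hT : HasTimeEstimates D T δ K) (hD : IsLipschitzDomain D) (hb : Bornology.IsBounded D) :
    ∃ δ' ≤ δ, IsNearIdentity D T δ' K := by
  obtain ⟨K', T', S', R', hE⟩ := hT.exists_isFlowExtension
  obtain ⟨η, hη0, hη1, hη⟩ := hD.exists_isLipschitzDomain_image hb
  obtain ⟨ρ, hρ0, hρ⟩ := exists_det_pos_of_norm_sub_id_le d
  -- the displacement has Lipschitz constant at most `m`: `1/2` yields injectivity, `η` the
  -- Lipschitz property of the image and `ρ` a positive Jacobian
  set m : ℝ := min (min (1 / 2) η) ρ with hm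
  have hm0 : 0 < m := lt_min (lt_min (by norm_num) (by exact_mod_cast hη0)) hρ0
  have hm2 : m ≤ 1 / 2 := (min_le_left _ _).trans (min_le_left _ _)
  have hmη : m ≤ η := (min_le_left _ _).trans (min_le_right _ _)
  have hmρ : m ≤ ρ := min_le_right _ _
  set δ' : ℝ := min δ (m / (K + K' + 1)) with hδ'
  have hKK : (0 : ℝ) < K + K' + 1 := by positivity
  have hδ0 : 0 < δ' := lt_min hT.pos (by positivity)
  have hδ'm : (K + K' + 1) * δ' ≤ m := by
    calc (K + K' + 1) * δ' ≤ (K + K' + 1) * (m / (K + K' + 1)) := by gcongr; exact min_le_right _ _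
      _ = m := by field_simp
  have hKδ : K * δ' ≤ m := by
    have : 0 ≤ (K' + 1) * δ' := by positivity
    linarith
  have hK'δ : K' * δ' ≤ m := by
    have : 0 ≤ (K + 1) * δ' := by positivity
    linarith
  have hT' := hT.mono hδ0 (min_le_left _ _)
  have h0 : (0 : ℝ) ∈ Ioo (-δ') δ' := ⟨by linarith, hδ0⟩
  have hI : Ioo (-δ') δ' ⊆ Ioo (-δ) δ :=
    Ioo_subset_Ioo (neg_le_neg (min_le_left _ _)) (min_le_left _ _)
  have hnorm : ∀ t ∈ Ioo (-δ') δ', ‖t‖ ≤ δ' := fun t ht => by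
    rw [Real.norm_eq_abs]; exact (abs_lt.2 ht).le
  have hlip : ∀ t ∈ Ioo (-δ') δ', LipschitzOnWith (K * ‖t‖₊) (fun x => T t x - x) D :=
    fun t ht => by
      have h1 := hT'.lipschitz_sub 0 h0 t ht
      rw [sub_zero] at h1
      refine LipschitzOnWith.of_dist_le_mul fun x hx y hy => ?_
      have h2 := h1.dist_le_mul x hx y hy
      simp only [hT.zero x hx, hT.zero y hy] at h2
      exact h2
  have hfd : ∀ᵐ x ∂(volume.restrict D), ∀ t ∈ Ioo (-δ') δ',
      ‖fderiv ℝ (T t) x - ContinuousLinearMap.id ℝ (Vec d)‖ ≤ K * ‖t‖ := by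
    filter_upwards [hT'.differentiableAt, ae_restrict_mem hD.1.measurableSet] with x hx hxD t ht
    have h1 := (hlip t ht).norm_fderiv_le_of_isOpen hD.1 hxD
    rw [fderiv_fun_sub (hx t ht) differentiableAt_fun_id, fderiv_fun_id] at h1
    exact h1
  have hhomeo : ∀ t ∈ Ioo (-δ') δ', ∃ h : Vec d ≃ₜ Vec d, ⇑h = T' t ∧ h '' D = T t '' D ∧
      IsLipschitzDomain (T t '' D) := fun t ht => by
    have h1 : LipschitzWith η fun x => T' t x - x :=
      (hE.lipschitz_sub_id t (hI ht)).weaken (by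
        rw [← NNReal.coe_le_coe, NNReal.coe_mul, coe_nnnorm]
        refine le_trans ?_ (hK'δ.trans hmη)
        gcongr
        exact hnorm t ht)
    obtain ⟨h, hh⟩ := exists_homeomorph_of_lipschitzWith_sub hη1 h1
    have h2 : h '' D = T t '' D := by
      rw [hh]; exact image_congr (hE.eqOn t (hI ht))
    exact ⟨h, hh, h2, h2 ▸ hη h (by rw [hh]; exact h1)⟩
  refine ⟨δ', min_le_left _ _, ⟨hT', by linarith, fun t ht x hx y hy => ?_, hfd, ?_,
    fun t ht => ?_, fun t ht => ?_, fun t ht y hy => ?_⟩⟩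
  · have h1 := (hlip t ht).dist_le_mul x hx y hy
    have h2 : (K * ‖t‖₊ : ℝ≥0) * dist x y ≤ 1 / 2 * dist x y := by
      gcongr
      rw [NNReal.coe_mul, coe_nnnorm]
      exact (mul_le_mul_of_nonneg_left (hnorm t ht) K.2).trans (hKδ.trans hm2)
    have h3 : dist x y ≤ dist (T t x) (T t y) + dist (T t x - x) (T t y - y) := by
      rw [dist_eq_norm, dist_eq_norm, dist_eq_norm]
      calc ‖x - y‖ = ‖(T t x - T t y) - (T t x - x - (T t y - y))‖ := by congr 1; abel
        _ ≤ _ := _root_.norm_sub_le _ _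
    push_cast
    linarith
  · filter_upwards [hfd] with x hx t ht
    refine hρ _ ((hx t ht).trans ?_)
    exact (mul_le_mul_of_nonneg_left (hnorm t ht) K.2).trans (hKδ.trans hmρ)
  · obtain ⟨_, _, _, h⟩ := hhomeo t ht
    exact h
  · obtain ⟨C, hC⟩ := hb.exists_norm_le
    refine isBounded_iff_forall_norm_le.2 ⟨K * ‖t‖ + C, ?_⟩
    rintro _ ⟨x, hx, rfl⟩
    have h1 := hT'.norm_sub_le 0 h0 t ht x hx
    rw [hT.zero x hx, sub_zero] at h1
    calc ‖T t x‖ = ‖T t x - x + x‖ := by rw [sub_add_cancel]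
      _ ≤ _ := (norm_add_le _ _).trans (add_le_add h1 (hC x hx))
  · obtain ⟨h, hh, h2, -⟩ := hhomeo t ht
    rw [← h2, ← h.image_frontier] at hy
    obtain ⟨x, hx, rfl⟩ := hy
    refine ⟨x, hx, ?_⟩
    have hcl : IsClosed {x | ‖h x - x‖ ≤ K * ‖t‖} :=
      isClosed_le (h.continuous.sub continuous_id).norm continuous_const
    refine closure_minimal (t := {x | ‖h x - x‖ ≤ K * ‖t‖}) (fun x hx => ?_) hcl
      (frontier_subset_closure hx)
    have h3 := hT'.norm_sub_le 0 h0 t ht x hx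
    rw [hT.zero x hx, sub_zero] at h3
    simp only [mem_ofPred_eq]
    rw [hh, hE.eqOn t (hI ht) hx]
    exact h3

end FirstVariation

/-! ### The first derivative of the flux -/

section FirstDerivative
variable {d : ℕ} {D : Set (Vec d)} {T : ℝ → Vec d → Vec d} {δ : ℝ} {K : ℝ≥0}

theorem integrableOn_traceCLM_comp_fderiv (hD : IsOpen D) (hfin : volume D ≠ ⊤)
    {M : Vec d → Vec d →L[ℝ] Vec d} {B : ℝ} (hM : AEStronglyMeasurable M (volume.restrict D))
    (hB : ∀ᵐ x ∂(volume.restrict D), ‖M x‖ ≤ B) {f : Vec d → Vec d} {L : ℝ≥0}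
    (hf : LipschitzOnWith L f D) :
    IntegrableOn (fun x => traceCLM d ((M x).comp (fderiv ℝ f x))) D := by
  have hc : Continuous fun p : (Vec d →L[ℝ] Vec d) × (Vec d →L[ℝ] Vec d) =>
      traceCLM d (p.1.comp p.2) := by fun_prop
  refine IntegrableOn.of_bound (lt_top_iff_ne_top.2 hfin)
    (hc.comp_aestronglyMeasurable
      (hM.prodMk (measurable_fderiv ℝ f).stronglyMeasurable.aestronglyMeasurable))
    (‖traceCLM d‖ * (B * L)) ?_
  filter_upwards [hB, ae_restrict_mem hD.measurableSet] with x hx hxD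
  refine ((traceCLM d).le_opNorm _).trans ?_
  gcongr
  have h1 := hf.norm_fderiv_le_of_isOpen hD hxD
  exact (ContinuousLinearMap.opNorm_comp_le _ _).trans
    (mul_le_mul hx h1 (norm_nonneg _) ((norm_nonneg _).trans hx))

theorem traceCLM_cofactorMap_comp_smulRight (A : Vec d →L[ℝ] Vec d) (φ : Vec d →L[ℝ] ℝ)
    (v : Vec d) :
    traceCLM d ((cofactorMap A).comp ((φ.comp A).smulRight v)) = A.det * φ v := by
  have h1 : (cofactorMap A).comp ((φ.comp A).smulRight v) =
      (φ.comp A).smulRight (cofactorMap A v) :=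
    ContinuousLinearMap.ext fun w => by simp
  have h2 : A (cofactorMap A v) = A.det • v := by
    have h3 := congrArg (fun B : Vec d →L[ℝ] Vec d => B v) (comp_cofactorMap A)
    exact h3
  rw [h1, traceCLM_smulRight, ContinuousLinearMap.comp_apply, h2, map_smul, smul_eq_mul]

/-- If `A = DT` and `B` is the Jacobi matrix of a field at the image point, this expresses its
divergence, multiplied by the Jacobian, through the derivative of the pulled back field. -/
theorem traceCLM_cofactorMap_comp_comp (A B : Vec d →L[ℝ] Vec d) :
    traceCLM d ((cofactorMap A).comp (B.comp A)) = A.det * traceCLM d B := by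
  rw [← ContinuousLinearMap.comp_assoc, traceCLM_comm, ← ContinuousLinearMap.comp_assoc,
    comp_cofactorMap, ContinuousLinearMap.smul_comp, ContinuousLinearMap.id_comp, map_smul,
    smul_eq_mul]

namespace IsNearIdentity

theorem mul_norm_le_one (h : IsNearIdentity D T δ K) {t : ℝ} (ht : t ∈ Ioo (-δ) δ) :
    K * ‖t‖ ≤ 1 := by
  refine le_trans ?_ h.mul_le_one
  gcongr
  rw [Real.norm_eq_abs]
  exact (abs_lt.2 ht).le

theorem zero_mem (h : IsNearIdentity D T δ K) : (0 : ℝ) ∈ Ioo (-δ) δ :=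
  ⟨by linarith [h.pos], h.pos⟩

theorem lipschitzOnWith (h : IsNearIdentity D T δ K) {t : ℝ} (ht : t ∈ Ioo (-δ) δ) :
    LipschitzOnWith 2 (T t) D := by
  have h1 := h.lipschitz_sub 0 h.zero_mem t ht
  rw [sub_zero] at h1
  refine LipschitzOnWith.of_dist_le_mul fun x hx y hy => ?_
  have h2 := h1.dist_le_mul x hx y hy
  simp only [h.zero x hx, h.zero y hy] at h2
  have h3 : (K * ‖t‖₊ : ℝ≥0) * dist x y ≤ 1 * dist x y := by
    gcongr
    rw [NNReal.coe_mul, coe_nnnorm]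
    exact h.mul_norm_le_one ht
  have h4 : dist (T t x) (T t y) ≤ dist (T t x - x) (T t y - y) + dist x y := by
    rw [dist_eq_norm, dist_eq_norm, dist_eq_norm]
    calc ‖T t x - T t y‖ = ‖(T t x - x - (T t y - y)) + (x - y)‖ := by congr 1; abel
      _ ≤ _ := norm_add_le _ _
  push_cast
  linarith

theorem injOn (h : IsNearIdentity D T δ K) {t : ℝ} (ht : t ∈ Ioo (-δ) δ) : InjOn (T t) D :=
  fun x hx y hy hxy => by
    have h1 := h.dist_le t ht x hx y hy
    rw [hxy, dist_self, mul_zero] at h1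
    exact dist_le_zero.1 h1

theorem norm_fderiv_le (h : IsNearIdentity D T δ K) :
    ∀ᵐ x ∂(volume.restrict D), ∀ t ∈ Ioo (-δ) δ, ‖fderiv ℝ (T t) x‖ ≤ 2 := by
  filter_upwards [h.norm_fderiv_sub_id_le] with x hx t ht
  calc ‖fderiv ℝ (T t) x‖ = ‖(fderiv ℝ (T t) x - ContinuousLinearMap.id ℝ (Vec d)) +
        ContinuousLinearMap.id ℝ (Vec d)‖ := by rw [sub_add_cancel]
    _ ≤ ‖fderiv ℝ (T t) x - ContinuousLinearMap.id ℝ (Vec d)‖ +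
        ‖ContinuousLinearMap.id ℝ (Vec d)‖ := norm_add_le _ _
    _ ≤ 1 + 1 := add_le_add ((hx t ht).trans (h.mul_norm_le_one ht))
        ContinuousLinearMap.norm_id_le
    _ = 2 := by norm_num

theorem norm_fderiv_sub_le (h : IsNearIdentity D T δ K) (hD : IsOpen D) :
    ∀ᵐ x ∂(volume.restrict D), ∀ s ∈ Ioo (-δ) δ, ∀ t ∈ Ioo (-δ) δ,
      ‖fderiv ℝ (T t) x - fderiv ℝ (T s) x‖ ≤ K * ‖t - s‖ := by
  filter_upwards [h.differentiableAt, ae_restrict_mem hD.measurableSet] with x hx hxD s hs t ht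
  have h1 := (h.lipschitz_sub s hs t ht).norm_fderiv_le_of_isOpen hD hxD
  rw [fderiv_fun_sub (hx t ht) (hx s hs)] at h1
  exact h1

theorem integrableOn_det_mul (h : IsNearIdentity D T δ K) (hD : IsOpen D) (hfin : volume D ≠ ⊤)
    {t : ℝ} (ht : t ∈ Ioo (-δ) δ) {γ : Vec d → ℝ} {C : ℝ} (hγ : Continuous γ)
    (hγC : ∀ y, ‖γ y‖ ≤ C) :
    IntegrableOn (fun x => (fderiv ℝ (T t) x).det * γ (T t x)) D := by
  obtain ⟨C₀, -, hC₀, -⟩ := exists_det_cofactorMap_bounds d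
  have h1 : Measurable fun x => (fderiv ℝ (T t) x).det :=
    ContinuousLinearMap.continuous_det.measurable.comp (measurable_fderiv ℝ (T t))
  have h2 : AEStronglyMeasurable (fun x => γ (T t x)) (volume.restrict D) :=
    (hγ.comp_continuousOn (h.lipschitzOnWith ht).continuousOn).aestronglyMeasurable
      hD.measurableSet
  refine IntegrableOn.of_bound (lt_top_iff_ne_top.2 hfin)
    (h1.stronglyMeasurable.aestronglyMeasurable.mul h2) (C₀ * C) ?_
  filter_upwards [h.norm_fderiv_le] with x hx
  rw [norm_mul]
  exact mul_le_mul (hC₀ _ (hx t ht)).1 (hγC _) (norm_nonneg _) C₀.2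

theorem aestronglyMeasurable_cofactorMap (T : ℝ → Vec d → Vec d) (D : Set (Vec d)) (t : ℝ) :
    AEStronglyMeasurable (fun x => cofactorMap (fderiv ℝ (T t) x)) (volume.restrict D) :=
  (continuous_cofactorMap.measurable.comp
    (measurable_fderiv ℝ (T t))).stronglyMeasurable.aestronglyMeasurable

theorem exists_norm_cofactorMap_le (h : IsNearIdentity D T δ K) :
    ∃ C : ℝ≥0, ∀ᵐ x ∂(volume.restrict D), ∀ t ∈ Ioo (-δ) δ,
      ‖cofactorMap (fderiv ℝ (T t) x)‖ ≤ C := by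
  obtain ⟨C₀, -, hC₀, -⟩ := exists_det_cofactorMap_bounds d
  refine ⟨C₀, ?_⟩
  filter_upwards [h.norm_fderiv_le] with x hx t ht using (hC₀ _ (hx t ht)).2

theorem lipschitzOnWith_smul_velocity (h : IsNearIdentity D T δ K) {γ : Vec d → ℝ} {C : ℝ≥0}
    (hγ : LipschitzWith C γ) (hγC : ∀ y, ‖γ y‖ ≤ C) {t : ℝ} (ht : t ∈ Ioo (-δ) δ) :
    LipschitzOnWith (C * K + C * 2 * K) (fun x => γ (T t x) • flowVelocity T t x) D := by
  have hγT : LipschitzOnWith (C * 2) (fun x => γ (T t x)) D :=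
    hγ.comp_lipschitzOnWith (h.lipschitzOnWith ht)
  refine LipschitzOnWith.of_dist_le_mul fun x hx y hy => ?_
  have h1 := hγT.dist_le_mul x hx y hy
  have h2 := (h.lipschitz_velocity t ht).dist_le_mul x hx y hy
  have h3 := h.norm_velocity_le t ht y hy
  rw [dist_eq_norm] at h1 h2 ⊢
  calc ‖γ (T t x) • flowVelocity T t x - γ (T t y) • flowVelocity T t y‖
      = ‖γ (T t x) • (flowVelocity T t x - flowVelocity T t y) +
        (γ (T t x) - γ (T t y)) • flowVelocity T t y‖ := by
        congr 1; rw [smul_sub, sub_smul]; abel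
    _ ≤ ‖γ (T t x)‖ * ‖flowVelocity T t x - flowVelocity T t y‖ +
        ‖γ (T t x) - γ (T t y)‖ * ‖flowVelocity T t y‖ := by
        refine (norm_add_le _ _).trans ?_
        rw [norm_smul, norm_smul]
    _ ≤ C * (K * dist x y) + ((C * 2 : ℝ≥0) * dist x y) * K :=
        add_le_add (mul_le_mul (hγC _) h2 (norm_nonneg _) C.2)
          (mul_le_mul h1 h3 (norm_nonneg _) (by positivity))
    _ = _ := by push_cast; ring

/-- The derivative of the integral of a fixed Lipschitz function over the deformed domain, written
as an integral over the original domain. -/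
theorem hasDerivAt_integral_det_mul (h : IsNearIdentity D T δ K) (hD : IsOpen D)
    (hfin : volume D ≠ ⊤) {γ : Vec d → ℝ} {C : ℝ≥0} (hγ : LipschitzWith C γ)
    (hγC : ∀ y, ‖γ y‖ ≤ C) {t : ℝ} (ht : t ∈ Ioo (-δ) δ) :
    HasDerivAt (fun u => ∫ x in D, (fderiv ℝ (T u) x).det * γ (T u x))
      (∫ x in D, traceCLM d ((cofactorMap (fderiv ℝ (T t) x)).comp
        (fderiv ℝ (fun x => γ (T t x) • flowVelocity T t x) x))) t := by
  obtain ⟨C₀, hdet, hC₀, -⟩ := exists_det_cofactorMap_bounds d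
  obtain ⟨C₁, hC₁⟩ := h.exists_norm_cofactorMap_le
  have hLip := h.lipschitzOnWith_smul_velocity hγ hγC ht
  have hint := integrableOn_traceCLM_comp_fderiv hD hfin (aestronglyMeasurable_cofactorMap T D t)
    (hC₁.mono fun x hx => hx t ht) hLip
  refine (hasDerivAt_integral_of_dominated_loc_of_lip (s := Ioo (-δ) δ)
    (μ := volume.restrict D) (F := fun u x => (fderiv ℝ (T u) x).det * γ (T u x))
    (bound := fun _ => ((C₀ * K * C + C₀ * (C * K) : ℝ≥0) : ℝ)) (isOpen_Ioo.mem_nhds ht) ?_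
    (h.integrableOn_det_mul hD hfin ht hγ.continuous hγC) hint.aestronglyMeasurable ?_
    (integrableOn_const hfin) ?_).2
  · filter_upwards [isOpen_Ioo.mem_nhds ht] with u hu
    exact (h.integrableOn_det_mul hD hfin hu hγ.continuous hγC).aestronglyMeasurable
  · filter_upwards [h.norm_fderiv_le, h.norm_fderiv_sub_le hD,
      ae_restrict_mem hD.measurableSet] with x hx hx2 hxD
    refine LipschitzOnWith.of_dist_le_mul fun u hu s hs => ?_
    have h1 : ‖(fderiv ℝ (T u) x).det - (fderiv ℝ (T s) x).det‖ ≤ C₀ * (K * ‖u - s‖) :=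
      (hdet _ _ (hx u hu) (hx s hs)).trans (mul_le_mul_of_nonneg_left (hx2 s hs u hu) C₀.2)
    have h2 : ‖γ (T u x) - γ (T s x)‖ ≤ C * (K * ‖u - s‖) := by
      have h3 := hγ.dist_le_mul (T u x) (T s x)
      rw [dist_eq_norm, dist_eq_norm] at h3
      exact h3.trans (mul_le_mul_of_nonneg_left (h.norm_sub_le s hs u hu x hxD) C.2)
    rw [dist_eq_norm, dist_eq_norm, Real.coe_nnabs, abs_of_nonneg (NNReal.coe_nonneg _)]
    calc ‖(fderiv ℝ (T u) x).det * γ (T u x) - (fderiv ℝ (T s) x).det * γ (T s x)‖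
        = ‖((fderiv ℝ (T u) x).det - (fderiv ℝ (T s) x).det) * γ (T u x) +
          (fderiv ℝ (T s) x).det * (γ (T u x) - γ (T s x))‖ := by congr 1; ring
      _ ≤ ‖(fderiv ℝ (T u) x).det - (fderiv ℝ (T s) x).det‖ * ‖γ (T u x)‖ +
          ‖(fderiv ℝ (T s) x).det‖ * ‖γ (T u x) - γ (T s x)‖ := by
          refine (norm_add_le _ _).trans ?_
          rw [norm_mul, norm_mul]
      _ ≤ C₀ * (K * ‖u - s‖) * C + C₀ * (C * (K * ‖u - s‖)) :=
          add_le_add (mul_le_mul h1 (hγC _) (norm_nonneg _) (by positivity))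
            (mul_le_mul (hC₀ _ (hx s hs)).1 h2 (norm_nonneg _) C₀.2)
      _ = _ := by push_cast; ring
  · filter_upwards [h.det_pos, h.differentiableAt, ae_restrict_mem hD.measurableSet,
      h.hasDerivAt_fderiv t ht, (h.lipschitz_velocity t ht).ae_differentiableAt_of_isOpen hD,
      ae_comp_of_antilipschitz (h.dist_le t ht) hγ.ae_differentiableAt hD.measurableSet]
      with x hx1 hx2 hxD hx3 hx4 hx5
    have h1 := hx3.det_clm (hx1 t ht).ne'
    have h2 : HasDerivAt (fun u => γ (T u x)) (fderiv ℝ γ (T t x) (flowVelocity T t x)) t :=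
      hx5.hasFDerivAt.comp_hasDerivAt t (h.hasDerivAt x hxD t ht)
    have h3 : HasFDerivAt (fun x => γ (T t x)) ((fderiv ℝ γ (T t x)).comp (fderiv ℝ (T t) x)) x :=
      hx5.hasFDerivAt.comp x (hx2 t ht).hasFDerivAt
    have h4 := (h3.fun_smul hx4.hasFDerivAt).fderiv
    have h5 := h1.fun_mul h2
    rw [h4, ContinuousLinearMap.comp_add, map_add, traceCLM_cofactorMap_comp_smulRight,
      ContinuousLinearMap.comp_smul, map_smul, smul_eq_mul, mul_comm (γ (T t x))]
    exact h5

end IsNearIdentity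

theorem HasFieldBounds.differentiableAt {b : Vec d × ℝ → Vec d} {C : ℝ≥0}
    (hb : HasFieldBounds b C) (z : Vec d × ℝ) : DifferentiableAt ℝ b z :=
  hb.contDiff.differentiable (by norm_num) z

theorem HasFieldBounds.hasDerivAt {b : Vec d × ℝ → Vec d} {C : ℝ≥0} (hb : HasFieldBounds b C)
    (y : Vec d) (t : ℝ) : HasDerivAt (fun s => b (y, s)) (timeDeriv b (y, t)) t := by
  have h1 : HasDerivAt (fun s : ℝ => (y, s)) ((0 : Vec d), (1 : ℝ)) t :=
    (hasDerivAt_const _ _).prodMk (hasDerivAt_id _)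
  have h2 : DifferentiableAt ℝ (fun s => b (y, s)) t :=
    ((hb.differentiableAt (y, t)).hasFDerivAt.comp_hasDerivAt t h1).differentiableAt
  exact h2.hasDerivAt

theorem dist_prodMk_right {X Y : Type*} [PseudoMetricSpace X] [PseudoMetricSpace Y] (x : X)
    (s t : Y) : dist (x, s) (x, t) = dist s t := by
  rw [Prod.dist_eq, dist_self]
  exact max_eq_right dist_nonneg

theorem dist_prodMk_left {X Y : Type*} [PseudoMetricSpace X] [PseudoMetricSpace Y] (x y : X)
    (t : Y) : dist (x, t) (y, t) = dist x y := by
  rw [Prod.dist_eq, dist_self]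
  exact max_eq_left dist_nonneg

theorem LipschitzWith.comp_prodMk_left {X Y F : Type*} [PseudoMetricSpace X] [PseudoMetricSpace Y]
    [PseudoMetricSpace F] {g : X × Y → F} {C : ℝ≥0} (hg : LipschitzWith C g) (t : Y) :
    LipschitzWith C fun x => g (x, t) :=
  LipschitzWith.of_dist_le_mul fun x y => by
    rw [← dist_prodMk_left x y t]; exact hg.dist_le_mul _ _

theorem HasFieldBounds.norm_slope_sub_timeDeriv_le {b : Vec d × ℝ → Vec d} {C : ℝ≥0}
    (hb : HasFieldBounds b C) (y : Vec d) {t u : ℝ} (ht : t ∈ Ioo (-δ) δ) (hu : u ∈ Ioo (-δ) δ)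
    (hut : u ≠ t) :
    ‖(u - t)⁻¹ • (b (y, u) - b (y, t)) - timeDeriv b (y, t)‖ ≤ C * ‖u - t‖ := by
  have h1 : deriv (fun s => b (y, s)) = fun s => timeDeriv b (y, s) :=
    funext fun s => (hb.hasDerivAt y s).deriv
  have h2 := norm_slope_sub_deriv_le (g := fun s => b (y, s)) (δ := δ) (B := C)
    (fun s _ => (hb.hasDerivAt y s).differentiableAt.differentiableWithinAt)
    (fun s _ r _ => by
      rw [h1, ← dist_eq_norm, ← dist_eq_norm, ← dist_prodMk_right y r s]
      exact hb.lipschitz_timeDeriv.dist_le_mul _ _) ht hu hut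
  rw [h1] at h2
  exact h2

theorem HasFieldBounds.hasFDerivAt_left {b : Vec d × ℝ → Vec d} {C : ℝ≥0}
    (hb : HasFieldBounds b C) (y : Vec d) (t : ℝ) : HasFDerivAt (fun y => b (y, t))
      ((fderiv ℝ b (y, t)).comp (ContinuousLinearMap.inl ℝ (Vec d) ℝ)) y :=
  hasFDerivAt_comp_prodMk_right (hb.differentiableAt (y, t))

theorem HasFieldBounds.lipschitzWith_sub {b : Vec d × ℝ → Vec d} {C : ℝ≥0}
    (hb : HasFieldBounds b C) (t u : ℝ) :
    LipschitzWith (C * ‖u - t‖₊) fun y => b (y, u) - b (y, t) := by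
  have h1 : ∀ y, HasFDerivAt (fun y => b (y, u) - b (y, t)) ((fderiv ℝ b (y, u) -
      fderiv ℝ b (y, t)).comp (ContinuousLinearMap.inl ℝ (Vec d) ℝ)) y := fun y => by
    rw [ContinuousLinearMap.sub_comp]
    exact (hb.hasFDerivAt_left y u).fun_sub (hb.hasFDerivAt_left y t)
  refine lipschitzWith_of_nnnorm_fderiv_le (𝕜 := ℝ) (fun y => (h1 y).differentiableAt) fun y => ?_
  rw [(h1 y).fderiv, ← NNReal.coe_le_coe, coe_nnnorm, NNReal.coe_mul, coe_nnnorm]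
  have h2 : ‖fderiv ℝ b (y, u) - fderiv ℝ b (y, t)‖ ≤ C * ‖u - t‖ := by
    rw [← dist_eq_norm (fderiv ℝ b (y, u)) _, ← dist_eq_norm u t, ← dist_prodMk_right y u t]
    exact hb.lipschitz_fderiv.dist_le_mul _ _
  refine (ContinuousLinearMap.opNorm_comp_le _ _).trans ?_
  calc _ ≤ C * ‖u - t‖ * 1 := mul_le_mul h2 (ContinuousLinearMap.norm_inl_le_one ℝ (Vec d) ℝ)
        (norm_nonneg _) (by positivity)
    _ = _ := mul_one _

namespace IsNearIdentity

/-- The part of the derivative of `∫_{T_u D} ∇·b(·,u)` that comes from the time dependence of `b`.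
As `∇·b` need not be differentiable in time almost everywhere on a fixed time slice, the difference
quotients of `b` are used, whose derivatives converge weakly. -/
theorem tendsto_integral_det_mul_slope (h : IsNearIdentity D T δ K) (hD : IsOpen D)
    (hfin : volume D ≠ ⊤) {b : Vec d × ℝ → Vec d} {C : ℝ≥0} (hb : HasFieldBounds b C) {t : ℝ}
    (ht : t ∈ Ioo (-δ) δ) :
    Tendsto (fun u => ∫ x in D, (fderiv ℝ (T u) x).det *
        ((u - t)⁻¹ * (spaceDiv b (T u x, u) - spaceDiv b (T u x, t)))) (𝓝[≠] t)
      (𝓝 (∫ x in D, traceCLM d ((cofactorMap (fderiv ℝ (T t) x)).comp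
        (fderiv ℝ (fun x => timeDeriv b (T t x, t)) x)))) := by
  obtain ⟨C₁, hC₁⟩ := h.exists_norm_cofactorMap_le
  have hnhds : ∀ᶠ u in 𝓝[≠] t, u ∈ Ioo (-δ) δ ∧ u ≠ t := by
    filter_upwards [mem_nhdsWithin_of_mem_nhds (isOpen_Ioo.mem_nhds ht), self_mem_nhdsWithin]
      with w h1 h2 using ⟨h1, h2⟩
  have hqL : ∀ u, u ≠ t → LipschitzWith C (fun y => (u - t)⁻¹ • (b (y, u) - b (y, t))) := by
    intro u hut
    have h2 : ‖u - t‖ ≠ 0 := norm_ne_zero_iff.2 (sub_ne_zero.2 hut)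
    refine LipschitzWith.of_dist_le_mul fun x y => ?_
    have h1 := (hb.lipschitzWith_sub t u).dist_le_mul x y
    rw [dist_smul₀]
    refine (mul_le_mul_of_nonneg_left h1 (norm_nonneg _)).trans (le_of_eq ?_)
    push_cast
    rw [norm_inv]
    field_simp
  have hmain := tendsto_setIntegral_trace_comp_fderiv hD hfin (l := 𝓝[≠] t)
    (M := fun u x => cofactorMap (fderiv ℝ (T u) x))
    (M₀ := fun x => cofactorMap (fderiv ℝ (T t) x))
    (f := fun u x => (u - t)⁻¹ • (b (T u x, u) - b (T u x, t)))
    (f₀ := fun x => timeDeriv b (T t x, t)) (K := C * 2) (B := C₁) (C := C)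
    (Eventually.of_forall fun u => aestronglyMeasurable_cofactorMap T D u)
    (aestronglyMeasurable_cofactorMap T D t)
    (by filter_upwards [hnhds] with u hu using hC₁.mono fun x hx => hx u hu.1)
    (hC₁.mono fun x hx => hx t ht)
    (by
      filter_upwards [h.hasDerivAt_fderiv t ht] with x hx
      have h1 := (continuous_cofactorMap.tendsto _).comp
        (hx.continuousAt.tendsto.mono_left (nhdsWithin_le_nhds (s := {t}ᶜ)))
      exact h1)
    (by
      filter_upwards [hnhds] with u hu
      exact (hqL u hu.2).comp_lipschitzOnWith (h.lipschitzOnWith hu.1))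
    ((hb.lipschitz_timeDeriv.comp_prodMk_left t).comp_lipschitzOnWith (h.lipschitzOnWith ht))
    (by
      filter_upwards [hnhds] with u hu x _
      have h1 := hb.lipschitz.dist_le_mul (T u x, u) (T u x, t)
      rw [dist_prodMk_right, dist_eq_norm, dist_eq_norm] at h1
      have h2 : ‖u - t‖ ≠ 0 := norm_ne_zero_iff.2 (sub_ne_zero.2 hu.2)
      rw [norm_smul, norm_inv]
      refine (mul_le_mul_of_nonneg_left h1 (by positivity)).trans (le_of_eq ?_)
      field_simp)
    (fun x hx => by
      have h0 : Tendsto (fun u => (C + C * K) * ‖u - t‖) (𝓝[≠] t) (𝓝 0) := by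
        have h1 : Continuous fun u : ℝ => ((C : ℝ) + C * K) * ‖u - t‖ := by fun_prop
        have h2 := h1.tendsto t
        simp only [sub_self, norm_zero, mul_zero] at h2
        exact h2.mono_left nhdsWithin_le_nhds
      rw [tendsto_iff_norm_sub_tendsto_zero]
      refine squeeze_zero_norm' ?_ h0
      filter_upwards [hnhds] with u hu
      rw [norm_norm]
      have h1 := hb.norm_slope_sub_timeDeriv_le (T u x) ht hu.1 hu.2
      have h2 : ‖timeDeriv b (T u x, t) - timeDeriv b (T t x, t)‖ ≤ C * (K * ‖u - t‖) := by
        have h3 := hb.lipschitz_timeDeriv.dist_le_mul (T u x, t) (T t x, t)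
        rw [dist_prodMk_left, dist_eq_norm, dist_eq_norm] at h3
        exact h3.trans (mul_le_mul_of_nonneg_left (h.norm_sub_le t ht u hu.1 x hx) C.2)
      calc _ ≤ C * ‖u - t‖ + C * (K * ‖u - t‖) :=
            (norm_sub_le_norm_sub_add_norm_sub _ (timeDeriv b (T u x, t)) _).trans
              (add_le_add h1 h2)
        _ = _ := by ring)
  refine hmain.congr' ?_
  filter_upwards [hnhds] with u hu
  refine integral_congr_ae ?_
  filter_upwards [h.differentiableAt] with x hx
  have h1 := ((hb.hasFDerivAt_left (T u x) u).fun_sub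
    (hb.hasFDerivAt_left (T u x) t)).fun_const_smul (u - t)⁻¹
  have h2 := HasFDerivAt.comp x h1 (hx u hu.1).hasFDerivAt
  have h3 : fderiv ℝ (fun x => (u - t)⁻¹ • (b (T u x, u) - b (T u x, t))) x = _ := h2.fderiv
  rw [h3, traceCLM_cofactorMap_comp_comp, map_smul, map_sub, smul_eq_mul,
    spaceDiv_eq_spaceTrace (hb.differentiableAt _), spaceDiv_eq_spaceTrace (hb.differentiableAt _)]
  rfl

end IsNearIdentity

/-- The field `b_t(T_t,t) + (∇·b)(T_t,t) ∂T_t/∂t`, whose flux is the derivative of the flux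
of `b`, pulled back to the original domain. -/
noncomputable def fluxField (b : Vec d × ℝ → Vec d) (T : ℝ → Vec d → Vec d) (t : ℝ) (x : Vec d) :
    Vec d :=
  timeDeriv b (T t x, t) + spaceDiv b (T t x, t) • flowVelocity T t x

namespace IsNearIdentity

theorem lipschitzOnWith_timeDeriv (h : IsNearIdentity D T δ K) {b : Vec d × ℝ → Vec d} {C : ℝ≥0}
    (hb : HasFieldBounds b C) {t : ℝ} (ht : t ∈ Ioo (-δ) δ) :
    LipschitzOnWith (C * 2) (fun x => timeDeriv b (T t x, t)) D :=
  (hb.lipschitz_timeDeriv.comp_prodMk_left t).comp_lipschitzOnWith (h.lipschitzOnWith ht)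

theorem lipschitzOnWith_spaceDiv_smul_velocity (h : IsNearIdentity D T δ K)
    {b : Vec d × ℝ → Vec d} {C : ℝ≥0} (hb : HasFieldBounds b C) {t : ℝ} (ht : t ∈ Ioo (-δ) δ) :
    LipschitzOnWith (C * K + C * 2 * K)
      (fun x => spaceDiv b (T t x, t) • flowVelocity T t x) D :=
  h.lipschitzOnWith_smul_velocity (hb.lipschitz_spaceDiv.comp_prodMk_left t)
    (fun _ => hb.norm_spaceDiv_le _) ht

theorem lipschitzOnWith_fluxField (h : IsNearIdentity D T δ K) {b : Vec d × ℝ → Vec d} {C : ℝ≥0}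
    (hb : HasFieldBounds b C) {t : ℝ} (ht : t ∈ Ioo (-δ) δ) :
    LipschitzOnWith (C * 2 + (C * K + C * 2 * K)) (fluxField b T t) D :=
  (h.lipschitzOnWith_timeDeriv hb ht).add (h.lipschitzOnWith_spaceDiv_smul_velocity hb ht)

/-- The first derivative of the flux, written as an integral over the original domain. -/
theorem hasDerivAt_integral_det_mul_spaceDiv (h : IsNearIdentity D T δ K) (hD : IsOpen D)
    (hfin : volume D ≠ ⊤) {b : Vec d × ℝ → Vec d} {C : ℝ≥0} (hb : HasFieldBounds b C) {t : ℝ}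
    (ht : t ∈ Ioo (-δ) δ) :
    HasDerivAt (fun u => ∫ x in D, (fderiv ℝ (T u) x).det * spaceDiv b (T u x, u))
      (∫ x in D, traceCLM d ((cofactorMap (fderiv ℝ (T t) x)).comp
        (fderiv ℝ (fluxField b T t) x))) t := by
  obtain ⟨C₁, hC₁⟩ := h.exists_norm_cofactorMap_le
  have hgl := fun t => hb.lipschitz_spaceDiv.comp_prodMk_left (Y := ℝ) t
  have hI := fun {f : Vec d → Vec d} {L : ℝ≥0} (hf : LipschitzOnWith L f D) =>
    integrableOn_traceCLM_comp_fderiv hD hfin (aestronglyMeasurable_cofactorMap T D t)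
      (hC₁.mono fun x hx => hx t ht) hf
  have hL₁ := h.lipschitzOnWith_timeDeriv hb ht
  have hL₂ := h.lipschitzOnWith_spaceDiv_smul_velocity hb ht
  have hA := h.hasDerivAt_integral_det_mul hD hfin (hgl t) (fun _ => hb.norm_spaceDiv_le _) ht
  have hB := h.tendsto_integral_det_mul_slope hD hfin hb ht
  rw [hasDerivAt_iff_tendsto_slope] at hA ⊢
  have hsum : ∫ x in D, traceCLM d ((cofactorMap (fderiv ℝ (T t) x)).comp
      (fderiv ℝ (fluxField b T t) x)) =
      (∫ x in D, traceCLM d ((cofactorMap (fderiv ℝ (T t) x)).comp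
        (fderiv ℝ (fun x => timeDeriv b (T t x, t)) x))) +
      ∫ x in D, traceCLM d ((cofactorMap (fderiv ℝ (T t) x)).comp
        (fderiv ℝ (fun x => spaceDiv b (T t x, t) • flowVelocity T t x) x)) := by
    rw [← integral_add (hI hL₁) (hI hL₂)]
    refine integral_congr_ae ?_
    filter_upwards [hL₁.ae_differentiableAt_of_isOpen hD, hL₂.ae_differentiableAt_of_isOpen hD]
      with x h1 h2
    have h3 : fderiv ℝ (fluxField b T t) x = _ := fderiv_fun_add h1 h2
    rw [h3, ContinuousLinearMap.comp_add, map_add]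
  rw [hsum]
  -- the difference quotient splits into the one for the time dependence of `b`, at the point `T u x`,
  -- and the one for the moving domain, with `b` frozen at time `t`
  refine (hB.add hA).congr' ?_
  filter_upwards [mem_nhdsWithin_of_mem_nhds (isOpen_Ioo.mem_nhds ht)] with u hu
  have h1 := h.integrableOn_det_mul hD hfin hu (hgl u).continuous
    (fun _ => hb.norm_spaceDiv_le _)
  have h2 := h.integrableOn_det_mul hD hfin hu (hgl t).continuous
    (fun _ => hb.norm_spaceDiv_le _)
  have h3 : ∫ x in D, (fderiv ℝ (T u) x).det *
      ((u - t)⁻¹ * (spaceDiv b (T u x, u) - spaceDiv b (T u x, t))) = (u - t)⁻¹ *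
      ((∫ x in D, (fderiv ℝ (T u) x).det * spaceDiv b (T u x, u)) -
        ∫ x in D, (fderiv ℝ (T u) x).det * spaceDiv b (T u x, t)) := by
    rw [← integral_sub h1 h2, ← integral_const_mul]
    refine integral_congr_ae (Eventually.of_forall fun x => ?_)
    ring
  rw [h3, slope_def_field, slope_def_field]
  ring

end IsNearIdentity
end FirstDerivative

/-! ### The difference quotients of the first derivative of the flux -/

section SecondDerivative
variable {d : ℕ} {D : Set (Vec d)} {T : ℝ → Vec d → Vec d} {δ : ℝ} {K : ℝ≥0}
  {b : Vec d × ℝ → Vec d} {C : ℝ≥0}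

theorem HasFieldBounds.norm_add_smul_sub_le (hb : HasFieldBounds b C) (p q v w : Vec d) (t s : ℝ) :
    ‖timeDeriv b (p, t) + spaceDiv b (p, t) • v - (timeDeriv b (q, s) + spaceDiv b (q, s) • w)‖ ≤
      C * (‖p - q‖ + ‖t - s‖) * (1 + ‖v‖) + C * ‖v - w‖ := by
  have hd : dist (p, t) (q, s) ≤ ‖p - q‖ + ‖t - s‖ := by
    rw [Prod.dist_eq, dist_eq_norm, dist_eq_norm]
    exact max_le_add_of_nonneg (norm_nonneg _) (norm_nonneg _)
  have h1 : ‖timeDeriv b (p, t) - timeDeriv b (q, s)‖ ≤ C * (‖p - q‖ + ‖t - s‖) := by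
    rw [← dist_eq_norm]
    exact (hb.lipschitz_timeDeriv.dist_le_mul _ _).trans (mul_le_mul_of_nonneg_left hd C.2)
  have h2 : ‖spaceDiv b (p, t) - spaceDiv b (q, s)‖ ≤ C * (‖p - q‖ + ‖t - s‖) := by
    rw [← dist_eq_norm]
    exact (hb.lipschitz_spaceDiv.dist_le_mul _ _).trans (mul_le_mul_of_nonneg_left hd C.2)
  calc _ = ‖(timeDeriv b (p, t) - timeDeriv b (q, s)) +
        ((spaceDiv b (p, t) - spaceDiv b (q, s)) • v + spaceDiv b (q, s) • (v - w))‖ := by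
        congr 1; rw [sub_smul, smul_sub]; abel
    _ ≤ ‖timeDeriv b (p, t) - timeDeriv b (q, s)‖ +
        (‖spaceDiv b (p, t) - spaceDiv b (q, s)‖ * ‖v‖ + ‖spaceDiv b (q, s)‖ * ‖v - w‖) := by
        refine (norm_add_le _ _).trans (add_le_add_right ?_ _)
        refine (norm_add_le _ _).trans ?_
        rw [norm_smul, norm_smul]
    _ ≤ C * (‖p - q‖ + ‖t - s‖) + (C * (‖p - q‖ + ‖t - s‖) * ‖v‖ + C * ‖v - w‖) := by
        have h3 := hb.norm_spaceDiv_le (q, s)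
        gcongr
    _ = _ := by ring

namespace IsNearIdentity

theorem fderiv_zero (h : IsNearIdentity D T δ K) (hD : IsOpen D) {x : Vec d} (hx : x ∈ D) :
    fderiv ℝ (T 0) x = ContinuousLinearMap.id ℝ (Vec d) := by
  have h1 : T 0 =ᶠ[𝓝 x] fun y => y := by
    filter_upwards [hD.mem_nhds hx] with y hy using h.zero y hy
  rw [h1.fderiv_eq, fderiv_fun_id]

/-- The contribution of the Jacobi matrix of `T_t` to the second derivative of the flux. -/
theorem tendsto_integral_cofactorMap_sub_id (h : IsNearIdentity D T δ K) (hD : IsOpen D)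
    (hfin : volume D ≠ ⊤) (hb : HasFieldBounds b C) :
    Tendsto (fun t : ℝ => ∫ x in D, traceCLM d ((t⁻¹ • (cofactorMap (fderiv ℝ (T t) x) -
        ContinuousLinearMap.id ℝ (Vec d))).comp (fderiv ℝ (fluxField b T t) x))) (𝓝[≠] 0)
      (𝓝 (∫ x in D, nullForm (fderiv ℝ (flowVelocity T 0) x) (fderiv ℝ (fluxField b T 0) x))) := by
  obtain ⟨C₀, -, -, hC₀⟩ := exists_det_cofactorMap_bounds d
  have h0 := h.zero_mem
  have hnhds : ∀ᶠ u in 𝓝[≠] (0 : ℝ), u ∈ Ioo (-δ) δ ∧ u ≠ 0 := by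
    filter_upwards [mem_nhdsWithin_of_mem_nhds (isOpen_Ioo.mem_nhds h0), self_mem_nhdsWithin]
      with w h1 h2 using ⟨h1, h2⟩
  have hbound : ∀ᶠ t in 𝓝[≠] (0 : ℝ), ∀ᵐ x ∂(volume.restrict D),
      ‖t⁻¹ • (cofactorMap (fderiv ℝ (T t) x) - ContinuousLinearMap.id ℝ (Vec d))‖ ≤ C₀ * K := by
    filter_upwards [hnhds] with t ht
    filter_upwards [h.norm_fderiv_le, h.norm_fderiv_sub_id_le] with x hx hx2
    have h1 := (hC₀ _ (hx t ht.1)).trans (mul_le_mul_of_nonneg_left (hx2 t ht.1) C₀.2)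
    have h2 : ‖t‖ ≠ 0 := norm_ne_zero_iff.2 ht.2
    rw [norm_smul, norm_inv]
    refine (mul_le_mul_of_nonneg_left h1 (by positivity)).trans (le_of_eq ?_)
    field_simp
  have hlim : ∀ᵐ x ∂(volume.restrict D), Tendsto
      (fun t : ℝ => t⁻¹ • (cofactorMap (fderiv ℝ (T t) x) - ContinuousLinearMap.id ℝ (Vec d)))
      (𝓝[≠] 0) (𝓝 (traceCLM d (fderiv ℝ (flowVelocity T 0) x) • ContinuousLinearMap.id ℝ (Vec d) -
        fderiv ℝ (flowVelocity T 0) x)) := by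
    filter_upwards [h.hasDerivAt_fderiv 0 h0, ae_restrict_mem hD.measurableSet] with x hx hxD
    have h1 := hasDerivAt_iff_tendsto_slope.1 (hx.cofactorMap (h.fderiv_zero hD hxD))
    refine h1.congr fun t => ?_
    rw [slope_def_module, sub_zero, h.fderiv_zero hD hxD, cofactorMap_id]
  have hmeas : Measurable fun x => traceCLM d (fderiv ℝ (flowVelocity T 0) x) •
      ContinuousLinearMap.id ℝ (Vec d) - fderiv ℝ (flowVelocity T 0) x := by
    have h1 : Continuous fun A : Vec d →L[ℝ] Vec d =>
        traceCLM d A • ContinuousLinearMap.id ℝ (Vec d) - A := by fun_prop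
    exact h1.measurable.comp (measurable_fderiv ℝ (flowVelocity T 0))
  -- the bound passes to the limit along a sequence of times, for which the exceptional null sets can
  -- be collected
  obtain ⟨s, hs⟩ := exists_seq_tendsto (𝓝[≠] (0 : ℝ))
  have hbound₀ : ∀ᵐ x ∂(volume.restrict D), ‖traceCLM d (fderiv ℝ (flowVelocity T 0) x) •
      ContinuousLinearMap.id ℝ (Vec d) - fderiv ℝ (flowVelocity T 0) x‖ ≤ C₀ * K := by
    obtain ⟨N, hN⟩ := eventually_atTop.1 (hs.eventually hbound)
    have h1 := ae_all_iff.2 fun n : ℕ => hN (N + n) (Nat.le_add_right N n)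
    filter_upwards [hlim, h1] with x hx hx2
    have h2 := (hx.comp hs).norm
    refine le_of_tendsto h2 ?_
    filter_upwards [eventually_ge_atTop N] with n hn
    obtain ⟨k, rfl⟩ := Nat.exists_eq_add_of_le hn
    exact hx2 k
  have hmain := tendsto_setIntegral_trace_comp_fderiv hD hfin (l := 𝓝[≠] (0 : ℝ))
    (M := fun t x => t⁻¹ • (cofactorMap (fderiv ℝ (T t) x) - ContinuousLinearMap.id ℝ (Vec d)))
    (f := fun t => fluxField b T t) (f₀ := fluxField b T 0) (C := C + C * K)
    (Eventually.of_forall fun t =>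
      (show Continuous fun A : Vec d →L[ℝ] Vec d => t⁻¹ • (A - ContinuousLinearMap.id ℝ (Vec d)) by
        fun_prop).comp_aestronglyMeasurable (aestronglyMeasurable_cofactorMap T D t))
    hmeas.stronglyMeasurable.aestronglyMeasurable hbound hbound₀ hlim
    (by filter_upwards [hnhds] with t ht using h.lipschitzOnWith_fluxField hb ht.1)
    (h.lipschitzOnWith_fluxField hb h0)
    (by
      filter_upwards [hnhds] with t ht x hx
      refine (norm_add_le _ _).trans (add_le_add (hb.norm_timeDeriv_le _) ?_)
      rw [norm_smul]
      exact mul_le_mul (hb.norm_spaceDiv_le _) (h.norm_velocity_le t ht.1 x hx) (norm_nonneg _)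
        C.2)
    (fun x hx => by
      have h0' : Tendsto (fun t : ℝ => C * (K * ‖t‖ + ‖t‖) * (1 + K) + C * (K * ‖t‖)) (𝓝[≠] 0)
          (𝓝 0) := by
        have h1 : Continuous fun t : ℝ => (C : ℝ) * (K * ‖t‖ + ‖t‖) * (1 + K) + C * (K * ‖t‖) := by
          fun_prop
        have h2 := h1.tendsto 0
        simp only [norm_zero, mul_zero, add_zero, zero_mul] at h2
        exact h2.mono_left nhdsWithin_le_nhds
      rw [tendsto_iff_norm_sub_tendsto_zero]
      refine squeeze_zero_norm' ?_ h0'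
      filter_upwards [hnhds] with t ht
      rw [norm_norm]
      have h1 := h.norm_sub_le 0 h0 t ht.1 x hx
      have h2 := h.norm_velocity_sub_le 0 h0 t ht.1 x hx
      have h3 := h.norm_velocity_le t ht.1 x hx
      have h4 := hb.norm_add_smul_sub_le (T t x) (T 0 x) (flowVelocity T t x)
        (flowVelocity T 0 x) t 0
      rw [sub_zero] at h1 h2 h4
      exact h4.trans (by gcongr))
  simp only [nullForm_eq_trace_comp]
  exact hmain

end IsNearIdentity

section Boundary
variable {τ σ : ℝ → Vec d → Vec d} {R : Vec d → Vec d} {K' : ℝ≥0}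

theorem IsFlowExtension.lipschitzWith (hE : IsFlowExtension D T δ K' τ σ R) {t : ℝ}
    (ht : t ∈ Ioo (-δ) δ) : LipschitzWith (K' * ‖t‖₊ + 1) (τ t) := by
  have h := (hE.lipschitz_sub_id t ht).add LipschitzWith.id
  simpa using h

theorem IsFlowExtension.locallyLipschitz_field (hE : IsFlowExtension D T δ K' τ σ R)
    (hb : HasFieldBounds b C) {t : ℝ} (ht : t ∈ Ioo (-δ) δ) :
    LocallyLipschitz fun x => timeDeriv b (τ t x, t) + spaceDiv b (τ t x, t) • σ t x := by
  have h1 := (hb.lipschitz_timeDeriv.comp_prodMk_left t).comp (hE.lipschitzWith ht)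
  have h2 := (hb.lipschitz_spaceDiv.comp_prodMk_left t).comp (hE.lipschitzWith ht)
  exact h1.locallyLipschitz.add
    (h2.locallyLipschitz.smul (hE.lipschitz_velocity t ht).locallyLipschitz)

/-- The divergence theorem for `fluxField b T t`, whose boundary values are given by the
extensions of `T` and of the velocity. -/
theorem IsFlowExtension.integral_trace_fderiv_fluxField (hE : IsFlowExtension D T δ K' τ σ R)
    (hD : IsLipschitzDomain D) (hbd : Bornology.IsBounded D) (hb : HasFieldBounds b C) {t : ℝ}
    (ht : t ∈ Ioo (-δ) δ) :
    ∫ x in D, traceCLM d (fderiv ℝ (fluxField b T t) x) = ∫ y, ⟪outerNormal D y,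
      timeDeriv b (τ t y, t) + spaceDiv b (τ t y, t) • σ t y⟫ ∂(area D) := by
  rw [hD.integral_divergence_of_locallyLipschitz hbd (hE.locallyLipschitz_field hb ht)]
  refine setIntegral_congr_fun hD.1.measurableSet fun x hx => ?_
  have h1 : fluxField b T t =ᶠ[𝓝 x]
      fun x => timeDeriv b (τ t x, t) + spaceDiv b (τ t x, t) • σ t x := by
    filter_upwards [hD.1.mem_nhds hx] with y hy
    rw [fluxField, hE.eqOn t ht hy, hE.eqOn_velocity t ht hy]
  beta_reduce
  rw [divergence_eq_trace, h1.fderiv_eq]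

/-- The contribution of the time dependence of the field `fluxField b T t` to the second derivative
of the flux, as a boundary integral. -/
theorem IsFlowExtension.tendsto_integral_trace_fderiv_fluxField
    (hE : IsFlowExtension D T δ K' τ σ R) (hδ : 0 < δ)
    (hD : IsLipschitzDomain D) (hbd : Bornology.IsBounded D) (hb : HasFieldBounds b C)
    (hdiff : ∀ᵐ x ∂(area D),
      DifferentiableAt ℝ (timeDeriv b) (x, 0) ∧ DifferentiableAt ℝ (spaceDiv b) (x, 0)) :
    Tendsto (fun t : ℝ => t⁻¹ * ((∫ x in D, traceCLM d (fderiv ℝ (fluxField b T t) x)) -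
        ∫ x in D, traceCLM d (fderiv ℝ (fluxField b T 0) x))) (𝓝[≠] 0)
      (𝓝 (∫ y, ⟪outerNormal D y, fderiv ℝ (timeDeriv b) (y, 0) (σ 0 y, 1) +
        (spaceDiv b (y, 0) • R y + fderiv ℝ (spaceDiv b) (y, 0) (σ 0 y, 1) • σ 0 y)⟫
          ∂(area D))) := by
  have h0 : (0 : ℝ) ∈ Ioo (-δ) δ := ⟨by linarith, hδ⟩
  have hnhds : ∀ᶠ u in 𝓝[≠] (0 : ℝ), u ∈ Ioo (-δ) δ ∧ u ≠ 0 := by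
    filter_upwards [mem_nhdsWithin_of_mem_nhds (isOpen_Ioo.mem_nhds h0), self_mem_nhdsWithin]
      with w h1 h2 using ⟨h1, h2⟩
  have := hD.isFiniteMeasure_area hbd
  have hfr : ∀ᵐ y ∂(area D), y ∈ frontier D := ae_restrict_mem isClosed_frontier.measurableSet
  set w : ℝ → Vec d → Vec d :=
    fun t y => timeDeriv b (τ t y, t) + spaceDiv b (τ t y, t) • σ t y with hw
  have hwb : ∀ t ∈ Ioo (-δ) δ, ∀ y ∈ closure D,
      ‖w t y - w 0 y‖ ≤ (C * (K' + 1) * (1 + K') + C * K') * ‖t‖ := fun t ht y hy => by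
    have h1 := hE.norm_sub_le t ht y hy
    have h2 := hE.norm_velocity_sub_le t ht y hy
    have h3 := hE.norm_velocity_le t ht y hy
    have h4 := hb.norm_add_smul_sub_le (τ t y) (τ 0 y) (σ t y) (σ 0 y) t 0
    rw [sub_zero, hE.zero y hy] at h4
    rw [hw]
    beta_reduce
    rw [hE.zero y hy]
    refine h4.trans ?_
    calc _ ≤ C * (K' * ‖t‖ + ‖t‖) * (1 + K') + C * (K' * ‖t‖) := by gcongr
      _ = _ := by ring
  have hwi : ∀ t ∈ Ioo (-δ) δ, Integrable (fun y => ⟪outerNormal D y, w t y⟫) (area D) :=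
    fun t ht => by
      have hc : Continuous (w t) := (hE.locallyLipschitz_field hb ht).continuous
      refine hD.integrable_inner_outerNormal hbd hc.aestronglyMeasurable (C := C + C * K')
        fun y hy => ?_
      refine (norm_add_le _ _).trans (add_le_add (hb.norm_timeDeriv_le _) ?_)
      rw [norm_smul]
      exact mul_le_mul (hb.norm_spaceDiv_le _)
        (hE.norm_velocity_le t ht y (frontier_subset_closure hy)) (norm_nonneg _) C.2
  have hmain : Tendsto (fun t : ℝ => ∫ y, t⁻¹ * (⟪outerNormal D y, w t y⟫ -
      ⟪outerNormal D y, w 0 y⟫) ∂(area D)) (𝓝[≠] 0) (𝓝 (∫ y, ⟪outerNormal D y,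
        fderiv ℝ (timeDeriv b) (y, 0) (σ 0 y, 1) +
        (spaceDiv b (y, 0) • R y + fderiv ℝ (spaceDiv b) (y, 0) (σ 0 y, 1) • σ 0 y)⟫
          ∂(area D))) := by
    refine tendsto_integral_filter_of_dominated_convergence
      (fun _ => (C * (K' + 1) * (1 + K') + C * K' : ℝ)) ?_ ?_ (integrable_const _) ?_
    · filter_upwards [hnhds] with t ht
      exact (((hwi t ht.1).sub (hwi 0 h0)).const_mul t⁻¹).aestronglyMeasurable
    · filter_upwards [hnhds] with t ht
      filter_upwards [hfr] with y hy
      have h1 := hwb t ht.1 y (frontier_subset_closure hy)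
      have h2 : ‖t‖ ≠ 0 := norm_ne_zero_iff.2 ht.2
      rw [← inner_sub_right, norm_mul, norm_inv]
      have h3 : ‖⟪outerNormal D y, w t y - w 0 y⟫‖ ≤ 1 * ‖w t y - w 0 y‖ :=
        (norm_inner_le_norm _ _).trans
          (mul_le_mul_of_nonneg_right (norm_outerNormal_le D y) (norm_nonneg _))
      rw [one_mul] at h3
      refine (mul_le_mul_of_nonneg_left (h3.trans h1) (by positivity)).trans (le_of_eq ?_)
      field_simp
    · filter_upwards [hfr, hdiff] with y hy hyd
      have hyc := frontier_subset_closure hy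
      have hc : HasDerivAt (fun t => (τ t y, t)) (σ 0 y, (1 : ℝ)) 0 :=
        (hE.hasDerivAt y hyc).prodMk (hasDerivAt_id 0)
      have hc0 : (y, (0 : ℝ)) = (τ 0 y, 0) := by rw [hE.zero y hyc]
      have h1 : HasDerivAt (fun t => timeDeriv b (τ t y, t))
          (fderiv ℝ (timeDeriv b) (y, 0) (σ 0 y, 1)) 0 :=
        hyd.1.hasFDerivAt.comp_hasDerivAt_of_eq 0 hc hc0
      have h2 : HasDerivAt (fun t => spaceDiv b (τ t y, t))
          (fderiv ℝ (spaceDiv b) (y, 0) (σ 0 y, 1)) 0 :=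
        hyd.2.hasFDerivAt.comp_hasDerivAt_of_eq 0 hc hc0
      have h3 := h1.fun_add (h2.fun_smul (hE.hasDerivAt_velocity y hyc))
      beta_reduce at h3
      rw [← hc0] at h3
      have h4 := hasDerivAt_iff_tendsto_slope.1 h3
      have h5 := ((innerSL ℝ (outerNormal D y)).continuous.tendsto _).comp h4
      refine h5.congr fun t => ?_
      simp only [Function.comp_apply, slope_def_module, sub_zero, innerSL_apply_apply,
        inner_smul_right, inner_sub_right, hw]
  refine hmain.congr' ?_
  filter_upwards [hnhds] with t ht
  rw [integral_const_mul, integral_sub (hwi t ht.1) (hwi 0 h0),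
    hE.integral_trace_fderiv_fluxField hD hbd hb ht.1,
    hE.integral_trace_fderiv_fluxField hD hbd hb h0]

end Boundary
end SecondDerivative

/-! ### The second derivative of the flux as a boundary integral -/

section NullFormBoundary
variable {d : ℕ} {D : Set (Vec d)}

theorem LocallyLipschitz.ae_differentiableAt_of_isBounded {F : Type*} [NormedAddCommGroup F]
    [NormedSpace ℝ F] [FiniteDimensional ℝ F] {f : Vec d → F} (hf : LocallyLipschitz f)
    (hb : Bornology.IsBounded D) (hD : MeasurableSet D) :
    ∀ᵐ x ∂(volume.restrict D), DifferentiableAt ℝ f x := by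
  obtain ⟨g, L, hg, hfg⟩ := hf.exists_lipschitzWith_eventuallyEq hb.isCompact_closure
  rw [eventually_nhdsSet_iff_forall] at hfg
  filter_upwards [ae_restrict_of_ae hg.ae_differentiableAt, ae_restrict_mem hD] with x hx hxD
  exact hx.congr_of_eventuallyEq ((hfg x (subset_closure hxD)).mono fun _ h => h.symm)

theorem integrableOn_nullForm_of_locallyLipschitz (hb : Bornology.IsBounded D)
    (hD : MeasurableSet D) {P Q : Vec d → Vec d} (hP : LocallyLipschitz P)
    (hQ : LocallyLipschitz Q) :
    IntegrableOn (fun x => nullForm (fderiv ℝ P x) (fderiv ℝ Q x)) D := by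
  obtain ⟨P', L, hP', hPP'⟩ := hP.exists_lipschitzWith_eventuallyEq hb.isCompact_closure
  obtain ⟨Q', M, hQ', hQQ'⟩ := hQ.exists_lipschitzWith_eventuallyEq hb.isCompact_closure
  rw [eventually_nhdsSet_iff_forall] at hPP' hQQ'
  refine (integrableOn_nullForm hb hP' hQ').congr_fun (fun x hx => ?_) hD
  have h1 : P' =ᶠ[𝓝 x] P := hPP' x (subset_closure hx)
  have h2 : Q' =ᶠ[𝓝 x] Q := hQQ' x (subset_closure hx)
  beta_reduce
  rw [h1.fderiv_eq, h2.fderiv_eq]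

/-- The integral of the null form depends only on the boundary values of the fields. -/
theorem IsLipschitzDomain.integral_nullForm_congr_left (hD : IsLipschitzDomain D)
    (hb : Bornology.IsBounded D) {P P' Q : Vec d → Vec d} (hP : LocallyLipschitz P)
    (hP' : LocallyLipschitz P') (hQ : LocallyLipschitz Q) (h : EqOn P P' (frontier D)) :
    ∫ x in D, nullForm (fderiv ℝ P x) (fderiv ℝ Q x) =
      ∫ x in D, nullForm (fderiv ℝ P' x) (fderiv ℝ Q x) := by
  have hm := hD.1.measurableSet
  have h1 := hD.integral_nullForm_eq_zero hb (hP.sub hP') hQ fun x hx => by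
    rw [h hx, sub_self]
  rw [← sub_eq_zero, ← integral_sub (integrableOn_nullForm_of_locallyLipschitz hb hm hP hQ)
    (integrableOn_nullForm_of_locallyLipschitz hb hm hP' hQ), ← h1]
  refine integral_congr_ae ?_
  filter_upwards [hP.ae_differentiableAt_of_isBounded hb hm,
    hP'.ae_differentiableAt_of_isBounded hb hm] with x hx hx'
  rw [fderiv_fun_sub hx hx', nullForm_comm (fderiv ℝ P x - fderiv ℝ P' x), nullForm_sub_right,
    nullForm_comm (fderiv ℝ Q x), nullForm_comm (fderiv ℝ Q x)]

end NullFormBoundary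

section BoundaryIntegrals
variable {d : ℕ} {D : Set (Vec d)}

theorem LocallyLipschitz.exists_norm_fderiv_le {F : Type*} [NormedAddCommGroup F]
    [NormedSpace ℝ F] {f : Vec d → F} (hf : LocallyLipschitz f) {s : Set (Vec d)}
    (hs : IsCompact s) : ∃ C : ℝ≥0, ∀ x ∈ s, ‖fderiv ℝ f x‖ ≤ C := by
  obtain ⟨g, L, hg, hfg⟩ := hf.exists_lipschitzWith_eventuallyEq hs
  rw [eventually_nhdsSet_iff_forall] at hfg
  refine ⟨L, fun x hx => ?_⟩
  have h1 : g =ᶠ[𝓝 x] f := hfg x hx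
  rw [← h1.fderiv_eq]
  exact norm_fderiv_le_of_lipschitz ℝ hg

theorem measurable_divergence (F : Vec d → Vec d) : Measurable (divergence F) := by
  have h1 : divergence F = fun x => traceCLM d (fderiv ℝ F x) := funext (divergence_eq_trace F)
  rw [h1]
  exact (traceCLM d).continuous.measurable.comp (measurable_fderiv ℝ F)

theorem measurable_fderiv_apply {F G : Vec d → Vec d} (hG : Continuous G) :
    Measurable fun x => fderiv ℝ F x (G x) := by
  have h1 : Continuous fun p : (Vec d →L[ℝ] Vec d) × Vec d => p.1 p.2 := by fun_prop
  exact h1.measurable.comp ((measurable_fderiv ℝ F).prodMk hG.measurable)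

theorem LocallyLipschitz.exists_norm_divergence_le {F : Vec d → Vec d} (hF : LocallyLipschitz F)
    {s : Set (Vec d)} (hs : IsCompact s) : ∃ C : ℝ≥0, ∀ x ∈ s, ‖divergence F x‖ ≤ C := by
  obtain ⟨C, hC⟩ := hF.exists_norm_fderiv_le hs
  refine ⟨‖traceCLM d‖₊ * C, fun x hx => ?_⟩
  rw [divergence_eq_trace]
  exact ((traceCLM d).le_opNorm _).trans (mul_le_mul_of_nonneg_left (hC x hx) (norm_nonneg _))

theorem IsLipschitzDomain.integrable_inner_divergence_smul (hD : IsLipschitzDomain D)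
    (hb : Bornology.IsBounded D) {F G : Vec d → Vec d} (hF : LocallyLipschitz F)
    (hG : Continuous G) :
    Integrable (fun y => ⟪outerNormal D y, divergence F y • G y⟫) (area D) := by
  have hK : IsCompact (frontier D) :=
    hb.isCompact_closure.of_isClosed_subset isClosed_frontier frontier_subset_closure
  obtain ⟨C, hC⟩ := hF.exists_norm_divergence_le hK
  obtain ⟨M, hM⟩ := hK.exists_bound_of_continuousOn hG.continuousOn
  refine hD.integrable_inner_outerNormal hb
    ((measurable_divergence F).smul hG.measurable).aestronglyMeasurable (C := C * M)
    fun y hy => ?_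
  rw [norm_smul]
  exact mul_le_mul (hC y hy) (hM y hy) (norm_nonneg _) C.2

theorem IsLipschitzDomain.integrable_inner_fderiv (hD : IsLipschitzDomain D)
    (hb : Bornology.IsBounded D) {F G : Vec d → Vec d} (hF : LocallyLipschitz F)
    (hG : Continuous G) :
    Integrable (fun y => ⟪outerNormal D y, fderiv ℝ F y (G y)⟫) (area D) := by
  have hK : IsCompact (frontier D) :=
    hb.isCompact_closure.of_isClosed_subset isClosed_frontier frontier_subset_closure
  obtain ⟨C, hC⟩ := hF.exists_norm_fderiv_le hK
  obtain ⟨M, hM⟩ := hK.exists_bound_of_continuousOn hG.continuousOn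
  refine hD.integrable_inner_outerNormal hb
    (measurable_fderiv_apply hG).aestronglyMeasurable (C := C * M) fun y hy => ?_
  exact ((fderiv ℝ F y).le_opNorm _).trans
    (mul_le_mul (hC y hy) (hM y hy) (norm_nonneg _) C.2)

theorem IsLipschitzDomain.integrable_inner_of_continuous (hD : IsLipschitzDomain D)
    (hb : Bornology.IsBounded D) {G : Vec d → Vec d} (hG : Continuous G) :
    Integrable (fun y => ⟪outerNormal D y, G y⟫) (area D) := by
  have hK : IsCompact (frontier D) :=
    hb.isCompact_closure.of_isClosed_subset isClosed_frontier frontier_subset_closure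
  obtain ⟨M, hM⟩ := hK.exists_bound_of_continuousOn hG.continuousOn
  exact hD.integrable_inner_outerNormal hb hG.aestronglyMeasurable hM

end BoundaryIntegrals

section SecondDerivative
variable {d : ℕ} {D : Set (Vec d)} {T : ℝ → Vec d → Vec d} {δ : ℝ} {K K' : ℝ≥0}
  {b : Vec d × ℝ → Vec d} {C : ℝ≥0} {τ σ : ℝ → Vec d → Vec d} {R S' : Vec d → Vec d}

/-- The integral of the null form of the velocity and of the field `fluxField b T 0` as a boundary
integral. As first derivatives of the velocity on the boundary do not make sense, the velocity is
replaced by an extension `S'` of its boundary values. -/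
theorem IsFlowExtension.integral_nullForm_fluxField (hE : IsFlowExtension D T δ K' τ σ R)
    (hδ : 0 < δ) (hD : IsLipschitzDomain D) (hbd : Bornology.IsBounded D) (hb : HasFieldBounds b C)
    (hdiff : ∀ᵐ x ∂(area D), DifferentiableAt ℝ (timeDeriv b) (x, 0))
    (hS' : IsBoundaryExtension D (σ 0) S') :
    ∫ x in D, nullForm (fderiv ℝ (flowVelocity T 0) x) (fderiv ℝ (fluxField b T 0) x) =
      (∫ y, ⟪outerNormal D y, divergence (fun y => timeDeriv b (y, 0)) y • σ 0 y -
        fderiv ℝ (fun y => timeDeriv b (y, 0)) y (σ 0 y)⟫ ∂(area D)) +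
      ∫ y, ⟪outerNormal D y, divergence S' y • spaceDiv b (y, 0) • S' y -
        fderiv ℝ S' y (spaceDiv b (y, 0) • S' y)⟫ ∂(area D) := by
  have h0 : (0 : ℝ) ∈ Ioo (-δ) δ := ⟨by linarith, hδ⟩
  have hm := hD.1.measurableSet
  have hσ : LocallyLipschitz (σ 0) := (hE.lipschitz_velocity 0 h0).locallyLipschitz
  have hβ : LocallyLipschitz fun y => timeDeriv b (y, 0) :=
    (hb.lipschitz_timeDeriv.comp_prodMk_left 0).locallyLipschitz
  have hγ : LocallyLipschitz fun y => spaceDiv b (y, 0) :=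
    (hb.lipschitz_spaceDiv.comp_prodMk_left 0).locallyLipschitz
  have hγσ := hγ.smul hσ
  have hγS := hγ.smul hS'.1
  have hsplit : ∫ x in D, nullForm (fderiv ℝ (flowVelocity T 0) x) (fderiv ℝ (fluxField b T 0) x) =
      (∫ x in D, nullForm (fderiv ℝ (σ 0) x) (fderiv ℝ (fun y => timeDeriv b (y, 0)) x)) +
      ∫ x in D, nullForm (fderiv ℝ (σ 0) x) (fderiv ℝ (fun y => spaceDiv b (y, 0) • σ 0 y) x) := by
    rw [← integral_add (integrableOn_nullForm_of_locallyLipschitz hbd hm hσ hβ)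
      (integrableOn_nullForm_of_locallyLipschitz hbd hm hσ hγσ)]
    refine integral_congr_ae ?_
    filter_upwards [hβ.ae_differentiableAt_of_isBounded hbd hm,
      hγσ.ae_differentiableAt_of_isBounded hbd hm, ae_restrict_mem hm] with x hx1 hx2 hx
    have h1 : flowVelocity T 0 =ᶠ[𝓝 x] σ 0 := by
      filter_upwards [hD.1.mem_nhds hx] with y hy using (hE.eqOn_velocity 0 h0 hy).symm
    have h2 : fluxField b T 0 =ᶠ[𝓝 x]
        fun y => timeDeriv b (y, 0) + spaceDiv b (y, 0) • σ 0 y := by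
      filter_upwards [hD.1.mem_nhds hx] with y hy
      rw [fluxField, ← hE.eqOn 0 h0 hy, hE.zero y (subset_closure hy), hE.eqOn_velocity 0 h0 hy]
    rw [h1.fderiv_eq, h2.fderiv_eq, fderiv_fun_add hx1 hx2, nullForm_add_right]
  rw [hsplit]
  congr 1
  · refine hD.integral_nullForm hbd hσ hβ (hdiff.mono fun x hx => ?_)
    exact (hasFDerivAt_comp_prodMk_right hx).differentiableAt
  · -- the velocity is replaced by its extension in one argument of the null form, and then, by
    -- symmetry, in the other one
    rw [hD.integral_nullForm_congr_left hbd hσ hS'.1 hγσ fun x hx => (hS'.2.1 hx).symm]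
    simp only [nullForm_comm (fderiv ℝ S' _)]
    rw [hD.integral_nullForm_congr_left hbd hγσ hγS hS'.1 fun x hx => by
      rw [hS'.2.1 hx]]
    exact hD.integral_nullForm hbd hγS hS'.1 hS'.2.2

theorem IsLipschitzDomain.integrable_inner_timeDeriv_timeDeriv (hD : IsLipschitzDomain D)
    (hbd : Bornology.IsBounded D) (hb : HasFieldBounds b C)
    (hdiff : ∀ᵐ x ∂(area D), DifferentiableAt ℝ (timeDeriv b) (x, 0)) :
    Integrable (fun y => ⟪outerNormal D y, timeDeriv (timeDeriv b) (y, 0)⟫) (area D) := by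
  have h1 : Measurable fun y : Vec d => fderiv ℝ (timeDeriv b) (y, 0) (0, 1) :=
    (measurable_fderiv_apply_const ℝ (timeDeriv b) ((0 : Vec d), (1 : ℝ))).comp
      measurable_prodMk_right
  refine hD.integrable_inner_outerNormal hbd (C := C)
    (h1.aestronglyMeasurable.congr (hdiff.mono fun y hy => (timeDeriv_eq_fderiv hy).symm))
    fun y _ => ?_
  refine norm_deriv_le_of_lipschitz (LipschitzWith.of_dist_le_mul fun s t => ?_)
  rw [← dist_prodMk_right y s t]
  exact hb.lipschitz_timeDeriv.dist_le_mul _ _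

/-- The second derivative at time zero of the flux of a globally defined field, expressed through
its first derivative. -/
theorem IsNearIdentity.hasDerivAt_integral_trace_cofactorMap (h : IsNearIdentity D T δ K)
    (hE : IsFlowExtension D T δ K' τ σ R) (hD : IsLipschitzDomain D)
    (hbd : Bornology.IsBounded D) (hb : HasFieldBounds b C)
    (hdiff : ∀ᵐ x ∂(area D),
      DifferentiableAt ℝ (timeDeriv b) (x, 0) ∧ DifferentiableAt ℝ (spaceDiv b) (x, 0))
    (hS' : IsBoundaryExtension D (σ 0) S') :
    Integrable (fun y => ⟪outerNormal D y, timeDeriv (timeDeriv b) (y, 0)⟫) (area D) ∧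
    Integrable (fun y => ⟪outerNormal D y, (2 * spaceDiv (timeDeriv b) (y, 0) +
      divergence (fun y => spaceDiv b (y, 0) • S' y) y) • σ 0 y⟫) (area D) ∧
    Integrable (fun y => ⟪outerNormal D y,
      spaceDiv b (y, 0) • (R y - fderiv ℝ S' y (S' y))⟫) (area D) ∧
    HasDerivAt (fun t => ∫ x in D, traceCLM d ((cofactorMap (fderiv ℝ (T t) x)).comp
        (fderiv ℝ (fluxField b T t) x)))
      ((∫ y, ⟪outerNormal D y, timeDeriv (timeDeriv b) (y, 0)⟫ ∂(area D)) +
        (∫ y, ⟪outerNormal D y, (2 * spaceDiv (timeDeriv b) (y, 0) +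
          divergence (fun y => spaceDiv b (y, 0) • S' y) y) • σ 0 y⟫ ∂(area D)) +
        ∫ y, ⟪outerNormal D y, spaceDiv b (y, 0) • (R y - fderiv ℝ S' y (S' y))⟫ ∂(area D)) 0 := by
  have hfin : volume D ≠ ⊤ := hbd.measure_lt_top.ne
  have h0 := h.zero_mem
  have hσ : Continuous (σ 0) := (hE.lipschitz_velocity 0 h0).continuous
  have hβ : LocallyLipschitz fun y => timeDeriv b (y, 0) :=
    (hb.lipschitz_timeDeriv.comp_prodMk_left 0).locallyLipschitz
  have hγ : LocallyLipschitz fun y => spaceDiv b (y, 0) :=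
    (hb.lipschitz_spaceDiv.comp_prodMk_left 0).locallyLipschitz
  have hγS : LocallyLipschitz fun y => spaceDiv b (y, 0) • S' y := hγ.smul hS'.1
  have hfr : ∀ᵐ y ∂(area D), y ∈ frontier D := ae_restrict_mem isClosed_frontier.measurableSet
  have hJ₁ := hD.integrable_inner_timeDeriv_timeDeriv hbd hb (hdiff.mono fun x hx => hx.1)
  have hJ₂ : Integrable (fun y => ⟪outerNormal D y, (2 * spaceDiv (timeDeriv b) (y, 0) +
      divergence (fun y => spaceDiv b (y, 0) • S' y) y) • σ 0 y⟫) (area D) := by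
    refine (((hD.integrable_inner_divergence_smul hbd hβ hσ).const_mul 2).add
      (hD.integrable_inner_divergence_smul hbd hγS hσ)).congr (Eventually.of_forall fun y => ?_)
    simp only [Pi.add_apply, inner_smul_right, spaceDiv]
    ring
  have hS'S' : Continuous fun y => spaceDiv b (y, 0) • S' y := hγS.continuous
  have hJ₃ : Integrable (fun y => ⟪outerNormal D y,
      spaceDiv b (y, 0) • (R y - fderiv ℝ S' y (S' y))⟫) (area D) := by
    refine ((hD.integrable_inner_of_continuous hbd
      (hγ.continuous.smul hE.continuous_acceleration)).sub
      (hD.integrable_inner_fderiv hbd hS'.1 hS'S')).congr (Eventually.of_forall fun y => ?_)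
    simp only [Pi.sub_apply, Pi.smul_apply', map_smul, smul_sub, inner_sub_right]
  refine ⟨hJ₁, hJ₂, hJ₃, ?_⟩
  have hA₁ : Integrable (fun y => ⟪outerNormal D y, divergence (fun y => timeDeriv b (y, 0)) y •
      σ 0 y - fderiv ℝ (fun y => timeDeriv b (y, 0)) y (σ 0 y)⟫) (area D) := by
    simp only [inner_sub_right]
    exact (hD.integrable_inner_divergence_smul hbd hβ hσ).sub
      (hD.integrable_inner_fderiv hbd hβ hσ)
  have hA₂ : Integrable (fun y => ⟪outerNormal D y, divergence S' y • spaceDiv b (y, 0) • S' y -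
      fderiv ℝ S' y (spaceDiv b (y, 0) • S' y)⟫) (area D) := by
    simp only [inner_sub_right]
    exact (hD.integrable_inner_divergence_smul hbd hS'.1 hS'S').sub
      (hD.integrable_inner_fderiv hbd hS'.1 hS'S')
  have hvol := h.tendsto_integral_cofactorMap_sub_id hD.1 hfin hb
  have hbdry := hE.tendsto_integral_trace_fderiv_fluxField h.pos hD hbd hb hdiff
  have hnull := hE.integral_nullForm_fluxField h.pos hD hbd hb (hdiff.mono fun x hx => hx.1) hS'
  -- the chain rule, `∂ₜ(∇·b) = ∇·bₜ` and the product rule for the divergence of `(∇·b) S'` show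
  -- that the integrands agree almost everywhere
  have hW : ∫ y, ⟪outerNormal D y, fderiv ℝ (timeDeriv b) (y, 0) (σ 0 y, 1) +
      (spaceDiv b (y, 0) • R y + fderiv ℝ (spaceDiv b) (y, 0) (σ 0 y, 1) • σ 0 y)⟫ ∂(area D) =
      ((∫ y, ⟪outerNormal D y, timeDeriv (timeDeriv b) (y, 0)⟫ ∂(area D)) +
        (∫ y, ⟪outerNormal D y, (2 * spaceDiv (timeDeriv b) (y, 0) +
          divergence (fun y => spaceDiv b (y, 0) • S' y) y) • σ 0 y⟫ ∂(area D)) +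
        ∫ y, ⟪outerNormal D y, spaceDiv b (y, 0) • (R y - fderiv ℝ S' y (S' y))⟫ ∂(area D)) -
      ((∫ y, ⟪outerNormal D y, divergence (fun y => timeDeriv b (y, 0)) y • σ 0 y -
        fderiv ℝ (fun y => timeDeriv b (y, 0)) y (σ 0 y)⟫ ∂(area D)) +
      ∫ y, ⟪outerNormal D y, divergence S' y • spaceDiv b (y, 0) • S' y -
        fderiv ℝ S' y (spaceDiv b (y, 0) • S' y)⟫ ∂(area D)) := by
    rw [← integral_add' hJ₁ hJ₂, ← integral_add' (hJ₁.add hJ₂) hJ₃, ← integral_add' hA₁ hA₂,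
      ← integral_sub' ((hJ₁.add hJ₂).add hJ₃) (hA₁.add hA₂)]
    refine integral_congr_ae ?_
    filter_upwards [hdiff, hS'.2.2, hfr] with y hy hyS hyf
    have e0 : ((σ 0 y, 1) : Vec d × ℝ) = ContinuousLinearMap.inl ℝ (Vec d) ℝ (σ 0 y) + (0, 1) := by
      simp
    have e1 := hasFDerivAt_comp_prodMk_right hy.1
    have e2 := hasFDerivAt_comp_prodMk_right hy.2
    have e3 : fderiv ℝ (timeDeriv b) (y, 0) (σ 0 y, 1) =
        fderiv ℝ (fun y => timeDeriv b (y, 0)) y (σ 0 y) + timeDeriv (timeDeriv b) (y, 0) := by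
      rw [e0, map_add, e1.fderiv, timeDeriv_eq_fderiv hy.1]
      rfl
    have e4 : fderiv ℝ (spaceDiv b) (y, 0) (σ 0 y, 1) =
        fderiv ℝ (fun y => spaceDiv b (y, 0)) y (σ 0 y) + spaceDiv (timeDeriv b) (y, 0) := by
      rw [e0, map_add, e2.fderiv, fderiv_spaceDiv_eq_spaceDiv_timeDeriv hb.contDiff hb.lipschitz
        hb.lipschitz_fderiv hy.1 hy.2]
      rfl
    have e5 : divergence (fun y => timeDeriv b (y, 0)) y = spaceDiv (timeDeriv b) (y, 0) := rfl
    simp only [Pi.add_apply, Pi.sub_apply]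
    rw [e3, e4, e5, divergence_smul e2.differentiableAt hyS, hS'.2.1 hyf]
    simp only [inner_add_right, inner_sub_right, inner_smul_right, map_smul]
    ring
  obtain ⟨C₁, hC₁⟩ := h.exists_norm_cofactorMap_le
  rw [hasDerivAt_iff_tendsto_slope]
  have hsum := hvol.add hbdry
  rw [hnull, hW, add_sub_cancel] at hsum
  refine hsum.congr' ?_
  filter_upwards [mem_nhdsWithin_of_mem_nhds (isOpen_Ioo.mem_nhds h0)] with t ht
  have hL := h.lipschitzOnWith_fluxField hb ht
  have i1 := integrableOn_traceCLM_comp_fderiv hD.1 hfin (aestronglyMeasurable_cofactorMap T D t)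
    (hC₁.mono fun x hx => hx t ht) hL
  have i2 := integrableOn_traceCLM_comp_fderiv hD.1 hfin
    (M := fun _ => ContinuousLinearMap.id ℝ (Vec d)) aestronglyMeasurable_const
    (B := ‖ContinuousLinearMap.id ℝ (Vec d)‖) (Eventually.of_forall fun _ => le_rfl) hL
  have e1 : ∫ x in D, traceCLM d ((t⁻¹ • (cofactorMap (fderiv ℝ (T t) x) -
      ContinuousLinearMap.id ℝ (Vec d))).comp (fderiv ℝ (fluxField b T t) x)) = t⁻¹ *
      ((∫ x in D, traceCLM d ((cofactorMap (fderiv ℝ (T t) x)).comp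
        (fderiv ℝ (fluxField b T t) x))) -
        ∫ x in D, traceCLM d (fderiv ℝ (fluxField b T t) x)) := by
    simp only [ContinuousLinearMap.id_comp] at i2
    rw [← integral_sub i1 i2, ← integral_const_mul]
    refine integral_congr_ae (Eventually.of_forall fun x => ?_)
    beta_reduce
    rw [ContinuousLinearMap.smul_comp, map_smul, ContinuousLinearMap.sub_comp, map_sub,
      ContinuousLinearMap.id_comp, smul_eq_mul]
  have e2 : ∫ x in D, traceCLM d ((cofactorMap (fderiv ℝ (T 0) x)).comp
      (fderiv ℝ (fluxField b T 0) x)) = ∫ x in D, traceCLM d (fderiv ℝ (fluxField b T 0) x) := by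
    refine setIntegral_congr_fun hD.1.measurableSet fun x hx => ?_
    beta_reduce
    rw [h.fderiv_zero hD.1 hx, cofactorMap_id, ContinuousLinearMap.id_comp]
  rw [e1, slope_def_field, sub_zero, e2]
  ring

end SecondDerivative

/-! ### Differentiable extensions of boundary values -/

section BoundaryExtension
variable {d : ℕ} {D : Set (Vec d)}

/-- A property that holds almost everywhere in the parameter domain of a chart holds at almost every
boundary point in this chart. -/
theorem IsSubgraphNear.ae_area {x₀ n : Vec d} {ψ : ((ℝ ∙ n)ᗮ : Submodule ℝ (Vec d)) → ℝ} {r : ℝ}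
    {M : ℝ≥0} (h : IsSubgraphNear D x₀ n ψ r) (hn : ‖n‖ = 1) (hD : IsOpen D)
    (hψ : LipschitzWith M ψ) {p : ((ℝ ∙ n)ᗮ : Submodule ℝ (Vec d)) → Prop}
    (hp : ∀ᵐ q, p q) :
    ∀ᵐ y ∂(area D), y ∈ Metric.ball x₀ r → p ((ℝ ∙ n)ᗮ.orthogonalProjectionOnto y) := by
  have hemb := isClosedEmbedding_graphMap hn hψ
  have h1 : ∀ᵐ y ∂((Measure.euclideanHausdorffMeasure (d - 1) : Measure (Vec d)).restrict
      (range (graphMap n ψ))), p ((ℝ ∙ n)ᗮ.orthogonalProjectionOnto y) := by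
    rw [restrict_range_graphMap_area hn hψ, hemb.measurableEmbedding.ae_map_iff]
    simp only [orthogonalProjectionOnto_graphMap]
    exact (withDensity_absolutelyContinuous _ _).ae_le hp
  rw [ae_restrict_iff' hemb.isClosed_range.measurableSet] at h1
  rw [area, ae_restrict_iff' isClosed_frontier.measurableSet]
  filter_upwards [h1] with y hy hyf hyb
  refine hy ((mem_range_graphMap_iff hn).2 ?_)
  exact (h.mem_frontier_iff hn hD hψ.continuous hyb).1 hyf

theorem LocallyLipschitz.finset_sum {X F ι : Type*} [PseudoMetricSpace X] [NormedAddCommGroup F]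
    {f : ι → X → F} {t : Finset ι} (hf : ∀ i ∈ t, LocallyLipschitz (f i)) :
    LocallyLipschitz fun x => ∑ i ∈ t, f i x := by
  classical
  induction t using Finset.induction_on with
  | empty => simpa using LocallyLipschitz.const (0 : F)
  | insert i t hi ih =>
    simp only [Finset.sum_insert hi]
    exact (hf i (Finset.mem_insert_self i t)).add
      (ih fun j hj => hf j (Finset.mem_insert_of_mem hj))

/-- The boundary values of a Lipschitz field have an extension that is differentiable at almost
every boundary point: in the coordinates of a chart, the field is extended to be constant in the
direction transversal to the boundary, and Rademacher's theorem applies to the field on the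
boundary; the local extensions are glued by a partition of unity. -/
theorem IsLipschitzDomain.exists_isBoundaryExtension (hD : IsLipschitzDomain D)
    (hb : Bornology.IsBounded D) {S : Vec d → Vec d} {L : ℝ≥0} (hS : LipschitzWith L S) :
    ∃ S', IsBoundaryExtension D S S' := by
  have hK : IsCompact (frontier D) :=
    hb.isCompact_closure.of_isClosed_subset isClosed_frontier frontier_subset_closure
  choose! n hn ψ M hψ r hr hchart using fun x (hx : x ∈ frontier D) => hD.exists_isSubgraphNear hx
  obtain ⟨t, χ, htK, hχ, hsum⟩ := exists_finite_smooth_partition hK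
    (fun x => Metric.ball x (r x)) fun x hx => ⟨Metric.isOpen_ball, Metric.mem_ball_self (hr x hx)⟩
  set P : ∀ x : Vec d, Vec d →L[ℝ] ((ℝ ∙ n x)ᗮ : Submodule ℝ (Vec d)) :=
    fun x => (ℝ ∙ n x)ᗮ.orthogonalProjectionOnto with hP
  set s : Vec d → Vec d → Vec d := fun x y => S (graphMap (n x) (ψ x) (P x y)) with hs
  have hsL : ∀ x ∈ t, LipschitzWith (L * (1 + M x)) (fun q => S (graphMap (n x) (ψ x) q)) :=
    fun x hx => hS.comp ((hψ x (htK x hx)).graphMap (hn x (htK x hx)))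
  have hχs : ∀ x ∈ t, LocallyLipschitz fun y => χ x y • s x y := fun x hx =>
    ((hχ x hx).1.locallyLipschitz (𝕂 := ℝ)).smul
      ((hsL x hx).comp (P x).lipschitz).locallyLipschitz
  refine ⟨fun y => ∑ x ∈ t, χ x y • s x y, LocallyLipschitz.finset_sum hχs, fun y hy => ?_, ?_⟩
  · have h1 : ∀ x ∈ t, χ x y • s x y = χ x y • S y := fun x hx => by
      by_cases hxy : y ∈ Metric.ball x (r x)
      · have h2 := ((hchart x (htK x hx)).mem_frontier_iff (hn x (htK x hx)) hD.1
          (hψ x (htK x hx)).continuous hxy).1 hy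
        obtain ⟨q, rfl⟩ := (mem_range_graphMap_iff (hn x (htK x hx))).2 h2
        rw [hs, hP]
        beta_reduce
        rw [orthogonalProjectionOnto_graphMap]
      · rw [image_eq_zero_of_notMem_tsupport fun h => hxy ((hχ x hx).2 h), zero_smul, zero_smul]
    beta_reduce
    rw [Finset.sum_congr rfl h1, ← Finset.sum_smul, hsum y hy, one_smul]
  · have h1 : ∀ᵐ y ∂(area D), ∀ x ∈ t, y ∈ Metric.ball x (r x) →
        DifferentiableAt ℝ (fun q => S (graphMap (n x) (ψ x) q)) (P x y) :=
      (Finset.eventually_all t).2 fun x hx =>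
        (hchart x (htK x hx)).ae_area (hn x (htK x hx)) hD.1 (hψ x (htK x hx))
          (hsL x hx).ae_differentiableAt
    filter_upwards [h1] with y hy
    refine DifferentiableAt.fun_sum fun x hx => ?_
    by_cases hxy : y ∈ Metric.ball x (r x)
    · exact ((hχ x hx).1.differentiable (by norm_num) y).fun_smul
        (DifferentiableAt.comp (g := fun q => S (graphMap (n x) (ψ x) q)) y (hy x hx hxy)
          (P x).differentiableAt)
    · have h2 : (fun y => χ x y • s x y) =ᶠ[𝓝 y] fun _ => 0 := by
        filter_upwards [(isClosed_tsupport (χ x)).isOpen_compl.mem_nhds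
          fun h => hxy ((hχ x hx).2 h)] with w hw
        rw [image_eq_zero_of_notMem_tsupport hw, zero_smul]
      exact (differentiableAt_const 0).congr_of_eventuallyEq h2

end BoundaryExtension

/-! ### The flux through the boundary of the deformed domain -/

section Localization
variable {d : ℕ} {a b : Vec d × ℝ → Vec d} {z : Vec d × ℝ}

theorem timeDeriv_congr (h : b =ᶠ[𝓝 z] a) : timeDeriv b z = timeDeriv a z := by
  have h1 : Tendsto (fun s : ℝ => (z.1, s)) (𝓝 z.2) (𝓝 z) :=
    (continuous_const.prodMk continuous_id).tendsto z.2
  have h2 : (fun s => b (z.1, s)) =ᶠ[𝓝 z.2] fun s => a (z.1, s) := h1.eventually h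
  exact h2.deriv_eq

theorem spaceDiv_congr (h : b =ᶠ[𝓝 z] a) : spaceDiv b z = spaceDiv a z := by
  have h1 : Tendsto (fun y : Vec d => (y, z.2)) (𝓝 z.1) (𝓝 z) :=
    (continuous_id.prodMk continuous_const).tendsto z.1
  exact divergence_congr (h1.eventually h)

theorem Filter.EventuallyEq.timeDeriv (h : b =ᶠ[𝓝 z] a) : timeDeriv b =ᶠ[𝓝 z] timeDeriv a :=
  h.eventuallyEq_nhds.mono fun _ hw => timeDeriv_congr hw

theorem Filter.EventuallyEq.spaceDiv (h : b =ᶠ[𝓝 z] a) : spaceDiv b =ᶠ[𝓝 z] spaceDiv a :=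
  h.eventuallyEq_nhds.mono fun _ hw => spaceDiv_congr hw

end Localization

section Flux
variable {d : ℕ} {D : Set (Vec d)} {T : ℝ → Vec d → Vec d} {δ : ℝ} {K : ℝ≥0}
  {a b : Vec d × ℝ → Vec d} {C : ℝ≥0}

/-- By the divergence theorem on the deformed domain and a change of variables, the flux is an
integral over the original domain. -/
theorem IsNearIdentity.boundaryFlux_eq (h : IsNearIdentity D T δ K) (hD : IsOpen D)
    (hb : HasFieldBounds b C) {t : ℝ} (ht : t ∈ Ioo (-δ) δ) :
    boundaryFlux D T b t = ∫ x in D, (fderiv ℝ (T t) x).det * spaceDiv b (T t x, t) := by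
  rw [boundaryFlux, (h.isLipschitzDomain_image t ht).integral_divergence (h.isBounded_image t ht)
    (hb.lipschitz.comp_prodMk_left t)]
  exact setIntegral_image_eq_of_det_pos hD (h.lipschitzOnWith ht) (h.injOn ht)
    (h.det_pos.mono fun x hx => hx t ht) fun y => spaceDiv b (y, t)

/-- Fields that agree near the boundary at time zero agree on the boundary of the deformed domain
for small times. -/
theorem IsNearIdentity.eventually_eqOn_frontier (h : IsNearIdentity D T δ K)
    (hbd : Bornology.IsBounded D) (hba : ∀ᶠ z in 𝓝ˢ (frontier D ×ˢ {(0 : ℝ)}), b z = a z) :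
    ∀ᶠ t in 𝓝 (0 : ℝ), ∀ y ∈ frontier (T t '' D), b (y, t) = a (y, t) := by
  have hK : IsCompact (frontier D ×ˢ {(0 : ℝ)}) :=
    (hbd.isCompact_closure.of_isClosed_subset isClosed_frontier frontier_subset_closure).prod
      isCompact_singleton
  obtain ⟨U, hU, hKU, hUab⟩ := mem_nhdsSet_iff_exists.1 hba
  obtain ⟨ρ, hρ, hρU⟩ := hK.exists_thickening_subset_open hU hKU
  have h1 : ∀ᶠ t in 𝓝 (0 : ℝ), (K + 1) * ‖t‖ < ρ := by
    have hc : Continuous fun t : ℝ => ((K : ℝ) + 1) * ‖t‖ := by fun_prop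
    refine (hc.tendsto 0).eventually (gt_mem_nhds ?_)
    simpa using hρ
  filter_upwards [h1, isOpen_Ioo.mem_nhds h.zero_mem] with t ht htI y hy
  obtain ⟨x, hx, hyx⟩ := h.exists_norm_sub_le t htI y hy
  refine hUab (hρU (Metric.mem_thickening_iff.2 ⟨(x, 0), ⟨hx, rfl⟩, ?_⟩))
  rw [Prod.dist_eq, dist_eq_norm, dist_eq_norm, sub_zero]
  refine lt_of_le_of_lt (max_le_add_of_nonneg (norm_nonneg _) (norm_nonneg _)) ?_
  linarith

end Flux

theorem mainTheorem8 {d : ℕ} (hd : 2 ≤ d) (Ω : Set (Vec d)) (hb : Bornology.IsBounded Ω)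
    (hΩ : IsC11Domain Ω) (ε : ℝ) (T : ℝ → Vec d → Vec d)
    (hT : IsTwiceDifferentiableFamily Ω ε T) (a : Vec d × ℝ → Vec d)
    (ha : IsC11Near (lateralBoundary Ω ε T) a)
    (ha₂ : ∀ᵐ x ∂(area Ω),
      DifferentiableAt ℝ (timeDeriv a) (x, 0) ∧ DifferentiableAt ℝ (spaceDiv a) (x, 0)) :
    (∀ᶠ t in 𝓝 (0 : ℝ),
      Integrable (fun y => ⟪outerNormal (T t '' Ω) y, a (y, t)⟫) (area (T t '' Ω)) ∧
      DifferentiableAt ℝ (boundaryFlux Ω T a) t) ∧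
    (∃ S', IsBoundaryExtension Ω (velocity Ω T) S') ∧
    ∀ S', IsBoundaryExtension Ω (velocity Ω T) S' →
      Integrable (fun x => ⟪outerNormal Ω x, timeDeriv (timeDeriv a) (x, 0)⟫) (area Ω) ∧
      Integrable (fun x =>
        (2 * spaceDiv (timeDeriv a) (x, 0) + divergence (fun y => spaceDiv a (y, 0) • S' y) x) *
          ⟪velocity Ω T x, outerNormal Ω x⟫) (area Ω) ∧
      Integrable (fun x =>
        spaceDiv a (x, 0) * ⟪acceleration Ω T x - fderiv ℝ S' x (S' x), outerNormal Ω x⟫)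
        (area Ω) ∧
      HasDerivAt (deriv (boundaryFlux Ω T a))
        ((∫ x, ⟪outerNormal Ω x, timeDeriv (timeDeriv a) (x, 0)⟫ ∂(area Ω)) +
          (∫ x, (2 * spaceDiv (timeDeriv a) (x, 0) +
              divergence (fun y => spaceDiv a (y, 0) • S' y) x) *
            ⟪velocity Ω T x, outerNormal Ω x⟫ ∂(area Ω)) +
          ∫ x, spaceDiv a (x, 0) *
            ⟪acceleration Ω T x - fderiv ℝ S' x (S' x), outerNormal Ω x⟫ ∂(area Ω)) 0 := by
  -- the `C^{1,1}` property of the boundary is only used in this form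
  have hL := hΩ.isLipschitzDomain
  have hfin : volume Ω ≠ ⊤ := hb.measure_lt_top.ne
  obtain ⟨K, hTE⟩ := hT.exists_hasTimeEstimates hL hb
  obtain ⟨δ, -, hN⟩ := hTE.exists_isNearIdentity hL hb
  obtain ⟨K', τ, σ, R, hE⟩ := hN.toHasTimeEstimates.exists_isFlowExtension
  have h0 := hN.zero_mem
  have hfrc : IsCompact (frontier Ω) :=
    hb.isCompact_closure.of_isClosed_subset isClosed_frontier frontier_subset_closure
  have hfr : ∀ᵐ y ∂(area Ω), y ∈ frontier Ω := ae_restrict_mem isClosed_frontier.measurableSet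
  have hΓ : frontier Ω ×ˢ {(0 : ℝ)} ⊆ lateralBoundary Ω ε T := by
    rintro ⟨x, t⟩ ⟨hx, ht⟩
    obtain rfl : t = 0 := ht
    refine ⟨⟨neg_lt_zero.2 hT.pos, hT.pos⟩, ?_⟩
    rwa [image_congr hT.zero, image_id']
  -- all quantities involve `a` only near `∂Ω × {0}`, so that it may be replaced by a global field
  obtain ⟨b, L, hb1, hbc, hbL, hba⟩ := ha.exists_contDiff_eq (hfrc.prod isCompact_singleton) hΓ
  obtain ⟨C, hC⟩ := HasCompactSupport.exists_hasFieldBounds hb1 hbc hbL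
  have hba' : ∀ x ∈ frontier Ω, b =ᶠ[𝓝 (x, (0 : ℝ))] a := fun x hx =>
    eventually_nhdsSet_iff_forall.1 hba (x, 0) ⟨hx, rfl⟩
  have hdiff : ∀ᵐ x ∂(area Ω),
      DifferentiableAt ℝ (timeDeriv b) (x, 0) ∧ DifferentiableAt ℝ (spaceDiv b) (x, 0) := by
    filter_upwards [ha₂, hfr] with x hx hxf
    exact ⟨hx.1.congr_of_eventuallyEq (hba' x hxf).timeDeriv,
      hx.2.congr_of_eventuallyEq (hba' x hxf).spaceDiv⟩
  have hev := hN.eventually_eqOn_frontier hb hba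
  have hflux : boundaryFlux Ω T a =ᶠ[𝓝 0]
      fun t => ∫ x in Ω, (fderiv ℝ (T t) x).det * spaceDiv b (T t x, t) := by
    filter_upwards [hev, isOpen_Ioo.mem_nhds h0] with t ht htI
    rw [← hN.boundaryFlux_eq hL.1 hC htI, boundaryFlux, boundaryFlux]
    refine setIntegral_congr_fun isClosed_frontier.measurableSet fun y hy => ?_
    rw [ht y hy]
  have hderiv : ∀ᶠ t in 𝓝 (0 : ℝ), HasDerivAt (boundaryFlux Ω T a)
      (∫ x in Ω, traceCLM d ((cofactorMap (fderiv ℝ (T t) x)).comp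
        (fderiv ℝ (fluxField b T t) x))) t := by
    filter_upwards [hflux.eventuallyEq_nhds, isOpen_Ioo.mem_nhds h0] with t ht htI
    exact (hN.hasDerivAt_integral_det_mul_spaceDiv hL.1 hfin hC htI).congr_of_eventuallyEq ht
  refine ⟨?_, ?_, fun S' hS' => ?_⟩
  · filter_upwards [hderiv, hev, isOpen_Ioo.mem_nhds h0] with t ht hta htI
    refine ⟨?_, ht.differentiableAt⟩
    refine ((hN.isLipschitzDomain_image t htI).integrable_inner_of_continuous
      (hN.isBounded_image t htI) (hC.lipschitz.comp_prodMk_left t).continuous).congr ?_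
    filter_upwards [ae_restrict_mem isClosed_frontier.measurableSet] with y hy
    rw [hta y hy]
  · obtain ⟨S', h1, h2, h3⟩ := hL.exists_isBoundaryExtension hb (hE.lipschitz_velocity 0 h0)
    exact ⟨S', h1, fun x hx =>
      (h2 hx).trans (hE.velocity_eq x (frontier_subset_closure hx)).symm, h3⟩
  · have hS : IsBoundaryExtension Ω (σ 0) S' := ⟨hS'.1, fun x hx =>
      (hS'.2.1 hx).trans (hE.velocity_eq x (frontier_subset_closure hx)), hS'.2.2⟩
    obtain ⟨i1, i2, i3, hG⟩ :=
      hN.hasDerivAt_integral_trace_cofactorMap hE hL hb hC hdiff hS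
    have e1 : (fun x => ⟪outerNormal Ω x, timeDeriv (timeDeriv b) (x, 0)⟫) =ᵐ[area Ω]
        fun x => ⟪outerNormal Ω x, timeDeriv (timeDeriv a) (x, 0)⟫ := by
      filter_upwards [hfr] with x hx
      rw [timeDeriv_congr (hba' x hx).timeDeriv]
    have e2 : (fun x => ⟪outerNormal Ω x, (2 * spaceDiv (timeDeriv b) (x, 0) +
        divergence (fun y => spaceDiv b (y, 0) • S' y) x) • σ 0 x⟫) =ᵐ[area Ω]
        fun x => (2 * spaceDiv (timeDeriv a) (x, 0) +
          divergence (fun y => spaceDiv a (y, 0) • S' y) x) *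
            ⟪velocity Ω T x, outerNormal Ω x⟫ := by
      filter_upwards [hfr] with x hx
      have h1 : Tendsto (fun y : Vec d => (y, (0 : ℝ))) (𝓝 x) (𝓝 (x, 0)) :=
        (continuous_id.prodMk continuous_const).tendsto x
      have h2 : (fun y => spaceDiv b (y, 0) • S' y) =ᶠ[𝓝 x] fun y => spaceDiv a (y, 0) • S' y :=
        (h1.eventually (hba' x hx).spaceDiv).mono fun y hy => by
          beta_reduce; rw [hy]
      rw [spaceDiv_congr (hba' x hx).timeDeriv, divergence_congr h2,
        hE.velocity_eq x (frontier_subset_closure hx), inner_smul_right, real_inner_comm]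
    have e3 : (fun x => ⟪outerNormal Ω x, spaceDiv b (x, 0) • (R x - fderiv ℝ S' x (S' x))⟫)
        =ᵐ[area Ω] fun x => spaceDiv a (x, 0) *
          ⟪acceleration Ω T x - fderiv ℝ S' x (S' x), outerNormal Ω x⟫ := by
      filter_upwards [hfr] with x hx
      rw [spaceDiv_congr (hba' x hx), hE.acceleration_eq x (frontier_subset_closure hx),
        inner_smul_right, real_inner_comm]
    refine ⟨i1.congr e1, i2.congr e2, i3.congr e3, ?_⟩
    rw [← integral_congr_ae e1, ← integral_congr_ae e2, ← integral_congr_ae e3]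
    exact hG.congr_of_eventuallyEq (hderiv.mono fun t ht => ht.deriv)
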